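/- **Setting.** Let $\omega=e^{2\pi i/3}$, $\langle z,w\rangle=\frac12(z\bar w+\bar z w)$, $\Lambda=\frac43\pi i\omega(\mathbb Z\oplus\omega\mathbb Z)$, $\Lambda^*=\sqrt3\,\omega(\mathbb Z\oplus\omega\mathbb Z)$, $2D_{\bar z}=\frac1i(\partial_{x_1}+i\partial_{x_2})$, $U(z)=\sum_{j=0}^2\omega^je^{\frac12(z\bar\omega^j-\bar z\omega^j)}$. Let $n\ge1$, let $t_1,\dots,t_{n-1}$ be non-zero real numbers, $\alpha\in\mathbb C$, and let $D_n(\alpha;t)$ be the $n\times n$ block tridiagonal operator with $2\times2$ blocks: the first diagonal block is $D(\alpha)=\begin{pmatrix}2D_{\bar z}&\alpha U(z)\\ \alpha U(-z)&2D_{\bar z}\end{pmatrix}$, the other diagonal blocks are $D(0)$, the $(j,j+1)$ block is $t_j\,\mathrm{diag}(1,0)$ and the $(j+1,j)$ block is $t_j\,\mathrm{diag}(0,1)$. It acts on the space $L^2_0$ of $v\in L^2(\mathbb C/3\Lambda;\mathbb C^{2n})$ such that, for $a=\frac43\pi i\omega(a_1+\omega a_2)\in\Lambda$, $v_i(z+a)=\omega^{-(a_1+a_2)}v_i(z)$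 for odd $i$ and $v_i(z+a)=v_i(z)$ for even $i$, with domain $L^2_0\cap H^1$. Assume that $\alpha$ is magic and simple: for every $k\in\mathbb C$ the eigenvalues $\pm E_j$, $0\le E_1\le E_2\le\cdots$ (with multiplicity) of $\begin{pmatrix}0&D(\alpha)^*+\bar k\\ D(\alpha)+k&0\end{pmatrix}$ on $L^2_0$ satisfy $E_1=0<E_2$; equivalently, $0$ is an eigenvalue of multiplicity exactly two. Let $0\ne u=(u_1,u_2)\in\ker_{L^2_0}D(\alpha)$ and, if $n\ge2$, assume $\int_{\mathbb C/\Lambda}u_2\,dm\ne0$. Put $\theta(\zeta)=-\sum_{m\in\mathbb Z}e^{\pi i(m+\frac12)^2\omega+2\pi i(m+\frac12)(\zeta+\frac12)}$, $z_S=\frac13\cdot\frac43\pi i\omega(-1+\omega)$ and, for $z=\frac43\pi i\omega\zeta$, $k=\sqrt3\,\omega\kappa$, $F_k(z)=e^{2\pi(\zeta-\bar\zeta)\kappa/\sqrt3}\,\theta(\zeta+\kappa)/\theta(\zeta)$. For $p=\sqrt3\,\omega(\omega p_1-p_2)\in\Lambda^*$ put $(\tau(p)f)(z)=e^{-i\langle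 z,p\rangle}f(z)$, $e^{(n)}_p(k)=[e^{\pi ip_1^2\omega+2\pi i\kappa p_1}(-1)^{p_1+p_2}]^n$ and $\tilde e^{(n)}_p(k)=e^{i\langle z_S,p\rangle}e^{(n)}_p(k)$. **Theorem.** (1) For $k\notin\Lambda^*$ the resolvent $(2D_{\bar z}+k)^{-1}$ exists on $L^2(\mathbb C/\Lambda)$, with values in $H^1$. There is a holomorphic map $\Phi:\mathbb C\to L^2(\mathbb C/3\Lambda;\mathbb C^{2n})$, $\Phi_k=(\phi_{1,k},\dots,\phi_{2n,k})$, with $(\phi_{1,k},\phi_{2,k})=\theta(\kappa)^{n-1}F_k(z+z_S)\,u(z)$ and $\phi_{2j-1,k}=0$ for $2\le j\le n$, for all $k$, and $\phi_{2m+2,k}=(-1)^m\big(\prod_{j=1}^mt_j\big)(2D_{\bar z}+k)^{-m}\phi_{2,k}$ for $0\le m\le n-1$, $k\notin\Lambda^*$. For every $k\in\mathbb C$, $\Phi_k\neq0$ and $\ker_{L^2_0}(D_n(\alpha;t)+k)=\mathbb C\,\Phi_k$. For $p\in\Lambda^*$, $\Phi_{k+p}=[\tilde e^{(n)}_p(k)]^{-1}\tau(p)\Phi_k$.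 (2) Let $L$ be the set of pairs $(k,\Phi)$, $k\in\mathbb C$, $\Phi\in\ker_{L^2_0}(D_n(\alpha;t)+k)$, modulo $(k,\Phi)\sim(k+p,\tau(p)\Phi)$, $p\in\Lambda^*$, with the quotient topology. Then $L$, with the projection $[k,\Phi]\mapsto[k]$, is a holomorphic line bundle over $\mathbb C/\Lambda^*$ with multipliers $\tilde e^{(n)}_p$: these satisfy the cocycle identity $\tilde e^{(n)}_{p+p'}(k)=\tilde e^{(n)}_{p'}(k+p)\,\tilde e^{(n)}_p(k)$, and the map $\mathbb C\times\mathbb C\to L$, $(k,c)\mapsto[k,c\,\Phi_k]$, is holomorphic, onto, and identifies $(k,c)$ exactly with the points $(k+p,\tilde e^{(n)}_p(k)c)$, $p\in\Lambda^*$. (3) The norm of $L^2(\mathbb C/3\Lambda;\mathbb C^{2n})$ induces a smooth Hermitian metric on $L$. The Chern number $c_1(L)=\frac i{2\pi}\int_{\mathbb C/\Lambda^*}\Omega$, where $\Omega$ is the curvature of the Chern connection of this metric, or of any other smooth Hermitian metric on $L$, is $c_1(L)=-n$. -/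

import Mathlib

open MeasureTheory Module
open scoped ContDiff Manifold Bundle Matrix ComplexConjugate

noncomputable section

namespace TMG

/-! ### Hexagonal lattices -/

/-- The primitive cube root of unity `exp (2πi/3)`. -/
def om : ℂ := Complex.exp (2 * Real.pi * Complex.I / 3)

/-- The lattice `c (ℤ ⊕ om ℤ)`. -/
def lattice (c : ℂ) : AddSubgroup ℂ := (Submodule.span ℤ {c, c * om}).toAddSubgroup

/-- The half-open period parallelogram of `lattice c`. -/
def cell (c : ℂ) : Set ℂ :=
  {z | ∃ x ∈ Set.Ico (0 : ℝ) 1, ∃ y ∈ Set.Ico (0 : ℝ) 1, z = c * (x + y * om)}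

/-- The generator of the moire lattice `Λ`: `Λ = lattice cLam`, and `3Λ = lattice (3 * cLam)`. -/
def cLam : ℂ := 4 / 3 * Real.pi * Complex.I * om

/-- The generator of the dual lattice: `Λ* = lattice cDual`. -/
def cDual : ℂ := (Real.sqrt 3 : ℂ) * om

/-- The point of `Λ` with integer coordinates `a₁, a₂`. -/
def lamPt (a₁ a₂ : ℤ) : ℂ := cLam * (a₁ + a₂ * om)

/-- The point `√3 om p`, `p = om p₁ - p₂`, of `Λ*`. -/
def dualPt (p₁ p₂ : ℤ) : ℂ := cDual * (om * p₁ - p₂)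

/-- The real pairing `⟨z, w⟩ = (z w̄ + z̄ w)/2`. -/
def pairing (z w : ℂ) : ℝ := (z * conj w).re

lemma om_eq : om = ⟨-1 / 2, Real.sqrt 3 / 2⟩ := by
  have h : (2 * Real.pi * Complex.I / 3 : ℂ) = ((2 * Real.pi / 3 : ℝ) : ℂ) * Complex.I := by
    push_cast; ring
  have e : (2 * Real.pi / 3 : ℝ) = Real.pi - Real.pi / 3 := by ring
  rw [om, h, Complex.exp_mul_I, ← Complex.ofReal_cos, ← Complex.ofReal_sin, e, Real.cos_pi_sub,
    Real.sin_pi_sub, Real.cos_pi_div_three, Real.sin_pi_div_three]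
  apply Complex.ext <;> simp
  norm_num

lemma om_im_ne : om.im ≠ 0 := by
  rw [om_eq]; simp

lemma om_ne : om ≠ 0 := Complex.exp_ne_zero _

lemma cLam_ne : cLam ≠ 0 := by
  simp [cLam, om_ne, Real.pi_ne_zero]

lemma cDual_ne : cDual ≠ 0 := by
  simp [cDual, om_ne]

lemma hexLI : LinearIndependent ℝ ![(1 : ℂ), om] := by
  rw [LinearIndependent.pair_iff]
  intro s t h
  have h2 := congrArg Complex.im h
  have h1 := congrArg Complex.re h
  simp [om_im_ne] at h2
  subst h2
  simpa using h1

/-- The real basis `c, c om` of the plane. -/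
def hexBasis (c : ℂ) (hc : c ≠ 0) : Basis (Fin 2) ℝ ℂ :=
  (basisOfLinearIndependentOfCardEqFinrank hexLI (by simp [Complex.finrank_real_complex])).map
    ((LinearEquiv.smulOfNeZero ℂ ℂ c hc).restrictScalars ℝ)

lemma hexBasis_zero (c : ℂ) (hc : c ≠ 0) : hexBasis c hc 0 = c := by
  simp [hexBasis]

lemma hexBasis_one (c : ℂ) (hc : c ≠ 0) : hexBasis c hc 1 = c * om := by
  simp [hexBasis]

lemma range_hexBasis (c : ℂ) (hc : c ≠ 0) : Set.range (hexBasis c hc) = {c, c * om} := by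
  ext z
  simp [Fin.exists_fin_two, hexBasis_zero, hexBasis_one, eq_comm]

lemma lattice_eq (c : ℂ) (hc : c ≠ 0) :
    lattice c = (Submodule.span ℤ (Set.range (hexBasis c hc))).toAddSubgroup := by
  rw [range_hexBasis]; rfl

lemma cell_eq (c : ℂ) (hc : c ≠ 0) : cell c = ZSpan.fundamentalDomain (hexBasis c hc) := by
  ext z
  rw [ZSpan.mem_fundamentalDomain]
  constructor
  · rintro ⟨x, hx, y, hy, rfl⟩
    have : c * (x + y * om) = x • hexBasis c hc 0 + y • hexBasis c hc 1 := by
      rw [hexBasis_zero, hexBasis_one]; simp only [Complex.real_smul]; ring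
    rw [this, map_add, map_smul, map_smul, Basis.repr_self, Basis.repr_self]
    intro i
    fin_cases i
    · simpa using hx
    · simpa using hy
  · intro h
    refine ⟨_, h 0, _, h 1, ?_⟩
    have := (hexBasis c hc).sum_repr z
    rw [Fin.sum_univ_two, hexBasis_zero, hexBasis_one] at this
    simp only [Complex.real_smul] at this
    linear_combination -this

lemma lattice_discrete (c : ℂ) (hc : c ≠ 0) : DiscreteTopology (lattice c) := by
  rw [lattice_eq c hc]; infer_instance

/-! ### The torus `ℂ/3Λ` and its square-integrable functions -/

/-- The torus `ℂ/3Λ`. -/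
abbrev Torus : Type := ℂ ⧸ lattice (3 * cLam)

/-- The projection `ℂ → ℂ/3Λ`. -/
def toTorus (z : ℂ) : Torus := QuotientAddGroup.mk z

/-- Lebesgue measure on `ℂ/3Λ`: the image of Lebesgue measure on a period parallelogram. -/
def torusMeasure : Measure Torus := (volume.restrict (cell (3 * cLam))).map toTorus

/-- `L²(ℂ/3Λ; ℂ^ι)`. -/
abbrev L2 (ι : Type) [Fintype ι] : Type := Lp (EuclideanSpace ℂ ι) 2 torusMeasure

lemma measurable_toTorus : Measurable toTorus := fun _ h => h

lemma three_cLam_ne : (3 * cLam) ≠ 0 := by simp [cLam_ne]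

instance : IsFiniteMeasure (volume.restrict (cell (3 * cLam))) := by
  rw [cell_eq _ three_cLam_ne]
  exact ⟨by
    rw [Measure.restrict_apply_univ]
    exact (ZSpan.fundamentalDomain_isBounded _).measure_lt_top⟩

/-- A property of almost all points of the torus holds at almost all points of the plane. -/
lemma quasi_toTorus : Measure.QuasiMeasurePreserving toTorus volume torusMeasure := by
  refine ⟨measurable_toTorus, Measure.AbsolutelyContinuous.mk fun s hs h0 => ?_⟩
  have hms : MeasurableSet (toTorus ⁻¹' s) := measurable_toTorus hs
  rw [torusMeasure, Measure.map_apply measurable_toTorus hs, Measure.restrict_apply hms,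
    cell_eq _ three_cLam_ne] at h0
  rw [Measure.map_apply measurable_toTorus hs]
  have hF := ZSpan.isAddFundamentalDomain' (hexBasis _ three_cLam_ne) (volume : Measure ℂ)
  have hcount : Countable
      (Submodule.span ℤ (Set.range (hexBasis _ three_cLam_ne))).toAddSubgroup := by
    have : Countable (Submodule.span ℤ (Set.range (hexBasis _ three_cLam_ne))) := inferInstance
    exact this
  refine hF.measure_zero_of_invariant _ (fun g => ?_) h0
  ext z
  rw [Set.mem_vadd_set_iff_neg_vadd_mem]
  have : toTorus (-g +ᵥ z) = toTorus z := by
    refine QuotientAddGroup.eq.2 ?_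
    rw [lattice_eq _ three_cLam_ne]
    have h2 : -(-g +ᵥ z) + z = (g : ℂ) := by
      change -(-(g : ℂ) + z) + z = g
      ring
    rw [h2]
    exact g.2
  simp only [Set.mem_preimage, this]

/-- `v` has the weak derivative `g` in the direction `e` on the torus: `∫ v ∂φ = -∫ g φ` for all
smooth `3Λ`-periodic functions `φ`, in every component. -/
def IsWeakDeriv {ι : Type} [Fintype ι] (e : ℂ) (v g : L2 ι) : Prop :=
  ∀ φ : ℂ → ℂ, ContDiff ℝ ∞ φ → (∀ a ∈ lattice (3 * cLam), ∀ z, φ (z + a) = φ z) → ∀ i : ι,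
    ∫ z in cell (3 * cLam), v (toTorus z) i * fderiv ℝ φ z e =
      -∫ z in cell (3 * cLam), g (toTorus z) i * φ z

/-! ### First-order systems -/

/-- A first-order system `A₁ ∂₁ + A₂ ∂₂ + B(z)` on `ℂ^ι`-valued functions, where `A₁`, `A₂` are
constant matrices and `∂₁`, `∂₂` are the derivatives in `x₁`, `x₂`, `z = x₁ + i x₂`. -/
structure System (ι : Type) where
  /-- the coefficient of `∂₁` -/
  a₁ : Matrix ι ι ℂ
  /-- the coefficient of `∂₂` -/
  a₂ : Matrix ι ι ℂ
  /-- the zeroth-order term -/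
  b : ℂ → Matrix ι ι ℂ

namespace System

/-- The formal adjoint `-A₁ᴴ ∂₁ - A₂ᴴ ∂₂ + B(z)ᴴ`. -/
def adjoint {ι : Type} (P : System ι) : System ι :=
  ⟨-P.a₁ᴴ, -P.a₂ᴴ, fun z => (P.b z)ᴴ⟩

/-- The chiral Hamiltonian `(0, P*; P, 0)`. -/
def hamiltonian {ι : Type} (P : System ι) : System (ι ⊕ ι) :=
  ⟨Matrix.fromBlocks 0 P.adjoint.a₁ P.a₁ 0, Matrix.fromBlocks 0 P.adjoint.a₂ P.a₂ 0,
    fun z => Matrix.fromBlocks 0 (P.adjoint.b z) (P.b z) 0⟩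

/-- `2 D_{z̄} + V(z)`, where `2 D_{z̄} = (1/i)(∂₁ + i ∂₂)`. -/
def dbar {ι : Type} [DecidableEq ι] (V : ℂ → Matrix ι ι ℂ) : System ι :=
  ⟨-Complex.I • 1, 1, V⟩

/-- `v` belongs to `H¹(ℂ/3Λ; ℂ^ι)` and `P v = f`. -/
def Maps {ι : Type} [Fintype ι] (P : System ι) (v f : L2 ι) : Prop :=
  ∃ g₁ g₂ : L2 ι, IsWeakDeriv 1 v g₁ ∧ IsWeakDeriv Complex.I v g₂ ∧
    ∀ᵐ z : ℂ, P.a₁ *ᵥ (g₁ (toTorus z)).ofLp + P.a₂ *ᵥ (g₂ (toTorus z)).ofLp +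
      P.b z *ᵥ (v (toTorus z)).ofLp = (f (toTorus z)).ofLp

end System

section Linear

variable {ι : Type} [Fintype ι]

lemma ae_add (v w : L2 ι) :
    ∀ᵐ z : ℂ, (v + w) (toTorus z) = v (toTorus z) + w (toTorus z) :=
  quasi_toTorus.ae (Lp.coeFn_add v w)

lemma ae_smul (c : ℂ) (v : L2 ι) : ∀ᵐ z : ℂ, (c • v) (toTorus z) = c • v (toTorus z) :=
  quasi_toTorus.ae (Lp.coeFn_smul c v)

lemma ae_zero : ∀ᵐ z : ℂ, (0 : L2 ι) (toTorus z) = 0 :=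
  quasi_toTorus.ae (Lp.coeFn_zero (EuclideanSpace ℂ ι) 2 torusMeasure)

lemma ae_shift {p : ℂ → Prop} (h : ∀ᵐ z : ℂ, p z) (a : ℂ) : ∀ᵐ z : ℂ, p (z + a) :=
  (measurePreserving_add_right volume a).quasiMeasurePreserving.ae h

lemma integrable_mul (v : L2 ι) (i : ι) {ψ : ℂ → ℂ} (hψ : Continuous ψ) :
    IntegrableOn (fun z => v (toTorus z) i * ψ z) (cell (3 * cLam)) := by
  have hmp : MeasurePreserving toTorus (volume.restrict (cell (3 * cLam))) torusMeasure :=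
    ⟨measurable_toTorus, rfl⟩
  have h1 : MemLp (fun z => v (toTorus z)) 2 (volume.restrict (cell (3 * cLam))) :=
    (Lp.memLp v).comp_measurePreserving hmp
  have h2 : MemLp (fun z => v (toTorus z) i) 2 (volume.restrict (cell (3 * cLam))) :=
    h1.continuousLinearMap_comp (EuclideanSpace.proj i : EuclideanSpace ℂ ι →L[ℂ] ℂ)
  have h3 : Integrable (fun z => v (toTorus z) i) (volume.restrict (cell (3 * cLam))) :=
    h2.integrable (by norm_num)
  have hb : Bornology.IsBounded (cell (3 * cLam)) := by
    rw [cell_eq _ three_cLam_ne]; exact ZSpan.fundamentalDomain_isBounded _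
  have hm : MeasurableSet (cell (3 * cLam)) := by
    rw [cell_eq _ three_cLam_ne]; exact ZSpan.fundamentalDomain_measurableSet _
  obtain ⟨C, hC⟩ := hb.isCompact_closure.exists_bound_of_continuousOn hψ.continuousOn
  refine h3.mul_bdd (c := C) hψ.aestronglyMeasurable ?_
  exact (ae_restrict_iff' hm).2 (Filter.Eventually.of_forall fun z hz => hC z (subset_closure hz))

lemma IsWeakDeriv.add {e : ℂ} {v w g h : L2 ι} (hv : IsWeakDeriv e v g)
    (hw : IsWeakDeriv e w h) : IsWeakDeriv e (v + w) (g + h) := by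
  intro φ hφ hp i
  have hc : Continuous fun z => fderiv ℝ φ z e :=
    (hφ.continuous_fderiv (by simp)).clm_apply continuous_const
  have e1 : ∫ z in cell (3 * cLam), (v + w) (toTorus z) i * fderiv ℝ φ z e =
      ∫ z in cell (3 * cLam),
        (v (toTorus z) i * fderiv ℝ φ z e + w (toTorus z) i * fderiv ℝ φ z e) := by
    refine integral_congr_ae (ae_restrict_of_ae ?_)
    filter_upwards [ae_add v w] with z hz
    rw [hz]; simp [add_mul]
  have e2 : ∫ z in cell (3 * cLam), (g + h) (toTorus z) i * φ z =
      ∫ z in cell (3 * cLam), (g (toTorus z) i * φ z + h (toTorus z) i * φ z) := by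
    refine integral_congr_ae (ae_restrict_of_ae ?_)
    filter_upwards [ae_add g h] with z hz
    rw [hz]; simp [add_mul]
  rw [e1, e2, integral_add (integrable_mul v i hc) (integrable_mul w i hc),
    integral_add (integrable_mul g i hφ.continuous) (integrable_mul h i hφ.continuous),
    hv φ hφ hp i, hw φ hφ hp i]
  ring

lemma IsWeakDeriv.smul {e : ℂ} {v g : L2 ι} (c : ℂ) (hv : IsWeakDeriv e v g) :
    IsWeakDeriv e (c • v) (c • g) := by
  intro φ hφ hp i
  have e1 : ∫ z in cell (3 * cLam), (c • v) (toTorus z) i * fderiv ℝ φ z e =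
      ∫ z in cell (3 * cLam), c * (v (toTorus z) i * fderiv ℝ φ z e) := by
    refine integral_congr_ae (ae_restrict_of_ae ?_)
    filter_upwards [ae_smul c v] with z hz
    rw [hz]; simp [mul_assoc]
  have e2 : ∫ z in cell (3 * cLam), (c • g) (toTorus z) i * φ z =
      ∫ z in cell (3 * cLam), c * (g (toTorus z) i * φ z) := by
    refine integral_congr_ae (ae_restrict_of_ae ?_)
    filter_upwards [ae_smul c g] with z hz
    rw [hz]; simp [mul_assoc]
  rw [e1, e2, integral_const_mul, integral_const_mul, hv φ hφ hp i]
  ring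

lemma System.Maps.add {P : System ι} {v w f h : L2 ι} (hv : P.Maps v f) (hw : P.Maps w h) :
    P.Maps (v + w) (f + h) := by
  obtain ⟨g₁, g₂, h1, h2, h3⟩ := hv
  obtain ⟨k₁, k₂, m1, m2, m3⟩ := hw
  refine ⟨g₁ + k₁, g₂ + k₂, h1.add m1, h2.add m2, ?_⟩
  filter_upwards [h3, m3, ae_add g₁ k₁, ae_add g₂ k₂, ae_add v w, ae_add f h] with z a b c d e q
  rw [c, d, e, q]
  simp only [WithLp.ofLp_add, Matrix.mulVec_add, ← a, ← b]
  abel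

lemma System.Maps.smul {P : System ι} {v f : L2 ι} (c : ℂ) (hv : P.Maps v f) :
    P.Maps (c • v) (c • f) := by
  obtain ⟨g₁, g₂, h1, h2, h3⟩ := hv
  refine ⟨c • g₁, c • g₂, h1.smul c, h2.smul c, ?_⟩
  filter_upwards [h3, ae_smul c g₁, ae_smul c g₂, ae_smul c v, ae_smul c f] with z a b d e q
  rw [b, d, e, q]
  simp only [WithLp.ofLp_smul, Matrix.mulVec_smul, ← a, smul_add]

lemma System.Maps.zero (P : System ι) : P.Maps 0 0 := by
  have hw : ∀ e : ℂ, IsWeakDeriv e (0 : L2 ι) 0 := by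
    intro e φ hφ hp i
    have e1 : ∫ z in cell (3 * cLam), (0 : L2 ι) (toTorus z) i * fderiv ℝ φ z e = 0 := by
      rw [← integral_zero ℂ ℂ (μ := volume.restrict (cell (3 * cLam)))]
      refine integral_congr_ae (ae_restrict_of_ae ?_)
      filter_upwards [ae_zero (ι := ι)] with z hz
      rw [hz]; simp
    have e2 : ∫ z in cell (3 * cLam), (0 : L2 ι) (toTorus z) i * φ z = 0 := by
      rw [← integral_zero ℂ ℂ (μ := volume.restrict (cell (3 * cLam)))]
      refine integral_congr_ae (ae_restrict_of_ae ?_)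
      filter_upwards [ae_zero (ι := ι)] with z hz
      rw [hz]; simp
    rw [e1, e2, neg_zero]
  refine ⟨0, 0, hw _, hw _, ?_⟩
  filter_upwards [ae_zero (ι := ι)] with z hz
  rw [hz]; simp

/-- The space `L²₀` of functions with `𝓛_a v = v` for `a ∈ Λ`, where
`(𝓛_a v)_i (z) = om^{c_i (a₁ + a₂)} v_i (z + a)` for `a = (4/3) π i om (a₁ + om a₂)`. -/
def L20 (c : ι → ℤ) : Submodule ℂ (L2 ι) where
  carrier := {v | ∀ a₁ a₂ : ℤ, ∀ᵐ z : ℂ, ∀ i,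
    om ^ (c i * (a₁ + a₂)) * v (toTorus (z + lamPt a₁ a₂)) i = v (toTorus z) i}
  add_mem' := by
    intro v w hv hw a₁ a₂
    filter_upwards [hv a₁ a₂, hw a₁ a₂, ae_add v w, ae_shift (ae_add v w) (lamPt a₁ a₂)]
      with z h1 h2 h3 h4 i
    rw [h3, h4]
    rw [PiLp.add_apply, PiLp.add_apply, mul_add _ (v _ i), h1 i, h2 i]
  zero_mem' := by
    intro a₁ a₂
    filter_upwards [ae_zero (ι := ι), ae_shift (ae_zero (ι := ι)) (lamPt a₁ a₂)] with z h3 h4 i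
    rw [h3, h4]; simp
  smul_mem' := by
    intro r v hv a₁ a₂
    filter_upwards [hv a₁ a₂, ae_smul r v, ae_shift (ae_smul r v) (lamPt a₁ a₂)]
      with z h1 h3 h4 i
    rw [h3, h4]
    simp only [PiLp.smul_apply, smul_eq_mul]
    rw [← h1 i]; ring

/-- The kernel of `P` on `L²₀` (with domain `L²₀ ∩ H¹`). -/
def System.kernel (P : System ι) (c : ι → ℤ) : Submodule ℂ (L2 ι) where
  carrier := {v | v ∈ L20 c ∧ P.Maps v 0}
  add_mem' := by
    rintro v w ⟨h1, h2⟩ ⟨h3, h4⟩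
    exact ⟨add_mem h1 h3, by simpa using h2.add h4⟩
  zero_mem' := ⟨zero_mem _, System.Maps.zero P⟩
  smul_mem' := by
    rintro r v ⟨h1, h2⟩
    exact ⟨Submodule.smul_mem _ r h1, by simpa using h2.smul r⟩

end Linear

/-! ### The twisted multilayer operators -/

/-- The potential `U(z) = ∑_{j=0}^{2} om^j exp ((z \bar om^j - \bar z om^j)/2)`. -/
def U (z : ℂ) : ℂ :=
  ∑ j ∈ Finset.range 3, om ^ j * Complex.exp (1 / 2 * (z * conj om ^ j - conj z * om ^ j))

/-- The `2 × 2` blocks of the zeroth-order part of `D_n(α; t)`; the layers are numbered from `0`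
here, and `t j` is the tunneling between the `j`-th and the `(j+1)`-th layer counted from `1`. -/
def potentialBlock (n : ℕ) (t : ℕ → ℝ) (α z : ℂ) (i j : Fin n) : Matrix (Fin 2) (Fin 2) ℂ :=
  if i.val = 0 ∧ j.val = 0 then !![0, α * U z; α * U (-z), 0]
  else if j.val = i.val + 1 then (t j.val : ℂ) • !![1, 0; 0, 0]
  else if i.val = j.val + 1 then (t i.val : ℂ) • !![0, 0; 0, 1]
  else 0

/-- The zeroth-order part of `D_n(α; t)`. -/
def potential (n : ℕ) (t : ℕ → ℝ) (α z : ℂ) : Matrix (Fin n × Fin 2) (Fin n × Fin 2) ℂ :=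
  Matrix.of fun i j => potentialBlock n t α z i.1 j.1 i.2 j.2

/-- `D_n(α; t) + k`. -/
def Dn (n : ℕ) (t : ℕ → ℝ) (α k : ℂ) : System (Fin n × Fin 2) :=
  System.dbar fun z => potential n t α z + k • 1

/-- `𝓛_a` multiplies the first entry of each layer by `om^{a₁ + a₂}`, and fixes the second. -/
def layerCharge (n : ℕ) (i : Fin n × Fin 2) : ℤ := if i.2 = 0 then 1 else 0

/-- `ker_{L²₀} (D_n(α; t) + k)`. -/
def kerDn (n : ℕ) (t : ℕ → ℝ) (α k : ℂ) : Submodule ℂ (L2 (Fin n × Fin 2)) :=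
  (Dn n t α k).kernel (layerCharge n)

/-- `α` is magic and simple: the eigenvalues `⋯ ≤ E_{-2} ≤ E_{-1} = -E_1 ≤ 0 ≤ E_1 ≤ E_2 ≤ ⋯` of the
Floquet Hamiltonian `H_k(α)` of the bilayer on `L²₀`, listed with multiplicity, satisfy
`E_1(α, k) = 0 < E_2(α, k)` for every `k`. That is, `0` is an eigenvalue of `H_k(α)` of multiplicity
exactly two. -/
def IsSimpleMagic (α : ℂ) : Prop :=
  ∀ k : ℂ, finrank ℂ
    ((Dn 1 (fun _ => 0) α k).hamiltonian.kernel (Sum.elim (layerCharge 1) (layerCharge 1))) = 2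

/-! ### Theta functions, resolvents and multipliers -/

/-- `θ(ζ) = -θ_{1/2,1/2}(ζ | om)`. -/
def theta (ζ : ℂ) : ℂ :=
  -∑' m : ℤ, Complex.exp (Real.pi * Complex.I * (m + 1 / 2) ^ 2 * om +
    2 * Real.pi * Complex.I * (m + 1 / 2) * (ζ + 1 / 2))

/-- `F_k(z)` in the variables `z = (4/3) π i om ζ`, `k = √3 om κ`:
`exp (2π (ζ - \bar ζ) κ / √3) θ(ζ + κ) / θ(ζ)`. -/
def F (k z : ℂ) : ℂ :=
  Complex.exp (2 * Real.pi * (z / cLam - conj (z / cLam)) * (k / cDual) / (Real.sqrt 3 : ℂ)) *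
    theta (z / cLam + k / cDual) / theta (z / cLam)

/-- The high-symmetry point `z_S = (1/3)(4/3) π i om (-1 + om)`. -/
def zS : ℂ := 1 / 3 * cLam * (-1 + om)

/-- The `Λ`-periodic scalar functions in `L²(ℂ/3Λ)`, i.e. `L²(ℂ/Λ)`. -/
def periodicL2 : Submodule ℂ (L2 Unit) := L20 fun _ => 0

/-- `w` is `Λ`-periodic, of class `H¹`, and `(2 D_{z̄} + k) w = f`. -/
def IsDbarSolution (k : ℂ) (f w : L2 Unit) : Prop :=
  w ∈ periodicL2 ∧ (System.dbar fun _ => k • (1 : Matrix Unit Unit ℂ)).Maps w f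

open Classical in
/-- The resolvent `(2 D_{z̄} + k)⁻¹` on `L²(ℂ/Λ)` (`0` where there is no solution). -/
def dbarResolvent (k : ℂ) (f : L2 Unit) : L2 Unit :=
  if h : ∃ w, IsDbarSolution k f w then h.choose else 0

/-- The component `v_i` of a vector-valued function. -/
def component {ι : Type} [Fintype ι] [DecidableEq ι] (i : ι) (v : L2 ι) : L2 Unit :=
  ((EuclideanSpace.proj i : EuclideanSpace ℂ ι →L[ℂ] ℂ).smulRight
    (EuclideanSpace.single () (1 : ℂ))).compLp v

/-- `v' = τ(p) v`, that is, `v'(z) = exp (-i ⟨z, p⟩) v(z)`. -/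
def IsTau {ι : Type} [Fintype ι] (p : ℂ) (v v' : L2 ι) : Prop :=
  ∀ᵐ z : ℂ, v' (toTorus z) = Complex.exp (-Complex.I * pairing z p) • v (toTorus z)

/-- The multiplier `e_p^{(n)}(k) = [exp (π i p₁² om + 2 π i κ p₁) (-1)^{p₁ + p₂}]^n`, where
`k = √3 om κ` and `p = √3 om (om p₁ - p₂)`. -/
def mult (n : ℕ) (p₁ p₂ : ℤ) (k : ℂ) : ℂ :=
  (Complex.exp (Real.pi * Complex.I * p₁ ^ 2 * om + 2 * Real.pi * Complex.I * (k / cDual) * p₁) *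
    (-1) ^ (p₁ + p₂)) ^ n

/-- The multiplier of the flat band: `e_p^{(n)}(k)` times the constant phase `exp (i ⟨z_S, p⟩)` that
comes from the shift by `z_S` in the flat band functions. -/
def flatMult (n : ℕ) (p₁ p₂ : ℤ) (k : ℂ) : ℂ :=
  Complex.exp (Complex.I * pairing zS (dualPt p₁ p₂)) * mult n p₁ p₂ k

/-! ### The complex torus `ℂ/Λ*` -/

/-- The complex torus `ℂ/Λ*`. -/
abbrev Base : Type := ℂ ⧸ lattice cDual

/-- The projection `ℂ → ℂ/Λ*`. -/
def toBase (k : ℂ) : Base := QuotientAddGroup.mk k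

lemma toBase_eq {k k' : ℂ} : toBase k = toBase k' ↔ k' - k ∈ lattice cDual := by
  rw [toBase, toBase, QuotientAddGroup.eq, neg_add_eq_sub]

lemma toBase_surjective : Function.Surjective toBase := QuotientAddGroup.mk_surjective

lemma toBase_localHomeo : IsLocalHomeomorph toBase :=
  ((lattice cDual).isAddQuotientCoveringMap_of_comm
    ⟨lattice_discrete cDual cDual_ne⟩).isCoveringMap.isLocalHomeomorph

/-- A local inverse of `ℂ → ℂ/Λ*` at a point of the torus. -/
def baseChart (b : Base) : OpenPartialHomeomorph Base ℂ :=
  (toBase_localHomeo b.out).choose.symm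

lemma baseChart_symm (b : Base) : ⇑(baseChart b).symm = toBase := by
  rw [baseChart, OpenPartialHomeomorph.symm_symm]
  exact (toBase_localHomeo b.out).choose_spec.2.symm

lemma mem_baseChart_source (b : Base) : b ∈ (baseChart b).source := by
  have h := (toBase_localHomeo b.out).choose_spec
  have h2 := (toBase_localHomeo b.out).choose.map_source h.1
  rw [← h.2] at h2
  have h3 : toBase b.out = b := Quotient.out_eq' b
  rwa [h3] at h2

/-- `ℂ/Λ*` as a complex manifold: the charts are local inverses of the projection. -/
instance : ChartedSpace ℂ Base where
  atlas := Set.range baseChart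
  chartAt := baseChart
  mem_chart_source := mem_baseChart_source
  chart_mem_atlas b := ⟨b, rfl⟩

lemma baseChart_right (b : Base) {x : ℂ} (hx : x ∈ (baseChart b).target) :
    (baseChart b) (toBase x) = x := by
  rw [← baseChart_symm b]; exact (baseChart b).right_inv hx

lemma toBase_baseChart (b : Base) {x : Base} (hx : x ∈ (baseChart b).source) :
    toBase (baseChart b x) = x := by
  rw [← baseChart_symm b]; exact (baseChart b).left_inv hx

lemma chart_transition (b b' : Base) :
    ContDiffOn ℂ ω ((baseChart b).symm ≫ₕ baseChart b')
      ((baseChart b).symm ≫ₕ baseChart b').source := by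
  have hf : ∀ y ∈ ((baseChart b).symm ≫ₕ baseChart b').source,
      ((baseChart b).symm ≫ₕ baseChart b') y - y ∈ lattice cDual := by
    intro y hy
    rw [← toBase_eq, OpenPartialHomeomorph.coe_trans, Function.comp_apply, baseChart_symm]
    have h2 : (baseChart b).symm y ∈ (baseChart b').source := hy.2
    rw [baseChart_symm] at h2
    exact (toBase_baseChart b' h2).symm
  set f := (baseChart b).symm ≫ₕ baseChart b' with hfdef
  intro x hx
  have hdisc : IsDiscrete (lattice cDual : Set ℂ) := ⟨lattice_discrete cDual cDual_ne⟩
  obtain ⟨V, hVo, hV⟩ := isDiscrete_iff_forall_mem_exists_isOpen.1 hdisc _ (hf x hx)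
  have hfx : ContinuousAt f x := f.continuousAt hx
  have hmem : f x - x ∈ V := by
    have : f x - x ∈ V ∩ (lattice cDual : Set ℂ) := by rw [hV]; rfl
    exact this.1
  have hev : ∀ᶠ y in nhds x, f y = y + (f x - x) := by
    filter_upwards [(hfx.sub continuousAt_id).preimage_mem_nhds (hVo.mem_nhds hmem),
      f.open_source.mem_nhds hx] with y h1 h2
    have h3 : f y - y ∈ V ∩ (lattice cDual : Set ℂ) := ⟨h1, hf y h2⟩
    rw [hV, Set.mem_singleton_iff] at h3
    rw [← h3]; ring
  have hc : ContDiffAt ℂ ω (fun y : ℂ => y + (f x - x)) x := contDiffAt_id.add contDiffAt_const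
  exact (hc.congr_of_eventuallyEq hev).contDiffWithinAt

instance : IsManifold 𝓘(ℂ, ℂ) ω Base := by
  refine isManifold_of_contDiffOn 𝓘(ℂ, ℂ) ω Base ?_
  rintro _ _ ⟨b, rfl⟩ ⟨b', rfl⟩
  simpa only [mfld_simps] using chart_transition b b'

/-! ### Hermitian metrics and Chern numbers of line bundles over `ℂ/Λ*` -/

/-- The Wirtinger derivative `∂_k = (∂_{k₁} - i ∂_{k₂})/2`. -/
def wirt (f : ℂ → ℂ) (k : ℂ) : ℂ := 1 / 2 * (fderiv ℝ f k 1 - Complex.I * fderiv ℝ f k Complex.I)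

/-- The Wirtinger derivative `∂_{k̄} = (∂_{k₁} + i ∂_{k₂})/2`. -/
def wirtBar (f : ℂ → ℂ) (k : ℂ) : ℂ :=
  1 / 2 * (fderiv ℝ f k 1 + Complex.I * fderiv ℝ f k Complex.I)

section LineBundle

variable (E : Base → Type) [∀ b, AddCommGroup (E b)] [∀ b, Module ℂ (E b)]
  [∀ b, TopologicalSpace (E b)] [TopologicalSpace (Bundle.TotalSpace ℂ E)] [FiberBundle ℂ E]

/-- The local frame of the line bundle `E` over a neighbourhood of `b₀` that the trivialization at
`b₀` gives, at the point of the torus represented by `k`. -/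
def localFrame (b₀ : Base) (k : ℂ) : E (toBase k) :=
  (trivializationAt ℂ E b₀).symm (toBase k) 1

/-- A smooth Hermitian metric on a line bundle, given by its squared norms. -/
structure HermitianMetric where
  /-- the squared norm on the fibres -/
  normSq : ∀ b, E b → ℝ
  normSq_smul : ∀ (b : Base) (c : ℂ) (v : E b), normSq b (c • v) = ‖c‖ ^ 2 * normSq b v
  normSq_pos : ∀ (b : Base) (v : E b), v ≠ 0 → 0 < normSq b v
  smooth : ∀ b₀ : Base, ContDiffOn ℝ ∞ (fun k => normSq (toBase k) (localFrame E b₀ k))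
    (toBase ⁻¹' (trivializationAt ℂ E b₀).baseSet)

variable {E}

/-- The coefficient of `dk` in the connection form `∂ log h` of the Chern connection, in the local
frame around `b₀`. -/
def HermitianMetric.connection (h : HermitianMetric E) (b₀ : Base) : ℂ → ℂ :=
  wirt fun k => (Real.log (h.normSq (toBase k) (localFrame E b₀ k)) : ℂ)

/-- The curvature `Ω = d(η dk) = (∂_{k̄} η) dk̄ ∧ dk`, `η dk` the connection form, as a multiple of
`dk₁ ∧ dk₂`; here `dk̄ ∧ dk = 2i dk₁ ∧ dk₂`. -/
def HermitianMetric.curvature (h : HermitianMetric E) (k : ℂ) : ℂ :=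
  wirtBar (h.connection (toBase k)) k * (2 * Complex.I)

/-- `(i / 2π) ∫_{ℂ/Λ*} Ω`. -/
def HermitianMetric.chernNumber (h : HermitianMetric E) : ℂ :=
  Complex.I / (2 * Real.pi) * ∫ k in cell cDual, h.curvature k

end LineBundle

/-! ### The flat band line bundle -/

/-- The fibre over `b ∈ ℂ/Λ*` of the flat band bundle `L`. An element is an equivalence class
`{(k, Φ)}` of pairs with `k` over `b`, `Φ ∈ ker_{L²₀} (D_n(α; t) + k)`, under
`(k, Φ) ∼ (k + p, τ(p) Φ)`, `p ∈ Λ*`, regarded as the graph of a function `k ↦ Φ`. -/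
def fiber (n : ℕ) (t : ℕ → ℝ) (α : ℂ) (b : Base) :
    Submodule ℂ ({k : ℂ // toBase k = b} → L2 (Fin n × Fin 2)) where
  carrier := {s | (∀ k, s k ∈ kerDn n t α k.1) ∧ ∀ k k', IsTau (k'.1 - k.1) (s k) (s k')}
  add_mem' := by
    rintro s r ⟨h1, h2⟩ ⟨h3, h4⟩
    refine ⟨fun k => add_mem (h1 k) (h3 k), fun k k' => ?_⟩
    filter_upwards [h2 k k', h4 k k', ae_add (s k) (r k), ae_add (s k') (r k')] with z a b c d
    rw [Pi.add_apply, Pi.add_apply, c, d, a, b, smul_add]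
  zero_mem' := by
    refine ⟨fun k => zero_mem _, fun k k' => ?_⟩
    filter_upwards [ae_zero (ι := Fin n × Fin 2)] with z a
    rw [Pi.zero_apply, Pi.zero_apply, a, smul_zero]
  smul_mem' := by
    rintro c s ⟨h1, h2⟩
    refine ⟨fun k => Submodule.smul_mem _ c (h1 k), fun k k' => ?_⟩
    filter_upwards [h2 k k', ae_smul c (s k), ae_smul c (s k')] with z a b d
    rw [Pi.smul_apply, Pi.smul_apply, b, d, a, smul_comm]

/-- The fibres of the flat band bundle. -/
abbrev Fiber (n : ℕ) (t : ℕ → ℝ) (α : ℂ) (b : Base) : Type := fiber n t α b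

/-- The total space of the flat band bundle `L`. -/
abbrev FlatBand (n : ℕ) (t : ℕ → ℝ) (α : ℂ) : Type := Bundle.TotalSpace ℂ (Fiber n t α)

/-- `ℓ = [k, Φ]_τ`: the class `ℓ` contains the pair `(k, Φ)`. -/
def IsClass {n : ℕ} {t : ℕ → ℝ} {α : ℂ} (ℓ : FlatBand n t α) (k : ℂ)
    (Φ : L2 (Fin n × Fin 2)) : Prop :=
  ∃ h : toBase k = ℓ.proj, ℓ.snd.1 ⟨k, h⟩ = Φ

/-- The quotient topology on `L`. The space of all pairs `(k, Φ)`, `Φ ∈ ker_{L²₀} (D_n(α; t) + k)`,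
has the topology induced from `ℂ × L²`, and `L` has the topology coinduced by `(k, Φ) ↦ [k, Φ]_τ`.
A pair `(k, Φ)` is given here by `k` and by its class `ℓ`, a function with `Φ = ℓ(k)`. -/
instance (n : ℕ) (t : ℕ → ℝ) (α : ℂ) : TopologicalSpace (FlatBand n t α) :=
  .coinduced (fun x : {x : ℂ × FlatBand n t α // toBase x.1 = x.2.proj} => x.1.2)
    (.induced (fun x => (x.1.1, x.1.2.snd.1 ⟨x.1.1, x.2⟩)) inferInstance)

end TMG

end

/-!
The operators have constant leading part and coefficients that are trigonometric polynomials, so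
everything is done with Fourier series on `ℂ/3Λ` (`fourierBasis`): the symmetry of `L²₀` and the
operators `τ(p)` are conditions on the coefficients (`mem_L20_iff`, `isTau_iff`), `2 D_{z̄}`
multiplies the coefficient of the character `chi m` by `pt m`, and elements of the kernels are
continuously differentiable (`exists_classical`), which makes Wronskians, zeros and derivatives of
solutions available.

*The bilayer.* Write `u` for a solution at quasi-momentum `0`. Conjugation turns the adjoint equation
at `k` into the original one at a reflected quasi-momentum, so the two-dimensional zero space of the
Hamiltonian at `k` consists of the solutions at `k` and at the reflected point. At the fixed point
`kFix` of the reflection there is thus a second solution; its Wronskian with `u` satisfies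
`(2 D_{z̄} + kFix) W = 0`, where `-kFix` is not a frequency, and vanishes. If `u` had no zero, the
second solution would be a scalar function times `u`, which is impossible for the same reason; hence
`u` has a zero (`IsFlat.exists_zero`). Multiplication by `F_l`, with its pole at that zero, leads to a
solution at quasi-momentum `l` (`IsFlat.twist`). Now there are solutions at every quasi-momentum, and
simplicity makes them unique up to scalars (`IsFlat.eq_const_mul`). Moving a second zero, or a second
order of the first, around with the functions `F_l` would make `u` vanish identically, so the zero is
simple and unique modulo `Λ` (`IsFlat.zero_unique`, `IsFlat.deriv_ne`). As `u` is an eigenfunction of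
the rotation by `om`, the zero sits at `-z_S` (`IsFlat.zero_neg_zS`). That `F_k` has the required
poles and zeros is `theta_eq_zero_iff`.

*The multilayer.* The second components of the layers satisfy the recursion
`(2 D_{z̄} + k) φ_{2j+2} = -t_j φ_{2j}`, which cannot be solved at `k ∈ Λ*`. The factor `θ(κ)^(n-1)`
repairs this: each layer spends one factor `θ(κ)` on the pole of one resolvent (`thetaQuot`, `amp`),
and the resulting family is holomorphic because its Fourier coefficients are and it is locally
bounded (`differentiable_of_coef`, `exists_multilayer_family`). Conversely, in a solution the first
components beyond the bilayer vanish, by descending induction on the layers; the one obstruction is a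
resonant character next to the bilayer, which enters the Wronskian with `u` through
`t_1 ∫ u₂ ≠ 0` (`BilayerFamily.coef_of_mem_kerDn`). So the bilayer part is a multiple of the bilayer
solution and determines the rest off `Λ*`; on `Λ*`, if `n ≥ 2`, the same integral makes the bilayer part vanish,
and a single character in the last layer remains (`BilayerFamily.ne_zero_and_kerDn_eq`).

*The bundle.* `Φ` is a nowhere vanishing holomorphic frame over the plane, so the flat band bundle
is the quotient of `ℂ × ℂ` by the multipliers, topologically as well (`IsFrame.isQuotientMap_toBand`),
and its transition functions are the multipliers (`IsFrame.contMDiffOn_coordChange`). For any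
Hermitian metric the logarithm of the squared norm of the frame is, by the size of the multipliers,
the sum of a periodic function and `(4π n / √3) (Im κ)²`. Only the second term contributes to the
integral of the curvature (`integral_wirtBar_wirt`), and it yields `-n` (`IsFrame.chernNumber_eq`).
-/

namespace TMG

/-! ### Integration over a period parallelogram -/

lemma om_re : om.re = -1 / 2 := by rw [om_eq]

lemma om_im : om.im = Real.sqrt 3 / 2 := by rw [om_eq]

/-- The real-linear map of the plane that sends the unit square onto `cell c`. -/
noncomputable def cellMap (c : ℂ) : ℂ →L[ℝ] ℂ :=
  Complex.reCLM.smulRight c + Complex.imCLM.smulRight (c * om)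

lemma cellMap_apply (c w : ℂ) : cellMap c w = c * (w.re + w.im * om) := by
  simp [cellMap]; ring

lemma cell_eq_image (c : ℂ) : cell c = cellMap c '' (Set.Ico 0 1 ×ℂ Set.Ico 0 1) := by
  ext z
  constructor
  · rintro ⟨x, hx, y, hy, rfl⟩
    exact ⟨⟨x, y⟩, ⟨hx, hy⟩, by rw [cellMap_apply]⟩
  · rintro ⟨w, ⟨hx, hy⟩, rfl⟩
    exact ⟨w.re, hx, w.im, hy, cellMap_apply c w⟩

lemma coord_injective {x y x' y' : ℝ} (h : (x + y * om : ℂ) = x' + y' * om) :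
    x = x' ∧ y = y' := by
  have h2 := congrArg Complex.im h
  have h1 := congrArg Complex.re h
  simp [om_im_ne] at h2
  subst h2
  simpa using h1

lemma cellMap_injective {c : ℂ} (hc : c ≠ 0) : Function.Injective (cellMap c) := by
  intro w w' h
  rw [cellMap_apply, cellMap_apply] at h
  obtain ⟨h1, h2⟩ := coord_injective (mul_left_cancel₀ hc h)
  exact Complex.ext h1 h2

lemma det_cellMap (c : ℂ) : (cellMap c).det = ‖c‖ ^ 2 * (Real.sqrt 3 / 2) := by
  rw [ContinuousLinearMap.det, ← LinearMap.det_toMatrix Complex.basisOneI, Matrix.det_fin_two]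
  simp [LinearMap.toMatrix_apply, cellMap_apply, om_re, om_im, ← Complex.normSq_eq_norm_sq,
    Complex.normSq_apply]
  ring

lemma measurableSet_cell {c : ℂ} (hc : c ≠ 0) : MeasurableSet (cell c) := by
  rw [cell_eq c hc]; exact ZSpan.fundamentalDomain_measurableSet _

lemma isBounded_cell {c : ℂ} (hc : c ≠ 0) : Bornology.IsBounded (cell c) := by
  rw [cell_eq c hc]; exact ZSpan.fundamentalDomain_isBounded _

lemma integrableOn_cell {c : ℂ} (hc : c ≠ 0) {f : ℂ → ℂ} (hf : Continuous f) :
    IntegrableOn f (cell c) :=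
  (hf.continuousOn.integrableOn_compact (isBounded_cell hc).isCompact_closure).mono_set
    subset_closure

lemma measurableSet_square : MeasurableSet (Set.Ico (0 : ℝ) 1 ×ℂ Set.Ico (0 : ℝ) 1) :=
  (measurableSet_Ico.preimage Complex.measurable_re).inter
    (measurableSet_Ico.preimage Complex.measurable_im)

lemma setIntegral_cell_eq {c : ℂ} (hc : c ≠ 0) (f : ℂ → ℂ) :
    ∫ z in cell c, f z = (‖c‖ ^ 2 * (Real.sqrt 3 / 2)) •
      ∫ p in Set.Ico (0 : ℝ) 1 ×ˢ Set.Ico (0 : ℝ) 1, f (c * (p.1 + p.2 * om)) := by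
  rw [cell_eq_image, integral_image_eq_integral_abs_det_fderiv_smul volume measurableSet_square
    (f' := fun _ => cellMap c) (fun x _ => (cellMap c).hasFDerivWithinAt)
    (cellMap_injective hc).injOn, det_cellMap, abs_of_nonneg (by positivity), integral_smul]
  congr 1
  have h := Complex.volume_preserving_equiv_real_prod.symm.setIntegral_preimage_emb
    Complex.measurableEquivRealProd.symm.measurableEmbedding (fun w => f (cellMap c w))
    (Set.Ico (0 : ℝ) 1 ×ℂ Set.Ico (0 : ℝ) 1)
  rw [← h]
  have hs : Complex.measurableEquivRealProd.symm ⁻¹' (Set.Ico (0 : ℝ) 1 ×ℂ Set.Ico (0 : ℝ) 1) =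
      Set.Ico (0 : ℝ) 1 ×ˢ Set.Ico (0 : ℝ) 1 := by
    ext p; rfl
  rw [hs]
  refine setIntegral_congr_fun (measurableSet_Ico.prod measurableSet_Ico) fun p _ => ?_
  simp only [cellMap_apply]
  rfl

lemma integrableOn_cell_iff {c : ℂ} (hc : c ≠ 0) (f : ℂ → ℂ) :
    IntegrableOn f (cell c) ↔ IntegrableOn (fun p : ℝ × ℝ => f (c * (p.1 + p.2 * om)))
      (Set.Ico (0 : ℝ) 1 ×ˢ Set.Ico (0 : ℝ) 1) := by
  have hdet : (0 : ℝ) < ‖c‖ ^ 2 * (Real.sqrt 3 / 2) := by positivity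
  rw [cell_eq_image, integrableOn_image_iff_integrableOn_abs_det_fderiv_smul volume
    measurableSet_square (f' := fun _ => cellMap c) (fun x _ => (cellMap c).hasFDerivWithinAt)
    (cellMap_injective hc).injOn, det_cellMap, abs_of_nonneg (by positivity)]
  have h := Complex.volume_preserving_equiv_real_prod.symm.integrableOn_comp_preimage
    Complex.measurableEquivRealProd.symm.measurableEmbedding (f := fun w => f (cellMap c w))
    (s := Set.Ico (0 : ℝ) 1 ×ℂ Set.Ico (0 : ℝ) 1)
  have hs : Complex.measurableEquivRealProd.symm ⁻¹' (Set.Ico (0 : ℝ) 1 ×ℂ Set.Ico (0 : ℝ) 1) =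
      Set.Ico (0 : ℝ) 1 ×ˢ Set.Ico (0 : ℝ) 1 := by
    ext p; rfl
  rw [hs] at h
  have h2 : (fun w => f (cellMap c w)) ∘ Complex.measurableEquivRealProd.symm =
      fun p : ℝ × ℝ => f (c * (p.1 + p.2 * om)) := by
    funext p
    simp only [Function.comp_apply, cellMap_apply]
    rfl
  rw [h2] at h
  rw [h]
  exact integrable_smul_iff hdet.ne' _

lemma self_mem_lattice (c : ℂ) : c ∈ lattice c := Submodule.subset_span (by simp)

lemma self_mul_om_mem_lattice (c : ℂ) : c * om ∈ lattice c := Submodule.subset_span (by simp)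

/-- The integral of a derivative of a periodic function over a period parallelogram vanishes. The
function may fail to be differentiable on a countable set. -/
lemma integral_cell_deriv_eq_zero {c : ℂ} (hc : c ≠ 0) {f : ℂ → ℂ} (hf : Continuous f)
    (hper : ∀ a ∈ lattice c, ∀ z, f (z + a) = f z) {s : Set ℂ} (hs : s.Countable)
    (hd : ∀ z ∉ s, DifferentiableAt ℝ f z) (A B : ℂ)
    (hint : IntegrableOn (fun z => A * fderiv ℝ f z 1 + B * fderiv ℝ f z Complex.I) (cell c)) :
    ∫ z in cell c, (A * fderiv ℝ f z 1 + B * fderiv ℝ f z Complex.I) = 0 := by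
  -- the coordinate vectors in terms of the periods
  have hexp : ∀ e : ℂ, ∃ a b : ℝ, e = a • c + b • (c * om) := fun e => by
    have := (hexBasis c hc).sum_repr e
    rw [Fin.sum_univ_two, hexBasis_zero, hexBasis_one] at this
    exact ⟨_, _, this.symm⟩
  obtain ⟨a₁, b₁, h1⟩ := hexp 1
  obtain ⟨a₂, b₂, h2⟩ := hexp Complex.I
  set A' : ℂ := A * a₁ + B * a₂ with hA'
  set B' : ℂ := A * b₁ + B * b₂ with hB'
  have hcomb : ∀ z, A * fderiv ℝ f z 1 + B * fderiv ℝ f z Complex.I =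
      A' * fderiv ℝ f z c + B' * fderiv ℝ f z (c * om) := by
    intro z
    rw [h1, h2]
    simp only [map_add, map_smul, hA', hB']
    simp only [Complex.real_smul]
    ring
  set T : ℝ × ℝ →L[ℝ] ℂ := (ContinuousLinearMap.fst ℝ ℝ ℝ).smulRight c +
    (ContinuousLinearMap.snd ℝ ℝ ℝ).smulRight (c * om) with hT
  have hTa : ∀ p : ℝ × ℝ, T p = c * (p.1 + p.2 * om) := by
    intro p; simp [hT]; ring
  have hTinj : Function.Injective T := by
    intro p p' h
    rw [hTa, hTa] at h
    obtain ⟨h1, h2⟩ := coord_injective (mul_left_cancel₀ hc h)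
    exact Prod.ext h1 h2
  have hcont : Continuous fun p => f (T p) := hf.comp T.continuous
  have hder : ∀ p, T p ∉ s → HasFDerivAt (fun p => f (T p)) ((fderiv ℝ f (T p)).comp T) p :=
    fun p hp => (hd _ hp).hasFDerivAt.comp p T.hasFDerivAt
  have hT1 : T (1, 0) = c := by rw [hTa]; simp
  have hT2 : T (0, 1) = c * om := by rw [hTa]; simp
  have hint2 := hint
  rw [integrableOn_cell_iff hc] at hint2
  simp only [hcomb, ← hTa] at hint2
  have hae : (Set.Icc (0 : ℝ) 1 ×ˢ Set.Icc (0 : ℝ) 1 : Set (ℝ × ℝ)) =ᵐ[volume]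
      (Set.Ico (0 : ℝ) 1 ×ˢ Set.Ico (0 : ℝ) 1 : Set (ℝ × ℝ)) :=
    (Measure.set_prod_ae_eq Ico_ae_eq_Icc Ico_ae_eq_Icc).symm
  have hint3 : IntegrableOn (fun p : ℝ × ℝ => (A' • (fderiv ℝ f (T p)).comp T) (1, 0) +
      (B' • (fderiv ℝ f (T p)).comp T) (0, 1)) (Set.Icc (0 : ℝ) 1 ×ˢ Set.Icc (0 : ℝ) 1) := by
    rw [integrableOn_congr_set_ae hae]
    simpa [hT1, hT2] using hint2
  have key := integral2_divergence_prod_of_hasFDerivAt_off_countable (fun p => A' * f (T p))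
    (fun p => B' * f (T p)) (fun p => A' • (fderiv ℝ f (T p)).comp T)
    (fun p => B' • (fderiv ℝ f (T p)).comp T) 0 0 1 1 (T ⁻¹' s) (hs.preimage hTinj)
    (hcont.const_mul _).continuousOn (hcont.const_mul _).continuousOn
    (fun p hp => (hder p hp.2).const_mul A') (fun p hp => (hder p hp.2).const_mul B')
    (by simpa only [Set.uIcc_of_le zero_le_one] using hint3)
  have hp1 : ∀ x : ℝ, f (T (x, 1)) = f (T (x, 0)) := by
    intro x
    rw [← hper _ (self_mul_om_mem_lattice c) (T (x, 0)), hTa, hTa]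
    congr 1; push_cast; ring
  have hp2 : ∀ y : ℝ, f (T (1, y)) = f (T (0, y)) := by
    intro x
    rw [← hper _ (self_mem_lattice c) (T (0, x)), hTa, hTa]
    congr 1; push_cast; ring
  simp only [hp1, hp2, sub_self, zero_add] at key
  rw [setIntegral_cell_eq hc]
  simp only [hcomb, ← hTa]
  rw [← setIntegral_congr_set hae, Measure.volume_eq_prod, setIntegral_prod]
  · have : ∀ g : ℝ → ℂ, ∫ x in Set.Icc (0 : ℝ) 1, g x = ∫ x in (0 : ℝ)..1, g x := fun g => by
      rw [intervalIntegral.integral_of_le zero_le_one, integral_Icc_eq_integral_Ioc]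
    simp only [this]
    simp only [_root_.smul_apply, ContinuousLinearMap.comp_apply, smul_eq_mul, hT1,
      hT2] at key
    rw [key, smul_zero]
  · simpa [Measure.volume_eq_prod, hT1, hT2] using hint3

lemma integral_cell_const {c : ℂ} (hc : c ≠ 0) (a : ℂ) :
    ∫ _ in cell c, a = (‖c‖ ^ 2 * (Real.sqrt 3 / 2)) • a := by
  rw [setIntegral_cell_eq hc]
  congr 1
  simp [Measure.volume_eq_prod, Measure.prod_prod, measureReal_def]


/-! ### The characters of `ℂ/3Λ` -/

/-- The point of the dual lattice of `3Λ` with integer coordinates `m`. -/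
noncomputable def pt (m : ℤ × ℤ) : ℂ := dualPt m.1 m.2 / 3

/-- The character `exp (i ⟨z, p⟩)` of `ℂ/3Λ`, where `p = pt m`. -/
noncomputable def chi (m : ℤ × ℤ) (z : ℂ) : ℂ := Complex.exp (Complex.I * pairing z (pt m))

lemma om_sq : om ^ 2 = -1 - om := by
  have h3 : (Real.sqrt 3 : ℂ) ^ 2 = 3 := by
    rw [← Complex.ofReal_pow, Real.sq_sqrt (by norm_num)]; norm_num
  have : om = -1 / 2 + (Real.sqrt 3 : ℂ) / 2 * Complex.I := by
    rw [om_eq]; apply Complex.ext <;> simp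
  rw [this]
  linear_combination (-1 / 4 : ℂ) * h3 + (Real.sqrt 3 : ℂ) ^ 2 / 4 * Complex.I_sq

lemma om_cube : om ^ 3 = 1 := by linear_combination (om - 1) * om_sq

lemma conj_om : conj om = -1 - om := by
  rw [om_eq]; apply Complex.ext <;> simp; norm_num

lemma om_mul_conj : om * conj om = 1 := by
  rw [conj_om]; linear_combination -om_sq

lemma norm_om : ‖om‖ = 1 := by
  rw [om, Complex.norm_exp]; simp

lemma om_ne_one : om ≠ 1 := fun h => om_im_ne (by rw [h]; simp)

lemma sqrt3_mul : (Real.sqrt 3 : ℂ) * (Real.sqrt 3 : ℂ) = 3 := by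
  rw [← Complex.ofReal_mul, Real.mul_self_sqrt (by norm_num)]; norm_num

lemma sqrt3_I : (Real.sqrt 3 : ℂ) * Complex.I = 1 + 2 * om := by
  rw [om_eq]; apply Complex.ext <;> simp <;> ring

lemma pairing_add_left (z w p : ℂ) : pairing (z + w) p = pairing z p + pairing w p := by
  simp [pairing, add_mul]

lemma pairing_add_right (z p q : ℂ) : pairing z (p + q) = pairing z p + pairing z q := by
  simp [pairing, mul_add]

lemma pairing_neg_right (z p : ℂ) : pairing z (-p) = -pairing z p := by
  simp [pairing]

lemma dualPt_add (p₁ p₂ q₁ q₂ : ℤ) :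
    dualPt (p₁ + q₁) (p₂ + q₂) = dualPt p₁ p₂ + dualPt q₁ q₂ := by
  simp only [dualPt]; push_cast; ring

lemma pairing_coord (x y : ℝ) (p₁ p₂ : ℤ) :
    pairing (cLam * (x + y * om)) (dualPt p₁ p₂) = 2 * Real.pi * (x * p₁ + y * p₂) := by
  have h3 : Real.sqrt 3 ^ 2 = 3 := Real.sq_sqrt (by norm_num)
  have h : cLam * (x + y * om) * conj (dualPt p₁ p₂) =
      4 / 3 * Real.pi * Real.sqrt 3 * Complex.I * ((x + y * om) * (conj om * p₁ - p₂)) := by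
    simp only [cLam, dualPt, cDual, map_mul, map_sub, Complex.conj_ofReal, map_intCast]
    linear_combination (4 / 3 * Real.pi * Real.sqrt 3 * Complex.I * ((x + y * om) *
      (conj om * p₁ - p₂))) * om_mul_conj
  rw [pairing, h, om_eq]
  simp
  linear_combination (2 / 3 * Real.pi * (x * p₁ + y * p₂)) * h3

lemma pairing_lamPt (a₁ a₂ p₁ p₂ : ℤ) :
    pairing (lamPt a₁ a₂) (dualPt p₁ p₂) = 2 * Real.pi * (a₁ * p₁ + a₂ * p₂) := by
  have := pairing_coord a₁ a₂ p₁ p₂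
  simpa [lamPt] using this

lemma pairing_div_three (z p : ℂ) : pairing z (p / 3) = pairing z p / 3 := by
  have : z * conj (p / 3) = ((1 / 3 : ℝ) : ℂ) * (z * conj p) := by
    rw [map_div₀, map_ofNat]; push_cast; ring
  rw [pairing, this, Complex.re_ofReal_mul, pairing]; ring

lemma pt_add (m m' : ℤ × ℤ) : pt (m + m') = pt m + pt m' := by
  simp only [pt, Prod.fst_add, Prod.snd_add, dualPt_add]; ring

lemma pt_zero : pt 0 = 0 := by simp [pt, dualPt]

lemma pt_neg (m : ℤ × ℤ) : pt (-m) = -pt m := by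
  have := pt_add m (-m)
  rw [add_neg_cancel, pt_zero] at this
  linear_combination -this

lemma pt_sub (m m' : ℤ × ℤ) : pt (m - m') = pt m - pt m' := by
  rw [sub_eq_add_neg, pt_add, pt_neg, sub_eq_add_neg]

lemma pt_three (p₁ p₂ : ℤ) : pt (3 * p₁, 3 * p₂) = dualPt p₁ p₂ := by
  simp only [pt, dualPt]; push_cast; ring

lemma chi_add (m m' : ℤ × ℤ) (z : ℂ) : chi (m + m') z = chi m z * chi m' z := by
  rw [chi, chi, chi, ← Complex.exp_add, pt_add, pairing_add_right]
  push_cast; ring_nf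

lemma chi_zero (z : ℂ) : chi 0 z = 1 := by simp [chi, pt_zero, pairing]

lemma chi_neg_mul (m : ℤ × ℤ) (z : ℂ) : chi (-m) z * chi m z = 1 := by
  rw [← chi_add, neg_add_cancel, chi_zero]

lemma conj_chi (m : ℤ × ℤ) (z : ℂ) : conj (chi m z) = chi (-m) z := by
  rw [chi, chi, ← Complex.exp_conj, pt_neg, pairing_neg_right]
  simp

lemma chi_neg_arg (m : ℤ × ℤ) (z : ℂ) : chi m (-z) = chi (-m) z := by
  rw [chi, chi, pt_neg]; simp [pairing]

lemma norm_chi (m : ℤ × ℤ) (z : ℂ) : ‖chi m z‖ = 1 := by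
  rw [chi, mul_comm, Complex.norm_exp_ofReal_mul_I]

lemma chi_ne (m : ℤ × ℤ) (z : ℂ) : chi m z ≠ 0 := Complex.exp_ne_zero _

lemma om_zpow (j : ℤ) : om ^ j = Complex.exp (2 * Real.pi * Complex.I / 3 * j) := by
  rw [om, ← Complex.exp_int_mul, mul_comm]

lemma chi_add_lamPt (m : ℤ × ℤ) (z : ℂ) (a₁ a₂ : ℤ) :
    chi m (z + lamPt a₁ a₂) = om ^ (a₁ * m.1 + a₂ * m.2) * chi m z := by
  rw [chi, chi, om_zpow, ← Complex.exp_add, pairing_add_left]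
  congr 1
  have h : pairing (lamPt a₁ a₂) (pt m) = 2 * Real.pi * (a₁ * m.1 + a₂ * m.2) / 3 := by
    rw [pt, pairing_div_three, pairing_lamPt]
  rw [h]; push_cast; ring

lemma mem_lattice_iff (c a : ℂ) : a ∈ lattice c ↔ ∃ x y : ℤ, a = c * (x + y * om) := by
  change a ∈ Submodule.span ℤ {c, c * om} ↔ _
  rw [Submodule.mem_span_pair]
  constructor
  · rintro ⟨x, y, rfl⟩
    exact ⟨x, y, by simp; ring⟩
  · rintro ⟨x, y, rfl⟩
    exact ⟨x, y, by simp; ring⟩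

lemma mem_lattice_cLam (a : ℂ) : a ∈ lattice cLam ↔ ∃ x y : ℤ, a = lamPt x y :=
  mem_lattice_iff _ _

lemma mem_lattice_three (a : ℂ) :
    a ∈ lattice (3 * cLam) ↔ ∃ x y : ℤ, a = lamPt (3 * x) (3 * y) := by
  rw [mem_lattice_iff]
  simp only [lamPt]
  push_cast
  constructor <;> rintro ⟨x, y, rfl⟩ <;> exact ⟨x, y, by ring⟩

lemma mem_lattice_cDual (a : ℂ) : a ∈ lattice cDual ↔ ∃ p₁ p₂ : ℤ, a = dualPt p₁ p₂ := by
  rw [mem_lattice_iff]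
  simp only [dualPt]
  constructor
  · rintro ⟨x, y, rfl⟩
    exact ⟨y, -x, by push_cast; ring⟩
  · rintro ⟨x, y, rfl⟩
    exact ⟨-y, x, by push_cast; ring⟩

lemma om_zpow_three_mul (j : ℤ) : om ^ (3 * j) = 1 := by
  rw [zpow_mul]; norm_cast; rw [om_cube, one_zpow]

lemma om_zpow_eq_one_iff (j : ℤ) : om ^ j = 1 ↔ (3 : ℤ) ∣ j := by
  constructor
  · intro h
    have h1 : j = 3 * (j / 3) + j % 3 := (Int.mul_ediv_add_emod j 3).symm
    have h2 : om ^ (j % 3) = 1 := by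
      rw [h1, zpow_add₀ om_ne, om_zpow_three_mul, one_mul] at h; exact h
    have h3 : j % 3 = 0 ∨ j % 3 = 1 ∨ j % 3 = 2 := by omega
    rcases h3 with h3 | h3 | h3
    · exact Int.dvd_of_emod_eq_zero h3
    · rw [h3, zpow_one] at h2; exact absurd h2 om_ne_one
    · rw [h3] at h2
      have h4 : om ^ 2 = 1 := by exact_mod_cast h2
      exact absurd (by linear_combination om_cube - om * h4) om_ne_one
  · rintro ⟨i, rfl⟩; exact om_zpow_three_mul i

lemma chi_periodic (m : ℤ × ℤ) {a : ℂ} (ha : a ∈ lattice (3 * cLam)) (z : ℂ) :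
    chi m (z + a) = chi m z := by
  obtain ⟨x, y, rfl⟩ := (mem_lattice_three a).1 ha
  rw [chi_add_lamPt, mul_assoc, mul_assoc, ← mul_add, om_zpow_three_mul, one_mul]

lemma hasFDerivAt_chi (m : ℤ × ℤ) (z : ℂ) : HasFDerivAt (chi m)
    (chi m z • ((Complex.I * (pt m).re) • (Complex.ofRealCLM.comp Complex.reCLM) +
      (Complex.I * (pt m).im) • (Complex.ofRealCLM.comp Complex.imCLM))) z := by
  have h : ∀ z, chi m z = Complex.exp (((Complex.I * (pt m).re) •
      (Complex.ofRealCLM.comp Complex.reCLM) + (Complex.I * (pt m).im) •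
      (Complex.ofRealCLM.comp Complex.imCLM) : ℂ →L[ℝ] ℂ) z) := by
    intro z
    simp [chi, pairing]
    ring_nf
  rw [funext h]
  exact (ContinuousLinearMap.hasFDerivAt _).cexp

lemma fderiv_chi (m : ℤ × ℤ) (z e : ℂ) :
    fderiv ℝ (chi m) z e = Complex.I * pairing e (pt m) * chi m z := by
  rw [(hasFDerivAt_chi m z).fderiv]
  simp [pairing]; ring

lemma contDiff_chi (m : ℤ × ℤ) : ContDiff ℝ ∞ (chi m) := by
  have : chi m = fun z => Complex.exp (((Complex.I * (pt m).re) •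
      (Complex.ofRealCLM.comp Complex.reCLM) + (Complex.I * (pt m).im) •
      (Complex.ofRealCLM.comp Complex.imCLM) : ℂ →L[ℝ] ℂ) z) := by
    funext z
    simp [chi, pairing]
    ring_nf
  rw [this]
  exact (ContinuousLinearMap.contDiff _).cexp

lemma continuous_chi (m : ℤ × ℤ) : Continuous (chi m) := (contDiff_chi m).continuous

lemma differentiable_chi (m : ℤ × ℤ) : Differentiable ℝ (chi m) :=
  (contDiff_chi m).differentiable (by simp)

/-- The potential is a sum of three characters. -/
lemma U_eq (z : ℂ) : U z = chi (-1, -1) z + om * chi (2, -1) z + om ^ 2 * chi (-1, 2) z := by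
  have key : ∀ (w : ℂ) (m : ℤ × ℤ), pt m = Complex.I * conj w →
      Complex.exp (1 / 2 * (z * w - conj z * conj w)) = chi m z := by
    intro w m h
    rw [chi, h]
    congr 1
    have h1 : (pairing z (Complex.I * conj w) : ℂ) =
        (z * conj (Complex.I * conj w) + conj z * (Complex.I * conj w)) / 2 := by
      have := Complex.add_conj (z * conj (Complex.I * conj w))
      rw [pairing]
      simp only [map_mul, Complex.conj_conj] at this ⊢
      rw [this]; push_cast; ring
    rw [h1]
    simp only [map_mul, Complex.conj_conj, Complex.conj_I]
    linear_combination (z * w / 2 - conj z * conj w / 2) * Complex.I_sq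
  have e3 := sqrt3_mul
  have e2 := om_sq
  have hs := sqrt3_I
  have hI : (Real.sqrt 3 : ℂ) = -Complex.I * (1 + 2 * om) := by
    linear_combination (-Complex.I) * hs + (Real.sqrt 3 : ℂ) * Complex.I_sq
  have k0 := key 1 (-1, -1) (by
    simp only [pt, dualPt, cDual, map_one]; push_cast; rw [hI]
    linear_combination (Complex.I * (2 * om - 3) / 3) * e2)
  have k1 := key (conj om) (2, -1) (by
    simp only [pt, dualPt, cDual, Complex.conj_conj]; push_cast; rw [hI]
    linear_combination (-Complex.I * (4 * om) / 3) * e2)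
  have k2 := key (conj om ^ 2) (-1, 2) (by
    simp only [pt, dualPt, cDual, map_pow, Complex.conj_conj]; push_cast; rw [hI]
    linear_combination (Complex.I * (2 * om) / 3) * e2)
  simp only [map_pow, map_one, Complex.conj_conj] at k0 k1 k2
  simp [U, Finset.sum_range_succ] at *
  rw [← k0, ← k1, ← k2]


section

/-! ### Fourier series on `ℂ/3Λ` -/

instance : IsClosed (lattice (3 * cLam) : Set ℂ) := by
  have := lattice_discrete _ three_cLam_ne
  exact AddSubgroup.isClosed_of_discrete

instance : BorelSpace Torus := QuotientAddGroup.borelSpace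

lemma continuous_toTorus : Continuous toTorus := continuous_quotient_mk'

lemma toTorus_surjective : Function.Surjective toTorus := QuotientAddGroup.mk_surjective

lemma toTorus_eq {z w : ℂ} : toTorus z = toTorus w ↔ w - z ∈ lattice (3 * cLam) := by
  rw [toTorus, toTorus, QuotientAddGroup.eq, neg_add_eq_sub]

lemma exists_mem_cell {c : ℂ} (hc : c ≠ 0) (z : ℂ) : ∃ w ∈ cell c, w - z ∈ lattice c := by
  refine ⟨ZSpan.fract (hexBasis c hc) z, ?_, ?_⟩
  · rw [cell_eq c hc]; exact ZSpan.fract_mem_fundamentalDomain _ z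
  · rw [lattice_eq c hc, ZSpan.fract]
    have : z - (ZSpan.floor (hexBasis c hc) z : ℂ) - z = -(ZSpan.floor (hexBasis c hc) z : ℂ) := by
      ring
    rw [this]
    exact neg_mem (ZSpan.floor (hexBasis c hc) z).2

instance : CompactSpace Torus := by
  refine ⟨?_⟩
  have h : (Set.univ : Set Torus) = toTorus '' closure (cell (3 * cLam)) := by
    refine (Set.eq_univ_of_forall fun x => ?_).symm
    obtain ⟨z, rfl⟩ := toTorus_surjective x
    obtain ⟨w, hw, hz⟩ := exists_mem_cell three_cLam_ne z
    exact ⟨w, subset_closure hw, (toTorus_eq.2 hz).symm⟩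
  rw [h]
  exact (isBounded_cell three_cLam_ne).isCompact_closure.image continuous_toTorus

instance : IsFiniteMeasure torusMeasure := by
  unfold torusMeasure; infer_instance

/-- The function on the torus that a `3Λ`-periodic function induces. -/
noncomputable def descend {X : Type*} (f : ℂ → X) (x : Torus) : X := f x.out

lemma descend_toTorus {X : Type*} {f : ℂ → X}
    (hf : ∀ a ∈ lattice (3 * cLam), ∀ z, f (z + a) = f z) (z : ℂ) :
    descend f (toTorus z) = f z := by
  have h : toTorus (toTorus z).out = toTorus z := Quotient.out_eq' _
  have h2 := toTorus_eq.1 h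
  have h3 := hf _ h2 (toTorus z).out
  rw [descend, ← h3]; congr 1; ring

lemma continuous_descend {X : Type*} [TopologicalSpace X] {f : ℂ → X} (hc : Continuous f)
    (hf : ∀ a ∈ lattice (3 * cLam), ∀ z, f (z + a) = f z) : Continuous (descend f) := by
  refine (QuotientAddGroup.isQuotientMap_mk (N := lattice (3 * cLam))).continuous_iff.2 ?_
  exact hc.congr fun z => (descend_toTorus hf z).symm

lemma integral_torus {g : Torus → ℂ} (hg : AEStronglyMeasurable g torusMeasure) :
    ∫ x, g x ∂torusMeasure = ∫ z in cell (3 * cLam), g (toTorus z) := by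
  exact integral_map measurable_toTorus.aemeasurable hg

variable {ι : Type} [Fintype ι]

lemma L2_ext {v w : L2 ι} (h : ∀ᵐ z : ℂ, v (toTorus z) = w (toTorus z)) : v = w := by
  refine Lp.ext ?_
  exact (ae_map_iff measurable_toTorus.aemeasurable (measurableSet_eq_fun
    (Lp.stronglyMeasurable v).measurable (Lp.stronglyMeasurable w).measurable)).2
    (ae_restrict_of_ae h)

/-- Fourier coefficients on `ℂ/3Λ`, without normalization. -/
noncomputable def fc (g : ℂ → ℂ) (m : ℤ × ℤ) : ℂ := ∫ z in cell (3 * cLam), g z * chi (-m) z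

/-- The Fourier coefficients of the component `i` of a square-integrable function. -/
noncomputable def coef (v : L2 ι) (i : ι) (m : ℤ × ℤ) : ℂ := fc (fun z => v (toTorus z) i) m

/-- The area of `ℂ/3Λ`. -/
noncomputable def area : ℝ := ‖3 * cLam‖ ^ 2 * (Real.sqrt 3 / 2)

lemma area_pos : 0 < area := by
  have := norm_pos_iff.2 three_cLam_ne
  unfold area; positivity

lemma pt_eq_zero {m : ℤ × ℤ} (h : pt m = 0) : m = 0 := by
  have h1 : (om * m.1 - m.2 : ℂ) = 0 := by
    have : cDual * (om * m.1 - m.2) = 0 := by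
      have h' : pt m = cDual * (om * m.1 - m.2) / 3 := rfl
      rw [h] at h'; linear_combination -3 * h'
    exact (mul_eq_zero.1 this).resolve_left cDual_ne
  obtain ⟨h2, h3⟩ := coord_injective (x := -m.2) (y := m.1) (x' := 0) (y' := 0)
    (by push_cast; linear_combination h1)
  ext
  · exact_mod_cast h3
  · have : (m.2 : ℝ) = 0 := by linarith
    exact_mod_cast this

lemma pt_injective : Function.Injective pt := fun m m' h => by
  have : m - m' = 0 := pt_eq_zero (by rw [pt_sub, h, sub_self])
  exact sub_eq_zero.1 this

lemma integral_chi (m : ℤ × ℤ) :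
    ∫ z in cell (3 * cLam), chi m z = if m = 0 then (area : ℂ) else 0 := by
  split_ifs with h
  · subst h
    simp only [chi_zero]
    rw [integral_cell_const three_cLam_ne]
    simp [area]
  · -- `2 D_{z̄}` multiplies the character by a non-zero constant
    have h0 : pt m ≠ 0 := fun h' => h (pt_eq_zero h')
    have hder : ∀ z, -Complex.I * fderiv ℝ (chi m) z 1 + 1 * fderiv ℝ (chi m) z Complex.I =
        pt m * chi m z := by
      intro z
      rw [fderiv_chi, fderiv_chi]
      have : pt m = (pairing 1 (pt m) : ℂ) + pairing Complex.I (pt m) * Complex.I := by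
        apply Complex.ext <;> simp [pairing]
      linear_combination (-chi m z) * this - (pairing 1 (pt m) : ℂ) * chi m z * Complex.I_sq
    have key := integral_cell_deriv_eq_zero three_cLam_ne (continuous_chi m)
      (fun a ha z => chi_periodic m ha z) Set.countable_empty
      (fun z _ => (differentiable_chi m) z) (-Complex.I) 1 (by
        simp only [hder]
        exact integrableOn_cell three_cLam_ne ((continuous_chi m).const_mul _))
    simp only [hder] at key
    rw [integral_const_mul] at key
    exact (mul_eq_zero.1 key).resolve_left h0

/-- The character `chi m` as a continuous function on the torus. -/
noncomputable def chiT (m : ℤ × ℤ) : C(Torus, ℂ) :=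
  ⟨descend (chi m), continuous_descend (continuous_chi m) fun _ ha z => chi_periodic m ha z⟩

lemma chiT_toTorus (m : ℤ × ℤ) (z : ℂ) : chiT m (toTorus z) = chi m z :=
  descend_toTorus (fun _ ha z => chi_periodic m ha z) z

lemma exists_coord {c : ℂ} (hc : c ≠ 0) (z : ℂ) : ∃ x y : ℝ, z = c * (x + y * om) := by
  have := (hexBasis c hc).sum_repr z
  rw [Fin.sum_univ_two, hexBasis_zero, hexBasis_one] at this
  simp only [Complex.real_smul] at this
  exact ⟨(hexBasis c hc).repr z 0, (hexBasis c hc).repr z 1, by linear_combination -this⟩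

lemma chi_coord (x y : ℝ) (m : ℤ × ℤ) : chi m (3 * cLam * (x + y * om)) =
    Complex.exp ((x * m.1 + y * m.2) * (2 * Real.pi * Complex.I)) := by
  have : (3 * cLam * (x + y * om) : ℂ) = cLam * (((3 * x : ℝ) : ℂ) + ((3 * y : ℝ) : ℂ) * om) := by
    push_cast; ring
  rw [chi, this, pt, pairing_div_three, pairing_coord]
  congr 1; push_cast; ring

lemma exp_eq_one_iff' (x : ℝ) :
    Complex.exp (x * (2 * Real.pi * Complex.I)) = 1 ↔ ∃ n : ℤ, x = n := by
  rw [Complex.exp_eq_one_iff]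
  constructor
  · rintro ⟨n, hn⟩
    refine ⟨n, ?_⟩
    have := mul_right_cancel₀ Complex.two_pi_I_ne_zero hn
    exact_mod_cast this
  · rintro ⟨n, rfl⟩; exact ⟨n, by push_cast; ring⟩

lemma mem_lattice_of_chi {a : ℂ} (h1 : chi (1, 0) a = 1) (h2 : chi (0, 1) a = 1) :
    a ∈ lattice (3 * cLam) := by
  obtain ⟨x, y, rfl⟩ := exists_coord three_cLam_ne a
  rw [chi_coord] at h1 h2
  obtain ⟨n, hn⟩ := (exp_eq_one_iff' x).1 (by simpa using h1)
  obtain ⟨n', hn'⟩ := (exp_eq_one_iff' y).1 (by simpa using h2)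
  rw [mem_lattice_iff]
  exact ⟨n, n', by rw [hn, hn']; push_cast; ring⟩

/-- The characters span a dense subspace of the continuous functions on the torus. -/
lemma span_chiT_closure : (Submodule.span ℂ (Set.range chiT)).topologicalClosure = ⊤ := by
  let S : StarSubalgebra ℂ C(Torus, ℂ) :=
    { toSubalgebra := Algebra.adjoin ℂ (Set.range chiT)
      star_mem' := by
        change Algebra.adjoin ℂ (Set.range chiT) ≤ star (Algebra.adjoin ℂ (Set.range chiT))
        refine Algebra.adjoin_le ?_
        rintro _ ⟨m, rfl⟩
        refine Algebra.subset_adjoin ⟨-m, ?_⟩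
        ext x
        obtain ⟨z, rfl⟩ := toTorus_surjective x
        rw [ContinuousMap.star_apply, chiT_toTorus, chiT_toTorus, ← conj_chi]
        rfl }
  have hS : S.toSubalgebra.toSubmodule = Submodule.span ℂ (Set.range chiT) := by
    apply Algebra.adjoin_eq_span_of_subset
    refine .trans (fun x ↦ Submonoid.closure_induction (fun _ ↦ id) ⟨0, ?_⟩ ?_)
      Submodule.subset_span
    · ext x
      obtain ⟨z, rfl⟩ := toTorus_surjective x
      rw [chiT_toTorus, chi_zero]; rfl
    · rintro _ _ _ _ ⟨m, rfl⟩ ⟨n, rfl⟩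
      refine ⟨m + n, ?_⟩
      ext x
      obtain ⟨z, rfl⟩ := toTorus_surjective x
      rw [ContinuousMap.mul_apply, chiT_toTorus, chiT_toTorus, chiT_toTorus, chi_add]
  have hsep : S.SeparatesPoints := by
    intro x y hxy
    obtain ⟨z, rfl⟩ := toTorus_surjective x
    obtain ⟨w, rfl⟩ := toTorus_surjective y
    by_contra! hcon
    have hm : ∀ m, chi m z = chi m w := by
      intro m
      have := hcon (chiT m) ⟨chiT m, Algebra.subset_adjoin ⟨m, rfl⟩, rfl⟩
      rwa [chiT_toTorus, chiT_toTorus] at this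
    have hd : ∀ m, chi m (w - z) = 1 := by
      intro m
      have h : chi m w = chi m (w - z) * chi m z := by
        rw [chi, chi, chi, ← Complex.exp_add]
        congr 1
        have := pairing_add_left (w - z) z (pt m)
        rw [sub_add_cancel] at this
        rw [this]; push_cast; ring
      rw [hm m] at h
      exact (mul_right_cancel₀ (chi_ne m w) (by rw [one_mul]; exact h)).symm
    exact hxy (toTorus_eq.2 (mem_lattice_of_chi (hd _) (hd _)))
  rw [← hS]
  exact congr_arg (Subalgebra.toSubmodule <| StarSubalgebra.toSubalgebra ·)
    (ContinuousMap.starSubalgebra_topologicalClosure_eq_top_of_separatesPoints S hsep)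

lemma integral_torus_conj_chiT (g : Torus → ℂ) (hg : AEStronglyMeasurable g torusMeasure)
    (m : ℤ × ℤ) : ∫ x, g x * conj (chiT m x) ∂torusMeasure = fc (fun z => g (toTorus z)) m := by
  rw [integral_torus (g := fun x => g x * conj (chiT m x)) (hg.mul
    (Complex.continuous_conj.comp (chiT m).continuous).aestronglyMeasurable), fc]
  simp only [chiT_toTorus, conj_chi]

/-- A scalar square-integrable function whose Fourier coefficients vanish is zero. -/
lemma Lp_eq_zero_of_fc (f : Lp ℂ 2 torusMeasure)
    (h : ∀ m, fc (fun z => f (toTorus z)) m = 0) : f = 0 := by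
  have hperp : ∀ g : C(Torus, ℂ), inner ℂ (ContinuousMap.toLp 2 torusMeasure ℂ g) f = 0 := by
    have hcl : (⊤ : Submodule ℂ C(Torus, ℂ)) ≤ LinearMap.ker
        ((innerSL ℂ f).comp
          (ContinuousMap.toLp (E := ℂ) 2 torusMeasure ℂ)).toLinearMap := by
      rw [← span_chiT_closure]
      refine Submodule.topologicalClosure_minimal _ ?_ (ContinuousLinearMap.isClosed_ker _)
      rw [Submodule.span_le]
      rintro _ ⟨m, rfl⟩
      change inner ℂ f (ContinuousMap.toLp 2 torusMeasure ℂ (chiT m)) = 0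
      rw [← inner_conj_symm, map_eq_zero, L2.inner_def, ← h m,
        ← integral_torus_conj_chiT _ (Lp.aestronglyMeasurable f)]
      refine integral_congr_ae ?_
      filter_upwards [ContinuousMap.coeFn_toLp (p := 2) (𝕜 := ℂ) torusMeasure (chiT m)] with x hx
      rw [hx]; simp
    intro g
    have : inner ℂ f (ContinuousMap.toLp 2 torusMeasure ℂ g) = 0 := hcl Submodule.mem_top
    rw [← inner_conj_symm, this, map_zero]
  have hd : DenseRange (ContinuousMap.toLp (E := ℂ) (α := Torus) 2 torusMeasure ℂ) :=
    ContinuousMap.toLp_denseRange ℂ torusMeasure ℂ (p := 2) (by norm_num)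
  have : inner ℂ f f = 0 := by
    refine hd.induction_on (p := fun g => inner ℂ g f = 0) f ?_ hperp
    exact isClosed_eq (by fun_prop) continuous_const
  exact inner_self_eq_zero.1 this

lemma aestronglyMeasurable_component (v : L2 ι) (i : ι) :
    AEStronglyMeasurable (fun x => v x i) torusMeasure :=
  (EuclideanSpace.proj i : EuclideanSpace ℂ ι →L[ℂ] ℂ).continuous.comp_aestronglyMeasurable
    (Lp.aestronglyMeasurable v)

/-- A square-integrable function is determined by its Fourier coefficients. -/
lemma L2_eq_zero_of_coef (v : L2 ι) (h : ∀ i m, coef v i m = 0) : v = 0 := by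
  have hi : ∀ i, (EuclideanSpace.proj i : EuclideanSpace ℂ ι →L[ℂ] ℂ).compLp v = 0 := by
    intro i
    refine Lp_eq_zero_of_fc _ fun m => ?_
    rw [← h i m, coef, fc, fc]
    refine integral_congr_ae (ae_restrict_of_ae ?_)
    filter_upwards [quasi_toTorus.ae
      ((EuclideanSpace.proj i : EuclideanSpace ℂ ι →L[ℂ] ℂ).coeFn_compLp v)] with z hz
    rw [hz]; rfl
  refine L2_ext ?_
  have hall : ∀ᵐ z : ℂ, ∀ i, v (toTorus z) i = 0 := by
    rw [ae_all_iff]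
    intro i
    have h1 := quasi_toTorus.ae
      ((EuclideanSpace.proj i : EuclideanSpace ℂ ι →L[ℂ] ℂ).coeFn_compLp v)
    rw [hi i] at h1
    filter_upwards [h1, quasi_toTorus.ae (Lp.coeFn_zero ℂ 2 torusMeasure)] with z h2 h3
    rw [h3] at h2
    exact h2.symm
  filter_upwards [hall, ae_zero (ι := ι)] with z h1 h2
  rw [h2]
  ext i
  exact h1 i

variable [DecidableEq ι]

/-- The function `chi m` in the component `i`. -/
noncomputable def charL2 (i : ι) (m : ℤ × ℤ) : L2 ι :=
  ContinuousMap.toLp 2 torusMeasure ℂ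
    ⟨fun x => chiT m x • EuclideanSpace.single i 1, by fun_prop⟩

lemma charL2_ae (i : ι) (m : ℤ × ℤ) :
    ∀ᵐ x ∂torusMeasure, charL2 i m x = chiT m x • EuclideanSpace.single i 1 :=
  ContinuousMap.coeFn_toLp (𝕜 := ℂ) torusMeasure _

lemma inner_charL2 (i : ι) (m : ℤ × ℤ) (v : L2 ι) : inner ℂ (charL2 i m) v = coef v i m := by
  rw [L2.inner_def, coef, ← integral_torus_conj_chiT _ (aestronglyMeasurable_component v i)]
  refine integral_congr_ae ?_
  filter_upwards [charL2_ae i m] with x hx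
  rw [hx, inner_smul_left, EuclideanSpace.inner_single_left]
  simp [mul_comm]

lemma coef_charL2 (i j : ι) (m m' : ℤ × ℤ) :
    coef (charL2 i m) j m' = if i = j ∧ m = m' then (area : ℂ) else 0 := by
  have h : ∀ᵐ z ∂(volume.restrict (cell (3 * cLam))), charL2 i m (toTorus z) j * chi (-m') z =
      (if i = j then 1 else 0) * chi (m - m') z := by
    refine ae_restrict_of_ae ?_
    filter_upwards [quasi_toTorus.ae (charL2_ae i m)] with z hz
    rw [hz, sub_eq_add_neg, chi_add, chiT_toTorus]
    by_cases hij : i = j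
    · simp [hij]
    · simp [hij, Ne.symm hij]
  rw [coef, fc, integral_congr_ae h, integral_const_mul, integral_chi]
  by_cases hij : i = j <;> simp [hij, sub_eq_zero]

/-- The normalized characters form a Hilbert basis. -/
noncomputable def fourierBasis (ι : Type) [Fintype ι] [DecidableEq ι] :
    HilbertBasis (ι × (ℤ × ℤ)) ℂ (L2 ι) :=
  HilbertBasis.mkOfOrthogonalEqBot
    (v := fun q : ι × (ℤ × ℤ) => ((Real.sqrt area)⁻¹ : ℂ) • charL2 q.1 q.2)
    (by
      classical
      rw [orthonormal_iff_ite]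
      rintro ⟨i, m⟩ ⟨j, m'⟩
      rw [inner_smul_left, inner_smul_right, ← inner_conj_symm, inner_charL2, coef_charL2]
      have h : (Real.sqrt area : ℂ) * (Real.sqrt area : ℂ) = area := by
        rw [← Complex.ofReal_mul, Real.mul_self_sqrt area_pos.le]
      have h0 : (Real.sqrt area : ℂ) ≠ 0 := by
        exact_mod_cast (Real.sqrt_pos.2 area_pos).ne'
      by_cases hc : i = j ∧ m = m'
      · obtain ⟨rfl, rfl⟩ := hc
        simp only [and_self, if_true, map_inv₀, Complex.conj_ofReal]
        rw [← h]; field_simp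
      · rw [if_neg hc, if_neg (by simpa using hc)]; simp)
    (by
      rw [Submodule.eq_bot_iff]
      intro v hv
      refine L2_eq_zero_of_coef v fun i m => ?_
      have := (Submodule.mem_orthogonal _ v).1 hv _ (Submodule.subset_span ⟨(i, m), rfl⟩)
      rw [inner_smul_left, inner_charL2] at this
      refine (mul_eq_zero.1 this).resolve_left ?_
      have h0 : (Real.sqrt area : ℂ) ≠ 0 := by
        exact_mod_cast (Real.sqrt_pos.2 area_pos).ne'
      simpa using h0)

lemma fourierBasis_repr (v : L2 ι) (i : ι) (m : ℤ × ℤ) :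
    (fourierBasis ι).repr v (i, m) = ((Real.sqrt area)⁻¹ : ℂ) * coef v i m := by
  rw [HilbertBasis.repr_apply_apply, fourierBasis, HilbertBasis.coe_mkOfOrthogonalEqBot,
    inner_smul_left, inner_charL2]
  simp

lemma coef_eq_repr (v : L2 ι) (i : ι) (m : ℤ × ℤ) :
    coef v i m = (Real.sqrt area : ℂ) * (fourierBasis ι).repr v (i, m) := by
  have h0 : (Real.sqrt area : ℂ) ≠ 0 := by
    exact_mod_cast (Real.sqrt_pos.2 area_pos).ne'
  rw [fourierBasis_repr, mul_inv_cancel_left₀ h0]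

lemma coef_add (v w : L2 ι) (i : ι) (m : ℤ × ℤ) :
    coef (v + w) i m = coef v i m + coef w i m := by
  simp only [← inner_charL2, inner_add_right]

lemma coef_smul (c : ℂ) (v : L2 ι) (i : ι) (m : ℤ × ℤ) :
    coef (c • v) i m = c * coef v i m := by
  simp only [← inner_charL2, inner_smul_right]

lemma coef_zero (i : ι) (m : ℤ × ℤ) : coef (0 : L2 ι) i m = 0 := by
  simp only [← inner_charL2, inner_zero_right]

lemma L2_ext_coef {v w : L2 ι} (h : ∀ i m, coef v i m = coef w i m) : v = w := by
  rw [← sub_eq_zero]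
  refine L2_eq_zero_of_coef _ fun i m => ?_
  rw [sub_eq_add_neg, ← neg_one_smul ℂ, coef_add, coef_smul, h]; ring

/-- The Fourier coefficient as a continuous linear functional. -/
noncomputable def coefCLM (i : ι) (m : ℤ × ℤ) : L2 ι →L[ℂ] ℂ := innerSL ℂ (charL2 i m)

lemma coefCLM_apply (i : ι) (m : ℤ × ℤ) (v : L2 ι) : coefCLM i m v = coef v i m :=
  inner_charL2 i m v

/-- Parseval's identity. -/
lemma hasSum_coef (v : L2 ι) :
    HasSum (fun q : ι × (ℤ × ℤ) => ‖coef v q.1 q.2‖ ^ 2) (area * ‖v‖ ^ 2) := by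
  have h := (lp.hasSum_norm (p := 2) (by norm_num) ((fourierBasis ι).repr v))
  rw [LinearIsometryEquiv.norm_map] at h
  have h2 := h.mul_left area
  have e : (2 : ENNReal).toReal = (2 : ℕ) := by norm_num
  simp only [e, Real.rpow_natCast] at h2
  refine h2.congr_fun fun q => ?_
  rw [fourierBasis_repr, norm_mul, mul_pow, norm_inv, Complex.norm_real, Real.norm_eq_abs, inv_pow,
    sq_abs, Real.sq_sqrt area_pos.le, mul_inv_cancel_left₀ area_pos.ne']

/-- Every square-summable family is a family of Fourier coefficients. -/
lemma exists_coef (x : ι → ℤ × ℤ → ℂ) (hx : ∀ i, Summable fun m => ‖x i m‖ ^ 2) :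
    ∃ v : L2 ι, ∀ i m, coef v i m = x i m := by
  have h0 : (Real.sqrt area : ℂ) ≠ 0 := by
    exact_mod_cast (Real.sqrt_pos.2 area_pos).ne'
  have hmem : Memℓp (fun q : ι × (ℤ × ℤ) => ((Real.sqrt area)⁻¹ : ℂ) * x q.1 q.2) 2 := by
    refine memℓp_gen ?_
    have e : (2 : ENNReal).toReal = (2 : ℕ) := by norm_num
    simp only [e, Real.rpow_natCast, norm_mul, mul_pow]
    refine Summable.mul_left _ ?_
    refine (summable_prod_of_nonneg (fun _ => by positivity)).2 ⟨hx, ?_⟩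
    exact (hasSum_fintype _).summable
  refine ⟨(fourierBasis ι).repr.symm ⟨_, hmem⟩, fun i m => ?_⟩
  rw [coef_eq_repr, LinearIsometryEquiv.apply_symm_apply]
  exact mul_inv_cancel_left₀ h0 _

lemma summable_coef (v : L2 ι) (i : ι) : Summable fun m => ‖coef v i m‖ ^ 2 :=
  (hasSum_coef v).summable.prod_factor i

end


section

/-! ### Operations on square-integrable functions and their Fourier coefficients -/

variable {ι : Type} [Fintype ι]

/-- A continuous periodic function defines a square-integrable function on the torus. -/
lemma exists_L2 (f : ℂ → ι → ℂ) (hc : ∀ i, Continuous fun z => f z i)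
    (hp : ∀ a ∈ lattice (3 * cLam), ∀ z, f (z + a) = f z) :
    ∃ v : L2 ι, ∀ᵐ z : ℂ, (v (toTorus z)).ofLp = f z := by
  have hc' : Continuous fun z => WithLp.toLp 2 (f z) :=
    (PiLp.continuous_toLp 2 _).comp (continuous_pi hc)
  have hp' : ∀ a ∈ lattice (3 * cLam), ∀ z,
      (WithLp.toLp 2 (f (z + a)) : EuclideanSpace ℂ ι) = WithLp.toLp 2 (f z) :=
    fun a ha z => by rw [hp a ha z]
  refine ⟨ContinuousMap.toLp 2 torusMeasure ℂ ⟨_, continuous_descend hc' hp'⟩, ?_⟩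
  filter_upwards [quasi_toTorus.ae (ContinuousMap.coeFn_toLp (p := 2) (𝕜 := ℂ) torusMeasure
    ⟨_, continuous_descend hc' hp'⟩)] with z hz
  rw [hz, ContinuousMap.coe_mk, descend_toTorus hp']

/-- A square-integrable function multiplied with a continuous periodic one. -/
lemma exists_mul (φ : ℂ → ℂ) (hc : Continuous φ)
    (hp : ∀ a ∈ lattice (3 * cLam), ∀ z, φ (z + a) = φ z) (v : L2 ι) :
    ∃ w : L2 ι, ∀ᵐ z : ℂ, w (toTorus z) = φ z • v (toTorus z) := by
  have hd := continuous_descend hc hp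
  obtain ⟨C, hC⟩ := isCompact_univ.exists_bound_of_continuousOn hd.continuousOn
  have hm : MemLp (fun x => descend φ x • v x) 2 torusMeasure := by
    refine (Lp.memLp v).of_le_mul (c := C)
      (hd.aestronglyMeasurable.smul (Lp.aestronglyMeasurable v)) ?_
    refine Filter.Eventually.of_forall fun x => ?_
    rw [norm_smul]
    exact mul_le_mul_of_nonneg_right (hC x (Set.mem_univ x)) (norm_nonneg _)
  refine ⟨hm.toLp _, ?_⟩
  filter_upwards [quasi_toTorus.ae hm.coeFn_toLp] with z hz
  rw [hz, descend_toTorus hp]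

lemma fc_congr {g h : ℂ → ℂ} (H : ∀ᵐ z : ℂ, g z = h z) (m : ℤ × ℤ) : fc g m = fc h m := by
  refine integral_congr_ae (ae_restrict_of_ae ?_)
  filter_upwards [H] with z hz
  rw [hz]

lemma fc_chi_mul (g : ℂ → ℂ) (s m : ℤ × ℤ) : fc (fun z => chi s z * g z) m = fc g (m - s) := by
  rw [fc, fc]
  refine integral_congr_ae (Filter.Eventually.of_forall fun z => ?_)
  simp only [neg_sub, sub_eq_add_neg s, chi_add]
  ring

lemma fc_const_mul (g : ℂ → ℂ) (c : ℂ) (m : ℤ × ℤ) : fc (fun z => c * g z) m = c * fc g m := by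
  rw [fc, fc, ← integral_const_mul]
  simp only [mul_assoc]

lemma fc_zero (m : ℤ × ℤ) : fc (fun _ => 0) m = 0 := by simp [fc]

lemma fc_add {g h : ℂ → ℂ} (hg : IntegrableOn g (cell (3 * cLam)))
    (hh : IntegrableOn h (cell (3 * cLam))) (m : ℤ × ℤ) :
    fc (fun z => g z + h z) m = fc g m + fc h m := by
  have hb : ∀ {g : ℂ → ℂ}, IntegrableOn g (cell (3 * cLam)) →
      IntegrableOn (fun z => g z * chi (-m) z) (cell (3 * cLam)) := fun hg =>
    Integrable.mul_bdd (c := 1) hg (continuous_chi _).aestronglyMeasurable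
      (Filter.Eventually.of_forall fun z => (norm_chi _ _).le)
  rw [fc, fc, fc, ← integral_add (hb hg) (hb hh)]
  simp only [add_mul]

lemma integrableOn_component (v : L2 ι) (i : ι) :
    IntegrableOn (fun z => v (toTorus z) i) (cell (3 * cLam)) := by
  simpa using integrable_mul v i continuous_const (ψ := fun _ => 1)

lemma fc_sum {κ : Type*} (s : Finset κ) (g : κ → ℂ → ℂ)
    (hg : ∀ i ∈ s, IntegrableOn (g i) (cell (3 * cLam))) (m : ℤ × ℤ) :
    fc (fun z => ∑ i ∈ s, g i z) m = ∑ i ∈ s, fc (g i) m := by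
  classical
  induction s using Finset.induction_on with
  | empty => simp [fc_zero]
  | insert a s ha ih =>
    have h1 := fun i hi => hg i (Finset.mem_insert_of_mem hi)
    have h2 : IntegrableOn (fun z => ∑ i ∈ s, g i z) (cell (3 * cLam)) :=
      integrable_finsetSum s h1
    simp only [Finset.sum_insert ha]
    rw [fc_add (hg a (Finset.mem_insert_self a s)) h2, ih h1]

/-- The action of a constant matrix on square-integrable functions. -/
noncomputable def matL2 [DecidableEq ι] (A : Matrix ι ι ℂ) (v : L2 ι) : L2 ι :=
  (Matrix.toEuclideanCLM (𝕜 := ℂ) A).compLp v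

lemma matL2_ae [DecidableEq ι] (A : Matrix ι ι ℂ) (v : L2 ι) :
    ∀ᵐ z : ℂ, (matL2 A v (toTorus z)).ofLp = A *ᵥ (v (toTorus z)).ofLp := by
  filter_upwards [quasi_toTorus.ae ((Matrix.toEuclideanCLM (𝕜 := ℂ) A).coeFn_compLp v)] with z hz
  rw [matL2, hz, Matrix.ofLp_toEuclideanCLM]

lemma coef_matL2 [DecidableEq ι] (A : Matrix ι ι ℂ) (v : L2 ι) (i : ι) (m : ℤ × ℤ) :
    coef (matL2 A v) i m = ∑ j, A i j * coef v j m := by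
  have h : ∀ᵐ z : ℂ, matL2 A v (toTorus z) i = ∑ j, A i j * v (toTorus z) j := by
    filter_upwards [matL2_ae A v] with z hz
    rw [hz]; rfl
  rw [coef, fc_congr h, fc_sum _ _ fun j _ => (integrableOn_component v j).const_mul _]
  simp only [fc_const_mul, coef]

/-! ### Translations -/

lemma isAddFundamentalDomain_cell : IsAddFundamentalDomain
    (Submodule.span ℤ (Set.range (hexBasis _ three_cLam_ne))).toAddSubgroup
    (cell (3 * cLam)) volume := by
  rw [cell_eq _ three_cLam_ne]
  exact ZSpan.isAddFundamentalDomain' (hexBasis _ three_cLam_ne) (volume : Measure ℂ)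

open scoped Pointwise in
lemma measurePreserving_torus_add (a : ℂ) :
    MeasurePreserving (fun x : Torus => x + toTorus a) torusMeasure torusMeasure := by
  have hms : Measurable fun x : Torus => x + toTorus a := (continuous_add_const _).measurable
  refine ⟨hms, ?_⟩
  have hcount : Countable
      (Submodule.span ℤ (Set.range (hexBasis _ three_cLam_ne))).toAddSubgroup := by
    have : Countable (Submodule.span ℤ (Set.range (hexBasis _ three_cLam_ne))) := inferInstance
    exact this
  ext s hs
  have hS : MeasurableSet (toTorus ⁻¹' s) := measurable_toTorus hs
  have e1 : (fun x : Torus => x + toTorus a) ∘ toTorus = toTorus ∘ fun z => z + a := rfl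
  have hF := isAddFundamentalDomain_cell
  have hF2 := hF.vadd_of_comm a
  rw [Measure.map_apply hms hs, torusMeasure, Measure.map_apply measurable_toTorus (hms hs),
    Measure.map_apply measurable_toTorus hs, ← Set.preimage_comp, e1, Set.preimage_comp,
    Measure.restrict_apply ((measurable_add_const a) hS), Measure.restrict_apply hS,
    hF.measure_set_eq hF2 hS]
  · have h2 : (fun z : ℂ => z + a) ⁻¹' (toTorus ⁻¹' s ∩ (a +ᵥ cell (3 * cLam))) =
        (fun z => z + a) ⁻¹' (toTorus ⁻¹' s) ∩ cell (3 * cLam) := by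
      rw [Set.preimage_inter]
      congr 1
      ext z
      rw [Set.mem_preimage, Set.mem_vadd_set_iff_neg_vadd_mem]
      have : -a +ᵥ (z + a) = z := by simp [vadd_eq_add]
      rw [this]
    rw [← h2]
    exact (measurePreserving_add_right volume a).measure_preimage
      (hS.inter ((measurableSet_cell three_cLam_ne).const_vadd a)).nullMeasurableSet
  · intro g
    ext z
    have : toTorus (g +ᵥ z) = toTorus z := by
      refine (toTorus_eq.2 ?_).symm
      rw [lattice_eq _ three_cLam_ne]
      have : (g +ᵥ z) - z = (g : ℂ) := by
        change ((g : ℂ) + z) - z = g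
        ring
      rw [this]
      exact g.2
    simp only [Set.mem_preimage, this]

/-- The translate `v (z + a)`. -/
noncomputable def transL2 (a : ℂ) (v : L2 ι) : L2 ι :=
  Lp.compMeasurePreserving _ (measurePreserving_torus_add a) v

lemma transL2_ae (a : ℂ) (v : L2 ι) :
    ∀ᵐ z : ℂ, transL2 a v (toTorus z) = v (toTorus (z + a)) :=
  quasi_toTorus.ae (Lp.coeFn_compMeasurePreserving v (measurePreserving_torus_add a))

lemma coef_transL2 (a : ℂ) (v : L2 ι) (i : ι) (m : ℤ × ℤ) :
    coef (transL2 a v) i m = chi m a * coef v i m := by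
  have hchi : ∀ z, chi m (z + a) = chi m z * chi m a := by
    intro z
    rw [chi, chi, chi, ← Complex.exp_add, pairing_add_left]
    push_cast; ring_nf
  have hconj : ∀ x, conj (chiT m (x + toTorus a)) * chi m a = conj (chiT m x) := by
    intro x
    obtain ⟨z, rfl⟩ := toTorus_surjective x
    have : toTorus z + toTorus a = toTorus (z + a) := rfl
    rw [this, chiT_toTorus, chiT_toTorus, hchi, map_mul, conj_chi, conj_chi]
    linear_combination chi (-m) z * chi_neg_mul m a
  have h := (measurePreserving_torus_add a).integral_comp
    (Homeomorph.addRight (toTorus a)).measurableEmbedding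
    (fun x => v x i * conj (chiT m x))
  rw [coef, coef, ← integral_torus_conj_chiT _ (aestronglyMeasurable_component v i), ← h,
    ← integral_torus_conj_chiT _ (aestronglyMeasurable_component (transL2 a v) i),
    ← integral_const_mul]
  refine integral_congr_ae ?_
  filter_upwards [Lp.coeFn_compMeasurePreserving v (measurePreserving_torus_add a)] with x hx
  rw [transL2, hx, Function.comp_apply, ← hconj x]
  ring

lemma chi_lamPt (m : ℤ × ℤ) (a₁ a₂ : ℤ) : chi m (lamPt a₁ a₂) = om ^ (a₁ * m.1 + a₂ * m.2) := by
  have := chi_add_lamPt m 0 a₁ a₂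
  rw [zero_add] at this
  rw [this]; simp [chi, pairing]

/-- The space `L²₀` in terms of Fourier coefficients. -/
lemma mem_L20_iff (c : ι → ℤ) (v : L2 ι) : v ∈ L20 c ↔
    ∀ i m, coef v i m ≠ 0 → (3 : ℤ) ∣ c i + m.1 ∧ (3 : ℤ) ∣ c i + m.2 := by
  classical
  have hcoef : ∀ a₁ a₂ i m, coef (matL2 (Matrix.diagonal fun i => om ^ (c i * (a₁ + a₂)))
      (transL2 (lamPt a₁ a₂) v)) i m =
      om ^ (a₁ * (c i + m.1) + a₂ * (c i + m.2)) * coef v i m := by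
    intro a₁ a₂ i m
    rw [coef_matL2]
    simp only [Matrix.diagonal_apply, ite_mul, zero_mul, Finset.sum_ite_eq, Finset.mem_univ,
      if_true]
    rw [coef_transL2, chi_lamPt, ← mul_assoc, ← zpow_add₀ om_ne]
    congr 2; ring
  have hae : ∀ a₁ a₂, ∀ᵐ z : ℂ, ∀ i, matL2 (Matrix.diagonal fun i => om ^ (c i * (a₁ + a₂)))
      (transL2 (lamPt a₁ a₂) v) (toTorus z) i =
      om ^ (c i * (a₁ + a₂)) * v (toTorus (z + lamPt a₁ a₂)) i := by
    intro a₁ a₂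
    filter_upwards [matL2_ae (Matrix.diagonal fun i => om ^ (c i * (a₁ + a₂)))
      (transL2 (lamPt a₁ a₂) v), transL2_ae (lamPt a₁ a₂) v] with z h1 h2 i
    rw [h1, h2, Matrix.mulVec_diagonal]
  constructor
  · intro hv i m hne
    have key : ∀ a₁ a₂ : ℤ, om ^ (a₁ * (c i + m.1) + a₂ * (c i + m.2)) = 1 := by
      intro a₁ a₂
      have : matL2 (Matrix.diagonal fun i => om ^ (c i * (a₁ + a₂)))
          (transL2 (lamPt a₁ a₂) v) = v := by
        refine L2_ext ?_
        filter_upwards [hae a₁ a₂, hv a₁ a₂] with z h1 h2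
        ext i
        rw [h1, h2]
      have h2 := hcoef a₁ a₂ i m
      rw [this] at h2
      exact (mul_right_cancel₀ hne (by rw [one_mul]; exact h2)).symm
    have k1 := key 1 0
    have k2 := key 0 1
    rw [om_zpow_eq_one_iff] at k1 k2
    simpa using And.intro k1 k2
  · intro h a₁ a₂
    have : matL2 (Matrix.diagonal fun i => om ^ (c i * (a₁ + a₂)))
        (transL2 (lamPt a₁ a₂) v) = v := by
      refine L2_ext_coef fun i m => ?_
      rw [hcoef]
      by_cases h0 : coef v i m = 0
      · rw [h0, mul_zero]
      · obtain ⟨h1, h2⟩ := h i m h0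
        rw [(om_zpow_eq_one_iff _).2 (dvd_add (h1.mul_left _) (h2.mul_left _)), one_mul]
    have h2 := hae a₁ a₂
    rw [this] at h2
    filter_upwards [h2] with z hz i
    exact (hz i).symm

/-- The operators `τ(p)` in terms of Fourier coefficients. -/
lemma isTau_iff (p₁ p₂ : ℤ) (v w : L2 ι) : IsTau (dualPt p₁ p₂) v w ↔
    ∀ i m, coef w i m = coef v i (m + (3 * p₁, 3 * p₂)) := by
  classical
  have hchi : ∀ z : ℂ, Complex.exp (-Complex.I * pairing z (dualPt p₁ p₂)) =
      chi (-(3 * p₁, 3 * p₂)) z := by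
    intro z
    rw [chi, pt_neg, pairing_neg_right, pt_three]; push_cast; ring_nf
  obtain ⟨x, hx⟩ := exists_mul (chi (-(3 * p₁, 3 * p₂))) (continuous_chi _)
    (fun a ha z => chi_periodic _ ha z) v
  have hcoef : ∀ i m, coef x i m = coef v i (m + (3 * p₁, 3 * p₂)) := by
    intro i m
    have : ∀ᵐ z : ℂ, x (toTorus z) i = chi (-(3 * p₁, 3 * p₂)) z * v (toTorus z) i := by
      filter_upwards [hx] with z hz
      rw [hz]; rfl
    rw [coef, fc_congr this, fc_chi_mul, coef, sub_neg_eq_add]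
  constructor
  · intro h i m
    have : w = x := L2_ext (by
      filter_upwards [h, hx] with z h1 h2
      rw [h1, h2, hchi])
    rw [this, hcoef]
  · intro h
    have : w = x := L2_ext_coef fun i m => by rw [h, hcoef]
    subst this
    filter_upwards [hx] with z hz
    rw [hz, hchi]

end


section

variable {ι : Type} [Fintype ι]

/-! ### Weak derivatives and Fourier coefficients -/

lemma coef_of_isWeakDeriv {e : ℂ} {v g : L2 ι} (h : IsWeakDeriv e v g) (i : ι) (m : ℤ × ℤ) :
    coef g i m = Complex.I * pairing e (pt m) * coef v i m := by
  have h1 := h (chi (-m)) (contDiff_chi _) (fun a ha z => chi_periodic _ ha z) i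
  simp only [fderiv_chi] at h1
  have h2 : ∫ z in cell (3 * cLam), v (toTorus z) i *
      (Complex.I * pairing e (pt (-m)) * chi (-m) z) =
      Complex.I * pairing e (pt (-m)) * coef v i m := by
    rw [coef, fc, ← integral_const_mul]
    congr 1; funext z; ring
  rw [h2, pt_neg, pairing_neg_right] at h1
  rw [coef, fc]
  push_cast at h1
  linear_combination h1

/-- A square-integrable function times a continuous periodic one is integrated termwise. -/
lemma hasSum_integral_mul [DecidableEq ι] (v : L2 ι) (i : ι) {ψ : ℂ → ℂ} (hc : Continuous ψ)
    (hp : ∀ a ∈ lattice (3 * cLam), ∀ z, ψ (z + a) = ψ z) :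
    HasSum (fun m => (area : ℂ)⁻¹ * coef v i m * fc ψ (-m))
      (∫ z in cell (3 * cLam), v (toTorus z) i * ψ z) := by
  classical
  obtain ⟨w, hw⟩ := exists_L2 (fun z => Pi.single (M := fun _ : ι => ℂ) i (conj (ψ z)))
    (fun j => by
      by_cases h : j = i
      · subst h; simpa [Function.comp_def] using Complex.continuous_conj.comp hc
      · simpa [h] using continuous_const)
    (fun a ha z => by rw [hp a ha z])
  have hinner : inner ℂ w v = ∫ z in cell (3 * cLam), v (toTorus z) i * ψ z := by
    rw [L2.inner_def, integral_torus (g := fun x => inner ℂ (w x) (v x))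
      ((Lp.aestronglyMeasurable w).inner (Lp.aestronglyMeasurable v))]
    refine integral_congr_ae (ae_restrict_of_ae ?_)
    filter_upwards [hw] with z hz
    rw [PiLp.inner_apply, hz, Finset.sum_eq_single i]
    · simp
    · intro j _ hj; simp [hj]
    · simp
  have hcw : ∀ j m, coef w j m = if j = i then conj (fc ψ (-m)) else 0 := by
    intro j m
    have h1 : ∀ᵐ z : ℂ, w (toTorus z) j = if j = i then conj (ψ z) else 0 := by
      filter_upwards [hw] with z hz
      rw [hz]
      by_cases h : j = i
      · subst h; simp
      · simp [h]
    rw [coef, fc_congr h1]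
    split_ifs with h
    · rw [fc, fc, ← integral_conj]
      simp only [map_mul, conj_chi, neg_neg]
    · exact fc_zero m
  have h := (fourierBasis ι).hasSum_inner_mul_inner w v
  rw [hinner] at h
  have h0 : ((Real.sqrt area : ℂ))⁻¹ * ((Real.sqrt area : ℂ))⁻¹ = (area : ℂ)⁻¹ := by
    rw [← mul_inv, ← Complex.ofReal_mul, Real.mul_self_sqrt area_pos.le]
  have hterm : ∀ q : ι × (ℤ × ℤ), inner ℂ w (fourierBasis ι q) * inner ℂ (fourierBasis ι q) v =
      if q.1 = i then (area : ℂ)⁻¹ * coef v q.1 q.2 * fc ψ (-q.2) else 0 := by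
    rintro ⟨j, m⟩
    rw [← inner_conj_symm w, ← HilbertBasis.repr_apply_apply, ← HilbertBasis.repr_apply_apply,
      fourierBasis_repr, fourierBasis_repr, hcw, ← h0]
    by_cases hj : j = i
    · simp [hj]; ring
    · simp [hj]
  simp only [hterm] at h
  have hinj : Function.Injective fun m : ℤ × ℤ => (i, m) := fun _ _ h => (Prod.ext_iff.1 h).2
  rw [← hinj.hasSum_iff] at h
  · simpa [Function.comp_def] using h
  · rintro ⟨j, m⟩ hj
    rw [if_neg]
    rintro rfl
    exact hj ⟨m, rfl⟩

lemma integral_cell_fderiv_eq_zero {c : ℂ} (hc : c ≠ 0) {f : ℂ → ℂ} (hf : ContDiff ℝ 1 f)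
    (hp : ∀ a ∈ lattice c, ∀ z, f (z + a) = f z) (e : ℂ) :
    ∫ z in cell c, fderiv ℝ f z e = 0 := by
  have he : ∀ z, fderiv ℝ f z e =
      e.re * fderiv ℝ f z 1 + e.im * fderiv ℝ f z Complex.I := by
    intro z
    have : e = e.re • (1 : ℂ) + e.im • Complex.I := by
      apply Complex.ext <;> simp
    conv_lhs => rw [this]
    simp only [map_add, map_smul]
    simp only [Complex.real_smul]
  have hd : ∀ e : ℂ, Continuous fun z => fderiv ℝ f z e := fun e =>
    (hf.continuous_fderiv (by simp)).clm_apply continuous_const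
  simp only [he]
  refine integral_cell_deriv_eq_zero hc hf.continuous hp Set.countable_empty
    (fun z _ => hf.differentiable (by simp) z) _ _ ?_
  exact integrableOn_cell hc (((hd 1).const_mul _).add ((hd Complex.I).const_mul _))

lemma fderiv_periodic {c : ℂ} {f : ℂ → ℂ} (hp : ∀ a ∈ lattice c, ∀ z, f (z + a) = f z) :
    ∀ a ∈ lattice c, ∀ z, fderiv ℝ f (z + a) = fderiv ℝ f z := by
  intro a ha z
  rw [← fderiv_comp_add_right]
  congr 1
  funext w
  exact hp a ha w

lemma fc_fderiv {f : ℂ → ℂ} (hf : ContDiff ℝ 1 f)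
    (hp : ∀ a ∈ lattice (3 * cLam), ∀ z, f (z + a) = f z) (e : ℂ) (m : ℤ × ℤ) :
    fc (fun z => fderiv ℝ f z e) m = Complex.I * pairing e (pt m) * fc f m := by
  have hd : Continuous fun z => fderiv ℝ f z e :=
    (hf.continuous_fderiv (by simp)).clm_apply continuous_const
  have hchi : ContDiff ℝ 1 (chi (-m)) := (contDiff_chi _).of_le (by simp)
  have h := integral_cell_fderiv_eq_zero three_cLam_ne (hf.mul hchi)
    (fun a ha z => by rw [hp a ha z, chi_periodic _ ha z]) e
  have hder : ∀ z, fderiv ℝ (fun z => f z * chi (-m) z) z e =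
      fderiv ℝ f z e * chi (-m) z + -(Complex.I * pairing e (pt m)) * (f z * chi (-m) z) := by
    intro z
    rw [fderiv_fun_mul (hf.differentiable (by simp) z) (differentiable_chi _ z)]
    simp only [_root_.add_apply, _root_.smul_apply, smul_eq_mul, fderiv_chi, pt_neg,
      pairing_neg_right]
    push_cast; ring
  simp only [hder] at h
  rw [integral_add, integral_const_mul] at h
  · rw [fc, fc]; linear_combination h
  · exact integrableOn_cell three_cLam_ne (hd.mul (continuous_chi _))
  · exact (integrableOn_cell three_cLam_ne (hf.continuous.mul (continuous_chi _))).const_mul _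

/-- A function has a weak derivative if its Fourier coefficients say so. -/
lemma isWeakDeriv_of_coef {e : ℂ} {v g : L2 ι}
    (h : ∀ i m, coef g i m = Complex.I * pairing e (pt m) * coef v i m) : IsWeakDeriv e v g := by
  classical
  intro φ hφ hp i
  have hφ1 : ContDiff ℝ 1 φ := hφ.of_le (by simp)
  have hc : Continuous fun z => fderiv ℝ φ z e :=
    (hφ1.continuous_fderiv (by simp)).clm_apply continuous_const
  have h1 := hasSum_integral_mul v i hc (fun a ha z => by rw [fderiv_periodic hp a ha z])
  have h2 := (hasSum_integral_mul g i hφ.continuous hp).neg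
  refine h1.unique (h2.congr_fun fun m => ?_)
  rw [fc_fderiv hφ1 hp, h, pt_neg, pairing_neg_right]
  push_cast; ring

/-- A classical derivative is a weak derivative. -/
lemma isWeakDeriv_of_contDiff {e : ℂ} {v g : L2 ι} {f : ℂ → ι → ℂ}
    (hf : ∀ i, ContDiff ℝ 1 fun z => f z i)
    (hp : ∀ a ∈ lattice (3 * cLam), ∀ z, f (z + a) = f z)
    (hv : ∀ᵐ z : ℂ, (v (toTorus z)).ofLp = f z)
    (hg : ∀ᵐ z : ℂ, (g (toTorus z)).ofLp = fun i => fderiv ℝ (fun z => f z i) z e) :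
    IsWeakDeriv e v g := by
  refine isWeakDeriv_of_coef fun i m => ?_
  have h1 : coef v i m = fc (fun z => f z i) m := fc_congr (by
    filter_upwards [hv] with z hz
    rw [hz]) m
  have h2 : coef g i m = fc (fun z => fderiv ℝ (fun z => f z i) z e) m := fc_congr (by
    filter_upwards [hg] with z hz
    rw [hz]) m
  rw [h1, h2, fc_fderiv (hf i) fun a ha z => by rw [hp a ha z]]

/-! ### Elliptic systems -/

namespace System

/-- The symbol `p₁ A₁ + p₂ A₂` of a first-order system, without the factor `i`. -/
def symbol (P : System ι) (p : ℂ) : Matrix ι ι ℂ := (p.re : ℂ) • P.a₁ + (p.im : ℂ) • P.a₂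

/-- Ellipticity, with a bound that suits the systems at hand. -/
def Elliptic (P : System ι) : Prop :=
  ∀ (p : ℂ) (x : ι → ℂ), ‖p‖ * ‖x‖ ≤ ‖P.symbol p *ᵥ x‖

/-- `f` is a continuously differentiable solution of `P f = 0` with the symmetry of `L²₀`. -/
structure Classical (P : System ι) (c : ι → ℤ) (f : ℂ → ι → ℂ) : Prop where
  contDiff : ∀ i, ContDiff ℝ 1 fun z => f z i
  phase : ∀ (a₁ a₂ : ℤ) (z : ℂ) (i : ι), om ^ (c i * (a₁ + a₂)) * f (z + lamPt a₁ a₂) i = f z i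
  eq : ∀ z, P.a₁ *ᵥ (fun i => fderiv ℝ (fun w => f w i) z 1) +
    P.a₂ *ᵥ (fun i => fderiv ℝ (fun w => f w i) z Complex.I) + P.b z *ᵥ f z = 0

end System

lemma periodic_of_phase {ι : Type} {c : ι → ℤ} {f : ℂ → ι → ℂ} (h : ∀ (a₁ a₂ : ℤ) (z : ℂ) (i : ι),
    om ^ (c i * (a₁ + a₂)) * f (z + lamPt a₁ a₂) i = f z i) :
    ∀ a ∈ lattice (3 * cLam), ∀ z, f (z + a) = f z := by
  intro a ha z
  obtain ⟨x, y, rfl⟩ := (mem_lattice_three a).1 ha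
  funext i
  rw [← h (3 * x) (3 * y) z i, ← mul_add, ← mul_assoc, mul_comm (c i), mul_assoc,
    om_zpow_three_mul, one_mul]

/-- A classical solution defines an element of the kernel. -/
lemma System.Classical.exists_mem_kernel {P : System ι} {c : ι → ℤ} {f : ℂ → ι → ℂ}
    (h : P.Classical c f) : ∃ v ∈ P.kernel c, ∀ᵐ z : ℂ, (v (toTorus z)).ofLp = f z := by
  have hper := periodic_of_phase h.phase
  have hperi : ∀ i, ∀ a ∈ lattice (3 * cLam), ∀ z, f (z + a) i = f z i :=
    fun i a ha z => by rw [hper a ha z]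
  obtain ⟨v, hv⟩ := exists_L2 f (fun i => (h.contDiff i).continuous) hper
  have hder : ∀ e : ℂ, ∃ g : L2 ι, ∀ᵐ z : ℂ,
      (g (toTorus z)).ofLp = fun i => fderiv ℝ (fun w => f w i) z e := fun e =>
    exists_L2 _ (fun i => ((h.contDiff i).continuous_fderiv (by simp)).clm_apply continuous_const)
      (fun a ha z => by
        funext i
        rw [fderiv_periodic (hperi i) a ha z])
  obtain ⟨g₁, h1⟩ := hder 1
  obtain ⟨g₂, h2⟩ := hder Complex.I
  refine ⟨v, ⟨fun a₁ a₂ => ?_, g₁, g₂, isWeakDeriv_of_contDiff h.contDiff hper hv h1,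
    isWeakDeriv_of_contDiff h.contDiff hper hv h2, ?_⟩, hv⟩
  · filter_upwards [hv, ae_shift hv (lamPt a₁ a₂)] with z h3 h4 i
    rw [h3, h4, h.phase]
  · filter_upwards [hv, h1, h2, ae_zero (ι := ι)] with z h3 h4 h5 h6
    rw [h3, h4, h5, h6, h.eq]
    rfl

/-- The Fourier coefficients of a vector-valued function. -/
noncomputable def coefv (v : L2 ι) (m : ℤ × ℤ) (i : ι) : ℂ := coef v i m

/-- An elliptic system can be solved coefficient by coefficient. -/
lemma System.Elliptic.maps_of_coef {P : System ι} (hP : P.Elliptic) {v f h : L2 ι}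
    (hh : ∀ᵐ z : ℂ, (h (toTorus z)).ofLp = P.b z *ᵥ (v (toTorus z)).ofLp)
    (hc : ∀ m, Complex.I • (P.symbol (pt m) *ᵥ coefv v m) + coefv h m = coefv f m) :
    P.Maps v f := by
  classical
  have hbound : ∀ m, ‖pt m‖ * ‖coefv v m‖ ≤ ‖coefv f m‖ + ‖coefv h m‖ := by
    intro m
    refine (hP _ _).trans ?_
    have h1 : ‖P.symbol (pt m) *ᵥ coefv v m‖ =
        ‖Complex.I • (P.symbol (pt m) *ᵥ coefv v m)‖ := by
      rw [norm_smul, Complex.norm_I, one_mul]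
    rw [h1, eq_sub_of_add_eq (hc m)]
    exact norm_sub_le _ _
  have hsq : ∀ w : L2 ι, Summable fun m => ‖coefv w m‖ ^ 2 := by
    intro w
    refine Summable.of_nonneg_of_le (fun _ => by positivity) (fun m => ?_)
      (summable_sum fun i (_ : i ∈ Finset.univ) => summable_coef w i)
    by_cases hι : Nonempty ι
    · obtain ⟨i, -, hi⟩ := Finset.exists_max_image Finset.univ (fun i => ‖coefv w m i‖)
        Finset.univ_nonempty
      have : ‖coefv w m‖ ≤ ‖coef w i m‖ :=
        (pi_norm_le_iff_of_nonneg (norm_nonneg _)).2 fun j => hi j (Finset.mem_univ j)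
      refine (pow_le_pow_left₀ (norm_nonneg _) this 2).trans ?_
      exact Finset.single_le_sum (f := fun i => ‖coef w i m‖ ^ 2) (fun _ _ => by positivity)
        (Finset.mem_univ i)
    · rw [not_nonempty_iff] at hι
      have : coefv w m = 0 := funext fun i => (IsEmpty.false i).elim
      rw [this]; simp
  have hg : ∀ e : ℂ, ‖e‖ ≤ 1 → ∃ g : L2 ι, ∀ i m,
      coef g i m = Complex.I * pairing e (pt m) * coef v i m := by
    intro e he
    refine exists_coef (fun i m => Complex.I * pairing e (pt m) * coef v i m) fun i => ?_
    refine Summable.of_nonneg_of_le (fun _ => by positivity) (fun m => ?_)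
      (((hsq f).add (hsq h)).mul_left 2)
    have h1 : |pairing e (pt m)| ≤ ‖pt m‖ := by
      refine (Complex.abs_re_le_norm _).trans ?_
      rw [norm_mul, RCLike.norm_conj]
      exact mul_le_of_le_one_left (norm_nonneg _) he
    have h2 : ‖Complex.I * pairing e (pt m) * coef v i m‖ ≤ ‖coefv f m‖ + ‖coefv h m‖ := by
      refine le_trans ?_ (hbound m)
      rw [norm_mul, norm_mul, Complex.norm_I, one_mul, Complex.norm_real]
      exact mul_le_mul h1 (norm_le_pi_norm (coefv v m) i) (norm_nonneg _) (norm_nonneg _)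
    refine (pow_le_pow_left₀ (norm_nonneg _) h2 2).trans ?_
    nlinarith [sq_nonneg (‖coefv f m‖ - ‖coefv h m‖)]
  obtain ⟨g₁, h1⟩ := hg 1 (by simp)
  obtain ⟨g₂, h2⟩ := hg Complex.I (by simp)
  refine ⟨g₁, g₂, isWeakDeriv_of_coef h1, isWeakDeriv_of_coef h2, ?_⟩
  have hsum : matL2 P.a₁ g₁ + matL2 P.a₂ g₂ + h = f := by
    refine L2_ext_coef fun i m => ?_
    have := congrFun (hc m) i
    simp only [Pi.add_apply, Pi.smul_apply, System.symbol, Matrix.add_mulVec, Matrix.smul_mulVec,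
      smul_eq_mul, Matrix.mulVec, dotProduct, coefv] at this
    rw [coef_add, coef_add, coef_matL2, coef_matL2, ← this, mul_add, Finset.mul_sum,
      Finset.mul_sum, Finset.mul_sum, Finset.mul_sum]
    congr 2 <;> refine Finset.sum_congr rfl fun j _ => ?_
    · rw [h1]; simp [pairing]; ring
    · rw [h2]; simp [pairing]; ring
  filter_upwards [matL2_ae P.a₁ g₁, matL2_ae P.a₂ g₂, hh, ae_add (matL2 P.a₁ g₁) (matL2 P.a₂ g₂),
    ae_add (matL2 P.a₁ g₁ + matL2 P.a₂ g₂) h] with z k1 k2 k3 k4 k5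
  rw [← hsum, k5, k4, WithLp.ofLp_add, WithLp.ofLp_add, k1, k2, k3]

/-! ### Regularity of solutions -/

/-- A trigonometric polynomial: a finite combination of characters. -/
def IsTrig (f : ℂ → ℂ) : Prop := f ∈ Submodule.span ℂ (Set.range chi)

lemma isTrig_chi (m : ℤ × ℤ) : IsTrig (chi m) := Submodule.subset_span ⟨m, rfl⟩

lemma isTrig_const (c : ℂ) : IsTrig fun _ => c := by
  have : (fun _ : ℂ => c) = c • chi 0 := by funext z; simp [chi_zero]
  rw [this]; exact Submodule.smul_mem _ _ (isTrig_chi 0)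

lemma IsTrig.add {f g : ℂ → ℂ} (hf : IsTrig f) (hg : IsTrig g) : IsTrig fun z => f z + g z :=
  Submodule.add_mem _ hf hg

lemma IsTrig.const_mul {f : ℂ → ℂ} (c : ℂ) (hf : IsTrig f) : IsTrig fun z => c * f z :=
  Submodule.smul_mem _ c hf

lemma IsTrig.continuous {f : ℂ → ℂ} (hf : IsTrig f) : Continuous f := by
  refine Submodule.span_induction (p := fun f _ => Continuous f) ?_ continuous_const
    (fun _ _ _ _ h1 h2 => h1.add h2) (fun c _ _ h => h.const_smul c) hf
  rintro _ ⟨m, rfl⟩; exact continuous_chi m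

lemma IsTrig.periodic {f : ℂ → ℂ} (hf : IsTrig f) :
    ∀ a ∈ lattice (3 * cLam), ∀ z, f (z + a) = f z := by
  intro a ha z
  refine Submodule.span_induction (p := fun f _ => f (z + a) = f z) ?_ rfl
    (fun _ _ _ _ h1 h2 => by simp [h1, h2]) (fun c _ _ h => by simp [h]) hf
  rintro _ ⟨m, rfl⟩; exact chi_periodic m ha z

/-- Decay of order `N` of a family indexed by the dual lattice. -/
def Decay (N : ℕ) (x : ℤ × ℤ → ℂ) : Prop := ∃ C, ∀ m, ‖x m‖ * (1 + ‖pt m‖) ^ N ≤ C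

lemma Decay.add {N : ℕ} {x y : ℤ × ℤ → ℂ} (hx : Decay N x) (hy : Decay N y) :
    Decay N fun m => x m + y m := by
  obtain ⟨C, hC⟩ := hx
  obtain ⟨D, hD⟩ := hy
  refine ⟨C + D, fun m => ?_⟩
  calc ‖x m + y m‖ * (1 + ‖pt m‖) ^ N ≤ (‖x m‖ + ‖y m‖) * (1 + ‖pt m‖) ^ N := by
        gcongr; exact norm_add_le _ _
    _ ≤ C + D := by rw [add_mul]; exact add_le_add (hC m) (hD m)

lemma Decay.const_mul {N : ℕ} {x : ℤ × ℤ → ℂ} (c : ℂ) (hx : Decay N x) :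
    Decay N fun m => c * x m := by
  obtain ⟨C, hC⟩ := hx
  refine ⟨‖c‖ * C, fun m => ?_⟩
  rw [norm_mul, mul_assoc]
  exact mul_le_mul_of_nonneg_left (hC m) (norm_nonneg _)

lemma Decay.shift {N : ℕ} {x : ℤ × ℤ → ℂ} (s : ℤ × ℤ) (hx : Decay N x) :
    Decay N fun m => x (m - s) := by
  obtain ⟨C, hC⟩ := hx
  refine ⟨C * (1 + ‖pt s‖) ^ N, fun m => ?_⟩
  have h1 : 1 + ‖pt m‖ ≤ (1 + ‖pt (m - s)‖) * (1 + ‖pt s‖) := by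
    have : ‖pt m‖ ≤ ‖pt (m - s)‖ + ‖pt s‖ := by
      have := norm_add_le (pt (m - s)) (pt s)
      rwa [← pt_add, sub_add_cancel] at this
    nlinarith [norm_nonneg (pt (m - s)), norm_nonneg (pt s)]
  calc ‖x (m - s)‖ * (1 + ‖pt m‖) ^ N
      ≤ ‖x (m - s)‖ * ((1 + ‖pt (m - s)‖) * (1 + ‖pt s‖)) ^ N := by gcongr
    _ = ‖x (m - s)‖ * (1 + ‖pt (m - s)‖) ^ N * (1 + ‖pt s‖) ^ N := by rw [mul_pow]; ring
    _ ≤ C * (1 + ‖pt s‖) ^ N := by gcongr; exact hC _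

lemma Decay.sum {N : ℕ} {κ : Type*} (s : Finset κ) {x : κ → ℤ × ℤ → ℂ}
    (hx : ∀ i ∈ s, Decay N (x i)) : Decay N fun m => ∑ i ∈ s, x i m := by
  classical
  induction s using Finset.induction_on with
  | empty => exact ⟨0, fun m => by simp⟩
  | insert a s ha ih =>
    simp only [Finset.sum_insert ha]
    exact (hx a (Finset.mem_insert_self a s)).add
      (ih fun i hi => hx i (Finset.mem_insert_of_mem hi))

lemma decay_trig_mul {N : ℕ} (v : L2 ι) (j : ι) (hv : Decay N (coef v j)) {f : ℂ → ℂ}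
    (hf : IsTrig f) : Decay N (fc fun z => f z * v (toTorus z) j) := by
  have hint : ∀ f : ℂ → ℂ, Continuous f →
      IntegrableOn (fun z => f z * v (toTorus z) j) (cell (3 * cLam)) := fun f hf => by
    simpa only [mul_comm] using integrable_mul v j hf
  suffices h : Continuous f ∧ Decay N (fc fun z => f z * v (toTorus z) j) from h.2
  refine Submodule.span_induction
    (p := fun f _ => Continuous f ∧ Decay N (fc fun z => f z * v (toTorus z) j)) ?_ ?_ ?_ ?_ hf
  · rintro _ ⟨m, rfl⟩
    refine ⟨continuous_chi m, ?_⟩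
    have := hv.shift m
    convert this using 2 with m'
    exact fc_chi_mul _ _ _
  · refine ⟨continuous_const, 0, fun m => ?_⟩
    simp [fc_zero]
  · rintro f g - - ⟨h1, h2⟩ ⟨h3, h4⟩
    refine ⟨h1.add h3, ?_⟩
    convert h2.add h4 using 2 with m
    simp only [Pi.add_apply, add_mul]
    exact fc_add (hint f h1) (hint g h3) m
  · rintro c f - ⟨h1, h2⟩
    refine ⟨h1.const_smul c, ?_⟩
    convert h2.const_mul c using 2 with m
    simp only [Pi.smul_apply, smul_eq_mul, mul_assoc]
    exact fc_const_mul _ _ _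

end


section

variable {ι : Type} [Fintype ι]

lemma coef_of_maps {P : System ι} (hb : ∀ i j, Continuous fun z => P.b z i j) {v f : L2 ι}
    (h : P.Maps v f) (m : ℤ × ℤ) :
    Complex.I • (P.symbol (pt m) *ᵥ coefv v m) +
      (fun i => ∑ j, fc (fun z => P.b z i j * v (toTorus z) j) m) = coefv f m := by
  classical
  obtain ⟨g₁, g₂, h1, h2, h3⟩ := h
  have hint : ∀ i j, IntegrableOn (fun z => P.b z i j * v (toTorus z) j) (cell (3 * cLam)) :=
    fun i j => by simpa only [mul_comm] using integrable_mul v j (hb i j)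
  funext i
  have hae : ∀ᵐ z : ℂ, f (toTorus z) i =
      (matL2 P.a₁ g₁ + matL2 P.a₂ g₂) (toTorus z) i + ∑ j, P.b z i j * v (toTorus z) j := by
    filter_upwards [matL2_ae P.a₁ g₁, matL2_ae P.a₂ g₂, h3,
      ae_add (matL2 P.a₁ g₁) (matL2 P.a₂ g₂)] with z k1 k2 k3 k4
    rw [← k3, k4, ← k1, ← k2]; rfl
  have hc : coef f i m = coef (matL2 P.a₁ g₁ + matL2 P.a₂ g₂) i m +
      ∑ j, fc (fun z => P.b z i j * v (toTorus z) j) m := by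
    have e1 : coef f i m = fc (fun z => (matL2 P.a₁ g₁ + matL2 P.a₂ g₂) (toTorus z) i +
        ∑ j, P.b z i j * v (toTorus z) j) m := fc_congr hae m
    rw [e1, fc_add (integrableOn_component _ i) (integrable_finsetSum _ fun j _ => hint i j),
      fc_sum _ _ fun j _ => hint i j]
    rfl
  simp only [Pi.add_apply, Pi.smul_apply, System.symbol, Matrix.add_mulVec, Matrix.smul_mulVec,
    smul_eq_mul, Matrix.mulVec, dotProduct, coefv]
  rw [hc, coef_add, coef_matL2, coef_matL2, mul_add, Finset.mul_sum,
    Finset.mul_sum, Finset.mul_sum, Finset.mul_sum]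
  congr 2 <;> refine Finset.sum_congr rfl fun j _ => ?_
  · rw [coef_of_isWeakDeriv h1]; simp [pairing]; ring
  · rw [coef_of_isWeakDeriv h2]; simp [pairing]; ring

lemma decay_zero (v : L2 ι) (i : ι) : Decay 0 (coef v i) := by
  classical
  refine ⟨Real.sqrt (∑' m, ‖coef v i m‖ ^ 2), fun m => ?_⟩
  rw [pow_zero, mul_one]
  exact Real.le_sqrt_of_sq_le ((summable_coef v i).le_tsum m fun _ _ => by positivity)

/-- The Fourier coefficients of a solution of an elliptic system decay rapidly: by the equation,
decay of order `N` improves to decay of order `N + 1`. -/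
lemma decay_of_maps {P : System ι} (hP : P.Elliptic) (hb : ∀ i j, IsTrig fun z => P.b z i j)
    {v : L2 ι} (h : P.Maps v 0) (N : ℕ) (i : ι) : Decay N (coef v i) := by
  classical
  induction N generalizing i with
  | zero => exact decay_zero v i
  | succ N ih =>
    have h1 : ∀ i, Decay N fun m => ∑ j, fc (fun z => P.b z i j * v (toTorus z) j) m :=
      fun i => Decay.sum _ fun j _ => decay_trig_mul v j (ih j) (hb i j)
    choose C hC using h1
    obtain ⟨D, hD⟩ := ih i
    refine ⟨D + ∑ i, |C i|, fun m => ?_⟩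
    have hb : ‖pt m‖ * ‖coef v i m‖ * (1 + ‖pt m‖) ^ N ≤ ∑ i, |C i| := by
      have h2 := coef_of_maps (fun i j => (hb i j).continuous) h m
      have h3 : coefv (0 : L2 ι) m = 0 := funext fun i => coef_zero i m
      rw [h3] at h2
      have h4 : ‖pt m‖ * ‖coefv v m‖ ≤
          ‖fun i => ∑ j, fc (fun z => P.b z i j * v (toTorus z) j) m‖ := by
        refine (hP _ _).trans (le_of_eq ?_)
        have h5 : ‖P.symbol (pt m) *ᵥ coefv v m‖ =
            ‖Complex.I • (P.symbol (pt m) *ᵥ coefv v m)‖ := by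
          rw [norm_smul, Complex.norm_I, one_mul]
        rw [h5, eq_neg_of_add_eq_zero_left h2, norm_neg]
      have hpos : (0 : ℝ) < (1 + ‖pt m‖) ^ N := by positivity
      have h6 : ‖fun i => ∑ j, fc (fun z => P.b z i j * v (toTorus z) j) m‖ ≤
          (∑ i, |C i|) / (1 + ‖pt m‖) ^ N := by
        refine (pi_norm_le_iff_of_nonneg (by positivity)).2 fun j => ?_
        rw [le_div_iff₀ hpos]
        exact ((hC j m).trans (le_abs_self _)).trans
          (Finset.single_le_sum (f := fun i => |C i|) (fun _ _ => abs_nonneg _) (Finset.mem_univ j))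
      have h7 : ‖coef v i m‖ ≤ ‖coefv v m‖ := norm_le_pi_norm (coefv v m) i
      rw [← le_div_iff₀ hpos]
      exact (mul_le_mul_of_nonneg_left h7 (norm_nonneg _)).trans (h4.trans h6)
    calc ‖coef v i m‖ * (1 + ‖pt m‖) ^ (N + 1)
        = ‖coef v i m‖ * (1 + ‖pt m‖) ^ N + ‖pt m‖ * ‖coef v i m‖ * (1 + ‖pt m‖) ^ N := by
          rw [pow_succ]; ring
      _ ≤ _ := add_le_add (hD m) hb

lemma norm_pt_sq (m : ℤ × ℤ) :
    ‖pt m‖ ^ 2 = ((m.1 : ℝ) ^ 2 + m.1 * m.2 + (m.2 : ℝ) ^ 2) / 3 := by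
  have h3 : Real.sqrt 3 ^ 2 = 3 := Real.sq_sqrt (by norm_num)
  have h : pt m = cDual * (om * m.1 - m.2) / 3 := rfl
  rw [h, norm_div, norm_mul, cDual, norm_mul, norm_om, Complex.norm_real, Real.norm_eq_abs,
    abs_of_nonneg (Real.sqrt_nonneg 3), div_pow, mul_pow, mul_one, h3, Complex.norm_ofNat,
    ← Complex.normSq_eq_norm_sq, Complex.normSq_apply, om_eq]
  simp
  linear_combination ((m.1 : ℝ) ^ 2 / 12) * h3

lemma summable_weight : Summable fun m : ℤ × ℤ => ((1 + ‖pt m‖) ^ 4)⁻¹ := by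
  have h1 : Summable fun j : ℤ => (1 + (j : ℝ) ^ 2)⁻¹ := by
    have h2 : Summable fun j : ℤ => 1 / (j : ℝ) ^ 2 :=
      Real.summable_one_div_int_pow.2 (by norm_num)
    refine Summable.of_norm_bounded_eventually (g := fun j : ℤ => 1 / (j : ℝ) ^ 2) h2 ?_
    filter_upwards [(Set.finite_singleton (0 : ℤ)).compl_mem_cofinite] with j hj
    have hj0 : (j : ℝ) ≠ 0 := by exact_mod_cast hj
    rw [Real.norm_of_nonneg (by positivity), one_div]
    exact inv_anti₀ (by positivity) (by linarith)
  have h2 : Summable fun m : ℤ × ℤ => (1 + (m.1 : ℝ) ^ 2)⁻¹ * (1 + (m.2 : ℝ) ^ 2)⁻¹ :=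
    h1.mul_of_nonneg h1 (fun _ => by positivity) (fun _ => by positivity)
  refine Summable.of_nonneg_of_le (fun _ => by positivity) (fun m => ?_) (h2.mul_left 36)
  have hs := norm_pt_sq m
  have h0 := norm_nonneg (pt m)
  set r := ‖pt m‖
  have h3 : 1 + (m.1 : ℝ) ^ 2 ≤ 6 * (1 + r) ^ 2 := by
    nlinarith [sq_nonneg ((m.1 : ℝ) + 2 * m.2)]
  have h4 : 1 + (m.2 : ℝ) ^ 2 ≤ 6 * (1 + r) ^ 2 := by
    nlinarith [sq_nonneg (2 * (m.1 : ℝ) + m.2)]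
  have h5 : (1 + (m.1 : ℝ) ^ 2) * (1 + (m.2 : ℝ) ^ 2) ≤ 36 * (1 + r) ^ 4 := by
    calc _ ≤ (6 * (1 + r) ^ 2) * (6 * (1 + r) ^ 2) := by gcongr
      _ = _ := by ring
  rw [← mul_inv, ← div_eq_mul_inv, inv_eq_one_div, div_le_div_iff₀ (by positivity) (by positivity),
    one_mul]
  exact h5

lemma norm_fderiv_chi_le (m : ℤ × ℤ) (z : ℂ) : ‖fderiv ℝ (chi m) z‖ ≤ ‖pt m‖ := by
  refine ContinuousLinearMap.opNorm_le_bound _ (norm_nonneg _) fun e => ?_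
  rw [fderiv_chi, norm_mul, norm_mul, norm_chi, Complex.norm_I, one_mul, mul_one,
    Complex.norm_real, Real.norm_eq_abs]
  refine (Complex.abs_re_le_norm _).trans ?_
  rw [norm_mul, RCLike.norm_conj, mul_comm]

/-- A rapidly decaying Fourier series converges to a continuously differentiable function. -/
lemma exists_contDiff_of_decay {x : ℤ × ℤ → ℂ} (hx : Decay 5 x) : ∃ f : ℂ → ℂ, ContDiff ℝ 1 f ∧
    (∀ a ∈ lattice (3 * cLam), ∀ z, f (z + a) = f z) ∧ ∀ m, fc f m = x m := by
  obtain ⟨C, hC⟩ := hx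
  have hA : ‖(area : ℂ)⁻¹‖ = area⁻¹ := by
    rw [norm_inv, Complex.norm_real, Real.norm_of_nonneg area_pos.le]
  have hApos := area_pos
  have hC0 : 0 ≤ C := le_trans (by positivity) (hC 0)
  -- the bounds for the terms of the series and for their first derivatives
  have hb0 : ∀ m, ‖(area : ℂ)⁻¹ * x m‖ ≤ area⁻¹ * C * ((1 + ‖pt m‖) ^ 4)⁻¹ := by
    intro m
    rw [norm_mul, hA, mul_assoc]
    gcongr
    rw [← div_eq_mul_inv, le_div_iff₀ (by positivity)]
    refine le_trans ?_ (hC m)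
    gcongr
    · linarith [norm_nonneg (pt m)]
    · norm_num
  have hb1 : ∀ m, ‖(area : ℂ)⁻¹ * x m‖ * ‖pt m‖ ≤ area⁻¹ * C * ((1 + ‖pt m‖) ^ 4)⁻¹ := by
    intro m
    rw [norm_mul, hA, mul_assoc, mul_assoc]
    refine mul_le_mul_of_nonneg_left ?_ (by positivity)
    rw [← div_eq_mul_inv, le_div_iff₀ (by positivity)]
    refine le_trans ?_ (hC m)
    have h5 : (1 + ‖pt m‖) ^ 5 = (1 + ‖pt m‖) * (1 + ‖pt m‖) ^ 4 := by ring
    rw [mul_assoc, h5]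
    gcongr
    linarith
  have hs : Summable fun m => area⁻¹ * C * ((1 + ‖pt m‖) ^ 4)⁻¹ := summable_weight.mul_left _
  have hsn : Summable fun m => ‖(area : ℂ)⁻¹ * x m‖ :=
    Summable.of_nonneg_of_le (fun _ => norm_nonneg _) hb0 hs
  refine ⟨fun z => ∑' m, ((area : ℂ)⁻¹ * x m) • chi m z, ?_, ?_, ?_⟩
  · refine contDiff_tsum (v := fun _ m => area⁻¹ * C * ((1 + ‖pt m‖) ^ 4)⁻¹)
      (fun m => ((contDiff_chi m).of_le (by simp)).const_smul _) (fun _ _ => hs) ?_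
    intro k m z hk
    have hk' : k ≤ 1 := by exact_mod_cast hk
    interval_cases k
    · rw [norm_iteratedFDeriv_zero, norm_smul, norm_chi, mul_one]
      exact hb0 m
    · rw [norm_iteratedFDeriv_one, fderiv_fun_const_smul (differentiable_chi m z), norm_smul]
      exact (mul_le_mul_of_nonneg_left (norm_fderiv_chi_le m z) (norm_nonneg _)).trans (hb1 m)
  · intro a ha z
    simp only [chi_periodic _ ha]
  · intro m
    have h1 : ∀ m', ∫ z in cell (3 * cLam), ‖((area : ℂ)⁻¹ * x m') • chi m' z * chi (-m) z‖ =
        area * ‖(area : ℂ)⁻¹ * x m'‖ := by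
      intro m'
      have : ∀ z, ‖((area : ℂ)⁻¹ * x m') • chi m' z * chi (-m) z‖ = ‖(area : ℂ)⁻¹ * x m'‖ := by
        intro z
        rw [norm_mul, norm_smul, norm_chi, norm_chi, mul_one, mul_one]
      simp only [this]
      have hc := integral_cell_const three_cLam_ne 1
      rw [setIntegral_const, smul_eq_mul]
      congr 1
      have hc2 : (volume.real (cell (3 * cLam)) : ℂ) = (area : ℂ) := by
        simpa [area] using hc
      exact_mod_cast hc2
    have h2 := hasSum_integral_of_summable_integral_norm
      (μ := volume.restrict (cell (3 * cLam)))
      (F := fun m' z => ((area : ℂ)⁻¹ * x m') • chi m' z * chi (-m) z)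
      (fun m' => integrableOn_cell three_cLam_ne
        (((continuous_chi m').const_smul ((area : ℂ)⁻¹ * x m')).mul (continuous_chi (-m))))
      (by simp only [h1]; exact hsn.mul_left _)
    have h3 : ∀ m', ∫ z in cell (3 * cLam), ((area : ℂ)⁻¹ * x m') • chi m' z * chi (-m) z =
        if m' = m then x m else 0 := by
      intro m'
      have : ∀ z, ((area : ℂ)⁻¹ * x m') • chi m' z * chi (-m) z =
          ((area : ℂ)⁻¹ * x m') * chi (m' - m) z := by
        intro z
        rw [sub_eq_add_neg, chi_add, smul_eq_mul, mul_assoc]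
      simp only [this]
      rw [integral_const_mul, integral_chi]
      have h0 : (area : ℂ) ≠ 0 := by exact_mod_cast area_pos.ne'
      by_cases h : m' = m
      · subst h; simp; field_simp
      · simp [h, sub_eq_zero]
    simp only [h3] at h2
    rw [fc]
    have h4 := (hasSum_ite_eq m (x m)).unique h2
    rw [h4]
    refine integral_congr_ae (Filter.Eventually.of_forall fun z => ?_)
    simp only
    rw [← tsum_mul_right]

/-- Two continuous functions that agree almost everywhere are equal. -/
lemma eq_of_ae_eq_continuous {f g : ℂ → ℂ} (hf : Continuous f) (hg : Continuous g)
    (h : ∀ᵐ z : ℂ, f z = g z) : ∀ z, f z = g z :=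
  fun z => congrFun ((Continuous.ae_eq_iff_eq volume hf hg).1 h) z

/-- Elements of the kernel of an elliptic system are classical solutions. -/
lemma exists_classical {P : System ι} {c : ι → ℤ} (hP : P.Elliptic)
    (hb : ∀ i j, IsTrig fun z => P.b z i j) {v : L2 ι} (hv : v ∈ P.kernel c) :
    ∃ f, P.Classical c f ∧ ∀ᵐ z : ℂ, (v (toTorus z)).ofLp = f z := by
  classical
  obtain ⟨hv0, hv1⟩ := hv
  choose f hf1 hf2 hf3 using fun i => exists_contDiff_of_decay (decay_of_maps hP hb hv1 5 i)
  have hper : ∀ a ∈ lattice (3 * cLam), ∀ z, (fun i => f i (z + a)) = fun i => f i z :=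
    fun a ha z => funext fun i => hf2 i a ha z
  have hvf : ∀ᵐ z : ℂ, (v (toTorus z)).ofLp = fun i => f i z := by
    obtain ⟨w, hw⟩ := exists_L2 (fun z i => f i z) (fun i => (hf1 i).continuous) hper
    have : v = w := L2_ext_coef fun i m => by
      rw [← hf3 i m]
      exact (fc_congr (by filter_upwards [hw] with z hz; rw [hz]) m).symm
    rw [this]; exact hw
  have hcd : ∀ (i : ι) (e : ℂ), Continuous fun z => fderiv ℝ (f i) z e := fun i e =>
    ((hf1 i).continuous_fderiv (by simp)).clm_apply continuous_const
  have hder : ∀ {e : ℂ} {g : L2 ι}, IsWeakDeriv e v g →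
      ∀ᵐ z : ℂ, (g (toTorus z)).ofLp = fun i => fderiv ℝ (f i) z e := by
    intro e g hg
    obtain ⟨w, hw⟩ := exists_L2 (fun z i => fderiv ℝ (f i) z e) (fun i => hcd i e)
      (fun a ha z => by funext i; rw [fderiv_periodic (hf2 i) a ha z])
    have : g = w := L2_ext_coef fun i m => by
      rw [coef_of_isWeakDeriv hg, ← hf3 i m, ← fc_fderiv (hf1 i) (hf2 i)]
      exact (fc_congr (by filter_upwards [hw] with z hz; rw [hz]) m).symm
    rw [this]; exact hw
  refine ⟨fun z i => f i z, ⟨hf1, fun a₁ a₂ z i => ?_, fun z => ?_⟩, hvf⟩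
  · refine eq_of_ae_eq_continuous (f := fun z => om ^ (c i * (a₁ + a₂)) * f i (z + lamPt a₁ a₂))
      (((hf1 i).continuous.comp (continuous_id.add continuous_const)).const_mul _)
      (hf1 i).continuous ?_ z
    filter_upwards [hvf, ae_shift hvf (lamPt a₁ a₂), hv0 a₁ a₂] with z h1 h2 h3
    have := h3 i
    rw [h1, h2] at this
    exact this
  · obtain ⟨g₁, g₂, h1, h2, h3⟩ := hv1
    funext i
    refine eq_of_ae_eq_continuous (f := fun z => (P.a₁ *ᵥ (fun i => fderiv ℝ (f i) z 1) +
      P.a₂ *ᵥ (fun i => fderiv ℝ (f i) z Complex.I) + P.b z *ᵥ fun i => f i z) i) (g := fun _ => 0)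
      ?_ continuous_const ?_ z
    · simp only [Pi.add_apply, Matrix.mulVec, dotProduct]
      refine ((continuous_finsetSum _ fun j _ => (hcd j 1).const_mul _).add
        (continuous_finsetSum _ fun j _ => (hcd j _).const_mul _)).add
        (continuous_finsetSum _ fun j _ => (hb i j).continuous.mul (hf1 j).continuous)
    · filter_upwards [hder h1, hder h2, hvf, h3, ae_zero (ι := ι)] with z k1 k2 k3 k4 k5
      rw [← k1, ← k2, ← k3, k4, k5]
      rfl

end


section

/-! ### The operator `2 D_{z̄}` -/

/-- The operator `2 D_{z̄} = (1/i)(∂₁ + i ∂₂)` on functions of the plane. -/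
noncomputable def dz (f : ℂ → ℂ) (z : ℂ) : ℂ :=
  -Complex.I * fderiv ℝ f z 1 + fderiv ℝ f z Complex.I

lemma dz_mul {f g : ℂ → ℂ} {z : ℂ} (hf : DifferentiableAt ℝ f z) (hg : DifferentiableAt ℝ g z) :
    dz (fun z => f z * g z) z = dz f z * g z + f z * dz g z := by
  rw [dz, dz, dz, fderiv_fun_mul hf hg]
  simp only [_root_.add_apply, _root_.smul_apply, smul_eq_mul]
  ring

lemma dz_add {f g : ℂ → ℂ} {z : ℂ} (hf : DifferentiableAt ℝ f z) (hg : DifferentiableAt ℝ g z) :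
    dz (fun z => f z + g z) z = dz f z + dz g z := by
  rw [dz, dz, dz, fderiv_fun_add hf hg]
  simp only [_root_.add_apply]
  ring

lemma dz_const_mul {f : ℂ → ℂ} {z : ℂ} (c : ℂ) (hf : DifferentiableAt ℝ f z) :
    dz (fun z => c * f z) z = c * dz f z := by
  rw [dz, dz, fderiv_const_mul hf]
  simp only [_root_.smul_apply, smul_eq_mul]
  ring

lemma dz_neg {f : ℂ → ℂ} {z : ℂ} : dz (fun z => -f z) z = -dz f z := by
  rw [dz, dz, fderiv_fun_neg]
  simp only [_root_.neg_apply]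
  ring

lemma dz_congr {f g : ℂ → ℂ} {z : ℂ} (h : f =ᶠ[nhds z] g) : dz f z = dz g z := by
  rw [dz, dz, h.fderiv_eq]

lemma dz_of_differentiableAt {f : ℂ → ℂ} {z : ℂ} (hf : DifferentiableAt ℂ f z) : dz f z = 0 := by
  have h := hf.hasFDerivAt.restrictScalars ℝ
  have h1 : ∀ e, fderiv ℝ f z e = fderiv ℂ f z e := fun e => by rw [h.fderiv]; rfl
  have h2 : fderiv ℂ f z Complex.I = Complex.I * fderiv ℂ f z 1 := by
    rw [← smul_eq_mul, ← map_smul, smul_eq_mul, mul_one]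
  rw [dz, h1, h1, h2]; ring

/-- A real-differentiable function with `2 D_{z̄} f = 0` at a point is complex differentiable
there. -/
lemma differentiableAt_of_dz {f : ℂ → ℂ} {z : ℂ} (hf : DifferentiableAt ℝ f z) (h : dz f z = 0) :
    DifferentiableAt ℂ f z := by
  rw [differentiableAt_complex_iff_differentiableAt_real]
  refine ⟨hf, ?_⟩
  rw [smul_eq_mul]
  rw [dz] at h
  linear_combination h

lemma pt_eq_pairing (m : ℤ × ℤ) :
    pt m = (pairing 1 (pt m) : ℂ) + pairing Complex.I (pt m) * Complex.I := by
  apply Complex.ext <;> simp [pairing]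

lemma dz_chi (m : ℤ × ℤ) (z : ℂ) : dz (chi m) z = pt m * chi m z := by
  rw [dz, fderiv_chi, fderiv_chi]
  linear_combination (-chi m z) * pt_eq_pairing m -
    (pairing 1 (pt m) : ℂ) * chi m z * Complex.I_sq

/-- Integration by parts against a character, for functions that are differentiable off a countable
set. -/
lemma fc_dz {f g : ℂ → ℂ} (hf : Continuous f)
    (hp : ∀ a ∈ lattice (3 * cLam), ∀ z, f (z + a) = f z) {s : Set ℂ} (hs : s.Countable)
    (hd : ∀ z ∉ s, DifferentiableAt ℝ f z) (hg : Continuous g) (h : ∀ z ∉ s, dz f z = g z)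
    (m : ℤ × ℤ) : fc g m = pt m * fc f m := by
  have hae : ∀ᵐ z : ℂ, -Complex.I * fderiv ℝ (fun z => f z * chi (-m) z) z 1 +
      1 * fderiv ℝ (fun z => f z * chi (-m) z) z Complex.I =
      g z * chi (-m) z - pt m * (f z * chi (-m) z) := by
    filter_upwards [hs.ae_notMem volume] with z hz
    have := dz_mul (hd z hz) (differentiable_chi (-m) z)
    rw [dz_chi, h z hz, pt_neg] at this
    rw [one_mul]
    refine Eq.trans this ?_
    ring
  have hi1 := integrableOn_cell three_cLam_ne (f := fun z => g z * chi (-m) z)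
    (hg.mul (continuous_chi (-m)))
  have hi2 := (integrableOn_cell three_cLam_ne (f := fun z => f z * chi (-m) z)
    (hf.mul (continuous_chi (-m)))).const_mul (pt m)
  have key := integral_cell_deriv_eq_zero three_cLam_ne (f := fun z => f z * chi (-m) z)
    (hf.mul (continuous_chi (-m)))
    (fun a ha z => by rw [hp a ha z, chi_periodic _ ha z]) hs
    (fun z hz => (hd z hz).mul (differentiable_chi (-m) z)) (-Complex.I) 1
    ((hi1.sub hi2).congr (ae_restrict_of_ae (by
      filter_upwards [hae] with z hz
      exact hz.symm)))
  rw [integral_congr_ae (ae_restrict_of_ae hae), integral_sub hi1 hi2, integral_const_mul] at key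
  rw [fc, fc]
  linear_combination key

lemma periodic_of_phase_scalar {c : ℤ} {f : ℂ → ℂ} (hp : ∀ (a₁ a₂ : ℤ) (z : ℂ),
    om ^ (c * (a₁ + a₂)) * f (z + lamPt a₁ a₂) = f z) :
    ∀ a ∈ lattice (3 * cLam), ∀ z, f (z + a) = f z := fun a ha z =>
  congrFun (periodic_of_phase (ι := Unit) (c := fun _ => c) (f := fun z _ => f z)
    (fun a₁ a₂ z _ => hp a₁ a₂ z) a ha z) ()

lemma eq_zero_of_fc {f : ℂ → ℂ} (hf : Continuous f)
    (hp : ∀ a ∈ lattice (3 * cLam), ∀ z, f (z + a) = f z) (h : ∀ m, fc f m = 0) (z : ℂ) :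
    f z = 0 := by
  obtain ⟨v, hv⟩ := exists_L2 (fun z (_ : Unit) => f z) (fun _ => hf)
    (fun a ha z => by funext i; exact hp a ha z)
  have hv' : ∀ᵐ z : ℂ, v (toTorus z) () = f z := by
    filter_upwards [hv] with z hz
    rw [hz]
  have : v = 0 := L2_eq_zero_of_coef v fun i m => by rw [← h m]; exact fc_congr hv' m
  rw [this] at hv'
  refine eq_of_ae_eq_continuous hf continuous_const (g := fun _ => 0) ?_ z
  filter_upwards [hv', ae_zero (ι := Unit)] with z h1 h2
  rw [← h1, h2]; rfl

lemma dvd_of_fc_ne_zero {c : ℤ} {f : ℂ → ℂ} (hf : Continuous f)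
    (hp : ∀ (a₁ a₂ : ℤ) (z : ℂ), om ^ (c * (a₁ + a₂)) * f (z + lamPt a₁ a₂) = f z) {m : ℤ × ℤ}
    (h : fc f m ≠ 0) : (3 : ℤ) ∣ c + m.1 ∧ (3 : ℤ) ∣ c + m.2 := by
  obtain ⟨v, hv⟩ := exists_L2 (fun z (_ : Unit) => f z) (fun _ => hf)
    (fun a ha z => by funext i; exact periodic_of_phase_scalar hp a ha z)
  have hv' : ∀ᵐ z : ℂ, v (toTorus z) () = f z := by
    filter_upwards [hv] with z hz
    rw [hz]
  refine (mem_L20_iff (fun _ : Unit => c) v).1 (fun a₁ a₂ => ?_) () m ?_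
  · filter_upwards [hv', ae_shift hv' (lamPt a₁ a₂)] with z h1 h2 _
    rw [h1, h2, hp]
  · rw [coef, fc_congr hv']; exact h

/-- A quasi-periodic solution of `(2 D_{z̄} + k) f = 0` vanishes unless `-k` is a frequency. -/
lemma scalar_solution_eq_zero {c : ℤ} {k : ℂ} {f : ℂ → ℂ} (hf : Continuous f)
    (hp : ∀ (a₁ a₂ : ℤ) (z : ℂ), om ^ (c * (a₁ + a₂)) * f (z + lamPt a₁ a₂) = f z)
    {s : Set ℂ} (hs : s.Countable) (hd : ∀ z ∉ s, DifferentiableAt ℝ f z)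
    (h : ∀ z ∉ s, dz f z + k * f z = 0)
    (hk : ∀ m : ℤ × ℤ, (3 : ℤ) ∣ c + m.1 → (3 : ℤ) ∣ c + m.2 → pt m + k ≠ 0) (z : ℂ) :
    f z = 0 := by
  have hper := periodic_of_phase_scalar hp
  refine eq_zero_of_fc hf hper (fun m => ?_) z
  by_contra hne
  obtain ⟨h1, h2⟩ := dvd_of_fc_ne_zero hf hp hne
  have := fc_dz hf hper hs hd (g := fun z => -k * f z) (hf.const_mul _)
    (fun z hz => by linear_combination h z hz) m
  rw [fc_const_mul] at this
  have h3 : (pt m + k) * fc f m = 0 := by linear_combination -this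
  exact (mul_ne_zero (hk m h1 h2) hne) h3

/-! ### Systems `2 D_{z̄} + V` -/

variable {ι : Type} [Fintype ι] [DecidableEq ι]

lemma symbol_dbar {ι : Type} [DecidableEq ι] (V : ℂ → Matrix ι ι ℂ) (p : ℂ) :
    (System.dbar V).symbol p = (-Complex.I * p) • (1 : Matrix ι ι ℂ) := by
  rw [System.symbol, System.dbar, smul_smul, ← add_smul]
  congr 1
  conv_rhs => rw [← Complex.re_add_im p]
  linear_combination (p.im : ℂ) * Complex.I_sq

lemma elliptic_dbar (V : ℂ → Matrix ι ι ℂ) : (System.dbar V).Elliptic := by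
  intro p x
  rw [symbol_dbar, Matrix.smul_mulVec, Matrix.one_mulVec, norm_smul]
  simp

lemma elliptic_hamiltonian (V : ℂ → Matrix ι ι ℂ) : (System.dbar V).hamiltonian.Elliptic := by
  intro p x
  have h1 : ∀ (y z : ι → ℂ), (System.dbar V).hamiltonian.symbol p *ᵥ Sum.elim y z =
      Sum.elim ((-Complex.I * conj p) • z) ((-Complex.I * p) • y) := by
    intro y z
    simp only [System.symbol, System.hamiltonian, System.adjoint, System.dbar]
    rw [Matrix.add_mulVec, Matrix.smul_mulVec, Matrix.smul_mulVec, Matrix.fromBlocks_mulVec,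
      Matrix.fromBlocks_mulVec]
    have hp := Complex.re_add_im p
    have hp' : conj p = p.re - p.im * Complex.I := by
      apply Complex.ext <;> simp
    funext i
    rcases i with i | i
    · simp [Matrix.smul_mulVec, Matrix.neg_mulVec]
      rw [hp']; linear_combination -(p.im : ℂ) * z i * Complex.I_sq
    · simp [Matrix.smul_mulVec, Matrix.neg_mulVec]
      conv_rhs => rw [← hp]
      linear_combination (p.im : ℂ) * y i * Complex.I_sq
  have hx : x = Sum.elim (fun i => x (Sum.inl i)) fun i => x (Sum.inr i) := by
    funext i; rcases i with i | i <;> rfl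
  have h2 : ‖p‖ * ‖x‖ = ‖(p : ℂ) • x‖ := (norm_smul _ _).symm
  rw [h2]
  refine (pi_norm_le_iff_of_nonneg (norm_nonneg _)).2 fun i => ?_
  rw [hx, h1]
  rcases i with i | i
  · refine le_trans (le_of_eq ?_) (norm_le_pi_norm _ (Sum.inr i))
    simp
  · refine le_trans (le_of_eq ?_) (norm_le_pi_norm _ (Sum.inl i))
    simp

lemma dbar_eq_apply (V : ℂ → Matrix ι ι ℂ) (f : ℂ → ι → ℂ) (z : ℂ) (i : ι) :
    ((System.dbar V).a₁ *ᵥ (fun i => fderiv ℝ (fun w => f w i) z 1) +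
      (System.dbar V).a₂ *ᵥ (fun i => fderiv ℝ (fun w => f w i) z Complex.I) +
      (System.dbar V).b z *ᵥ f z) i = dz (fun w => f w i) z + (V z *ᵥ f z) i := by
  simp only [System.dbar, Pi.add_apply, Matrix.smul_mulVec, Matrix.one_mulVec, Pi.smul_apply,
    smul_eq_mul, dz]

lemma System.Classical.dbar_eq {V : ℂ → Matrix ι ι ℂ} {c : ι → ℤ} {f : ℂ → ι → ℂ}
    (h : (System.dbar V).Classical c f) (z : ℂ) (i : ι) :
    dz (fun w => f w i) z + (V z *ᵥ f z) i = 0 := by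
  rw [← dbar_eq_apply, h.eq]; rfl

/-- A continuous function that solves `(2 D_{z̄} + V) f = 0` off a countable set is a classical
solution. -/
lemma classical_of_countable {V : ℂ → Matrix ι ι ℂ} (hV : ∀ i j, IsTrig fun z => V z i j)
    {c : ι → ℤ} {f : ℂ → ι → ℂ} (hc : ∀ i, Continuous fun z => f z i)
    (hph : ∀ (a₁ a₂ : ℤ) (z : ℂ) (i : ι),
      om ^ (c i * (a₁ + a₂)) * f (z + lamPt a₁ a₂) i = f z i)
    {s : Set ℂ} (hs : s.Countable) (hd : ∀ z ∉ s, ∀ i, DifferentiableAt ℝ (fun w => f w i) z)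
    (heq : ∀ z ∉ s, ∀ i, dz (fun w => f w i) z + (V z *ᵥ f z) i = 0) :
    (System.dbar V).Classical c f := by
  have hper := periodic_of_phase hph
  have hperi : ∀ i, ∀ a ∈ lattice (3 * cLam), ∀ z, f (z + a) i = f z i :=
    fun i a ha z => by rw [hper a ha z]
  have hVf : ∀ i, Continuous fun z => (V z *ᵥ f z) i := fun i =>
    continuous_finsetSum _ fun j _ => (hV i j).continuous.mul (hc j)
  obtain ⟨v, hv⟩ := exists_L2 f hc hper
  obtain ⟨h, hh⟩ := exists_L2 (fun z => V z *ᵥ f z) hVf (fun a ha z => by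
    rw [hper a ha z]
    congr 1
    ext i j
    exact (hV i j).periodic a ha z)
  have hmaps : (System.dbar V).Maps v 0 := by
    refine (elliptic_dbar V).maps_of_coef (h := h) ?_ fun m => ?_
    · filter_upwards [hv, hh] with z h1 h2
      rw [h1, h2]; rfl
    · funext i
      have e1 : coef h i m = fc (fun z => (V z *ᵥ f z) i) m := fc_congr (by
        filter_upwards [hh] with z hz
        rw [hz]) m
      have e2 : coef v i m = fc (fun z => f z i) m := fc_congr (by
        filter_upwards [hv] with z hz
        rw [hz]) m
      have e3 := fc_dz (hc i) (hperi i) hs (fun z hz => hd z hz i)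
        (g := fun z => -1 * (V z *ᵥ f z) i) ((hVf i).const_mul _)
        (fun z hz => by linear_combination heq z hz i) m
      rw [fc_const_mul, ← e1, ← e2] at e3
      rw [symbol_dbar, Matrix.smul_mulVec, Matrix.one_mulVec]
      simp only [Pi.add_apply, Pi.smul_apply, smul_eq_mul, coefv, coef_zero]
      linear_combination -e3 - pt m * coef v i m * Complex.I_sq
  have hmem : v ∈ (System.dbar V).kernel c := by
    refine ⟨fun a₁ a₂ => ?_, hmaps⟩
    filter_upwards [hv, ae_shift hv (lamPt a₁ a₂)] with z h3 h4 i
    rw [h3, h4, hph]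
  obtain ⟨g, hg, hvg⟩ := exists_classical (elliptic_dbar V) hV hmem
  have hfg : f = g := by
    funext z i
    refine eq_of_ae_eq_continuous (hc i) (hg.contDiff i).continuous ?_ z
    filter_upwards [hv, hvg] with z h1 h2
    rw [← h1, ← h2]
  rw [hfg]
  exact hg

/-! ### The resolvent of `2 D_{z̄}` -/

lemma isDbarSolution_iff (k : ℂ) (f w : L2 Unit) : IsDbarSolution k f w ↔
    w ∈ periodicL2 ∧ ∀ m, (pt m + k) * coef w () m = coef f () m := by
  refine and_congr_right fun _ => ?_
  constructor
  · intro h m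
    have := congrFun (coef_of_maps (fun i j => by
      simpa [System.dbar] using continuous_const) h m) ()
    rw [symbol_dbar] at this
    simp only [Pi.add_apply, Pi.smul_apply, smul_eq_mul, coefv, Matrix.smul_mulVec,
      Matrix.one_mulVec, Finset.univ_unique, Finset.sum_singleton, System.dbar,
      Matrix.smul_apply, PUnit.default_eq_unit, Matrix.one_apply_eq, mul_one, fc_const_mul] at this
    rw [← this, ← coef]
    linear_combination pt m * coef w () m * Complex.I_sq
  · intro h
    refine (elliptic_dbar _).maps_of_coef (h := k • w) ?_ fun m => ?_
    · filter_upwards [ae_smul k w] with z hz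
      rw [hz]
      simp [System.dbar, Matrix.smul_mulVec]
    · funext i
      rw [symbol_dbar, Matrix.smul_mulVec, Matrix.one_mulVec]
      simp only [Pi.add_apply, Pi.smul_apply, smul_eq_mul, coefv, coef_smul]
      rw [← h m]
      linear_combination -pt m * coef w () m * Complex.I_sq

lemma isClosed_lattice {c : ℂ} (hc : c ≠ 0) : IsClosed (lattice c : Set ℂ) := by
  have := lattice_discrete c hc
  exact AddSubgroup.isClosed_of_discrete

lemma pt_mem_dual {m : ℤ × ℤ} (h1 : (3 : ℤ) ∣ m.1) (h2 : (3 : ℤ) ∣ m.2) :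
    pt m ∈ lattice cDual := by
  obtain ⟨a, ha⟩ := h1
  obtain ⟨b, hb⟩ := h2
  rw [mem_lattice_cDual]
  refine ⟨a, b, ?_⟩
  rw [← pt_three, ← ha, ← hb]

lemma pt_add_ne {k : ℂ} (hk : k ∉ lattice cDual) {m : ℤ × ℤ} (h1 : (3 : ℤ) ∣ m.1)
    (h2 : (3 : ℤ) ∣ m.2) : pt m + k ≠ 0 := by
  intro h
  refine hk ?_
  rw [eq_neg_of_add_eq_zero_right h]
  exact neg_mem (pt_mem_dual h1 h2)

lemma exists_lower_bound {k : ℂ} (hk : k ∉ lattice cDual) : ∃ δ > 0, ∀ m : ℤ × ℤ,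
    (3 : ℤ) ∣ m.1 → (3 : ℤ) ∣ m.2 → δ ≤ ‖pt m + k‖ := by
  have hcl := isClosed_lattice cDual_ne
  refine ⟨Metric.infDist (-k) (lattice cDual : Set ℂ), ?_, fun m h1 h2 => ?_⟩
  · refine (hcl.notMem_iff_infDist_pos ⟨0, zero_mem _⟩).1 ?_
    intro h
    exact hk (by simpa using neg_mem h)
  · refine (Metric.infDist_le_dist_of_mem (pt_mem_dual h1 h2)).trans (le_of_eq ?_)
    rw [dist_eq_norm, ← norm_neg]; congr 1; ring

lemma dvd_of_coef_ne_zero {f : L2 Unit} (hf : f ∈ periodicL2) {m : ℤ × ℤ}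
    (h : coef f () m ≠ 0) : (3 : ℤ) ∣ m.1 ∧ (3 : ℤ) ∣ m.2 := by
  simpa using (mem_L20_iff (fun _ : Unit => 0) f).1 hf () m h

/-- The resolvent of `2 D_{z̄}` exists off the dual lattice. -/
lemma existsUnique_isDbarSolution {k : ℂ} (hk : k ∉ lattice cDual) {f : L2 Unit}
    (hf : f ∈ periodicL2) : ∃! w, IsDbarSolution k f w := by
  obtain ⟨δ, hδ, hb⟩ := exists_lower_bound hk
  obtain ⟨w, hw⟩ := exists_coef (fun (_ : Unit) m => coef f () m / (pt m + k)) (fun i => by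
    refine Summable.of_nonneg_of_le (fun _ => by positivity) (fun m => ?_)
      ((summable_coef f ()).mul_left ((δ ^ 2)⁻¹))
    by_cases h0 : coef f () m = 0
    · simp [h0]
    · obtain ⟨h1, h2⟩ := dvd_of_coef_ne_zero hf h0
      rw [norm_div, div_pow, div_eq_inv_mul]
      gcongr
      exact hb m h1 h2)
  refine ⟨w, (isDbarSolution_iff k f w).2 ⟨?_, fun m => ?_⟩, fun w' hw' => ?_⟩
  · refine (mem_L20_iff (fun _ : Unit => 0) w).2 fun _ m h => ?_
    rw [hw] at h
    simpa using dvd_of_coef_ne_zero hf (m := m) (fun h0 => h (by rw [h0, zero_div]))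
  · rw [hw]
    by_cases h0 : coef f () m = 0
    · simp [h0]
    · obtain ⟨h1, h2⟩ := dvd_of_coef_ne_zero hf h0
      exact mul_div_cancel₀ _ (pt_add_ne hk h1 h2)
  · obtain ⟨h1, h2⟩ := (isDbarSolution_iff k f w').1 hw'
    refine L2_ext_coef fun _ m => ?_
    rw [hw, ← h2 m]
    by_cases h0 : coef w' () m = 0
    · simp [h0]
    · obtain ⟨h3, h4⟩ := dvd_of_coef_ne_zero h1 h0
      exact (mul_div_cancel_left₀ _ (pt_add_ne hk h3 h4)).symm

lemma dbarResolvent_spec {k : ℂ} (hk : k ∉ lattice cDual) {f : L2 Unit} (hf : f ∈ periodicL2) :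
    dbarResolvent k f ∈ periodicL2 ∧
      ∀ m, coef (dbarResolvent k f) () m = coef f () m / (pt m + k) := by
  have hex := (existsUnique_isDbarSolution hk hf).exists
  have h : IsDbarSolution k f (dbarResolvent k f) := by
    rw [dbarResolvent, dif_pos hex]; exact hex.choose_spec
  obtain ⟨h1, h2⟩ := (isDbarSolution_iff _ _ _).1 h
  refine ⟨h1, fun m => ?_⟩
  rw [← h2 m]
  by_cases h0 : coef (dbarResolvent k f) () m = 0
  · simp [h0]
  · obtain ⟨h3, h4⟩ := dvd_of_coef_ne_zero h1 h0
    exact (mul_div_cancel_left₀ _ (pt_add_ne hk h3 h4)).symm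

lemma dbarResolvent_iterate_spec {k : ℂ} (hk : k ∉ lattice cDual) {f : L2 Unit}
    (hf : f ∈ periodicL2) (j : ℕ) : (dbarResolvent k)^[j] f ∈ periodicL2 ∧
      ∀ m, coef ((dbarResolvent k)^[j] f) () m = coef f () m / (pt m + k) ^ j := by
  induction j with
  | zero => exact ⟨hf, fun m => by simp⟩
  | succ j ih =>
    rw [Function.iterate_succ_apply']
    obtain ⟨h1, h2⟩ := dbarResolvent_spec hk ih.1
    refine ⟨h1, fun m => ?_⟩
    rw [h2, ih.2, div_div, pow_succ]

end


/-! ### The theta function -/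

/-- The terms of the theta series. -/
noncomputable def thetaTerm (ζ : ℂ) (m : ℤ) : ℂ :=
  Complex.exp (Real.pi * Complex.I * (m + 1 / 2) ^ 2 * om +
    2 * Real.pi * Complex.I * (m + 1 / 2) * (ζ + 1 / 2))

lemma om_im_pos : 0 < om.im := by rw [om_im]; positivity

lemma thetaTerm_eq (ζ : ℂ) (m : ℤ) : thetaTerm ζ m =
    Complex.exp (Real.pi * Complex.I * om / 4 + Real.pi * Complex.I * (ζ + 1 / 2)) *
      jacobiTheta₂_term m (ζ + 1 / 2 + om / 2) om := by
  rw [thetaTerm, jacobiTheta₂_term, ← Complex.exp_add]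
  congr 1; ring

lemma theta_eq_jacobi (ζ : ℂ) : theta ζ =
    -(Complex.exp (Real.pi * Complex.I * om / 4 + Real.pi * Complex.I * (ζ + 1 / 2)) *
      jacobiTheta₂ (ζ + 1 / 2 + om / 2) om) := by
  rw [jacobiTheta₂, ← tsum_mul_left]
  simp only [← thetaTerm_eq]
  rfl

lemma summable_thetaTerm (ζ : ℂ) : Summable (thetaTerm ζ) := by
  have h : Summable fun m => jacobiTheta₂_term m (ζ + 1 / 2 + om / 2) om :=
    (summable_jacobiTheta₂_term_iff _ _).2 om_im_pos
  exact (h.mul_left _).congr fun m => (thetaTerm_eq ζ m).symm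

lemma differentiable_theta : Differentiable ℂ theta := by
  intro ζ
  rw [funext theta_eq_jacobi]
  have h : DifferentiableAt ℂ (fun ζ : ℂ => jacobiTheta₂ (ζ + 1 / 2 + om / 2) om) ζ :=
    (differentiableAt_jacobiTheta₂_fst (ζ + 1 / 2 + om / 2) om_im_pos).comp
      (f := fun ζ : ℂ => ζ + 1 / 2 + om / 2) ζ (by fun_prop)
  fun_prop

lemma continuous_theta : Continuous theta := differentiable_theta.continuous

lemma exp_pi_mul_I_int (j : ℤ) : Complex.exp (Real.pi * Complex.I * j) = (-1) ^ j := by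
  rw [mul_comm, Complex.exp_int_mul, Complex.exp_pi_mul_I]

/-- The quasi-periodicity of theta. -/
lemma theta_add (ζ : ℂ) (p₁ p₂ : ℤ) : theta (ζ + (om * p₁ - p₂)) *
    (Complex.exp (Real.pi * Complex.I * p₁ ^ 2 * om + 2 * Real.pi * Complex.I * ζ * p₁) *
      (-1) ^ (p₁ + p₂)) = theta ζ := by
  have h : ∀ m : ℤ, thetaTerm (ζ + (om * p₁ - p₂)) m *
      (Complex.exp (Real.pi * Complex.I * p₁ ^ 2 * om + 2 * Real.pi * Complex.I * ζ * p₁) *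
      (-1) ^ (p₁ + p₂)) = thetaTerm ζ (m + p₁) := by
    intro m
    rw [thetaTerm, thetaTerm, ← exp_pi_mul_I_int, ← Complex.exp_add, ← Complex.exp_add,
      Complex.exp_eq_exp_iff_exists_int]
    exact ⟨-m * p₂, by push_cast; ring⟩
  have h1 : theta (ζ + (om * p₁ - p₂)) = -∑' m, thetaTerm (ζ + (om * p₁ - p₂)) m := rfl
  have h2 : theta ζ = -∑' m, thetaTerm ζ m := rfl
  rw [h1, h2, neg_mul, ← tsum_mul_right]
  simp only [h]
  congr 1
  exact (Equiv.addRight p₁).tsum_eq (thetaTerm ζ)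

lemma theta_factor_ne (ζ : ℂ) (p₁ p₂ : ℤ) :
    Complex.exp (Real.pi * Complex.I * p₁ ^ 2 * om + 2 * Real.pi * Complex.I * ζ * p₁) *
      (-1 : ℂ) ^ (p₁ + p₂) ≠ 0 :=
  mul_ne_zero (Complex.exp_ne_zero _) (zpow_ne_zero _ (by norm_num))

/-- The terms of the sine series of theta. -/
noncomputable def sineTerm (ζ : ℂ) (n : ℕ) : ℂ :=
  (-1) ^ n * Complex.exp (Real.pi * Complex.I * ((n : ℂ) + 1 / 2) ^ 2 * om) *
    Complex.sin ((2 * n + 1 : ℕ) * (Real.pi * ζ))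

lemma thetaTerm_add (ζ : ℂ) (n : ℕ) :
    thetaTerm ζ n + thetaTerm ζ (-(n + 1)) = -2 * sineTerm ζ n := by
  set E := Complex.exp (Real.pi * Complex.I * ((n : ℂ) + 1 / 2) ^ 2 * om) with hE
  have hn : Complex.exp (Real.pi * Complex.I * (n : ℂ)) = (-1) ^ n := by
    have := exp_pi_mul_I_int n
    simpa using this
  have hn' : Complex.exp (-(Real.pi * Complex.I * (n : ℂ))) = (-1) ^ n := by
    have := exp_pi_mul_I_int (-n)
    rw [zpow_neg, ← inv_zpow] at this
    norm_num at this
    rw [← this]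
  have hI' : Complex.exp (-(Real.pi / 2 * Complex.I)) = -Complex.I := by
    rw [Complex.exp_neg, Complex.exp_pi_div_two_mul_I, Complex.inv_I]
  have e1 : thetaTerm ζ n = E * ((-1) ^ n * Complex.I *
      Complex.exp ((2 * n + 1 : ℕ) * (Real.pi * ζ) * Complex.I)) := by
    have hI : Complex.I = Complex.exp (Real.pi / 2 * Complex.I) :=
      Complex.exp_pi_div_two_mul_I.symm
    have e : ((-1) ^ n * Complex.I * Complex.exp ((2 * n + 1 : ℕ) * (Real.pi * ζ) * Complex.I)) =
        (-1) ^ n * Complex.exp (Real.pi / 2 * Complex.I) *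
          Complex.exp ((2 * n + 1 : ℕ) * (Real.pi * ζ) * Complex.I) := by rw [← hI]
    rw [e, hE, ← hn, ← Complex.exp_add, ← Complex.exp_add, ← Complex.exp_add, thetaTerm]
    congr 1; push_cast; ring
  have e2 : thetaTerm ζ (-(n + 1)) = E * ((-1) ^ n * -Complex.I *
      Complex.exp (-((2 * n + 1 : ℕ) * (Real.pi * ζ)) * Complex.I)) := by
    rw [hE, ← hn', ← hI', ← Complex.exp_add, ← Complex.exp_add,
      ← Complex.exp_add, thetaTerm]
    congr 1; push_cast; ring
  rw [e1, e2, sineTerm, Complex.sin, ← hE]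
  ring

lemma theta_eq_sine (ζ : ℂ) : theta ζ = 2 * ∑' n, sineTerm ζ n := by
  have hs := summable_thetaTerm ζ
  have h1 : theta ζ = -∑' m, thetaTerm ζ m := rfl
  have hn : Summable fun n : ℕ => thetaTerm ζ n := hs.comp_injective Nat.cast_injective
  have hn' : Summable fun n : ℕ => thetaTerm ζ (-(n + 1)) := hs.comp_injective (fun a b h => by
    simpa using h)
  rw [h1, tsum_of_nat_of_neg_add_one hn hn', ← hn.tsum_add hn']
  simp only [thetaTerm_add]
  rw [tsum_mul_left]; ring

lemma norm_cos_le (w : ℂ) : ‖Complex.cos w‖ ≤ Real.exp |w.im| := by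
  rw [Complex.cos, norm_div, Complex.norm_two, div_le_iff₀ (by norm_num)]
  refine (norm_add_le _ _).trans ?_
  rw [Complex.norm_exp, Complex.norm_exp]
  have h1 : (w * Complex.I).re ≤ |w.im| := by simpa using neg_le_abs w.im
  have h2 : (-w * Complex.I).re ≤ |w.im| := by simpa using le_abs_self w.im
  linarith [Real.exp_le_exp.2 h1, Real.exp_le_exp.2 h2]

lemma norm_sin_odd_le (x : ℂ) (n : ℕ) : ‖Complex.sin ((2 * n + 1 : ℕ) * x)‖ ≤
    (2 * n + 1) * Real.exp (2 * n * |x.im|) * ‖Complex.sin x‖ := by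
  induction n with
  | zero => simp
  | succ n ih =>
    have h : Complex.sin ((2 * (n + 1) + 1 : ℕ) * x) = Complex.sin ((2 * n + 1 : ℕ) * x) +
        2 * Complex.cos ((2 * n + 2 : ℕ) * x) * Complex.sin x := by
      have e1 : ((2 * (n + 1) + 1 : ℕ) : ℂ) * x = (2 * n + 2 : ℕ) * x + x := by push_cast; ring
      have e2 : ((2 * n + 1 : ℕ) : ℂ) * x = (2 * n + 2 : ℕ) * x - x := by push_cast; ring
      rw [e1, e2, Complex.sin_add, Complex.sin_sub]; ring
    have hc : ‖Complex.cos ((2 * n + 2 : ℕ) * x)‖ ≤ Real.exp ((2 * n + 2) * |x.im|) := by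
      refine (norm_cos_le _).trans (le_of_eq ?_)
      have : (((2 * n + 2 : ℕ) : ℂ) * x).im = (2 * n + 2 : ℕ) * x.im := by
        rw [← Complex.ofReal_natCast, Complex.im_ofReal_mul]
      rw [this, abs_mul, Nat.abs_cast]
      push_cast; rfl
    have hmono : Real.exp (2 * n * |x.im|) ≤ Real.exp ((2 * n + 2) * |x.im|) :=
      Real.exp_le_exp.2 (mul_le_mul_of_nonneg_right (by linarith) (abs_nonneg _))
    rw [h]
    calc _ ≤ ‖Complex.sin ((2 * n + 1 : ℕ) * x)‖ +
          2 * ‖Complex.cos ((2 * n + 2 : ℕ) * x)‖ * ‖Complex.sin x‖ := by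
          refine (norm_add_le _ _).trans (le_of_eq ?_)
          rw [norm_mul, norm_mul, Complex.norm_two]
      _ ≤ (2 * n + 1) * Real.exp ((2 * n + 2) * |x.im|) * ‖Complex.sin x‖ +
          2 * Real.exp ((2 * n + 2) * |x.im|) * ‖Complex.sin x‖ := by
          gcongr
          exact ih.trans (by gcongr)
      _ = _ := by push_cast; ring_nf

lemma exp_period_le : Real.exp (-(Real.pi * Real.sqrt 3 / 2)) ≤ 1 / 10 := by
  have hs : (1.7 : ℝ) < Real.sqrt 3 := by
    rw [Real.lt_sqrt (by norm_num)]; norm_num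
  have hp := Real.pi_gt_three
  have h1 : (5 / 2 : ℝ) ≤ Real.pi * Real.sqrt 3 / 2 := by nlinarith
  have h2 : (10 : ℝ) ≤ Real.exp (5 / 2) := by
    have h3 : Real.exp (5 / 2) ^ 2 = Real.exp 1 ^ 5 := by
      rw [← Real.exp_nat_mul, ← Real.exp_nat_mul]; norm_num
    have h4 := Real.exp_one_gt_d9
    have h5 : (2.7 : ℝ) ^ 5 ≤ Real.exp 1 ^ 5 := pow_le_pow_left₀ (by norm_num) (by linarith) 5
    nlinarith [Real.exp_pos (5 / 2 : ℝ)]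
  rw [Real.exp_neg, one_div]
  exact inv_anti₀ (by norm_num) (h2.trans (Real.exp_le_exp.2 h1))

/-- In a strip of height one period, the sine series is dominated by its first term. -/
lemma norm_sineTerm_le {ζ : ℂ} (hζ : |ζ.im| ≤ Real.sqrt 3 / 4) (n : ℕ) : ‖sineTerm ζ n‖ ≤
    Real.exp (-(Real.pi * Real.sqrt 3 / 8)) * ‖Complex.sin (Real.pi * ζ)‖ * (3 / 10) ^ n := by
  set r := Real.exp (-(Real.pi * Real.sqrt 3 / 2)) with hr
  have h1 : ‖Complex.exp (Real.pi * Complex.I * ((n : ℂ) + 1 / 2) ^ 2 * om)‖ =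
      Real.exp (-(Real.pi * Real.sqrt 3 / 8)) *
        Real.exp (-(Real.pi * Real.sqrt 3 / 2) * (n ^ 2 + n)) := by
    rw [Complex.norm_exp, ← Real.exp_add]
    congr 1
    have : (Real.pi * Complex.I * ((n : ℂ) + 1 / 2) ^ 2 * om) =
        ((Real.pi * ((n : ℝ) + 1 / 2) ^ 2 : ℝ) : ℂ) * (Complex.I * om) := by push_cast; ring
    rw [this, Complex.re_ofReal_mul, Complex.I_mul_re, om_im]
    ring
  have h2 : Real.exp (2 * n * |(Real.pi * ζ).im|) ≤ Real.exp (Real.pi * Real.sqrt 3 / 2 * n) := by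
    rw [Real.exp_le_exp, Complex.im_ofReal_mul, abs_mul, abs_of_pos Real.pi_pos]
    calc 2 * n * (Real.pi * |ζ.im|) = 2 * n * Real.pi * |ζ.im| := by ring
      _ ≤ 2 * n * Real.pi * (Real.sqrt 3 / 4) :=
        mul_le_mul_of_nonneg_left hζ (by positivity)
      _ = _ := by ring
  have h3 : (2 * n + 1 : ℝ) ≤ 3 ^ n := by
    have := one_add_mul_le_pow (show (-2 : ℝ) ≤ 2 by norm_num) n
    norm_num at this; linarith
  have h4 : Real.exp (-(Real.pi * Real.sqrt 3 / 2) * (n ^ 2 + n)) *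
      Real.exp (Real.pi * Real.sqrt 3 / 2 * n) ≤ (1 / 10) ^ n := by
    rw [← Real.exp_add]
    calc _ = Real.exp (-(Real.pi * Real.sqrt 3 / 2)) ^ (n ^ 2) := by
          rw [← Real.exp_nat_mul]; congr 1; push_cast; ring
      _ ≤ (1 / 10) ^ (n ^ 2) := pow_le_pow_left₀ (Real.exp_pos _).le exp_period_le _
      _ ≤ (1 / 10) ^ n := pow_le_pow_of_le_one (by norm_num) (by norm_num)
          (Nat.le_self_pow (by norm_num) n)
  rw [sineTerm, norm_mul, norm_mul, norm_pow, norm_neg, norm_one, one_pow, one_mul, h1]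
  have h5 := norm_sin_odd_le (Real.pi * ζ) n
  calc _ ≤ Real.exp (-(Real.pi * Real.sqrt 3 / 8)) *
        Real.exp (-(Real.pi * Real.sqrt 3 / 2) * (n ^ 2 + n)) *
        (3 ^ n * Real.exp (Real.pi * Real.sqrt 3 / 2 * n) * ‖Complex.sin (Real.pi * ζ)‖) := by
        gcongr
        exact h5.trans (by gcongr)
    _ = Real.exp (-(Real.pi * Real.sqrt 3 / 8)) * ‖Complex.sin (Real.pi * ζ)‖ * (3 ^ n *
        (Real.exp (-(Real.pi * Real.sqrt 3 / 2) * (n ^ 2 + n)) *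
        Real.exp (Real.pi * Real.sqrt 3 / 2 * n))) := by ring
    _ ≤ Real.exp (-(Real.pi * Real.sqrt 3 / 8)) * ‖Complex.sin (Real.pi * ζ)‖ * (3 ^ n *
        (1 / 10) ^ n) := by gcongr
    _ = _ := by rw [← mul_pow]; norm_num

/-- In a strip whose translates by the periods of theta cover the plane, the first term of the sine
series dominates the others; so the only zeros of theta there are those of the sine. -/
lemma le_norm_theta {ζ : ℂ} (hζ : |ζ.im| ≤ Real.sqrt 3 / 4) :
    Real.exp (-(Real.pi * Real.sqrt 3 / 8)) * ‖Complex.sin (Real.pi * ζ)‖ ≤ ‖theta ζ‖ := by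
  set C := Real.exp (-(Real.pi * Real.sqrt 3 / 8)) * ‖Complex.sin (Real.pi * ζ)‖ with hC
  have hg : HasSum (fun n : ℕ => C * (3 / 10 : ℝ) ^ n) (C * (1 - 3 / 10)⁻¹) :=
    (hasSum_geometric_of_lt_one (by norm_num) (by norm_num)).mul_left C
  have hs : Summable (sineTerm ζ) := Summable.of_norm_bounded hg.summable (norm_sineTerm_le hζ)
  have hg' : HasSum (fun n : ℕ => C * (3 / 10 : ℝ) ^ (n + 1)) (C * (3 / 7)) := by
    have := hg.mul_left (3 / 10)
    have e : 3 / 10 * (C * (1 - 3 / 10)⁻¹) = C * (3 / 7) := by norm_num; ring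
    rw [e] at this
    exact this.congr_fun fun n => by ring
  have h1 : ‖∑' n, sineTerm ζ (n + 1)‖ ≤ C * (3 / 7) :=
    tsum_of_norm_bounded hg' fun n => norm_sineTerm_le hζ (n + 1)
  have h0 : ‖sineTerm ζ 0‖ = C := by
    rw [sineTerm, norm_mul, norm_mul, hC]
    simp only [pow_zero, norm_one, one_mul, Nat.cast_zero, zero_add, mul_zero, Nat.cast_one]
    congr 1
    rw [Complex.norm_exp]
    congr 1
    have : (Real.pi * Complex.I * (1 / 2) ^ 2 * om) =
        ((Real.pi * (1 / 2) ^ 2 : ℝ) : ℂ) * (Complex.I * om) := by push_cast; ring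
    rw [this, Complex.re_ofReal_mul, Complex.I_mul_re, om_im]
    ring
  rw [theta_eq_sine, hs.tsum_eq_zero_add, norm_mul, Complex.norm_two]
  have h2 : ‖sineTerm ζ 0‖ - ‖∑' n, sineTerm ζ (n + 1)‖ ≤
      ‖sineTerm ζ 0 + ∑' n, sineTerm ζ (n + 1)‖ := by
    have := norm_sub_norm_le (sineTerm ζ 0) (-∑' n, sineTerm ζ (n + 1))
    rwa [norm_neg, sub_neg_eq_add] at this
  have hC0 : 0 ≤ C := by positivity
  linarith

lemma theta_zero : theta 0 = 0 := by
  have h : ∀ n, sineTerm 0 n = 0 := fun n => by simp [sineTerm]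
  rw [theta_eq_sine]
  simp [h]

/-- The zeros of theta are the points of the lattice `ℤ ⊕ om ℤ`. -/
lemma theta_eq_zero_iff (ζ : ℂ) : theta ζ = 0 ↔ ∃ x y : ℤ, ζ = x + y * om := by
  constructor
  · intro h
    set j : ℤ := round (ζ.im / (Real.sqrt 3 / 2)) with hj
    have h3 : (0 : ℝ) < Real.sqrt 3 := by positivity
    have him : |(ζ - j * om).im| ≤ Real.sqrt 3 / 4 := by
      have h1 := abs_sub_round (ζ.im / (Real.sqrt 3 / 2))
      rw [← hj] at h1
      have h2 : (ζ - j * om).im = (ζ.im / (Real.sqrt 3 / 2) - j) * (Real.sqrt 3 / 2) := by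
        rw [sub_mul, div_mul_cancel₀ _ (by positivity)]
        simp [om_im]
      rw [h2, abs_mul, abs_of_pos (show (0 : ℝ) < Real.sqrt 3 / 2 by positivity)]
      nlinarith
    have h0 : theta (ζ - j * om) = 0 := by
      have := theta_add (ζ - j * om) j 0
      have e : ζ - j * om + (om * j - (0 : ℤ)) = ζ := by push_cast; ring
      rw [e, h, zero_mul] at this
      exact this.symm
    have h4 := le_norm_theta him
    rw [h0, norm_zero] at h4
    have h5 : Complex.sin (Real.pi * (ζ - j * om)) = 0 := by
      by_contra hne
      have := mul_pos (Real.exp_pos (-(Real.pi * Real.sqrt 3 / 8))) (norm_pos_iff.2 hne)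
      linarith
    obtain ⟨i, hi⟩ := Complex.sin_eq_zero_iff.1 h5
    refine ⟨i, j, ?_⟩
    have hpi : (Real.pi : ℂ) ≠ 0 := by exact_mod_cast Real.pi_ne_zero
    have : ζ - j * om = i := mul_left_cancel₀ hpi (by rw [hi]; ring)
    linear_combination this
  · rintro ⟨x, y, rfl⟩
    have := theta_add 0 y (-x)
    rw [theta_zero] at this
    have e : (0 : ℂ) + (om * y - (-x : ℤ)) = x + y * om := by push_cast; ring
    rw [e] at this
    exact (mul_eq_zero.1 this).resolve_right (theta_factor_ne _ _ _)

lemma deriv_theta_zero : deriv theta 0 ≠ 0 := by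
  intro h
  have h1 : HasDerivAt theta 0 0 := by
    have := (differentiable_theta 0).hasDerivAt
    rwa [h] at this
  rw [hasDerivAt_iff_isLittleO] at h1
  simp only [theta_zero, sub_zero, smul_zero] at h1
  have h2 : (fun ζ : ℂ => Complex.sin (Real.pi * ζ)) =O[nhds 0] theta := by
    refine Asymptotics.IsBigO.of_bound (Real.exp (Real.pi * Real.sqrt 3 / 8)) ?_
    have hev : ∀ᶠ ζ : ℂ in nhds 0, |ζ.im| < Real.sqrt 3 / 4 :=
      (Complex.continuous_im.abs.tendsto' 0 0 (by simp)).eventually_lt_const (by positivity)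
    filter_upwards [hev] with ζ hζ
    have := le_norm_theta hζ.le
    rw [Real.exp_neg] at this
    rwa [← inv_mul_le_iff₀ (Real.exp_pos _)]
  have h3 := h2.trans_isLittleO h1
  have h4 : HasDerivAt (fun ζ : ℂ => Complex.sin (Real.pi * ζ)) 0 0 := by
    rw [hasDerivAt_iff_isLittleO]
    simpa using h3
  have h5 : HasDerivAt (fun ζ : ℂ => Complex.sin (Real.pi * ζ)) (Real.pi : ℂ) 0 := by
    have := ((hasDerivAt_id (0 : ℂ)).const_mul (Real.pi : ℂ)).csin
    simpa using this
  have := h5.unique h4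
  exact Real.pi_ne_zero (by exact_mod_cast this)

/-- The zeros of theta are simple. -/
lemma deriv_theta_ne_zero {ζ : ℂ} (h : theta ζ = 0) : deriv theta ζ ≠ 0 := by
  obtain ⟨x, y, rfl⟩ := (theta_eq_zero_iff ζ).1 h
  intro h0
  -- differentiate the quasi-periodicity relation at the origin
  have h1 : HasDerivAt theta 0 (0 + (om * y - (-x : ℤ))) := by
    have e : (0 : ℂ) + (om * y - (-x : ℤ)) = x + y * om := by push_cast; ring
    rw [e, ← h0]
    exact (differentiable_theta _).hasDerivAt
  have hz : theta (0 + (om * y - (-x : ℤ))) = 0 := by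
    have e : (0 : ℂ) + (om * y - (-x : ℤ)) = x + y * om := by push_cast; ring
    rw [e, h]
  have h2 : HasDerivAt (fun ζ => theta (ζ + (om * y - (-x : ℤ)))) 0 0 :=
    h1.comp_add_const 0 _
  have h3 : DifferentiableAt ℂ (fun ζ : ℂ => Complex.exp (Real.pi * Complex.I * (y : ℂ) ^ 2 * om +
      2 * Real.pi * Complex.I * ζ * y) * (-1) ^ (y + -x)) 0 := by fun_prop
  have h4 := h2.mul h3.hasDerivAt
  rw [hz, zero_mul, zero_mul, add_zero] at h4
  have h5 : (fun ζ => theta (ζ + (om * y - (-x : ℤ))) *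
      (Complex.exp (Real.pi * Complex.I * (y : ℂ) ^ 2 * om +
      2 * Real.pi * Complex.I * ζ * y) * (-1) ^ (y + -x))) = theta :=
    funext fun ζ => theta_add ζ y (-x)
  have h6 : HasDerivAt theta 0 0 := by
    rw [← h5]; exact h4
  exact deriv_theta_zero h6.deriv


section

/-! ### The bilayer equation -/

lemma continuous_U : Continuous U := by
  rw [funext U_eq]
  exact (((continuous_chi _).add ((continuous_chi _).const_mul _)).add
    ((continuous_chi _).const_mul _))

lemma isTrig_U : IsTrig U := by
  rw [funext U_eq]
  exact ((isTrig_chi _).add ((isTrig_chi _).const_mul _)).add ((isTrig_chi _).const_mul _)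

lemma isTrig_U_neg : IsTrig fun z => U (-z) := by
  have : (fun z => U (-z)) = fun z => chi (1, 1) z + om * chi (-2, 1) z + om ^ 2 * chi (1, -2) z := by
    funext z
    rw [U_eq, chi_neg_arg, chi_neg_arg, chi_neg_arg]
    rfl
  rw [this]
  exact ((isTrig_chi _).add ((isTrig_chi _).const_mul _)).add ((isTrig_chi _).const_mul _)

/-- `(f, g)` is a classical solution of `(D(α) + k) (f, g) = 0` with the phases of `L²₀`. -/
structure IsFlat (α k : ℂ) (f g : ℂ → ℂ) : Prop where
  contDiff₁ : ContDiff ℝ 1 f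
  contDiff₂ : ContDiff ℝ 1 g
  phase₁ : ∀ (a₁ a₂ : ℤ) (z : ℂ), om ^ (a₁ + a₂) * f (z + lamPt a₁ a₂) = f z
  phase₂ : ∀ (a₁ a₂ : ℤ) (z : ℂ), g (z + lamPt a₁ a₂) = g z
  eq₁ : ∀ z, dz f z + α * U z * g z + k * f z = 0
  eq₂ : ∀ z, dz g z + α * U (-z) * f z + k * g z = 0

/-- The function with values in `ℂ²`, the bilayer fibre, that has the components `f`, `g`. -/
def pair (f g : ℂ → ℂ) (z : ℂ) (i : Fin 1 × Fin 2) : ℂ := if i.2 = 0 then f z else g z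

lemma potential_one_mulVec (t : ℕ → ℝ) (α k z : ℂ) (x : Fin 1 × Fin 2 → ℂ) (s : Fin 2) :
    ((potential 1 t α z + k • (1 : Matrix (Fin 1 × Fin 2) (Fin 1 × Fin 2) ℂ)) *ᵥ x) (0, s) =
      (if s = 0 then α * U z * x (0, 1) else α * U (-z) * x (0, 0)) + k * x (0, s) := by
  rw [Matrix.add_mulVec, Matrix.smul_mulVec, Matrix.one_mulVec]
  simp only [Pi.add_apply, Pi.smul_apply, smul_eq_mul, Matrix.mulVec, dotProduct, potential,
    Matrix.of_apply, Fintype.sum_prod_type, Fin.sum_univ_two, Fin.sum_univ_one, potentialBlock]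
  fin_cases s <;> simp

lemma isTrig_potential_one (t : ℕ → ℝ) (α k : ℂ) (i j : Fin 1 × Fin 2) : IsTrig fun z =>
    (potential 1 t α z + k • (1 : Matrix (Fin 1 × Fin 2) (Fin 1 × Fin 2) ℂ)) i j := by
  refine IsTrig.add ?_ (isTrig_const _)
  obtain ⟨i, s⟩ := i
  obtain ⟨j, r⟩ := j
  obtain rfl := Subsingleton.elim i 0
  obtain rfl := Subsingleton.elim j 0
  fin_cases s <;> fin_cases r <;> simp [potential, potentialBlock]
  · exact isTrig_const 0
  · exact isTrig_U.const_mul α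
  · exact isTrig_U_neg.const_mul α
  · exact isTrig_const 0

lemma isFlat_iff_classical (t : ℕ → ℝ) (α k : ℂ) (f g : ℂ → ℂ) :
    IsFlat α k f g ↔ (Dn 1 t α k).Classical (layerCharge 1) (pair f g) := by
  constructor
  · intro h
    refine ⟨?_, ?_, fun z => ?_⟩
    · rintro ⟨i, s⟩
      fin_cases s
      · exact h.contDiff₁
      · exact h.contDiff₂
    · rintro a₁ a₂ z ⟨i, s⟩
      fin_cases s
      · simpa [layerCharge, pair] using h.phase₁ a₁ a₂ z
      · simpa [layerCharge, pair] using h.phase₂ a₁ a₂ z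
    · funext i
      rw [Dn, dbar_eq_apply]
      obtain ⟨i, s⟩ := i
      obtain rfl := Subsingleton.elim i 0
      rw [potential_one_mulVec]
      fin_cases s
      · simpa [pair, add_assoc] using h.eq₁ z
      · simpa [pair, add_assoc] using h.eq₂ z
  · intro h
    have e := h.dbar_eq
    refine ⟨h.contDiff (0, 0), h.contDiff (0, 1), fun a₁ a₂ z => ?_, fun a₁ a₂ z => ?_,
      fun z => ?_, fun z => ?_⟩
    · simpa [layerCharge, pair] using h.phase a₁ a₂ z (0, 0)
    · simpa [layerCharge, pair] using h.phase a₁ a₂ z (0, 1)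
    · have := e z (0, 0)
      rw [potential_one_mulVec] at this
      simpa [pair, add_assoc] using this
    · have := e z (0, 1)
      rw [potential_one_mulVec] at this
      simpa [pair, add_assoc] using this

lemma exists_isFlat {t : ℕ → ℝ} {α k : ℂ} {v : L2 (Fin 1 × Fin 2)} (hv : v ∈ kerDn 1 t α k) :
    ∃ f g, IsFlat α k f g ∧ ∀ᵐ z : ℂ, v (toTorus z) (0, 0) = f z ∧ v (toTorus z) (0, 1) = g z := by
  obtain ⟨f, hf, hvf⟩ := exists_classical (elliptic_dbar _) (isTrig_potential_one t α k) hv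
  refine ⟨fun z => f z (0, 0), fun z => f z (0, 1), (isFlat_iff_classical t α k _ _).2 ?_, ?_⟩
  · have hp : pair (fun z => f z (0, 0)) (fun z => f z (0, 1)) = f := by
      funext z i
      obtain ⟨i, s⟩ := i
      obtain rfl := Subsingleton.elim i 0
      fin_cases s <;> rfl
    rw [hp]; exact hf
  · filter_upwards [hvf] with z hz
    rw [hz]; exact ⟨rfl, rfl⟩

lemma IsFlat.exists_mem {α k : ℂ} {f g : ℂ → ℂ} (h : IsFlat α k f g) (t : ℕ → ℝ) :
    ∃ v ∈ kerDn 1 t α k, ∀ᵐ z : ℂ, v (toTorus z) (0, 0) = f z ∧ v (toTorus z) (0, 1) = g z := by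
  obtain ⟨v, hv, hvf⟩ := ((isFlat_iff_classical t α k f g).1 h).exists_mem_kernel
  refine ⟨v, hv, ?_⟩
  filter_upwards [hvf] with z hz
  rw [hz]; exact ⟨rfl, rfl⟩

/-- A continuous function that solves the bilayer equation off a countable set is a classical
solution. -/
lemma isFlat_of_countable {α k : ℂ} {f g : ℂ → ℂ} (hf : Continuous f) (hg : Continuous g)
    (h₁ : ∀ (a₁ a₂ : ℤ) (z : ℂ), om ^ (a₁ + a₂) * f (z + lamPt a₁ a₂) = f z)
    (h₂ : ∀ (a₁ a₂ : ℤ) (z : ℂ), g (z + lamPt a₁ a₂) = g z) {s : Set ℂ} (hs : s.Countable)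
    (hdf : ∀ z ∉ s, DifferentiableAt ℝ f z) (hdg : ∀ z ∉ s, DifferentiableAt ℝ g z)
    (e₁ : ∀ z ∉ s, dz f z + α * U z * g z + k * f z = 0)
    (e₂ : ∀ z ∉ s, dz g z + α * U (-z) * f z + k * g z = 0) : IsFlat α k f g := by
  refine (isFlat_iff_classical (fun _ => 0) α k f g).2
    (classical_of_countable (isTrig_potential_one _ α k) ?_ ?_ hs ?_ ?_)
  · rintro ⟨i, r⟩
    fin_cases r
    · exact hf
    · exact hg
  · rintro a₁ a₂ z ⟨i, r⟩
    fin_cases r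
    · simpa [layerCharge, pair] using h₁ a₁ a₂ z
    · simpa [layerCharge, pair] using h₂ a₁ a₂ z
  · rintro z hz ⟨i, r⟩
    fin_cases r
    · exact hdf z hz
    · exact hdg z hz
  · rintro z hz ⟨i, r⟩
    obtain rfl := Subsingleton.elim i 0
    rw [potential_one_mulVec]
    fin_cases r
    · simpa [pair, add_assoc] using e₁ z hz
    · simpa [pair, add_assoc] using e₂ z hz

namespace IsFlat

variable {α k : ℂ} {f g : ℂ → ℂ}

lemma differentiable₁ (h : IsFlat α k f g) : Differentiable ℝ f := h.contDiff₁.differentiable (by simp)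

lemma differentiable₂ (h : IsFlat α k f g) : Differentiable ℝ g := h.contDiff₂.differentiable (by simp)

/-- The set of zeros of a solution is periodic. -/
lemma zero_add (h : IsFlat α k f g) {z : ℂ} (h₁ : f z = 0) (h₂ : g z = 0) (a₁ a₂ : ℤ) :
    f (z + lamPt a₁ a₂) = 0 ∧ g (z + lamPt a₁ a₂) = 0 := by
  refine ⟨?_, by rw [h.phase₂, h₂]⟩
  have := h.phase₁ a₁ a₂ z
  rw [h₁] at this
  exact (mul_eq_zero.1 this).resolve_left (zpow_ne_zero _ om_ne)

end IsFlat

/-! ### The adjoint equation and the multiplicity of the bilayer kernel -/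

/-- The charges of the two halves of the chiral Hamiltonian. -/
abbrev hamCharge : (Fin 1 × Fin 2) ⊕ (Fin 1 × Fin 2) → ℤ :=
  Sum.elim (layerCharge 1) (layerCharge 1)

/-- The kernel of the chiral Hamiltonian of the bilayer. -/
noncomputable abbrev hamKernel (α k : ℂ) : Submodule ℂ (L2 ((Fin 1 × Fin 2) ⊕ (Fin 1 × Fin 2))) :=
  (Dn 1 (fun _ => 0) α k).hamiltonian.kernel hamCharge

lemma isTrig_conj {f : ℂ → ℂ} (hf : IsTrig f) : IsTrig fun z => conj (f z) := by
  refine Submodule.span_induction (p := fun f _ => IsTrig fun z => conj (f z)) ?_ ?_ ?_ ?_ hf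
  · rintro _ ⟨m, rfl⟩
    simp only [conj_chi]; exact isTrig_chi _
  · simpa using isTrig_const 0
  · intro f g _ _ h1 h2
    simpa using h1.add h2
  · intro c f _ h
    simpa using h.const_mul (conj c)

lemma isTrig_hamiltonian (α k : ℂ) (i j : (Fin 1 × Fin 2) ⊕ (Fin 1 × Fin 2)) :
    IsTrig fun z => (Dn 1 (fun _ => 0) α k).hamiltonian.b z i j := by
  rcases i with i | i <;> rcases j with j | j
  · exact isTrig_const 0
  · exact isTrig_conj (isTrig_potential_one (fun _ => 0) α k j i)
  · exact isTrig_potential_one (fun _ => 0) α k i j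
  · exact isTrig_const 0

lemma fderiv_conj_apply {f : ℂ → ℂ} (z e : ℂ) :
    fderiv ℝ (fun z => conj (f z)) z e = conj (fderiv ℝ f z e) := by
  have h := (Complex.conjCLE : ℂ ≃L[ℝ] ℂ).comp_fderiv (f := f) (x := z)
  exact DFunLike.congr_fun h e

lemma dz_conj {f : ℂ → ℂ} (z : ℂ) :
    dz (fun z => conj (f z)) z = conj (Complex.I * fderiv ℝ f z 1 + fderiv ℝ f z Complex.I) := by
  rw [dz, fderiv_conj_apply, fderiv_conj_apply]
  simp

/-- The four components of `H_k(α) v = 0`. The solutions of the adjoint equation are written as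
`conj` of a function. -/
lemma hamiltonian_classical_iff (α k : ℂ) (f : ℂ → (Fin 1 × Fin 2) ⊕ (Fin 1 × Fin 2) → ℂ) :
    (Dn 1 (fun _ => 0) α k).hamiltonian.Classical hamCharge f ↔
      (Dn 1 (fun _ => 0) α k).Classical (layerCharge 1) (fun z i => f z (Sum.inl i)) ∧
      (Dn 1 (fun _ => 0) α k).adjoint.Classical (layerCharge 1) (fun z i => f z (Sum.inr i)) := by
  have key : ∀ z, ((Dn 1 (fun _ => 0) α k).hamiltonian.a₁ *ᵥ
        (fun i => fderiv ℝ (fun w => f w i) z 1) +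
      (Dn 1 (fun _ => 0) α k).hamiltonian.a₂ *ᵥ (fun i => fderiv ℝ (fun w => f w i) z Complex.I) +
      (Dn 1 (fun _ => 0) α k).hamiltonian.b z *ᵥ f z) = Sum.elim
      ((Dn 1 (fun _ => 0) α k).adjoint.a₁ *ᵥ
        (fun i => fderiv ℝ (fun w => f w (Sum.inr i)) z 1) +
      (Dn 1 (fun _ => 0) α k).adjoint.a₂ *ᵥ
        (fun i => fderiv ℝ (fun w => f w (Sum.inr i)) z Complex.I) +
      (Dn 1 (fun _ => 0) α k).adjoint.b z *ᵥ fun i => f z (Sum.inr i))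
      ((Dn 1 (fun _ => 0) α k).a₁ *ᵥ
        (fun i => fderiv ℝ (fun w => f w (Sum.inl i)) z 1) +
      (Dn 1 (fun _ => 0) α k).a₂ *ᵥ
        (fun i => fderiv ℝ (fun w => f w (Sum.inl i)) z Complex.I) +
      (Dn 1 (fun _ => 0) α k).b z *ᵥ fun i => f z (Sum.inl i)) := by
    intro z
    simp only [System.hamiltonian, Matrix.fromBlocks_mulVec]
    funext i
    rcases i with i | i <;> simp [Function.comp_def]
  constructor
  · intro h
    refine ⟨⟨fun i => h.contDiff _, fun a₁ a₂ z i => h.phase a₁ a₂ z (Sum.inl i), fun z => ?_⟩,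
      ⟨fun i => h.contDiff _, fun a₁ a₂ z i => h.phase a₁ a₂ z (Sum.inr i), fun z => ?_⟩⟩
    · have e := h.eq z
      rw [key] at e
      funext i
      exact congrFun e (Sum.inr i)
    · have e := h.eq z
      rw [key] at e
      funext i
      exact congrFun e (Sum.inl i)
  · rintro ⟨h1, h2⟩
    refine ⟨?_, ?_, fun z => ?_⟩
    · rintro (i | i)
      · exact h1.contDiff i
      · exact h2.contDiff i
    · rintro a₁ a₂ z (i | i)
      · exact h1.phase a₁ a₂ z i
      · exact h2.phase a₁ a₂ z i
    · rw [key, h1.eq, h2.eq]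
      funext i
      rcases i with i | i <;> rfl

/-- The frequency that exchanges the phases of the two components. -/
abbrev adjFreq : ℤ × ℤ := (-1, -1)

lemma adjoint_eq_apply (α k : ℂ) (w : ℂ → Fin 1 × Fin 2 → ℂ) (z : ℂ) (s : Fin 2) :
    ((Dn 1 (fun _ => 0) α k).adjoint.a₁ *ᵥ (fun i => fderiv ℝ (fun z => w z i) z 1) +
      (Dn 1 (fun _ => 0) α k).adjoint.a₂ *ᵥ (fun i => fderiv ℝ (fun z => w z i) z Complex.I) +
      (Dn 1 (fun _ => 0) α k).adjoint.b z *ᵥ w z) (0, s) =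
    -conj (dz (fun z => conj (w z (0, s))) z) + conj k * w z (0, s) +
      if s = 0 then conj (α * U (-z)) * w z (0, 1) else conj (α * U z) * w z (0, 0) := by
  rw [dz_conj, Complex.conj_conj]
  have e : ((Dn 1 (fun _ => 0) α k).adjoint.b z *ᵥ w z) (0, s) = conj k * w z (0, s) +
      if s = 0 then conj (α * U (-z)) * w z (0, 1) else conj (α * U z) * w z (0, 0) := by
    simp only [System.adjoint, Dn, System.dbar, Matrix.mulVec, dotProduct, potential,
      Matrix.conjTranspose_apply, Matrix.add_apply, Matrix.smul_apply,
      Matrix.of_apply, Fintype.sum_prod_type, Fin.sum_univ_two, Fin.sum_univ_one, potentialBlock]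
    fin_cases s <;> simp [Matrix.one_apply]
    ring
  rw [Pi.add_apply, Pi.add_apply, e]
  simp only [System.adjoint, Dn, System.dbar, Matrix.conjTranspose_smul, Matrix.conjTranspose_one,
    Matrix.neg_mulVec, Matrix.smul_mulVec, Matrix.one_mulVec, Pi.neg_apply, Pi.smul_apply,
    smul_eq_mul]
  simp
  ring

lemma chi_adjFreq_add (z : ℂ) (a₁ a₂ : ℤ) :
    om ^ (a₁ + a₂) * chi adjFreq (z + lamPt a₁ a₂) = chi adjFreq z := by
  rw [chi_add_lamPt, ← mul_assoc, ← zpow_add₀ om_ne,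
    show a₁ + a₂ + (a₁ * adjFreq.1 + a₂ * adjFreq.2) = 0 by simp; ring, zpow_zero,
    one_mul]

lemma conj_om_zpow_mul (j : ℤ) : conj (om ^ j) * om ^ j = 1 := by
  rw [map_zpow₀, ← mul_zpow, mul_comm, om_mul_conj, one_zpow]

/-- Complex conjugation turns the adjoint equation into the bilayer equation at another
quasi-momentum. -/
lemma isFlat_of_adjoint {α k : ℂ} {w : ℂ → Fin 1 × Fin 2 → ℂ}
    (h : (Dn 1 (fun _ => 0) α k).adjoint.Classical (layerCharge 1) w) :
    IsFlat α (-k - pt adjFreq) (fun z => chi adjFreq z * conj (w z (0, 1)))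
      fun z => -chi adjFreq z * conj (w z (0, 0)) := by
  have hc : ∀ i, ContDiff ℝ 1 fun z => conj (w z i) := fun i =>
    Complex.conjCLE.contDiff.comp (h.contDiff i)
  have hχ : ContDiff ℝ 1 (chi adjFreq) := (contDiff_chi _).of_le (by simp)
  have hd : ∀ i, Differentiable ℝ fun z => conj (w z i) := fun i =>
    (hc i).differentiable (by simp)
  have e : ∀ z s, -dz (fun z => conj (w z (0, s))) z + k * conj (w z (0, s)) +
      (if s = 0 then α * U (-z) * conj (w z (0, 1)) else α * U z * conj (w z (0, 0))) = 0 := by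
    intro z s
    have := congrArg conj ((adjoint_eq_apply α k w z s).symm.trans (congrFun (h.eq z) (0, s)))
    fin_cases s <;> simpa using this
  have hn : ∀ z, dz (fun z => -chi adjFreq z) z = -(pt adjFreq * chi adjFreq z) := fun z => by
    rw [dz_neg, dz_chi]
  refine ⟨hχ.mul (hc _), hχ.neg.mul (hc _), fun a₁ a₂ z => ?_, fun a₁ a₂ z => ?_, fun z => ?_,
    fun z => ?_⟩
  · have h2 := h.phase a₁ a₂ z (0, 1)
    simp [layerCharge] at h2
    rw [← mul_assoc, chi_adjFreq_add, h2]
  · have h1 := congrArg conj (h.phase a₁ a₂ z (0, 0))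
    simp only [layerCharge, if_true, one_mul, map_mul] at h1
    linear_combination (-chi adjFreq z) * h1 -
      conj (w (z + lamPt a₁ a₂) (0, 0)) * conj (om ^ (a₁ + a₂)) * chi_adjFreq_add z a₁ a₂ +
      chi adjFreq (z + lamPt a₁ a₂) * conj (w (z + lamPt a₁ a₂) (0, 0)) *
        conj_om_zpow_mul (a₁ + a₂)
  · rw [dz_mul (differentiable_chi _ z) (hd _ z), dz_chi]
    have := e z 1
    simp at this
    linear_combination -chi adjFreq z * this
  · rw [dz_mul (f := fun z => -chi adjFreq z) (differentiable_chi _ z).neg (hd _ z), hn]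
    have := e z 0
    simp at this
    linear_combination chi adjFreq z * this

/-- The antilinear symmetry `(f, g) ↦ (-conj g, conj f)`, up to a character that restores the phases of
`L²₀`, maps solutions at `-k - pt adjFreq` to solutions of the adjoint equation at `k`. -/
lemma IsFlat.adjoint {α k : ℂ} {f g : ℂ → ℂ} (h : IsFlat α (-k - pt adjFreq) f g) :
    (Dn 1 (fun _ => 0) α k).adjoint.Classical (layerCharge 1)
      (pair (fun z => -conj (chi (-adjFreq) z * g z)) fun z => conj (chi (-adjFreq) z * f z)) := by
  have hχ : ContDiff ℝ 1 (chi (-adjFreq)) := (contDiff_chi _).of_le (by simp)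
  have hph : ∀ z a₁ a₂, chi (-adjFreq) (z + lamPt a₁ a₂) = om ^ (a₁ + a₂) * chi (-adjFreq) z := by
    intro z a₁ a₂
    rw [chi_add_lamPt]
    congr 2
    simp [adjFreq]
  refine ⟨?_, ?_, fun z => ?_⟩
  · rintro ⟨i, s⟩
    fin_cases s
    · exact (Complex.conjCLE.contDiff.comp (hχ.mul h.contDiff₂)).neg
    · exact Complex.conjCLE.contDiff.comp (hχ.mul h.contDiff₁)
  · rintro a₁ a₂ z ⟨i, s⟩
    fin_cases s
    · simp only [layerCharge, pair, Fin.zero_eta, if_true, one_mul, h.phase₂, hph, map_mul]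
      linear_combination -conj (chi (-adjFreq) z) * conj (g z) * conj_om_zpow_mul (a₁ + a₂)
    · simp only [layerCharge, pair, Fin.mk_one, one_ne_zero, if_false, zero_mul, zpow_zero, one_mul,
        hph]
      congr 1
      linear_combination chi (-adjFreq) z * h.phase₁ a₁ a₂ z
  · funext i
    obtain ⟨i, s⟩ := i
    obtain rfl := Subsingleton.elim i 0
    refine (adjoint_eq_apply _ _ _ _ _).trans ?_
    have e1 : ∀ z, dz (fun z => chi (-adjFreq) z * f z) z =
        -pt adjFreq * chi (-adjFreq) z * f z + chi (-adjFreq) z * dz f z := fun z => by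
      rw [dz_mul (differentiable_chi _ z) (h.differentiable₁ z), dz_chi, pt_neg]
    have e2 : ∀ z, dz (fun z => -(chi (-adjFreq) z * g z)) z =
        -(-pt adjFreq * chi (-adjFreq) z * g z + chi (-adjFreq) z * dz g z) := fun z => by
      rw [dz_neg, dz_mul (differentiable_chi _ z) (h.differentiable₂ z), dz_chi, pt_neg]
    refine (map_eq_zero (starRingEnd ℂ)).1 ?_
    fin_cases s
    · simp only [pair, Fin.zero_eta, if_true, map_neg, Complex.conj_conj, e2, one_ne_zero, if_false]
      simp only [map_add, map_neg, map_mul, Complex.conj_conj]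
      linear_combination chi (-adjFreq) z * h.eq₂ z
    · simp only [pair, Fin.mk_one, if_true, Complex.conj_conj, e1, one_ne_zero, if_false]
      simp only [map_add, map_neg, map_mul, Complex.conj_conj]
      linear_combination -chi (-adjFreq) z * h.eq₁ z

end


section

/-! ### Multiplication by quotients of theta functions -/

/-- The exponential factor of `F_k`. -/
noncomputable def expF (k z : ℂ) : ℂ :=
  Complex.exp (2 * Real.pi * (z / cLam - conj (z / cLam)) * (k / cDual) / (Real.sqrt 3 : ℂ))

lemma expF_ne (k z : ℂ) : expF k z ≠ 0 := Complex.exp_ne_zero _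

/-- The numerator of `F_k`. -/
noncomputable def numF (k z : ℂ) : ℂ := expF k z * theta (z / cLam + k / cDual)

lemma F_eq (k z : ℂ) : F k z = numF k z / theta (z / cLam) := rfl

lemma sqrt3_ne : (Real.sqrt 3 : ℂ) ≠ 0 := by
  rw [Complex.ofReal_ne_zero]; positivity

lemma om_sub_conj : om - conj om = Real.sqrt 3 * Complex.I := by
  rw [conj_om, sqrt3_I]; ring

lemma lamPt_div (a₁ a₂ : ℤ) : lamPt a₁ a₂ / cLam = a₁ + a₂ * om := by
  rw [lamPt, mul_div_cancel_left₀ _ cLam_ne]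

lemma expF_add (k z : ℂ) (a₁ a₂ : ℤ) :
    expF k (z + lamPt a₁ a₂) = expF k z * Complex.exp (2 * Real.pi * Complex.I * (k / cDual) * a₂) := by
  rw [expF, expF, ← Complex.exp_add, add_div, lamPt_div]
  congr 1
  simp only [map_add, map_mul, map_intCast]
  have h := om_sub_conj
  have h3 := sqrt3_ne
  have e : z / cLam + (a₁ + a₂ * om) - (conj (z / cLam) + (a₁ + a₂ * conj om)) =
      z / cLam - conj (z / cLam) + a₂ * (Real.sqrt 3 * Complex.I) := by
    linear_combination (a₂ : ℂ) * h
  rw [e]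
  field_simp

lemma theta_add_lamPt (ζ : ℂ) (a₁ a₂ : ℤ) : theta (ζ + (a₁ + a₂ * om)) *
    (Complex.exp (Real.pi * Complex.I * a₂ ^ 2 * om + 2 * Real.pi * Complex.I * ζ * a₂) *
      (-1) ^ (a₂ - a₁)) = theta ζ := by
  have h := theta_add ζ a₂ (-a₁)
  push_cast at h
  rw [← h]
  congr 2
  ring_nf

/-- `F_k` is `Λ`-periodic. -/
lemma F_add (k z : ℂ) (a₁ a₂ : ℤ) : F k (z + lamPt a₁ a₂) = F k z := by
  rw [F_eq, F_eq, numF, numF, expF_add, add_div, lamPt_div]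
  have h1 := theta_add_lamPt (z / cLam + k / cDual) a₁ a₂
  have h2 := theta_add_lamPt (z / cLam) a₁ a₂
  rw [← h1, ← h2]
  have e : Complex.exp (Real.pi * Complex.I * a₂ ^ 2 * om +
      2 * Real.pi * Complex.I * (z / cLam + k / cDual) * a₂) =
      Complex.exp (Real.pi * Complex.I * a₂ ^ 2 * om + 2 * Real.pi * Complex.I * (z / cLam) * a₂) *
      Complex.exp (2 * Real.pi * Complex.I * (k / cDual) * a₂) := by
    rw [← Complex.exp_add]; congr 1; ring
  rw [e, show z / cLam + (a₁ + a₂ * om) + k / cDual = z / cLam + k / cDual + (a₁ + a₂ * om) by ring]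
  have hn : (-1 : ℂ) ^ (a₂ - a₁) ≠ 0 := zpow_ne_zero _ (by norm_num)
  have hE := Complex.exp_ne_zero (Real.pi * Complex.I * a₂ ^ 2 * om +
    2 * Real.pi * Complex.I * (z / cLam) * a₂)
  rw [← mul_div_mul_right _ (theta (z / cLam + (a₁ + a₂ * om))) (mul_ne_zero hE hn)]
  ring

lemma conj_cLam : conj cLam = -(4 / 3 * Real.pi * Complex.I) * om ^ 2 := by
  simp only [cLam, map_mul, map_div₀, map_ofNat, Complex.conj_ofReal, Complex.conj_I, conj_om,
    om_sq]
  ring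

lemma expF_eq_exp (k z : ℂ) : expF k z = Complex.exp
    ((2 * Real.pi * (k / cDual) / Real.sqrt 3 / cLam) * z -
      (2 * Real.pi * (k / cDual) / Real.sqrt 3 / conj cLam) * conj z) := by
  rw [expF, map_div₀]; congr 1; ring

lemma contDiff_expF (k : ℂ) : ContDiff ℝ ∞ (expF k) := by
  rw [funext (expF_eq_exp k)]
  exact ((contDiff_const.mul contDiff_id).sub
    (contDiff_const.mul Complex.conjCLE.contDiff)).cexp

lemma dz_expF (k z : ℂ) : dz (expF k) z = -k * expF k z := by
  set a := 2 * Real.pi * (k / cDual) / Real.sqrt 3 / cLam with ha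
  set b := 2 * Real.pi * (k / cDual) / Real.sqrt 3 / conj cLam with hb
  have h : HasFDerivAt (expF k) (expF k z • (a • ContinuousLinearMap.id ℝ ℂ -
      b • (Complex.conjCLE : ℂ →L[ℝ] ℂ))) z := by
    rw [funext (expF_eq_exp k)]
    exact (((hasFDerivAt_id z).const_mul a).sub
      ((Complex.conjCLE : ℂ →L[ℝ] ℂ).hasFDerivAt.const_mul b)).cexp
  rw [dz, h.fderiv]
  simp
  have hb' : b * (2 * Complex.I) = -k := by
    rw [hb, conj_cLam, cDual]
    have h3 := sqrt3_ne
    have ho := om_ne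
    have hpi : (Real.pi : ℂ) ≠ 0 := by exact_mod_cast Real.pi_ne_zero
    have hs : (Real.sqrt 3 : ℂ) ^ 2 = 3 := by
      rw [← Complex.ofReal_pow, Real.sq_sqrt (by norm_num)]; norm_num
    field_simp
    rw [hs, om_cube]
    ring
  linear_combination expF k z * hb'

lemma continuous_numF : Continuous fun p : ℂ × ℂ => numF p.1 p.2 := by
  refine Continuous.mul ?_ (continuous_theta.comp ?_)
  · unfold expF
    fun_prop
  · fun_prop

lemma differentiable_numF (k : ℂ) : Differentiable ℝ (numF k) := by
  refine ((contDiff_expF k).differentiable (by simp)).mul ?_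
  have : Differentiable ℂ fun z => theta (z / cLam + k / cDual) :=
    differentiable_theta.comp (by fun_prop)
  exact this.restrictScalars ℝ

lemma dz_numF (k z : ℂ) : dz (numF k) z = -k * numF k z := by
  have h : DifferentiableAt ℂ (fun z => theta (z / cLam + k / cDual)) z :=
    (differentiable_theta _).comp z (by fun_prop)
  have := dz_mul (((contDiff_expF k).differentiable (by simp)) z) (h.restrictScalars ℝ)
  rw [dz_expF, dz_of_differentiableAt h] at this
  change dz (fun z => expF k z * theta (z / cLam + k / cDual)) z = _
  rw [this, numF]
  ring

lemma theta_div_eq_zero_iff (z : ℂ) : theta (z / cLam) = 0 ↔ ∃ a₁ a₂ : ℤ, z = lamPt a₁ a₂ := by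
  rw [theta_eq_zero_iff]
  simp only [lamPt, div_eq_iff cLam_ne, mul_comm cLam]

lemma numF_eq_zero_iff (k z : ℂ) :
    numF k z = 0 ↔ ∃ a₁ a₂ : ℤ, z + k / cDual * cLam = lamPt a₁ a₂ := by
  rw [numF, mul_eq_zero, or_iff_right (expF_ne k z), ← theta_div_eq_zero_iff, add_div,
    mul_div_cancel_right₀ _ cLam_ne]

lemma countable_range_lamPt (s : ℂ) : {z : ℂ | ∃ a₁ a₂ : ℤ, z + s = lamPt a₁ a₂}.Countable := by
  have : {z : ℂ | ∃ a₁ a₂ : ℤ, z + s = lamPt a₁ a₂} =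
      Set.range fun q : ℤ × ℤ => lamPt q.1 q.2 - s := by
    ext z
    simp only [Set.mem_ofPred_eq, Set.mem_range, Prod.exists]
    constructor <;> rintro ⟨a, b, h⟩ <;> exact ⟨a, b, by linear_combination -h⟩
  rw [this]
  exact Set.countable_range _

/-- The denominator of `F_k(z + s)`. -/
noncomputable def den (s z : ℂ) : ℂ := theta ((z + s) / cLam)

lemma differentiable_den (s : ℂ) : Differentiable ℂ (den s) :=
  differentiable_theta.comp (by fun_prop)

lemma den_eq_zero_iff (s z : ℂ) : den s z = 0 ↔ ∃ a₁ a₂ : ℤ, z + s = lamPt a₁ a₂ :=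
  theta_div_eq_zero_iff _

lemma countable_den_zeros (s : ℂ) : {z | den s z = 0}.Countable := by
  simp only [den_eq_zero_iff]
  exact countable_range_lamPt s

lemma deriv_den_ne_zero {s z : ℂ} (h : den s z = 0) : deriv (den s) z ≠ 0 := by
  have h1 : HasDerivAt (fun z : ℂ => (z + s) / cLam) (1 / cLam) z :=
    ((hasDerivAt_id z).add_const s).div_const cLam
  have h2 : HasDerivAt (den s) (deriv theta ((z + s) / cLam) * (1 / cLam)) z :=
    (differentiable_theta _).hasDerivAt.comp z h1
  rw [h2.deriv]
  exact mul_ne_zero (deriv_theta_ne_zero h) (one_div_ne_zero cLam_ne)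

/-- The quotient `f(z) / θ((z + s)/cLam)`, extended by de l'Hôpital's rule to the zeros of the
denominator. -/
noncomputable def quot (s : ℂ) (f : ℂ → ℂ) (z : ℂ) : ℂ :=
  if den s z = 0 then deriv f z / deriv (den s) z else f z / den s z

lemma continuous_quot {s : ℂ} {f : ℂ → ℂ} (hf : Continuous f)
    (hz : ∀ z, den s z = 0 → f z = 0) (hd : ∀ z, den s z = 0 → DifferentiableAt ℂ f z) :
    Continuous (quot s f) := by
  rw [continuous_iff_continuousAt]
  intro z
  by_cases h : den s z = 0
  · have c1 : ContinuousAt (dslope f z) z := continuousAt_dslope_same.2 (hd z h)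
    have c2 : ContinuousAt (dslope (den s) z) z :=
      continuousAt_dslope_same.2 (differentiable_den s z)
    have hne : dslope (den s) z z ≠ 0 := by
      rw [dslope_same]; exact deriv_den_ne_zero h
    refine (c1.div c2 hne).congr ?_
    filter_upwards [c2.eventually_ne hne] with w hw
    by_cases hwz : w = z
    · rw [hwz, Pi.div_apply, dslope_same, dslope_same, quot, if_pos h]
    · have e1 := sub_smul_dslope f z w
      have e2 := sub_smul_dslope (den s) z w
      rw [hz z h, sub_zero, smul_eq_mul] at e1
      rw [h, sub_zero, smul_eq_mul] at e2
      have h0 : w - z ≠ 0 := sub_ne_zero.2 hwz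
      rw [quot, if_neg (by rw [← e2]; exact mul_ne_zero h0 hw), ← e1, ← e2, Pi.div_apply,
        mul_div_mul_left _ _ h0]
  · refine (hf.continuousAt.div (differentiable_den s z).continuousAt h).congr ?_
    filter_upwards [(differentiable_den s z).continuousAt.eventually_ne h] with w hw
    rw [quot, if_neg hw]; rfl

/-- The function `F_l(z + s) f(z)`, extended to the zeros of the denominator of `F_l`. -/
noncomputable def twist (l s : ℂ) (f : ℂ → ℂ) (z : ℂ) : ℂ := numF l (z + s) * quot s f z

lemma twist_eq {l s z : ℂ} {f : ℂ → ℂ} (h : den s z ≠ 0) : twist l s f z = F l (z + s) * f z := by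
  rw [twist, quot, if_neg h, F_eq, den]; ring

lemma twist_eq_zero_of_eq_zero {l s z : ℂ} {f : ℂ → ℂ} (h : den s z ≠ 0) (hf : f z = 0) :
    twist l s f z = 0 := by
  rw [twist_eq h, hf, mul_zero]

/-- Two continuous functions that agree off a countable set agree. -/
lemma eq_of_countable {f g : ℂ → ℂ} (hf : Continuous f) (hg : Continuous g) {s : Set ℂ}
    (hs : s.Countable) (h : ∀ z ∉ s, f z = g z) (z : ℂ) : f z = g z := by
  refine eq_of_ae_eq_continuous hf hg ?_ z
  filter_upwards [hs.ae_notMem volume] with z hz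
  exact h z hz

lemma eq_zero_of_twist {l s : ℂ} {f : ℂ → ℂ} (hf : Continuous f) (h : ∀ z, twist l s f z = 0)
    (z : ℂ) : f z = 0 := by
  refine eq_of_countable hf continuous_const (g := fun _ => 0)
    ((countable_den_zeros s).union (countable_range_lamPt (s + l / cDual * cLam))) ?_ z
  intro z hz
  rw [Set.mem_union, not_or] at hz
  have h1 : den s z ≠ 0 := hz.1
  have h2 := h z
  rw [twist_eq h1, F_eq, mul_eq_zero, div_eq_zero_iff] at h2
  refine h2.resolve_left ?_
  rintro (h3 | h3)
  · rw [numF_eq_zero_iff, add_assoc] at h3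
    exact hz.2 h3
  · exact h1 h3

namespace IsFlat

variable {α k : ℂ} {f g f' g' : ℂ → ℂ}

lemma den_zero (h : IsFlat α k f g) {s : ℂ} (h₁ : f (-s) = 0) (h₂ : g (-s) = 0) {z : ℂ}
    (hz : den s z = 0) : f z = 0 ∧ g z = 0 := by
  obtain ⟨a₁, a₂, e⟩ := (den_eq_zero_iff s z).1 hz
  rw [eq_sub_of_add_eq e, sub_eq_neg_add]
  exact h.zero_add h₁ h₂ a₁ a₂

lemma differentiableAt_of_zero (h : IsFlat α k f g) {z : ℂ} (h₁ : f z = 0) (h₂ : g z = 0) :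
    DifferentiableAt ℂ f z ∧ DifferentiableAt ℂ g z := by
  constructor
  · refine differentiableAt_of_dz (h.differentiable₁ z) ?_
    have := h.eq₁ z
    rw [h₁, h₂] at this
    simpa using this
  · refine differentiableAt_of_dz (h.differentiable₂ z) ?_
    have := h.eq₂ z
    rw [h₁, h₂] at this
    simpa using this

lemma continuous_quot (h : IsFlat α k f g) {s : ℂ} (h₁ : f (-s) = 0) (h₂ : g (-s) = 0) :
    Continuous (quot s f) ∧ Continuous (quot s g) :=
  ⟨TMG.continuous_quot h.contDiff₁.continuous (fun _ hz => (h.den_zero h₁ h₂ hz).1) fun _ hz =>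
      (h.differentiableAt_of_zero (h.den_zero h₁ h₂ hz).1 (h.den_zero h₁ h₂ hz).2).1,
    TMG.continuous_quot h.contDiff₂.continuous (fun _ hz => (h.den_zero h₁ h₂ hz).2) fun _ hz =>
      (h.differentiableAt_of_zero (h.den_zero h₁ h₂ hz).1 (h.den_zero h₁ h₂ hz).2).2⟩

/-- A solution with a zero can be multiplied by `F_l`, with the pole at that zero: this changes the
quasi-momentum by `l`. -/
lemma twist (h : IsFlat α k f g) {s : ℂ} (h₁ : f (-s) = 0) (h₂ : g (-s) = 0) (l : ℂ) :
    IsFlat α (k + l) (twist l s f) (twist l s g) := by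
  obtain ⟨q₁, q₂⟩ := h.continuous_quot h₁ h₂
  have hn : Continuous fun z => numF l (z + s) :=
    (differentiable_numF l).continuous.comp (continuous_add_const s)
  have c₁ : Continuous (TMG.twist l s f) := hn.mul q₁
  have c₂ : Continuous (TMG.twist l s g) := hn.mul q₂
  have hper : ∀ (a₁ a₂ : ℤ) z, z ∉ {z | den s z = 0} → z + lamPt a₁ a₂ ∉ {z | den s z = 0} := by
    intro a₁ a₂ z hz hz'
    refine hz ((den_eq_zero_iff s z).2 ?_)
    obtain ⟨b₁, b₂, e⟩ := (den_eq_zero_iff _ _).1 hz'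
    refine ⟨b₁ - a₁, b₂ - a₂, ?_⟩
    rw [show z + s = lamPt b₁ b₂ - lamPt a₁ a₂ by rw [← e]; ring, lamPt, lamPt, lamPt]
    push_cast; ring
  have hF : ∀ (a₁ a₂ : ℤ) z, F l (z + lamPt a₁ a₂ + s) = F l (z + s) := fun a₁ a₂ z => by
    rw [show z + lamPt a₁ a₂ + s = z + s + lamPt a₁ a₂ by ring, F_add]
  have hloc : ∀ (f : ℂ → ℂ) z, z ∉ {z | den s z = 0} →
      TMG.twist l s f =ᶠ[nhds z] fun z => numF l (z + s) * ((den s z)⁻¹ * f z) := by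
    intro f z hz
    filter_upwards [(differentiable_den s z).continuousAt.eventually_ne hz] with w hw
    rw [TMG.twist, quot, if_neg hw]; ring
  have hnd : Differentiable ℝ fun z => numF l (z + s) :=
    (differentiable_numF l).comp (differentiable_id.add_const s)
  have hndz : ∀ z, dz (fun z => numF l (z + s)) z = -l * numF l (z + s) := fun z => by
    rw [← dz_numF, dz, dz, fderiv_comp_add_right]
  have hi : ∀ z, z ∉ {z | den s z = 0} → DifferentiableAt ℂ (fun z => (den s z)⁻¹) z :=
    fun z hz => (differentiable_den s z).inv hz
  -- `F_l` is annihilated by `2 D_{z̄} + l` off its poles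
  have hdz : ∀ f : ℂ → ℂ, Differentiable ℝ f → ∀ z, z ∉ {z | den s z = 0} →
      DifferentiableAt ℝ (TMG.twist l s f) z ∧ dz (TMG.twist l s f) z =
        numF l (z + s) * (den s z)⁻¹ * (dz f z - l * f z) := by
    intro f hf z hz
    have d1 : DifferentiableAt ℝ (fun z => (den s z)⁻¹) z := (hi z hz).restrictScalars ℝ
    have d2 : DifferentiableAt ℝ (fun z => (den s z)⁻¹ * f z) z := d1.mul (hf z)
    have d3 : DifferentiableAt ℝ (fun z => numF l (z + s) * ((den s z)⁻¹ * f z)) z :=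
      (hnd z).mul d2
    refine ⟨d3.congr_of_eventuallyEq (hloc f z hz), ?_⟩
    rw [dz_congr (hloc f z hz), dz_mul (hnd z) d2, dz_mul d1 (hf z), hndz,
      dz_of_differentiableAt (hi z hz)]
    ring
  have hval : ∀ (f : ℂ → ℂ) z, z ∉ {z | den s z = 0} →
      TMG.twist l s f z = numF l (z + s) * (den s z)⁻¹ * f z := by
    intro f z hz
    rw [(hloc f z hz).self_of_nhds]; ring
  refine isFlat_of_countable c₁ c₂ (fun a₁ a₂ => ?_) (fun a₁ a₂ => ?_) (countable_den_zeros s)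
    (fun z hz => (hdz f h.differentiable₁ z hz).1) (fun z hz => (hdz g h.differentiable₂ z hz).1)
    (fun z hz => ?_) (fun z hz => ?_)
  · refine eq_of_countable (continuous_const.mul (c₁.comp (continuous_add_const _))) c₁
      (countable_den_zeros s) fun z hz => ?_
    rw [twist_eq hz]
    rw [twist_eq (hper a₁ a₂ z hz), hF, mul_left_comm, h.phase₁]
  · refine eq_of_countable (c₂.comp (continuous_add_const _)) c₂
      (countable_den_zeros s) fun z hz => ?_
    rw [twist_eq hz]
    rw [twist_eq (hper a₁ a₂ z hz), hF, h.phase₂]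
  · rw [(hdz f h.differentiable₁ z hz).2, hval f z hz, hval g z hz]
    linear_combination numF l (z + s) * (den s z)⁻¹ * h.eq₁ z
  · rw [(hdz g h.differentiable₂ z hz).2, hval f z hz, hval g z hz]
    linear_combination numF l (z + s) * (den s z)⁻¹ * h.eq₂ z

end IsFlat

end


section

/-! ### The common zero of the flat band functions -/

variable {α k : ℂ} {f g f' g' : ℂ → ℂ}

/-- The quasi-momentum that is fixed by the symmetry between the equation and its adjoint. -/
noncomputable abbrev kFix : ℂ := -pt adjFreq / 2

lemma pt_add_kFix_ne {m : ℤ × ℤ} : pt m + kFix ≠ 0 := by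
  intro h
  have h1 : pt (m + m - adjFreq) = 0 := by
    rw [pt_sub, pt_add]
    linear_combination 2 * h
  have h2 := congrArg Prod.fst (pt_eq_zero h1)
  simp at h2
  omega

/-- At `kFix` there is a non-zero solution: of the two components of a zero mode of the Hamiltonian one
solves the equation and the other, after the symmetry, solves it as well. -/
lemma exists_isFlat_kFix (hα : IsSimpleMagic α) :
    ∃ f g, IsFlat α kFix f g ∧ ¬∀ z, f z = 0 ∧ g z = 0 := by
  have h2 : finrank ℂ (hamKernel α kFix) = 2 := hα kFix
  have : Nontrivial (hamKernel α kFix) := Module.nontrivial_of_finrank_pos (R := ℂ) (by omega)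
  obtain ⟨⟨v, hv⟩, hv0⟩ := exists_ne (0 : hamKernel α kFix)
  obtain ⟨w, hw, hvw⟩ := exists_classical (elliptic_hamiltonian _) (isTrig_hamiltonian α kFix) hv
  obtain ⟨h1, h2⟩ := (hamiltonian_classical_iff α kFix w).1 hw
  have h3 := isFlat_of_adjoint h2
  rw [show -kFix - pt adjFreq = kFix by rw [kFix]; ring] at h3
  by_contra hcon
  push Not at hcon
  have e3 := hcon _ _ h3
  have hp : pair (fun z => w z (Sum.inl (0, 0))) (fun z => w z (Sum.inl (0, 1))) =
      fun z i => w z (Sum.inl i) := by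
    funext z i
    obtain ⟨i, s⟩ := i
    obtain rfl := Subsingleton.elim i 0
    fin_cases s <;> rfl
  have e1 := hcon _ _ ((isFlat_iff_classical (fun _ => 0) α kFix _ _).2 (by rw [hp]; exact h1))
  refine hv0 (Subtype.ext (L2_ext ?_))
  filter_upwards [hvw, ae_zero (ι := (Fin 1 × Fin 2) ⊕ (Fin 1 × Fin 2))] with z h4 h5
  refine (?_ : v (toTorus z) = (0 : L2 _) (toTorus z))
  rw [h5]
  refine PiLp.ext fun i => ?_
  rw [h4]
  have e1z := e1 z
  have e3z := e3 z
  simp only [mul_eq_zero, neg_eq_zero, chi_ne, false_or, map_eq_zero] at e3z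
  rcases i with ⟨i, s⟩ | ⟨i, s⟩ <;> obtain rfl := Subsingleton.elim i 0 <;> fin_cases s
  · exact e1z.1
  · exact e1z.2
  · exact e3z.2
  · exact e3z.1

/-- The three-dimensional family of zero modes of the Hamiltonian that two solutions at `k` and one
at `-k - pt adjFreq` would span does not exist, hence the solutions at `k` are dependent. -/
lemma IsFlat.dependent (hα : IsSimpleMagic α) (h : IsFlat α k f g)
    (h0 : ¬∀ z, f z = 0 ∧ g z = 0) (h' : IsFlat α k f' g') {f'' g'' : ℂ → ℂ}
    (h'' : IsFlat α (-k - pt adjFreq) f'' g'') (h0'' : ¬∀ z, f'' z = 0 ∧ g'' z = 0) :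
    ∃ c : ℂ, ∀ z, f' z = c * f z ∧ g' z = c * g z := by
  have zcl : ∀ P : System (Fin 1 × Fin 2), P.Classical (layerCharge 1) fun _ _ => 0 := fun P =>
    ⟨fun i => contDiff_const, fun a₁ a₂ z i => by simp, fun z => by
      have : (fun _ : Fin 1 × Fin 2 => (0 : ℂ)) = 0 := rfl
      simp [this]⟩
  have up : ∀ {f g}, IsFlat α k f g → ∃ v ∈ hamKernel α k, ∀ᵐ z : ℂ,
      (v (toTorus z)).ofLp = Sum.elim (pair f g z) fun _ => 0 := by
    intro f g h
    exact ((hamiltonian_classical_iff α k (fun z => Sum.elim (pair f g z) fun _ => 0)).2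
      ⟨(isFlat_iff_classical _ α k f g).1 h, zcl _⟩).exists_mem_kernel
  obtain ⟨v, hv, ev⟩ := up h
  obtain ⟨v', hv', ev'⟩ := up h'
  obtain ⟨v'', hv'', ev''⟩ := ((hamiltonian_classical_iff α k (fun z => Sum.elim (fun _ => 0)
    (pair (fun z => -conj (chi (-adjFreq) z * g'' z))
      (fun z => conj (chi (-adjFreq) z * f'' z)) z))).2 ⟨zcl _, h''.adjoint⟩).exists_mem_kernel
  have h2 : finrank ℂ (hamKernel α k) = 2 := hα k
  have : Module.Finite ℂ (hamKernel α k) := Module.finite_of_finrank_pos (by omega)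
  have hdep : ¬LinearIndependent ℂ ![(⟨v, hv⟩ : hamKernel α k), ⟨v', hv'⟩, ⟨v'', hv''⟩] := by
    intro hli
    have := hli.fintype_card_le_finrank
    rw [Fintype.card_fin] at this
    omega
  rw [Fintype.not_linearIndependent_iff] at hdep
  obtain ⟨c, hc, i, hi⟩ := hdep
  rw [Fin.sum_univ_three] at hc
  have hsum : c 0 • v + c 1 • v' + c 2 • v'' = 0 := congrArg Subtype.val hc
  have hae : ∀ᵐ z : ℂ, ∀ i, c 0 * Sum.elim (pair f g z) (fun _ => 0) i +
      c 1 * Sum.elim (pair f' g' z) (fun _ => 0) i + c 2 * Sum.elim (fun _ => 0)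
      (pair (fun z => -conj (chi (-adjFreq) z * g'' z))
      (fun z => conj (chi (-adjFreq) z * f'' z)) z) i = 0 := by
    filter_upwards [ev, ev', ev'', ae_smul (c 0) v, ae_smul (c 1) v', ae_smul (c 2) v'',
      ae_add (c 0 • v) (c 1 • v'), ae_add (c 0 • v + c 1 • v') (c 2 • v''),
      ae_zero (ι := (Fin 1 × Fin 2) ⊕ (Fin 1 × Fin 2))] with z a1 a2 a3 a4 a5 a6 a7 a8 a9 i
    rw [hsum, a9, a7, a4, a5, a6] at a8
    have := congrArg (fun x : EuclideanSpace ℂ _ => x.ofLp i) a8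
    simp only [WithLp.ofLp_add, WithLp.ofLp_smul, a1, a2, a3, Pi.add_apply, Pi.smul_apply,
      smul_eq_mul, WithLp.ofLp_zero, Pi.zero_apply] at this
    exact this.symm
  have cf := h.contDiff₁.continuous
  have cg := h.contDiff₂.continuous
  have cf' := h'.contDiff₁.continuous
  have cg' := h'.contDiff₂.continuous
  have cf'' := h''.contDiff₁.continuous
  have cg'' := h''.contDiff₂.continuous
  have cχ := continuous_chi (-adjFreq)
  -- the two halves of the Hamiltonian do not interact, so `c 2 = 0`, and then `c 1 ≠ 0`
  have e1 : ∀ z, c 0 * f z + c 1 * f' z = 0 :=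
    eq_of_ae_eq_continuous (g := fun _ => 0) (by fun_prop) continuous_const (by
      filter_upwards [hae] with z hz
      simpa [pair] using hz (Sum.inl (0, 0)))
  have e2 : ∀ z, c 0 * g z + c 1 * g' z = 0 :=
    eq_of_ae_eq_continuous (g := fun _ => 0) (by fun_prop) continuous_const (by
      filter_upwards [hae] with z hz
      simpa [pair] using hz (Sum.inl (0, 1)))
  have e3 : ∀ z, c 2 * (-conj (chi (-adjFreq) z * g'' z)) = 0 :=
    eq_of_ae_eq_continuous (g := fun _ => 0)
      (continuous_const.mul (Complex.continuous_conj.comp (cχ.mul cg'')).neg) continuous_const (by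
      filter_upwards [hae] with z hz
      simpa [pair] using hz (Sum.inr (0, 0)))
  have e4 : ∀ z, c 2 * (conj (chi (-adjFreq) z * f'' z)) = 0 :=
    eq_of_ae_eq_continuous (g := fun _ => 0)
      (continuous_const.mul (Complex.continuous_conj.comp (cχ.mul cf''))) continuous_const (by
      filter_upwards [hae] with z hz
      simpa [pair] using hz (Sum.inr (0, 1)))
  have hc2 : c 2 = 0 := by
    by_contra hne
    refine h0'' fun z => ⟨?_, ?_⟩
    · have := (mul_eq_zero.1 (e4 z)).resolve_left hne
      rw [map_eq_zero, mul_eq_zero] at this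
      exact this.resolve_left (chi_ne _ _)
    · have := (mul_eq_zero.1 (e3 z)).resolve_left hne
      rw [neg_eq_zero, map_eq_zero, mul_eq_zero] at this
      exact this.resolve_left (chi_ne _ _)
  have hc1 : c 1 ≠ 0 := by
    intro hc1
    have hc0 : c 0 ≠ 0 := by
      intro hc0
      fin_cases i
      · exact hi hc0
      · exact hi hc1
      · exact hi hc2
    refine h0 fun z => ⟨?_, ?_⟩
    · have := e1 z
      rw [hc1, zero_mul, add_zero] at this
      exact (mul_eq_zero.1 this).resolve_left hc0
    · have := e2 z
      rw [hc1, zero_mul, add_zero] at this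
      exact (mul_eq_zero.1 this).resolve_left hc0
  refine ⟨-c 0 / c 1, fun z => ⟨?_, ?_⟩⟩
  · field_simp
    linear_combination e1 z
  · field_simp
    linear_combination e2 z

/-- A non-zero solution at quasi-momentum `0` has a zero. Otherwise the solution at `kFix`, whose
Wronskian with it vanishes, would be a multiple of it by a periodic function. -/
lemma IsFlat.exists_zero (hα : IsSimpleMagic α) (h : IsFlat α 0 f g) :
    ∃ z, f z = 0 ∧ g z = 0 := by
  obtain ⟨f', g', h', h0'⟩ := exists_isFlat_kFix hα
  have hW : ∀ z, f z * g' z - g z * f' z = 0 := by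
    refine scalar_solution_eq_zero (c := 1) (k := kFix) ?_ ?_ Set.countable_empty ?_ ?_
      (fun m _ _ => pt_add_kFix_ne)
    · exact (h.contDiff₁.continuous.mul h'.contDiff₂.continuous).sub
        (h.contDiff₂.continuous.mul h'.contDiff₁.continuous)
    · intro a₁ a₂ z
      rw [one_mul, h.phase₂, h'.phase₂]
      linear_combination g' z * h.phase₁ a₁ a₂ z - g z * h'.phase₁ a₁ a₂ z
    · exact fun z _ => ((h.differentiable₁ z).mul (h'.differentiable₂ z)).sub
        ((h.differentiable₂ z).mul (h'.differentiable₁ z))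
    · intro z _
      have d1 : DifferentiableAt ℝ (fun z => f z * g' z) z :=
        (h.differentiable₁ z).mul (h'.differentiable₂ z)
      have d2 : DifferentiableAt ℝ (fun z => -(g z * f' z)) z :=
        ((h.differentiable₂ z).mul (h'.differentiable₁ z)).neg
      have e : dz (fun z => f z * g' z - g z * f' z) z =
          dz (fun z => f z * g' z) z + dz (fun z => -(g z * f' z)) z := by
        rw [← dz_add d1 d2]; simp only [sub_eq_add_neg]
      rw [e, dz_neg, dz_mul (h.differentiable₁ z) (h'.differentiable₂ z),
        dz_mul (h.differentiable₂ z) (h'.differentiable₁ z)]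
      linear_combination g' z * h.eq₁ z + f z * h'.eq₂ z - f' z * h.eq₂ z - g z * h'.eq₁ z
  by_contra hcon
  push Not at hcon
  have hne : ∀ z, f z * conj (f z) + g z * conj (g z) ≠ 0 := by
    intro z hz
    rw [Complex.mul_conj, Complex.mul_conj] at hz
    have h1 : Complex.normSq (f z) + Complex.normSq (g z) = 0 := by exact_mod_cast hz
    have h2 := Complex.normSq_nonneg (f z)
    have h3 := Complex.normSq_nonneg (g z)
    exact hcon z (Complex.normSq_eq_zero.1 (by linarith)) (Complex.normSq_eq_zero.1 (by linarith))
  set q : ℂ → ℂ := fun z => (f' z * conj (f z) + g' z * conj (g z)) /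
    (f z * conj (f z) + g z * conj (g z)) with hq
  have q1 : ∀ z, f' z = q z * f z := fun z => by
    rw [hq]
    simp only
    rw [div_mul_eq_mul_div, eq_div_iff (hne z)]
    linear_combination -(conj (g z)) * hW z
  have q2 : ∀ z, g' z = q z * g z := fun z => by
    rw [hq]
    simp only
    rw [div_mul_eq_mul_div, eq_div_iff (hne z)]
    linear_combination (conj (f z)) * hW z
  have hcj : ∀ {f : ℂ → ℂ}, Differentiable ℝ f → Differentiable ℝ fun z => conj (f z) :=
    fun hf => (Complex.conjCLE : ℂ →L[ℝ] ℂ).differentiable.comp hf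
  have hqd : Differentiable ℝ q := by
    have n1 : Differentiable ℝ fun z => f' z * conj (f z) + g' z * conj (g z) :=
      (h'.differentiable₁.mul (hcj h.differentiable₁)).add
        (h'.differentiable₂.mul (hcj h.differentiable₂))
    have n2 : Differentiable ℝ fun z => f z * conj (f z) + g z * conj (g z) :=
      (h.differentiable₁.mul (hcj h.differentiable₁)).add
        (h.differentiable₂.mul (hcj h.differentiable₂))
    intro z
    have n3 := ((differentiableAt_inv (𝕜 := ℂ) (hne z)).restrictScalars ℝ).comp z (n2 z)
    exact (n1 z).mul n3
  refine h0' fun z => ?_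
  have hz : q z = 0 := by
    refine scalar_solution_eq_zero (c := 0) (k := kFix) hqd.continuous ?_ Set.countable_empty
      (fun z _ => hqd z) ?_ (fun m _ _ => pt_add_kFix_ne) z
    · intro a₁ a₂ z
      rw [zero_mul, zpow_zero, one_mul]
      rcases not_and_or.1 (fun hh => hcon z hh.1 hh.2) with hz | hz
      · have e1 := q1 (z + lamPt a₁ a₂)
        have e2 := q1 z
        rw [← h'.phase₁ a₁ a₂ z, e1, mul_left_comm, h.phase₁] at e2
        exact mul_right_cancel₀ hz e2
      · have e1 := q2 (z + lamPt a₁ a₂)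
        have e2 := q2 z
        rw [← h'.phase₂ a₁ a₂ z, e1, h.phase₂] at e2
        exact mul_right_cancel₀ hz e2
    · intro z _
      have d1 : dz f' z = dz q z * f z + q z * dz f z := by
        rw [funext q1, dz_mul (hqd z) (h.differentiable₁ z)]
      have d2 : dz g' z = dz q z * g z + q z * dz g z := by
        rw [funext q2, dz_mul (hqd z) (h.differentiable₂ z)]
      have e1 := h'.eq₁ z
      have e2 := h'.eq₂ z
      rw [d1, q1, q2] at e1
      rw [d2, q1, q2] at e2
      rcases not_and_or.1 (fun hh => hcon z hh.1 hh.2) with hz | hz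
      · refine mul_right_cancel₀ hz ?_
        linear_combination e1 - q z * h.eq₁ z
      · refine mul_right_cancel₀ hz ?_
        linear_combination e2 - q z * h.eq₂ z
  rw [q1, q2, hz]
  simp

lemma IsFlat.twist_ne (h : IsFlat α k f g) (h0 : ¬∀ z, f z = 0 ∧ g z = 0) (l s : ℂ) :
    ¬∀ z, TMG.twist l s f z = 0 ∧ TMG.twist l s g z = 0 := fun hz =>
  h0 fun z => ⟨eq_zero_of_twist h.contDiff₁.continuous (fun z => (hz z).1) z,
    eq_zero_of_twist h.contDiff₂.continuous (fun z => (hz z).2) z⟩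

/-- The bilayer kernel is at most one-dimensional at every quasi-momentum. -/
lemma IsFlat.eq_const_mul (hα : IsSimpleMagic α) {u₁ u₂ : ℂ → ℂ} (hu : IsFlat α 0 u₁ u₂)
    (hu0 : ¬∀ z, u₁ z = 0 ∧ u₂ z = 0) (h : IsFlat α k f g)
    (h0 : ¬∀ z, f z = 0 ∧ g z = 0) (h' : IsFlat α k f' g') :
    ∃ c : ℂ, ∀ z, f' z = c * f z ∧ g' z = c * g z := by
  obtain ⟨z₀, h1, h2⟩ := hu.exists_zero hα
  rw [← neg_neg z₀] at h1 h2
  have := hu.twist h1 h2 (-k - pt adjFreq)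
  rw [_root_.zero_add] at this
  exact h.dependent hα h0 h' this (hu.twist_ne hu0 _ _)

/-- If multiplication by `F_l` removes the zero `-s` of `u`, and the product still vanishes at `-s'`,
then the solution `u` vanishes at the point where `F_l(· + s)` does, unless `F_{-l}(· + s')` has its
pole there. -/
lemma IsFlat.zero_of_twist (hα : IsSimpleMagic α) (h : IsFlat α 0 f g)
    (h0 : ¬∀ z, f z = 0 ∧ g z = 0) {s s' : ℂ} (h₁ : f (-s) = 0) (h₂ : g (-s) = 0)
    {z : ℂ} (hz' : den s' z ≠ 0)
    (t₁ : TMG.twist (-(cDual * ((z + s) / cLam))) s f (-s') = 0)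
    (t₂ : TMG.twist (-(cDual * ((z + s) / cLam))) s g (-s') = 0) : f z = 0 ∧ g z = 0 := by
  set l := -(cDual * ((z + s) / cLam)) with hl
  have hv := h.twist h₁ h₂ l
  have hw := hv.twist t₁ t₂ (-l)
  rw [_root_.zero_add, add_neg_cancel] at hw
  obtain ⟨c, hc⟩ := h.eq_const_mul hα h0 h h0 hw
  -- `l` is chosen such that `F_l(· + s)` vanishes at `z`
  have hnum : numF l (z + s) = 0 := by
    rw [numF_eq_zero_iff]
    refine ⟨0, 0, ?_⟩
    rw [hl, lamPt]
    have := cLam_ne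
    have := cDual_ne
    simp only [Int.cast_zero, zero_mul, add_zero, mul_zero]
    field_simp
    ring
  have e1 : ∀ f : ℂ → ℂ, TMG.twist l s f z = 0 := fun f => by rw [TMG.twist, hnum, zero_mul]
  have hc0 : c ≠ 0 := by
    rintro rfl
    refine hv.twist_ne (h.twist_ne h0 l s) (-l) s' fun z => ?_
    simpa using hc z
  have e2 := hc z
  rw [twist_eq_zero_of_eq_zero hz' (e1 f), twist_eq_zero_of_eq_zero hz' (e1 g)] at e2
  exact ⟨(mul_eq_zero.1 e2.1.symm).resolve_left hc0, (mul_eq_zero.1 e2.2.symm).resolve_left hc0⟩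

/-- The zero of a solution at quasi-momentum `0` is unique modulo `Λ`. -/
lemma IsFlat.zero_unique (hα : IsSimpleMagic α) (h : IsFlat α 0 f g)
    (h0 : ¬∀ z, f z = 0 ∧ g z = 0) {z₀ z₁ : ℂ} (h₁ : f z₀ = 0) (h₂ : g z₀ = 0)
    (h₃ : f z₁ = 0) (h₄ : g z₁ = 0) : ∃ a₁ a₂ : ℤ, z₁ - z₀ = lamPt a₁ a₂ := by
  rw [← neg_neg z₀] at h₁ h₂
  rw [sub_eq_add_neg, ← den_eq_zero_iff]
  by_contra hne
  refine h0 fun z => ?_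
  by_cases hz : den (-z₀) z = 0
  · exact h.den_zero h₁ h₂ hz
  rw [← neg_neg z₁] at h₃ h₄ hne
  by_cases hz' : den (-z₁) z = 0
  · exact h.den_zero h₃ h₄ hz'
  exact h.zero_of_twist hα h0 h₁ h₂ hz' (twist_eq_zero_of_eq_zero hne h₃)
    (twist_eq_zero_of_eq_zero hne h₄)

/-- The zero of a solution at quasi-momentum `0` is simple. The derivatives are complex ones: at a
common zero of `f` and `g` the equation reads `2 D_{z̄} f = 2 D_{z̄} g = 0`. -/
lemma IsFlat.deriv_ne (hα : IsSimpleMagic α) (h : IsFlat α 0 f g)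
    (h0 : ¬∀ z, f z = 0 ∧ g z = 0) {z₀ : ℂ} (h₁ : f z₀ = 0) (h₂ : g z₀ = 0) :
    ¬(deriv f z₀ = 0 ∧ deriv g z₀ = 0) := by
  rintro ⟨d₁, d₂⟩
  rw [← neg_neg z₀] at h₁ h₂
  refine h0 fun z => ?_
  by_cases hz : den (-z₀) z = 0
  · exact h.den_zero h₁ h₂ hz
  have hden : den (-z₀) (- -z₀) = 0 := (den_eq_zero_iff _ _).2 ⟨0, 0, by simp [lamPt]⟩
  refine h.zero_of_twist hα h0 h₁ h₂ hz ?_ ?_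
  · rw [TMG.twist, quot, if_pos hden, neg_neg, d₁, zero_div, mul_zero]
  · rw [TMG.twist, quot, if_pos hden, neg_neg, d₂, zero_div, mul_zero]

end


section

/-! ### Rotation by `om` and the position of the zero -/

variable {α k : ℂ} {f g : ℂ → ℂ}

lemma U_rot (z : ℂ) : U (om * z) = om * U z := by
  have h : om * conj om = 1 := om_mul_conj
  simp only [U, Finset.sum_range_succ, Finset.sum_range_zero, pow_zero, pow_one, mul_one, _root_.zero_add,
    one_mul, map_mul]
  have e1 : om * z * conj om - conj om * conj z * om = z - conj z := by
    linear_combination (z - conj z) * h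
  have e2 : om * z * conj om ^ 2 - conj om * conj z * om ^ 2 = z * conj om - conj z * om := by
    linear_combination (z * conj om - conj z * om) * h
  have e3 : om * z - conj om * conj z = z * conj om ^ 2 - conj z * om ^ 2 := by
    rw [conj_om]
    have := om_sq
    linear_combination (conj z - z) * this
  rw [e1, e2, e3]
  linear_combination -Complex.exp (1 / 2 * (z * conj om ^ 2 - conj z * om ^ 2)) * om_cube

lemma om_mul_lamPt (a₁ a₂ : ℤ) : om * lamPt a₁ a₂ = lamPt (-a₂) (a₁ - a₂) := by
  simp only [lamPt]
  push_cast
  linear_combination cLam * a₂ * om_sq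

lemma dz_rot {z : ℂ} (hf : DifferentiableAt ℝ f (om * z)) :
    dz (fun z => f (om * z)) z = conj om * dz f (om * z) := by
  have h1 : HasFDerivAt (fun z : ℂ => om * z) (om • ContinuousLinearMap.id ℝ ℂ) z :=
    (hasFDerivAt_id z).const_mul om
  have h2 : fderiv ℝ (fun z => f (om * z)) z =
      (fderiv ℝ f (om * z)).comp (om • ContinuousLinearMap.id ℝ ℂ) :=
    (hf.hasFDerivAt.comp z h1).fderiv
  have hre := Complex.re_add_im om
  have e1 : fderiv ℝ f (om * z) om =
      om.re * fderiv ℝ f (om * z) 1 + om.im * fderiv ℝ f (om * z) Complex.I := by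
    have : om = om.re • (1 : ℂ) + om.im • Complex.I := by simp
    refine (congrArg (fderiv ℝ f (om * z)) this).trans ?_
    rw [map_add, map_smul, map_smul, Complex.real_smul, Complex.real_smul]
  have e2 : fderiv ℝ f (om * z) (om * Complex.I) =
      -om.im * fderiv ℝ f (om * z) 1 + om.re * fderiv ℝ f (om * z) Complex.I := by
    have : om * Complex.I = (-om.im) • (1 : ℂ) + om.re • Complex.I := by
      rw [Complex.real_smul, Complex.real_smul]
      push_cast
      conv_lhs => rw [← hre]
      linear_combination (om.im : ℂ) * Complex.I_sq
    rw [this, map_add, map_smul, map_smul, Complex.real_smul, Complex.real_smul]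
    push_cast; ring
  have hc : conj om = om.re - om.im * Complex.I := by
    apply Complex.ext <;> simp
  rw [dz, dz, h2]
  simp only [ContinuousLinearMap.comp_apply, _root_.smul_apply,
    ContinuousLinearMap.id_apply, smul_eq_mul, mul_one]
  rw [e1, e2, hc]
  linear_combination -(om.im : ℂ) * fderiv ℝ f (om * z) 1 * Complex.I_sq

/-- The rotation by `om` maps solutions at quasi-momentum `0` to solutions. -/
lemma IsFlat.rot (h : IsFlat α 0 f g) :
    IsFlat α 0 (fun z => f (om * z)) fun z => g (om * z) where
  contDiff₁ := h.contDiff₁.comp (contDiff_const.mul contDiff_id)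
  contDiff₂ := h.contDiff₂.comp (contDiff_const.mul contDiff_id)
  phase₁ a₁ a₂ z := by
    have := h.phase₁ (-a₂) (a₁ - a₂) (om * z)
    rw [mul_add, om_mul_lamPt, show a₁ + a₂ = (-a₂ + (a₁ - a₂)) + 3 * a₂ by ring,
      zpow_add₀ om_ne, om_zpow_three_mul, mul_one, this]
  phase₂ a₁ a₂ z := by rw [mul_add, om_mul_lamPt, h.phase₂]
  eq₁ z := by
    rw [dz_rot (h.differentiable₁ _)]
    have := h.eq₁ (om * z)
    rw [U_rot] at this
    linear_combination conj om * this - α * U z * g (om * z) * om_mul_conj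
  eq₂ z := by
    rw [dz_rot (h.differentiable₂ _)]
    have := h.eq₂ (om * z)
    rw [← mul_neg, U_rot] at this
    linear_combination conj om * this - α * U (-z) * f (om * z) * om_mul_conj

lemma om_mul_zS : om * zS = zS + lamPt 0 (-1) := by
  simp only [zS, lamPt]
  push_cast
  linear_combination (1 / 3 * cLam) * om_sq

lemma om_mul_neg_zS : om * -zS = -zS + lamPt 0 1 := by
  simp only [zS, lamPt]
  push_cast
  linear_combination (-1 / 3 * cLam) * om_sq

lemma lamPt_inj {a₁ a₂ b₁ b₂ : ℤ} (h : lamPt a₁ a₂ = lamPt b₁ b₂) : a₁ = b₁ ∧ a₂ = b₂ := by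
  rw [lamPt, lamPt, mul_right_inj' cLam_ne] at h
  have h2 := congrArg Complex.im h
  simp [om_im_ne] at h2
  have h1 := congrArg Complex.re h
  simp [h2] at h1
  exact ⟨h1, h2⟩

lemma three_zS : 3 * zS = lamPt (-1) 1 := by
  simp only [zS, lamPt]; push_cast; ring

lemma zS_ne (a₁ a₂ : ℤ) : zS ≠ lamPt a₁ a₂ := by
  intro h
  have h3 : lamPt (3 * a₁) (3 * a₂) = lamPt (-1) 1 := by
    rw [← three_zS, h]; simp only [lamPt]; push_cast; ring
  have := (lamPt_inj h3).1
  omega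

lemma om_sq_ne_one : om ^ 2 ≠ 1 := by
  intro h
  have := (om_zpow_eq_one_iff 2).1 (by exact_mod_cast h)
  omega

/-- A solution at quasi-momentum `0` vanishes at `-z_S`. By uniqueness it is an eigenfunction of the
rotation, with an eigenvalue `μ`. For `μ ≠ 1` it would have two different zeros among the
fixed points `0`, `±z_S` of the rotation. For `μ = 1` its linear part at the zero determines the
class of that zero. -/
lemma IsFlat.zero_neg_zS (hα : IsSimpleMagic α) (h : IsFlat α 0 f g)
    (h0 : ¬∀ z, f z = 0 ∧ g z = 0) : f (-zS) = 0 ∧ g (-zS) = 0 := by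
  obtain ⟨μ, hμ⟩ := h.eq_const_mul hα h0 h h0 h.rot
  have kill : ∀ {c x : ℂ}, c * x = x → c ≠ 1 → x = 0 := by
    intro c x h1 h2
    exact (mul_eq_zero.1 (show (c - 1) * x = 0 by linear_combination h1)).resolve_left
      (sub_ne_zero.2 h2)
  have f0 := (hμ 0).1
  have g0 := (hμ 0).2
  rw [mul_zero] at f0 g0
  have gS := (hμ zS).2
  have fS := (hμ zS).1
  have gS' := (hμ (-zS)).2
  have fS' := (hμ (-zS)).1
  rw [om_mul_zS] at fS gS
  rw [om_mul_neg_zS] at fS' gS'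
  have pS := h.phase₁ 0 (-1) zS
  have pS' := h.phase₁ 0 1 (-zS)
  rw [h.phase₂] at gS gS'
  rw [fS] at pS
  rw [fS'] at pS'
  norm_num at pS pS'
  by_cases hμ1 : μ = 1
  · obtain ⟨z₀, h1, h2⟩ := h.exists_zero hα
    have h1' : f (om * z₀) = 0 := by rw [(hμ z₀).1, h1, mul_zero]
    have h2' : g (om * z₀) = 0 := by rw [(hμ z₀).2, h2, mul_zero]
    obtain ⟨a, b, hab⟩ := h.zero_unique hα h0 h1 h2 h1' h2'
    -- differentiate `f (om z) = f z`, `g (om z) = g z` at the zero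
    have hder : ∀ {φ : ℂ → ℂ} {c : ℂ}, (∀ z, φ (z + lamPt a b) = c * φ z) →
        (∀ z, φ (om * z) = φ z) → DifferentiableAt ℂ φ z₀ →
        c * om * deriv φ z₀ = deriv φ z₀ := by
      intro φ c e1 e2 hd
      have h3 : HasDerivAt (fun z => c * φ (om * z - lamPt a b)) (c * (deriv φ z₀ * om)) z₀ := by
        have hi : HasDerivAt (fun z : ℂ => om * z - lamPt a b) om z₀ := by
          simpa using ((hasDerivAt_id z₀).const_mul om).sub_const (lamPt a b)
        have hz : om * z₀ - lamPt a b = z₀ := by rw [← hab]; ring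
        have hd' : HasDerivAt φ (deriv φ z₀) (om * z₀ - lamPt a b) := by
          rw [hz]; exact hd.hasDerivAt
        exact (hd'.comp z₀ hi).const_mul c
      have h4 : (fun z => c * φ (om * z - lamPt a b)) = φ := by
        funext z
        rw [← e1, sub_add_cancel, e2]
      rw [h4] at h3
      linear_combination -h3.deriv
    have hd := h.differentiableAt_of_zero h1 h2
    have dg := hder (c := 1) (fun z => by rw [h.phase₂, one_mul])
      (fun z => by rw [(hμ z).2, hμ1, one_mul]) hd.2
    have df := hder (c := om ^ (-(a + b))) (fun z => by
      rw [← h.phase₁ a b z, ← mul_assoc, ← zpow_add₀ om_ne, neg_add_cancel, zpow_zero, one_mul])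
      (fun z => by rw [(hμ z).1, hμ1, one_mul]) hd.1
    rw [one_mul] at dg
    have hg0 := kill dg om_ne_one
    have hc : om ^ (-(a + b)) * om = 1 := by
      by_contra hne
      exact h.deriv_ne hα h0 h1 h2 ⟨kill df hne, hg0⟩
    rw [← zpow_add_one₀ om_ne, om_zpow_eq_one_iff] at hc
    obtain ⟨j, hj⟩ := hc
    have hz : -zS = z₀ + lamPt (a + j) (-j) := by
      have ha : (a : ℂ) = 1 - b - 3 * j := by
        have : a = 1 - b - 3 * j := by omega
        rw [this]; push_cast; ring
      have hne : om - 1 ≠ 0 := sub_ne_zero.2 om_ne_one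
      refine mul_left_cancel₀ hne ?_
      have e1 : (om - 1) * z₀ = lamPt a b := by rw [← hab]; ring
      rw [mul_add, e1]
      simp only [zS, lamPt]
      push_cast
      rw [ha]
      linear_combination (cLam * (j - 1 / 3)) * om_sq
    rw [hz]
    exact h.zero_add h1 h2 _ _
  · exfalso
    have hf0 := kill f0.symm hμ1
    have hg0 := kill g0.symm hμ1
    have hgS := kill gS.symm hμ1
    have hgS' := kill gS'.symm hμ1
    have hcase : om * μ ≠ 1 ∨ om⁻¹ * μ ≠ 1 := by
      by_contra hcon
      push Not at hcon
      have h2 : μ = om := by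
        have := hcon.2
        rw [inv_mul_eq_iff_eq_mul₀ om_ne, mul_one] at this
        exact this
      have := hcon.1
      rw [h2, ← sq] at this
      exact om_sq_ne_one this
    rcases hcase with hc | hc
    · have hfS' : f (-zS) = 0 := kill (by rw [mul_assoc]; exact pS') hc
      obtain ⟨a, b, hab⟩ := h.zero_unique hα h0 hfS' hgS' hf0 hg0
      exact zS_ne a b (by rw [← hab]; ring)
    · have hfS : f zS = 0 := kill (by rw [mul_assoc]; exact pS) hc
      obtain ⟨a, b, hab⟩ := h.zero_unique hα h0 hf0 hg0 hfS hgS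
      exact zS_ne a b (by rw [← hab]; ring)

end


section

/-! ### Holomorphic families of square-integrable functions -/

variable {ι : Type} [Fintype ι] [DecidableEq ι]

/-- A locally bounded family with holomorphic Fourier coefficients is continuous, since the Schwarz
lemma bounds its finite sections uniformly. -/
lemma continuous_of_coef {Φ : ℂ → L2 ι} (hc : ∀ i m, Differentiable ℂ fun k => coef (Φ k) i m)
    (hb : ∀ k₀, ∃ C, ∀ k ∈ Metric.ball k₀ 1, ‖Φ k‖ ≤ C) : Continuous Φ := by
  rw [continuous_iff_continuousAt]
  intro k₀
  obtain ⟨C, hC⟩ := hb k₀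
  have hC0 : 0 ≤ C := (norm_nonneg _).trans (hC k₀ (Metric.mem_ball_self one_pos))
  set M := 2 * (Real.sqrt area * C) with hM
  have ha := area_pos
  have key : ∀ k ∈ Metric.ball k₀ 1, area * ‖Φ k - Φ k₀‖ ^ 2 ≤ (M * dist k k₀) ^ 2 := by
    intro k hk
    refine hasSum_le_of_sum_le (hasSum_coef (Φ k - Φ k₀)) fun S => ?_
    set T : ℂ → EuclideanSpace ℂ S := fun k => WithLp.toLp 2 fun q => coef (Φ k) q.1.1 q.1.2 with hT
    have hTd : Differentiable ℂ T := differentiable_euclidean.2 fun q => hc _ _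
    have hTb : ∀ k ∈ Metric.ball k₀ 1, ‖T k‖ ≤ Real.sqrt area * C := by
      intro k hk
      refine le_of_sq_le_sq ?_ (by positivity)
      rw [EuclideanSpace.norm_sq_eq, mul_pow, Real.sq_sqrt ha.le]
      calc ∑ q : S, ‖T k q‖ ^ 2 = ∑ q ∈ S, ‖coef (Φ k) q.1 q.2‖ ^ 2 :=
            Finset.sum_coe_sort S fun q => ‖coef (Φ k) q.1 q.2‖ ^ 2
        _ ≤ area * ‖Φ k‖ ^ 2 :=
            sum_le_hasSum S (fun _ _ => by positivity) (hasSum_coef (Φ k))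
        _ ≤ area * C ^ 2 := by gcongr; exact hC k hk
    have hmaps : Set.MapsTo T (Metric.ball k₀ 1) (Metric.closedBall (T k₀) M) := by
      intro k hk
      rw [mem_closedBall_iff_norm]
      refine (norm_sub_le _ _).trans ?_
      rw [hM, two_mul]
      exact add_le_add (hTb k hk) (hTb k₀ (Metric.mem_ball_self one_pos))
    have h := Complex.dist_le_div_mul_dist_of_mapsTo_ball hTd.differentiableOn hmaps hk
    rw [div_one, dist_eq_norm] at h
    calc ∑ q ∈ S, ‖coef (Φ k - Φ k₀) q.1 q.2‖ ^ 2 = ∑ q : S, ‖(T k - T k₀) q‖ ^ 2 := by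
          rw [← Finset.sum_coe_sort S fun q => ‖coef (Φ k - Φ k₀) q.1 q.2‖ ^ 2]
          refine Finset.sum_congr rfl fun q _ => ?_
          rw [sub_eq_add_neg, ← neg_one_smul ℂ, coef_add, coef_smul, neg_one_mul, ← sub_eq_add_neg]
          rfl
      _ = ‖T k - T k₀‖ ^ 2 := (EuclideanSpace.norm_sq_eq _).symm
      _ ≤ (M * dist k k₀) ^ 2 := by gcongr
  rw [Metric.continuousAt_iff']
  intro ε hε
  have hlim : Filter.Tendsto (fun k => (M * dist k k₀) ^ 2) (nhds k₀) (nhds 0) := by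
    have : Continuous fun k => (M * dist k k₀) ^ 2 := by fun_prop
    simpa using this.tendsto k₀
  filter_upwards [Metric.ball_mem_nhds k₀ one_pos,
    hlim.eventually_lt_const (show 0 < area * ε ^ 2 by positivity)] with k h1 h2
  have h3 := (key k h1).trans_lt h2
  rw [dist_eq_norm]
  exact lt_of_pow_lt_pow_left₀ 2 hε.le (lt_of_mul_lt_mul_left h3 ha.le)

/-- A locally bounded family with holomorphic Fourier coefficients is holomorphic: it is equal to
its Cauchy integrals. -/
lemma differentiable_of_coef {Φ : ℂ → L2 ι} (hc : ∀ i m, Differentiable ℂ fun k => coef (Φ k) i m)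
    (hb : ∀ k₀, ∃ C, ∀ k ∈ Metric.ball k₀ 1, ‖Φ k‖ ≤ C) : Differentiable ℂ Φ := by
  have hcont := continuous_of_coef hc hb
  intro k₀
  have hci : CircleIntegrable Φ k₀ ((1 : NNReal) : ℝ) := hcont.continuousOn.circleIntegrable (by simp)
  have hps := hasFPowerSeriesOn_cauchy_integral hci one_pos
  have heq : ∀ w ∈ Metric.ball k₀ 1, (2 * Real.pi * Complex.I : ℂ)⁻¹ •
      (∮ z in C(k₀, ((1 : NNReal) : ℝ)), (z - w)⁻¹ • Φ z) = Φ w := by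
    intro w hw
    refine L2_ext_coef fun i m => ?_
    rw [coef_smul, ← coefCLM_apply, circleIntegral, ← ContinuousLinearMap.intervalIntegral_comp_comm]
    · have hd := (hc i m).differentiableOn (s := Metric.closedBall k₀ ((1 : NNReal) : ℝ))
      have h := hd.circleIntegral_sub_inv_smul (w := w) (by simpa using hw)
      rw [circleIntegral] at h
      simp only [map_smul, coefCLM_apply]
      rw [h, smul_eq_mul, inv_mul_cancel_left₀]
      simp [Real.pi_ne_zero]
    · have hcs : ContinuousOn (fun z => (z - w)⁻¹ • Φ z) (Metric.sphere k₀ ((1 : NNReal) : ℝ)) := by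
        refine ContinuousOn.smul (ContinuousOn.inv₀ (continuousOn_id.sub continuousOn_const) fun z hz hzw => ?_)
          hcont.continuousOn
        have hzw' : z = w := sub_eq_zero.1 hzw
        rw [hzw', mem_sphere_iff_norm] at hz
        rw [mem_ball_iff_norm, hz] at hw
        simp at hw
      exact (hcs.circleIntegrable (by simp)).out
  refine hps.analyticAt.differentiableAt.congr_of_eventuallyEq ?_
  filter_upwards [Metric.ball_mem_nhds k₀ one_pos] with w hw
  exact (heq w hw).symm

end


/-! ### The flat band functions of the bilayer -/

/-- The derivative of `k ↦ F_k(z)`, up to the denominator. -/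
noncomputable def numFDeriv (k z : ℂ) : ℂ :=
  expF k z * (2 * Real.pi * (z / cLam - conj (z / cLam)) * (1 / cDual) / (Real.sqrt 3 : ℂ)) *
    theta (z / cLam + k / cDual) + expF k z * (deriv theta (z / cLam + k / cDual) * (1 / cDual))

lemma hasDerivAt_numF (k z : ℂ) : HasDerivAt (fun k => numF k z) (numFDeriv k z) k := by
  have h0 : HasDerivAt (fun k : ℂ => k / cDual) (1 / cDual) k := (hasDerivAt_id k).div_const _
  have h1 : HasDerivAt (fun k => expF k z) (expF k z *
      (2 * Real.pi * (z / cLam - conj (z / cLam)) * (1 / cDual) / (Real.sqrt 3 : ℂ))) k :=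
    ((h0.const_mul _).div_const _).cexp
  have h2 : HasDerivAt (fun k => theta (z / cLam + k / cDual))
      (deriv theta (z / cLam + k / cDual) * (1 / cDual)) k :=
    (differentiable_theta _).hasDerivAt.comp k (h0.const_add _)
  exact h1.mul h2

lemma continuous_numFDeriv : Continuous fun p : ℂ × ℂ => numFDeriv p.1 p.2 := by
  have h1 : Continuous theta := continuous_theta
  have h2 : Continuous (deriv theta) := by
    have : ContDiff ℂ 1 theta := differentiable_theta.contDiff
    exact this.continuous_deriv le_rfl
  have h3 : Continuous fun p : ℂ × ℂ => p.2 / cLam + p.1 / cDual := by fun_prop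
  have h4 : Continuous fun p : ℂ × ℂ => expF p.1 p.2 := by
    unfold expF; fun_prop
  have h5 := h1.comp h3
  have h6 := h2.comp h3
  unfold numFDeriv
  exact ((h4.mul (by fun_prop)).mul h5).add (h4.mul (h6.mul continuous_const))

lemma exists_bound_cell {G : ℂ × ℂ → ℂ} (hG : Continuous G) (k₀ : ℂ) :
    ∃ C, 0 ≤ C ∧ ∀ k ∈ Metric.ball k₀ 1, ∀ z ∈ cell (3 * cLam), ‖G (k, z)‖ ≤ C := by
  have hK : IsCompact (Metric.closedBall k₀ 1 ×ˢ closure (cell (3 * cLam))) :=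
    (isCompact_closedBall _ _).prod (isBounded_cell three_cLam_ne).isCompact_closure
  obtain ⟨C, hC⟩ := hK.exists_bound_of_continuousOn hG.continuousOn
  exact ⟨|C|, abs_nonneg C, fun k hk z hz => (hC (k, z)
    ⟨Metric.ball_subset_closedBall hk, subset_closure hz⟩).trans (le_abs_self C)⟩

/-- The Fourier coefficients of `F_k(z + s) f(z)` are holomorphic in `k`. -/
lemma differentiable_fc_numF {q : ℂ → ℂ} (hq : Continuous q) (s : ℂ) (m : ℤ × ℤ) :
    Differentiable ℂ fun k => fc (fun z => numF k (z + s) * q z) m := by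
  intro k₀
  have hc1 : Continuous fun p : ℂ × ℂ => numF p.1 (p.2 + s) * q p.2 * chi (-m) p.2 := by
    have h : Continuous fun p : ℂ × ℂ => (p.1, p.2 + s) := by fun_prop
    exact ((continuous_numF.comp h).mul (hq.comp continuous_snd)).mul
      ((continuous_chi _).comp continuous_snd)
  have hc2 : Continuous fun p : ℂ × ℂ => numFDeriv p.1 (p.2 + s) * q p.2 * chi (-m) p.2 := by
    have h : Continuous fun p : ℂ × ℂ => (p.1, p.2 + s) := by fun_prop
    exact ((continuous_numFDeriv.comp h).mul (hq.comp continuous_snd)).mul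
      ((continuous_chi _).comp continuous_snd)
  obtain ⟨C, -, hC⟩ := exists_bound_cell hc2 k₀
  have hcz : ∀ (k : ℂ) {G : ℂ × ℂ → ℂ}, Continuous G → Continuous fun z => G (k, z) :=
    fun k G hG => hG.comp (by fun_prop)
  refine (hasDerivAt_integral_of_dominated_loc_of_deriv_le
    (μ := volume.restrict (cell (3 * cLam)))
    (F := fun k z => numF k (z + s) * q z * chi (-m) z)
    (F' := fun k z => numFDeriv k (z + s) * q z * chi (-m) z) (bound := fun _ => C)
    (Metric.ball_mem_nhds k₀ one_pos) (Filter.Eventually.of_forall fun k =>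
      (hcz k hc1).aestronglyMeasurable) (integrableOn_cell three_cLam_ne (hcz k₀ hc1))
    (hcz k₀ hc2).aestronglyMeasurable ?_ (integrable_const C) ?_).2.differentiableAt
  · refine (ae_restrict_iff' (measurableSet_cell three_cLam_ne)).2
      (Filter.Eventually.of_forall fun z hz k hk => hC k hk z hz)
  · exact Filter.Eventually.of_forall fun z k _ =>
      ((hasDerivAt_numF k (z + s)).mul_const _).mul_const _

lemma norm_le_of_bound {ι : Type} [Fintype ι] {v : L2 ι} {C : ℝ} (hC : 0 ≤ C)
    (h : ∀ᵐ z : ℂ, z ∈ cell (3 * cLam) → ‖v (toTorus z)‖ ≤ C) :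
    ‖v‖ ≤ measureUnivNNReal torusMeasure ^ (2 : ENNReal).toReal⁻¹ * C := by
  refine Lp.norm_le_of_ae_bound hC ((ae_map_iff measurable_toTorus.aemeasurable
    (measurableSet_le (Lp.stronglyMeasurable v).measurable.norm measurable_const)).2 ?_)
  exact (ae_restrict_iff' (measurableSet_cell three_cLam_ne)).2 h

/-- The family `F_k(z + z_S) u(z)` of solutions of the bilayer equation is a holomorphic family of
square-integrable functions. -/
lemma exists_bilayer_family {α : ℂ} {u₁ u₂ : ℂ → ℂ} (hu : IsFlat α 0 u₁ u₂) (h₁ : u₁ (-zS) = 0)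
    (h₂ : u₂ (-zS) = 0) : ∃ φ : ℂ → L2 (Fin 1 × Fin 2), Differentiable ℂ φ ∧
      ∀ k, ∀ᵐ z : ℂ, φ k (toTorus z) (0, 0) = twist k zS u₁ z ∧
        φ k (toTorus z) (0, 1) = twist k zS u₂ z := by
  have hk : ∀ k, IsFlat α k (twist k zS u₁) (twist k zS u₂) := fun k => by
    simpa using hu.twist h₁ h₂ k
  choose φ hφ1 hφ2 using fun k => (hk k).exists_mem fun _ => 0
  obtain ⟨q₁, q₂⟩ := hu.continuous_quot h₁ h₂
  refine ⟨φ, differentiable_of_coef ?_ ?_, hφ2⟩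
  · rintro ⟨i, s⟩ m
    obtain rfl := Subsingleton.elim i 0
    fin_cases s
    · have e : (fun k => coef (φ k) (0, 0) m) =
          fun k => fc (fun z => numF k (z + zS) * quot zS u₁ z) m := by
        funext k
        refine fc_congr ?_ m
        filter_upwards [hφ2 k] with z hz
        exact hz.1
      exact e ▸ differentiable_fc_numF q₁ zS m
    · have e : (fun k => coef (φ k) (0, 1) m) =
          fun k => fc (fun z => numF k (z + zS) * quot zS u₂ z) m := by
        funext k
        refine fc_congr ?_ m
        filter_upwards [hφ2 k] with z hz
        exact hz.2
      exact e ▸ differentiable_fc_numF q₂ zS m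
  · intro k₀
    have hc : ∀ {q : ℂ → ℂ}, Continuous q →
        Continuous fun p : ℂ × ℂ => numF p.1 (p.2 + zS) * q p.2 := by
      intro q hq
      have h : Continuous fun p : ℂ × ℂ => (p.1, p.2 + zS) := by fun_prop
      exact (continuous_numF.comp h).mul (hq.comp continuous_snd)
    obtain ⟨C₁, p₁, hC₁⟩ := exists_bound_cell (hc q₁) k₀
    obtain ⟨C₂, p₂, hC₂⟩ := exists_bound_cell (hc q₂) k₀
    refine ⟨_, fun k hk => norm_le_of_bound (C := C₁ + C₂) (by positivity) ?_⟩
    filter_upwards [hφ2 k] with z hz hzc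
    refine le_of_sq_le_sq ?_ (by positivity)
    rw [EuclideanSpace.norm_sq_eq, Fintype.sum_prod_type, Fin.sum_univ_one, Fin.sum_univ_two, hz.1,
      hz.2]
    have b1 : ‖twist k zS u₁ z‖ ≤ C₁ := hC₁ k hk z hzc
    have b2 : ‖twist k zS u₂ z‖ ≤ C₂ := hC₂ k hk z hzc
    nlinarith [norm_nonneg (twist k zS u₁ z), norm_nonneg (twist k zS u₂ z), mul_nonneg p₁ p₂]


section

/-- The holomorphic family of bilayer solutions `F_k(z + z_S) u(z)`, `u = (u₁, u₂)`, for a simple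
magic `α`. -/
structure BilayerFamily (α : ℂ) (u₁ u₂ : ℂ → ℂ) (φ : ℂ → L2 (Fin 1 × Fin 2)) : Prop where
  simple : IsSimpleMagic α
  flat : IsFlat α 0 u₁ u₂
  ne : ¬∀ z, u₁ z = 0 ∧ u₂ z = 0
  zero₁ : u₁ (-zS) = 0
  zero₂ : u₂ (-zS) = 0
  ae_eq : ∀ k, ∀ᵐ z : ℂ, φ k (toTorus z) (0, 0) = twist k zS u₁ z ∧
    φ k (toTorus z) (0, 1) = twist k zS u₂ z

lemma mult_eq (n : ℕ) (p₁ p₂ : ℤ) (k : ℂ) : mult n p₁ p₂ k = mult 1 p₁ p₂ k ^ n := by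
  rw [mult, mult, pow_one]

lemma mult_ne (n : ℕ) (p₁ p₂ : ℤ) (k : ℂ) : mult n p₁ p₂ k ≠ 0 :=
  pow_ne_zero _ (mul_ne_zero (Complex.exp_ne_zero _) (zpow_ne_zero _ (by norm_num)))

lemma flatMult_ne (n : ℕ) (p₁ p₂ : ℤ) (k : ℂ) : flatMult n p₁ p₂ k ≠ 0 :=
  mul_ne_zero (Complex.exp_ne_zero _) (mult_ne n p₁ p₂ k)

lemma add_dualPt_div (k : ℂ) (p₁ p₂ : ℤ) :
    (k + dualPt p₁ p₂) / cDual = k / cDual + (om * p₁ - p₂) := by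
  rw [add_div, dualPt, mul_div_cancel_left₀ _ cDual_ne]

lemma theta_mul_mult (k : ℂ) (p₁ p₂ : ℤ) :
    theta ((k + dualPt p₁ p₂) / cDual) * mult 1 p₁ p₂ k = theta (k / cDual) := by
  rw [add_dualPt_div, mult, pow_one, theta_add]

/-- The behaviour of `F_k` under translations of `k` by the dual lattice. -/
lemma numF_mul_mult (k z : ℂ) (p₁ p₂ : ℤ) : numF (k + dualPt p₁ p₂) z * mult 1 p₁ p₂ k =
    Complex.exp (-Complex.I * pairing z (dualPt p₁ p₂)) * numF k z := by
  obtain ⟨x, y, hz⟩ := exists_coord cLam_ne z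
  have hζ : z / cLam = x + y * om := by rw [hz, mul_div_cancel_left₀ _ cLam_ne]
  have hθ := theta_add (z / cLam + k / cDual) p₁ p₂
  have hpair : (pairing z (dualPt p₁ p₂) : ℂ) = 2 * Real.pi * (x * p₁ + y * p₂) := by
    rw [hz, pairing_coord]; push_cast; ring
  have hsub : z / cLam - conj (z / cLam) = y * (Real.sqrt 3 * Complex.I) := by
    rw [hζ, ← om_sub_conj]
    simp only [map_add, map_mul, Complex.conj_ofReal]
    ring
  have hexp : expF (k + dualPt p₁ p₂) z = expF k z *
      Complex.exp (-Complex.I * pairing z (dualPt p₁ p₂)) *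
      Complex.exp (2 * Real.pi * Complex.I * (z / cLam) * p₁) := by
    rw [expF, expF, ← Complex.exp_add, ← Complex.exp_add, add_dualPt_div, hsub, hpair, hζ]
    congr 1
    have h3 := sqrt3_ne
    field_simp
    ring
  have hm : Complex.exp (Real.pi * Complex.I * p₁ ^ 2 * om +
      2 * Real.pi * Complex.I * (z / cLam + k / cDual) * p₁) =
      Complex.exp (Real.pi * Complex.I * p₁ ^ 2 * om + 2 * Real.pi * Complex.I * (k / cDual) * p₁) *
      Complex.exp (2 * Real.pi * Complex.I * (z / cLam) * p₁) := by
    rw [← Complex.exp_add]; congr 1; ring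
  rw [hm] at hθ
  rw [numF, numF, hexp, add_dualPt_div, mult, pow_one, ← hθ, add_assoc (z / cLam)]
  ring

lemma numF_zero (z : ℂ) : numF 0 z = theta (z / cLam) := by
  simp [numF, expF]

lemma twist_mul_flatMult (k z : ℂ) (p₁ p₂ : ℤ) (f : ℂ → ℂ) :
    flatMult 1 p₁ p₂ k * twist (k + dualPt p₁ p₂) zS f z =
      chi (-(3 * p₁, 3 * p₂)) z * twist k zS f z := by
  have h := numF_mul_mult k (z + zS) p₁ p₂
  have e : Complex.exp (Complex.I * pairing zS (dualPt p₁ p₂)) *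
      Complex.exp (-Complex.I * pairing (z + zS) (dualPt p₁ p₂)) = chi (-(3 * p₁, 3 * p₂)) z := by
    rw [chi, pt_neg, pt_three, ← Complex.exp_add, pairing_add_left, pairing_neg_right]
    push_cast; ring_nf
  rw [twist, twist, flatMult, ← e]
  linear_combination (Complex.exp (Complex.I * pairing zS (dualPt p₁ p₂)) * quot zS f z) * h

namespace BilayerFamily

variable {α : ℂ} {u₁ u₂ : ℂ → ℂ} {φ : ℂ → L2 (Fin 1 × Fin 2)} (B : BilayerFamily α u₁ u₂ φ)

include B

lemma isFlat (k : ℂ) : IsFlat α k (twist k zS u₁) (twist k zS u₂) := by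
  simpa using B.flat.twist B.zero₁ B.zero₂ k

lemma twist_ne (k : ℂ) : ¬∀ z, twist k zS u₁ z = 0 ∧ twist k zS u₂ z = 0 :=
  B.flat.twist_ne B.ne k zS

lemma coef₁ (k : ℂ) (m : ℤ × ℤ) : coef (φ k) (0, 0) m = fc (twist k zS u₁) m :=
  fc_congr (by filter_upwards [B.ae_eq k] with z hz; exact hz.1) m

lemma coef₂ (k : ℂ) (m : ℤ × ℤ) : coef (φ k) (0, 1) m = fc (twist k zS u₂) m :=
  fc_congr (by filter_upwards [B.ae_eq k] with z hz; exact hz.2) m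

lemma dvd₁ {k : ℂ} {m : ℤ × ℤ} (h : coef (φ k) (0, 0) m ≠ 0) :
    (3 : ℤ) ∣ 1 + m.1 ∧ (3 : ℤ) ∣ 1 + m.2 := by
  rw [B.coef₁] at h
  refine dvd_of_fc_ne_zero (c := 1) (B.isFlat k).contDiff₁.continuous (fun a₁ a₂ z => ?_) h
  rw [one_mul, (B.isFlat k).phase₁]

lemma dvd₂ {k : ℂ} {m : ℤ × ℤ} (h : coef (φ k) (0, 1) m ≠ 0) :
    (3 : ℤ) ∣ m.1 ∧ (3 : ℤ) ∣ m.2 := by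
  rw [B.coef₂] at h
  simpa using dvd_of_fc_ne_zero (c := 0) (B.isFlat k).contDiff₂.continuous (fun a₁ a₂ z => by
    rw [zero_mul, zpow_zero, one_mul, (B.isFlat k).phase₂]) h

lemma tau (k : ℂ) (p₁ p₂ : ℤ) (s : Fin 2) (m : ℤ × ℤ) :
    flatMult 1 p₁ p₂ k * coef (φ (k + dualPt p₁ p₂)) (0, s) m =
      coef (φ k) (0, s) (m + (3 * p₁, 3 * p₂)) := by
  fin_cases s
  · change flatMult 1 p₁ p₂ k * coef (φ (k + dualPt p₁ p₂)) (0, 0) m = coef (φ k) (0, 0) _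
    rw [B.coef₁, B.coef₁, ← fc_const_mul]
    simp only [twist_mul_flatMult]
    rw [fc_chi_mul, sub_neg_eq_add]
  · change flatMult 1 p₁ p₂ k * coef (φ (k + dualPt p₁ p₂)) (0, 1) m = coef (φ k) (0, 1) _
    rw [B.coef₂, B.coef₂, ← fc_const_mul]
    simp only [twist_mul_flatMult]
    rw [fc_chi_mul, sub_neg_eq_add]

/-- At a point of the dual lattice the resonant coefficient of the second component is a non-zero
multiple of the mean of `u₂`. -/
lemma coef_resonant_ne (h0 : fc u₂ 0 ≠ 0) (p₁ p₂ : ℤ) :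
    coef (φ (dualPt p₁ p₂)) (0, 1) (-(3 * p₁, 3 * p₂)) ≠ 0 := by
  have h1 := B.tau 0 p₁ p₂ 1 (-(3 * p₁, 3 * p₂))
  rw [zero_add, neg_add_cancel] at h1
  have h2 : coef (φ 0) (0, 1) 0 = fc u₂ 0 := by
    rw [B.coef₂]
    refine congrArg (fun f => fc f 0) (funext (eq_of_countable (B.isFlat 0).contDiff₂.continuous
      B.flat.contDiff₂.continuous (countable_den_zeros zS) fun z hz => ?_))
    rw [twist_eq hz, F_eq, numF_zero, ← den, div_self hz, one_mul]
  intro h3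
  rw [h3, mul_zero, h2] at h1
  exact h0 h1.symm

lemma coef_eq₁ (k : ℂ) (m : ℤ × ℤ) : (pt m + k) * coef (φ k) (0, 0) m +
    fc (fun z => α * U z * φ k (toTorus z) (0, 1)) m = 0 := by
  have h := B.isFlat k
  have hU : Continuous fun z => α * U z * twist k zS u₂ z :=
    (continuous_const.mul continuous_U).mul h.contDiff₂.continuous
  have h1 := fc_dz (g := fun z => -1 * (α * U z * twist k zS u₂ z + k * twist k zS u₁ z))
    h.contDiff₁.continuous (periodic_of_phase_scalar (c := 1) fun a₁ a₂ z => by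
      rw [one_mul, h.phase₁]) Set.countable_empty (fun z _ => h.differentiable₁ z)
    ((hU.add (h.contDiff₁.continuous.const_mul _)).const_mul _)
    (fun z _ => by linear_combination h.eq₁ z) m
  rw [fc_const_mul, fc_add (integrableOn_cell three_cLam_ne hU) (integrableOn_cell three_cLam_ne
    (h.contDiff₁.continuous.const_mul _)), fc_const_mul] at h1
  have h2 : fc (fun z => α * U z * φ k (toTorus z) (0, 1)) m =
      fc (fun z => α * U z * twist k zS u₂ z) m := fc_congr (by
    filter_upwards [B.ae_eq k] with z hz
    rw [hz.2]) m
  rw [h2, B.coef₁]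
  linear_combination -h1

lemma coef_eq₂ (k : ℂ) (m : ℤ × ℤ) : (pt m + k) * coef (φ k) (0, 1) m +
    fc (fun z => α * U (-z) * φ k (toTorus z) (0, 0)) m = 0 := by
  have h := B.isFlat k
  have hU : Continuous fun z => α * U (-z) * twist k zS u₁ z :=
    (continuous_const.mul (continuous_U.comp continuous_neg)).mul h.contDiff₁.continuous
  have h1 := fc_dz (g := fun z => -1 * (α * U (-z) * twist k zS u₁ z + k * twist k zS u₂ z))
    h.contDiff₂.continuous (periodic_of_phase_scalar (c := 0) fun a₁ a₂ z => by
      rw [zero_mul, zpow_zero, one_mul, h.phase₂]) Set.countable_empty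
    (fun z _ => h.differentiable₂ z)
    ((hU.add (h.contDiff₂.continuous.const_mul _)).const_mul _)
    (fun z _ => by linear_combination h.eq₂ z) m
  rw [fc_const_mul, fc_add (integrableOn_cell three_cLam_ne hU) (integrableOn_cell three_cLam_ne
    (h.contDiff₂.continuous.const_mul _)), fc_const_mul] at h1
  have h2 : fc (fun z => α * U (-z) * φ k (toTorus z) (0, 0)) m =
      fc (fun z => α * U (-z) * twist k zS u₁ z) m := fc_congr (by
    filter_upwards [B.ae_eq k] with z hz
    rw [hz.1]) m
  rw [h2, B.coef₂]
  linear_combination -h1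

end BilayerFamily

end


/-! ### The quotients of theta by its linear factors -/

lemma theta_div_cDual_eq_zero_iff (k : ℂ) : theta (k / cDual) = 0 ↔ k ∈ lattice cDual := by
  rw [theta_eq_zero_iff, mem_lattice_iff]
  simp only [div_eq_iff cDual_ne, mul_comm cDual]

lemma differentiable_theta_div : Differentiable ℂ fun k => theta (k / cDual) :=
  differentiable_theta.comp (by fun_prop)

open Classical in
/-- The quotient `θ(k/cDual) / (pt m + k)`, extended to its removable singularity, for `pt m` in the
dual lattice; it is `0` for the other frequencies. -/
noncomputable def thetaQuot (m : ℤ × ℤ) (k : ℂ) : ℂ :=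
  if (3 : ℤ) ∣ m.1 ∧ (3 : ℤ) ∣ m.2 then dslope (fun k => theta (k / cDual)) (-pt m) k else 0

lemma theta_neg_pt {m : ℤ × ℤ} (h : (3 : ℤ) ∣ m.1 ∧ (3 : ℤ) ∣ m.2) :
    theta (-pt m / cDual) = 0 :=
  (theta_div_cDual_eq_zero_iff _).2 (neg_mem (pt_mem_dual h.1 h.2))

lemma mul_thetaQuot {m : ℤ × ℤ} (h : (3 : ℤ) ∣ m.1 ∧ (3 : ℤ) ∣ m.2) (k : ℂ) :
    (pt m + k) * thetaQuot m k = theta (k / cDual) := by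
  have := sub_smul_dslope (fun k => theta (k / cDual)) (-pt m) k
  rw [theta_neg_pt h, sub_zero, smul_eq_mul] at this
  rw [thetaQuot, if_pos h, ← this]
  ring

lemma differentiable_thetaQuot (m : ℤ × ℤ) : Differentiable ℂ (thetaQuot m) := by
  by_cases h : (3 : ℤ) ∣ m.1 ∧ (3 : ℤ) ∣ m.2
  · have e : thetaQuot m = dslope (fun k => theta (k / cDual)) (-pt m) :=
      funext fun k => if_pos h
    rw [e, ← differentiableOn_univ, Complex.differentiableOn_dslope Filter.univ_mem]
    exact differentiable_theta_div.differentiableOn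
  · have e : thetaQuot m = fun _ => 0 := funext fun k => if_neg h
    rw [e]
    exact differentiable_const 0

lemma thetaQuot_self_ne {m : ℤ × ℤ} (h : (3 : ℤ) ∣ m.1 ∧ (3 : ℤ) ∣ m.2) :
    thetaQuot m (-pt m) ≠ 0 := by
  rw [thetaQuot, if_pos h, dslope_same]
  have h1 : HasDerivAt (fun k : ℂ => k / cDual) (1 / cDual) (-pt m) := (hasDerivAt_id _).div_const _
  have h2 : HasDerivAt (fun k => theta (k / cDual)) (deriv theta (-pt m / cDual) * (1 / cDual))
    (-pt m) := (differentiable_theta _).hasDerivAt.comp _ h1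
  rw [h2.deriv]
  exact mul_ne_zero (deriv_theta_ne_zero (theta_neg_pt h)) (one_div_ne_zero cDual_ne)

/-- The bound is uniform in the frequency, by the maximum principle near the singularity. -/
lemma exists_bound_thetaQuot (k₀ : ℂ) :
    ∃ C, 0 ≤ C ∧ ∀ m, ∀ k ∈ Metric.ball k₀ 1, ‖thetaQuot m k‖ ≤ C := by
  obtain ⟨C, hC⟩ := (isCompact_closedBall k₀ 4).exists_bound_of_continuousOn
    differentiable_theta_div.continuous.continuousOn
  have hC0 : 0 ≤ C := (norm_nonneg _).trans (hC k₀ (Metric.mem_closedBall_self (by norm_num)))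
  refine ⟨C, hC0, fun m k hk => ?_⟩
  by_cases h : (3 : ℤ) ∣ m.1 ∧ (3 : ℤ) ∣ m.2
  · have far : ∀ k ∈ Metric.closedBall k₀ 4, 1 ≤ ‖pt m + k‖ → ‖thetaQuot m k‖ ≤ C := by
      intro k hk h1
      have h2 := hC k hk
      rw [← mul_thetaQuot h k, norm_mul] at h2
      exact (le_mul_of_one_le_left (norm_nonneg _) h1).trans h2
    rw [mem_ball_iff_norm] at hk
    by_cases h1 : 1 ≤ ‖pt m + k‖
    · exact far k (by rw [mem_closedBall_iff_norm]; linarith) h1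
    · refine Complex.norm_le_of_forall_mem_frontier_norm_le (U := Metric.ball (-pt m) 1)
        Metric.isBounded_ball (differentiable_thetaQuot m).diffContOnCl (fun w hw => ?_) ?_
      · rw [frontier_ball _ one_ne_zero, mem_sphere_iff_norm, sub_neg_eq_add] at hw
        refine far w ?_ (by rw [add_comm]; exact hw.ge)
        rw [mem_closedBall_iff_norm]
        have e : w - k₀ = (w + pt m) - (pt m + k) + (k - k₀) := by ring
        rw [e]
        refine (norm_add_le _ _).trans ?_
        have := norm_sub_le (w + pt m) (pt m + k)
        linarith
      · refine subset_closure ?_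
        rw [mem_ball_iff_norm, sub_neg_eq_add, add_comm]
        exact not_le.1 h1
  · rw [thetaQuot, if_neg h, norm_zero]; exact hC0

/-- A translation of `k` by the dual lattice is a shift of the frequency, up to the multiplier. -/
lemma thetaQuot_mul_mult (m : ℤ × ℤ) (p₁ p₂ : ℤ) (k : ℂ) :
    thetaQuot m (k + dualPt p₁ p₂) * mult 1 p₁ p₂ k = thetaQuot (m + (3 * p₁, 3 * p₂)) k := by
  have hiff : ((3 : ℤ) ∣ (m + (3 * p₁, 3 * p₂)).1 ∧ (3 : ℤ) ∣ (m + (3 * p₁, 3 * p₂)).2) ↔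
      (3 : ℤ) ∣ m.1 ∧ (3 : ℤ) ∣ m.2 := by
    simp only [Prod.fst_add, Prod.snd_add]
    omega
  by_cases h : (3 : ℤ) ∣ m.1 ∧ (3 : ℤ) ∣ m.2
  · have hpt : pt (m + (3 * p₁, 3 * p₂)) = pt m + dualPt p₁ p₂ := by rw [pt_add, pt_three]
    have hm : Continuous fun k => mult 1 p₁ p₂ k := by
      unfold mult; fun_prop
    have h1 : Continuous fun k => thetaQuot m (k + dualPt p₁ p₂) * mult 1 p₁ p₂ k :=
      ((differentiable_thetaQuot m).continuous.comp (continuous_add_const _)).mul hm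
    refine congrFun (Continuous.ext_on (dense_compl_singleton (-pt (m + (3 * p₁, 3 * p₂)))) h1
      (differentiable_thetaQuot _).continuous fun k hk => ?_) k
    have hne : pt m + (k + dualPt p₁ p₂) ≠ 0 := by
      intro h0
      refine hk ?_
      rw [Set.mem_singleton_iff, hpt]
      linear_combination h0
    refine mul_left_cancel₀ hne ?_
    rw [← mul_assoc, mul_thetaQuot h, theta_mul_mult, ← mul_thetaQuot (hiff.2 h), hpt]
    ring
  · rw [thetaQuot, thetaQuot, if_neg h, if_neg fun h' => h (hiff.1 h'), zero_mul]

/-! ### The multilayer equation -/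

/-- The component `(j, s)` of a vector, `0` if `j` is not the number of a layer. -/
def layer {n : ℕ} (x : Fin n × Fin 2 → ℂ) (j : ℕ) (s : Fin 2) : ℂ :=
  if h : j < n then x (⟨j, h⟩, s) else 0

lemma layer_val {n : ℕ} (x : Fin n × Fin 2 → ℂ) (j : Fin n) (s : Fin 2) :
    layer x j s = x (j, s) := dif_pos j.2

lemma sum_ite_val {n : ℕ} (a : ℕ) (g : Fin n → ℂ) :
    ∑ j : Fin n, (if j.val = a then g j else 0) = if h : a < n then g ⟨a, h⟩ else 0 := by
  split_ifs with h
  · rw [Finset.sum_eq_single ⟨a, h⟩]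
    · simp
    · intro j _ hj
      rw [if_neg]
      exact fun h' => hj (Fin.ext h')
    · simp
  · refine Finset.sum_eq_zero fun j _ => if_neg ?_
    rintro rfl
    exact h j.2

lemma potential_mulVec_zero (n : ℕ) (t : ℕ → ℝ) (α k z : ℂ) (x : Fin n × Fin 2 → ℂ) (j : Fin n) :
    ((potential n t α z + k • (1 : Matrix (Fin n × Fin 2) (Fin n × Fin 2) ℂ)) *ᵥ x) (j, 0) =
      (if j.val = 0 then α * U z * layer x 0 1 else 0) + t (j + 1) * layer x (j + 1) 0 +
        k * layer x j 0 := by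
  rw [Matrix.add_mulVec, Matrix.smul_mulVec, Matrix.one_mulVec, Pi.add_apply, Pi.smul_apply,
    smul_eq_mul, layer_val]
  congr 1
  rw [Matrix.mulVec, dotProduct, Fintype.sum_prod_type]
  have e : ∀ j' : Fin n, ∑ r : Fin 2, potential n t α z (j, 0) (j', r) * x (j', r) =
      (if j'.val = 0 then if j.val = 0 then α * U z * x (j', 1) else 0 else 0) +
        if j'.val = j.val + 1 then t (j + 1) * x (j', 0) else 0 := by
    intro j'
    rw [Fin.sum_univ_two]
    simp only [potential, Matrix.of_apply, potentialBlock]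
    by_cases h1 : j'.val = 0
    · have h2 : j'.val ≠ j.val + 1 := by omega
      by_cases h3 : j.val = 0
      · simp [h1, h3]
      · by_cases h4 : j.val = j'.val + 1
        · rw [if_neg (fun h => h3 h.1), if_neg h2, if_pos h4, if_pos h1, if_neg h3, if_neg h2]
          simp
        · rw [if_neg (fun h => h3 h.1), if_neg h2, if_neg h4, if_pos h1, if_neg h3, if_neg h2]
          simp
    · rw [if_neg (fun h => h1 h.2), if_neg h1]
      by_cases h2 : j'.val = j.val + 1
      · simp [h2]
      · by_cases h4 : j.val = j'.val + 1
        · rw [if_neg h2, if_pos h4, if_neg h2]; simp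
        · rw [if_neg h2, if_neg h4, if_neg h2]; simp
  simp only [e]
  rw [Finset.sum_add_distrib, sum_ite_val, sum_ite_val, layer, layer]
  have hn : 0 < n := j.pos
  rw [dif_pos hn, dif_pos hn]
  congr 1
  split_ifs <;> simp

lemma potential_mulVec_one (n : ℕ) (t : ℕ → ℝ) (α k z : ℂ) (x : Fin n × Fin 2 → ℂ) (j : Fin n) :
    ((potential n t α z + k • (1 : Matrix (Fin n × Fin 2) (Fin n × Fin 2) ℂ)) *ᵥ x) (j, 1) =
      (if j.val = 0 then α * U (-z) * layer x 0 0 else t j * layer x (j - 1) 1) +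
        k * layer x j 1 := by
  rw [Matrix.add_mulVec, Matrix.smul_mulVec, Matrix.one_mulVec, Pi.add_apply, Pi.smul_apply,
    smul_eq_mul, layer_val]
  congr 1
  rw [Matrix.mulVec, dotProduct, Fintype.sum_prod_type]
  have e : ∀ j' : Fin n, ∑ r : Fin 2, potential n t α z (j, 1) (j', r) * x (j', r) =
      if j'.val = j.val - 1 then
        if j.val = 0 then α * U (-z) * x (j', 0) else t j * x (j', 1) else 0 := by
    intro j'
    rw [Fin.sum_univ_two]
    simp only [potential, Matrix.of_apply, potentialBlock]
    by_cases h3 : j.val = 0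
    · by_cases h1 : j'.val = 0
      · simp [h1, h3]
      · have h4 : ¬j.val = j'.val + 1 := by omega
        have h5 : ¬j'.val = j.val - 1 := by omega
        rw [if_neg (fun h => h1 h.2), if_neg h4, if_neg h5]
        split_ifs <;> simp
    · rw [if_neg (fun h => h3 h.1), if_neg h3]
      by_cases h4 : j.val = j'.val + 1
      · have h2 : ¬j'.val = j.val + 1 := by omega
        have h5 : j'.val = j.val - 1 := by omega
        rw [if_neg h2, if_pos h4, if_pos h5]
        simp
      · have h5 : ¬j'.val = j.val - 1 := by omega
        rw [if_neg h4, if_neg h5]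
        split_ifs <;> simp
  simp only [e]
  rw [sum_ite_val, layer, layer]
  have hn : 0 < n := j.pos
  have hj : j.val - 1 < n := by have := j.2; omega
  rw [dif_pos hn, dif_pos hj, dif_pos hj]
  split_ifs with h
  · simp [h]
  · rfl

lemma isTrig_potential (n : ℕ) (t : ℕ → ℝ) (α k : ℂ) (i j : Fin n × Fin 2) : IsTrig fun z =>
    (potential n t α z + k • (1 : Matrix (Fin n × Fin 2) (Fin n × Fin 2) ℂ)) i j := by
  refine IsTrig.add ?_ (isTrig_const _)
  obtain ⟨i, s⟩ := i
  obtain ⟨j, r⟩ := j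
  simp only [potential, Matrix.of_apply, potentialBlock]
  split_ifs with h1 h2 h3
  · fin_cases s <;> fin_cases r
    · exact isTrig_const 0
    · exact isTrig_U.const_mul α
    · exact isTrig_U_neg.const_mul α
    · exact isTrig_const 0
  · exact isTrig_const _
  · exact isTrig_const _
  · exact isTrig_const _


section

/-! ### The flat band functions of the multilayer -/

section General

variable {ι : Type} [Fintype ι]

lemma ae_sum {κ : Type*} (s : Finset κ) (w : κ → L2 ι) :
    ∀ᵐ z : ℂ, (∑ i ∈ s, w i) (toTorus z) = ∑ i ∈ s, w i (toTorus z) := by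
  classical
  induction s using Finset.induction_on with
  | empty => simpa using ae_zero
  | insert a s ha ih =>
    filter_upwards [ih, ae_add (w a) (∑ i ∈ s, w i)] with z h1 h2
    rw [Finset.sum_insert ha, Finset.sum_insert ha, h2, h1]

variable [DecidableEq ι]

lemma exists_mulVec {V : ℂ → Matrix ι ι ℂ} (hV : ∀ i j, IsTrig fun z => V z i j) (v : L2 ι) :
    ∃ h : L2 ι, ∀ᵐ z : ℂ, (h (toTorus z)).ofLp = V z *ᵥ (v (toTorus z)).ofLp := by
  choose w hw using fun q : ι × ι =>
    exists_mul _ (hV q.1 q.2).continuous (fun a ha z => (hV q.1 q.2).periodic a ha z) v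
  refine ⟨∑ q, matL2 (Matrix.single q.1 q.2 1) (w q), ?_⟩
  have hall : ∀ᵐ z : ℂ, ∀ q : ι × ι, w q (toTorus z) = V z q.1 q.2 • v (toTorus z) ∧
      (matL2 (Matrix.single q.1 q.2 1) (w q) (toTorus z)).ofLp =
        Matrix.single q.1 q.2 1 *ᵥ (w q (toTorus z)).ofLp :=
    ae_all_iff.2 fun q => (hw q).and (matL2_ae _ _)
  filter_upwards [hall, ae_sum Finset.univ fun q : ι × ι => matL2 (Matrix.single q.1 q.2 1) (w q)]
    with z h1 h2
  rw [h2, WithLp.ofLp_sum]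
  funext i
  have e : ∀ q : ι × ι, (matL2 (Matrix.single q.1 q.2 1) (w q) (toTorus z)).ofLp i =
      if q.1 = i then V z i q.2 * v (toTorus z) q.2 else 0 := by
    intro q
    rw [(h1 q).2, (h1 q).1]
    simp only [Matrix.mulVec, dotProduct, Matrix.single_apply, ite_mul, one_mul, zero_mul,
      WithLp.ofLp_smul, Pi.smul_apply, smul_eq_mul, ite_and]
    by_cases hq : q.1 = i
    · simp [hq]
    · simp [hq]
  rw [Finset.sum_apply, Finset.sum_congr rfl fun q _ => e q, Fintype.sum_prod_type,
    Finset.sum_eq_single i]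
  · simp only [if_true]; rfl
  · intro j _ hj
    simp only [if_neg hj, Finset.sum_const_zero]
  · simp

lemma sum_coef_le (v : L2 ι) (i : ι) (T : Finset (ℤ × ℤ)) :
    ∑ m ∈ T, ‖coef v i m‖ ^ 2 ≤ area * ‖v‖ ^ 2 := by
  have h := sum_le_hasSum (T.map ⟨fun m => (i, m), fun a b h => (Prod.mk.inj h).2⟩)
    (fun _ _ => by positivity) (hasSum_coef v)
  rwa [Finset.sum_map] at h

end General

variable {n : ℕ} {t : ℕ → ℝ} {α k : ℂ}

lemma fc_layer (v : L2 (Fin n × Fin 2)) (j : ℕ) (s : Fin 2) (m : ℤ × ℤ) :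
    fc (fun z => layer (v (toTorus z)).ofLp j s) m = layer (coefv v m) j s := by
  unfold layer
  split_ifs
  · rfl
  · exact fc_zero m

lemma integrableOn_layer (v : L2 (Fin n × Fin 2)) (j : ℕ) (s : Fin 2) :
    IntegrableOn (fun z => layer (v (toTorus z)).ofLp j s) (cell (3 * cLam)) := by
  unfold layer
  split_ifs
  · exact integrableOn_component v _
  · exact integrableOn_zero

lemma integrableOn_mul_layer {ψ : ℂ → ℂ} (hψ : Continuous ψ) (v : L2 (Fin n × Fin 2)) (j : ℕ)
    (s : Fin 2) :
    IntegrableOn (fun z => ψ z * layer (v (toTorus z)).ofLp j s) (cell (3 * cLam)) := by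
  unfold layer
  split_ifs
  · simpa only [mul_comm] using integrable_mul v _ hψ
  · simp

/-- The multilayer equation in terms of the Fourier coefficients. -/
lemma mem_kerDn_of_coef {v : L2 (Fin n × Fin 2)} (hv : v ∈ L20 (layerCharge n))
    (h₁ : ∀ (j : Fin n) m, (pt m + k) * layer (coefv v m) j 0 + (if j.val = 0 then
      fc (fun z => α * U z * layer (v (toTorus z)).ofLp 0 1) m else 0) +
      t (j + 1) * layer (coefv v m) (j + 1) 0 = 0)
    (h₂ : ∀ (j : Fin n) m, (pt m + k) * layer (coefv v m) j 1 + (if j.val = 0 then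
      fc (fun z => α * U (-z) * layer (v (toTorus z)).ofLp 0 0) m else
      t j * layer (coefv v m) (j - 1) 1) = 0) : v ∈ kerDn n t α k := by
  obtain ⟨h, hh⟩ := exists_mulVec (isTrig_potential n t α k) v
  refine ⟨hv, (elliptic_dbar _).maps_of_coef (h := h) hh fun m => ?_⟩
  have hc1 : Continuous fun z => α * U z := continuous_const.mul continuous_U
  have hc2 : Continuous fun z => α * U (-z) :=
    continuous_const.mul (continuous_U.comp continuous_neg)
  have il := integrableOn_layer v
  have iu1 := integrableOn_mul_layer hc1 v
  have iu2 := integrableOn_mul_layer hc2 v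
  funext i
  rw [symbol_dbar, Matrix.smul_mulVec, Matrix.one_mulVec]
  simp only [Pi.add_apply, Pi.smul_apply, smul_eq_mul]
  have e0 : coefv (0 : L2 (Fin n × Fin 2)) m i = 0 := coef_zero i m
  rw [e0]
  obtain ⟨j, s⟩ := i
  have hs : s = 0 ∨ s = 1 := by fin_cases s <;> simp
  rcases hs with rfl | rfl
  · have e : coefv h m (j, 0) = (if j.val = 0 then
        fc (fun z => α * U z * layer (v (toTorus z)).ofLp 0 1) m else 0) +
        t (j + 1) * layer (coefv v m) (j + 1) 0 + k * layer (coefv v m) j 0 := by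
      have e1 : coefv h m (j, 0) = fc (fun z => ((if j.val = 0 then
          α * U z * layer (v (toTorus z)).ofLp 0 1 else 0) +
          t (j + 1) * layer (v (toTorus z)).ofLp (j + 1) 0) +
          k * layer (v (toTorus z)).ofLp j 0) m := fc_congr (by
        filter_upwards [hh] with z hz
        rw [hz, potential_mulVec_zero]) m
      have i1 : IntegrableOn (fun z => if j.val = 0 then
          α * U z * layer (v (toTorus z)).ofLp 0 1 else 0) (cell (3 * cLam)) := by
        split_ifs
        · exact iu1 0 1
        · exact integrableOn_zero
      have i2 : IntegrableOn (fun z => (if j.val = 0 then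
          α * U z * layer (v (toTorus z)).ofLp 0 1 else 0) +
          t (j + 1) * layer (v (toTorus z)).ofLp (j + 1) 0) (cell (3 * cLam)) :=
        i1.add ((il _ _).const_mul _)
      rw [e1, fc_add i2 ((il _ _).const_mul _),
        fc_add i1 ((il _ _).const_mul _), fc_const_mul, fc_const_mul, fc_layer, fc_layer]
      congr 2
      split_ifs
      · rfl
      · exact fc_zero m
    rw [e]
    have := h₁ j m
    rw [layer_val] at this ⊢
    linear_combination this - pt m * coefv v m (j, 0) * Complex.I_sq
  · have e : coefv h m (j, 1) = (if j.val = 0 then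
        fc (fun z => α * U (-z) * layer (v (toTorus z)).ofLp 0 0) m else
        t j * layer (coefv v m) (j - 1) 1) + k * layer (coefv v m) j 1 := by
      have e1 : coefv h m (j, 1) = fc (fun z => (if j.val = 0 then
          α * U (-z) * layer (v (toTorus z)).ofLp 0 0 else
          t j * layer (v (toTorus z)).ofLp (j - 1) 1) +
          k * layer (v (toTorus z)).ofLp j 1) m := fc_congr (by
        filter_upwards [hh] with z hz
        rw [hz, potential_mulVec_one]) m
      have i1 : IntegrableOn (fun z => if j.val = 0 then
          α * U (-z) * layer (v (toTorus z)).ofLp 0 0 else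
          t j * layer (v (toTorus z)).ofLp (j - 1) 1) (cell (3 * cLam)) := by
        split_ifs
        · exact iu2 0 0
        · exact (il _ _).const_mul _
      rw [e1, fc_add i1 ((il _ _).const_mul _), fc_const_mul, fc_layer]
      congr 1
      split_ifs
      · rfl
      · rw [fc_const_mul, fc_layer]
    rw [e]
    have := h₂ j m
    rw [layer_val] at this ⊢
    linear_combination this - pt m * coefv v m (j, 1) * Complex.I_sq

/-- The Fourier coefficients of the multilayer flat band function: its bilayer part is multiplied by
`θ(k/cDual)^(n-1)`, and each further layer trades one factor `θ(k/cDual)` for a division by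
`pt m + k`, as the resolvent of `2 D_{z̄}` requires. -/
noncomputable def amp (n : ℕ) (t : ℕ → ℝ) (φ : ℂ → L2 (Fin 1 × Fin 2)) (k : ℂ) (j : ℕ) (s : Fin 2)
    (m : ℤ × ℤ) : ℂ :=
  if s = 0 then if j = 0 then theta (k / cDual) ^ (n - 1) * coef (φ k) (0, 0) m else 0
  else (-1) ^ j * (∏ i ∈ Finset.Icc 1 j, (t i : ℂ)) * thetaQuot m k ^ j *
    theta (k / cDual) ^ (n - 1 - j) * coef (φ k) (0, 1) m

variable {φ : ℂ → L2 (Fin 1 × Fin 2)}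

lemma amp_zero_zero (m : ℤ × ℤ) :
    amp n t φ k 0 0 m = theta (k / cDual) ^ (n - 1) * coef (φ k) (0, 0) m := by
  simp [amp]

lemma amp_zero (j : ℕ) (hj : j ≠ 0) (m : ℤ × ℤ) : amp n t φ k j 0 m = 0 := by
  simp [amp, hj]

lemma amp_one (j : ℕ) (m : ℤ × ℤ) : amp n t φ k j 1 m =
    (-1) ^ j * (∏ i ∈ Finset.Icc 1 j, (t i : ℂ)) * thetaQuot m k ^ j *
    theta (k / cDual) ^ (n - 1 - j) * coef (φ k) (0, 1) m := by
  simp [amp]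

lemma amp_zero_one (m : ℤ × ℤ) :
    amp n t φ k 0 1 m = theta (k / cDual) ^ (n - 1) * coef (φ k) (0, 1) m := by
  simp [amp]

lemma differentiable_amp (hφ : Differentiable ℂ φ) (j : ℕ) (s : Fin 2) (m : ℤ × ℤ) :
    Differentiable ℂ fun k => amp n t φ k j s m := by
  have hc : ∀ i, Differentiable ℂ fun k => coef (φ k) i m := fun i => by
    simp only [← coefCLM_apply]
    exact (coefCLM i m).differentiable.comp hφ
  have hθ := differentiable_theta_div
  have hq := differentiable_thetaQuot m
  unfold amp
  split_ifs
  · exact (hθ.pow _).mul (hc _)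
  · exact differentiable_const 0
  · exact (((hq.pow j).const_mul _).mul (hθ.pow _)).mul (hc _)

lemma exists_bound_amp (n : ℕ) (t : ℕ → ℝ) (φ : ℂ → L2 (Fin 1 × Fin 2)) (k₀ : ℂ) : ∃ D, 0 ≤ D ∧
    ∀ k ∈ Metric.ball k₀ 1, ∀ (j : Fin n) (s : Fin 2) (m : ℤ × ℤ),
      ‖amp n t φ k j s m‖ ≤ D * ‖coef (φ k) (0, s) m‖ := by
  obtain ⟨C, hC0, hC⟩ := exists_bound_thetaQuot k₀
  obtain ⟨K, hK⟩ := (isCompact_closedBall k₀ 1).exists_bound_of_continuousOn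
    differentiable_theta_div.continuous.continuousOn
  have hK0 : 0 ≤ K := (norm_nonneg _).trans (hK k₀ (Metric.mem_closedBall_self zero_le_one))
  set d : ℕ → ℝ := fun j => ‖∏ i ∈ Finset.Icc 1 j, (t i : ℂ)‖ * C ^ j * K ^ (n - 1 - j) with hd
  have hd0 : ∀ j, 0 ≤ d j := fun j => by positivity
  refine ⟨K ^ (n - 1) + ∑ j : Fin n, d j, by positivity, fun k hk j s m => ?_⟩
  have hk' := hK k (Metric.ball_subset_closedBall hk)
  have hs : 0 ≤ ∑ j : Fin n, d j := Finset.sum_nonneg fun j _ => hd0 j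
  have hp : 0 ≤ K ^ (n - 1) := by positivity
  have hs01 : s = 0 ∨ s = 1 := by fin_cases s <;> simp
  rcases hs01 with rfl | rfl
  · by_cases hj : j.val = 0
    · rw [hj, amp_zero_zero, norm_mul, norm_pow]
      gcongr
      exact (pow_le_pow_left₀ (norm_nonneg _) hk' _).trans (by linarith)
    · rw [amp_zero _ hj, norm_zero]; positivity
  · rw [amp_one, norm_mul]
    gcongr
    rw [norm_mul, norm_mul, norm_mul, norm_pow, norm_pow, norm_pow, norm_neg, norm_one, one_pow,
      one_mul]
    have h1 : d j ≤ ∑ j : Fin n, d j :=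
      Finset.single_le_sum (f := fun j : Fin n => d j) (fun j _ => hd0 j) (Finset.mem_univ j)
    have h2 : ‖∏ i ∈ Finset.Icc 1 j.val, (t i : ℂ)‖ * ‖thetaQuot m k‖ ^ j.val *
        ‖theta (k / cDual)‖ ^ (n - 1 - j) ≤ d j := by
      simp only [hd]
      gcongr
      exact hC m k hk
    linarith

lemma sum_amp_le {D : ℝ} (hD : ∀ (j : Fin n) (s : Fin 2) (m : ℤ × ℤ),
      ‖amp n t φ k j s m‖ ≤ D * ‖coef (φ k) (0, s) m‖) (i : Fin n × Fin 2) (T : Finset (ℤ × ℤ)) :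
    ∑ m ∈ T, ‖amp n t φ k i.1 i.2 m‖ ^ 2 ≤ D ^ 2 * (area * ‖φ k‖ ^ 2) := by
  calc ∑ m ∈ T, ‖amp n t φ k i.1 i.2 m‖ ^ 2 ≤
      ∑ m ∈ T, D ^ 2 * ‖coef (φ k) (0, i.2) m‖ ^ 2 := by
        refine Finset.sum_le_sum fun m _ => ?_
        rw [← mul_pow]
        exact pow_le_pow_left₀ (norm_nonneg _) (hD i.1 i.2 m) 2
    _ ≤ _ := by
        rw [← Finset.mul_sum]
        gcongr
        exact sum_coef_le _ _ _

/-- The multilayer flat band functions form a holomorphic family of square-integrable functions. -/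
lemma exists_multilayer_family (n : ℕ) (t : ℕ → ℝ) (hφ : Differentiable ℂ φ) :
    ∃ Φ : ℂ → L2 (Fin n × Fin 2), Differentiable ℂ Φ ∧
      ∀ k (i : Fin n × Fin 2) m, coef (Φ k) i m = amp n t φ k i.1 i.2 m := by
  have hex : ∀ k, ∃ v : L2 (Fin n × Fin 2), ∀ i m, coef v i m = amp n t φ k i.1 i.2 m := by
    intro k
    obtain ⟨D, -, hD⟩ := exists_bound_amp n t φ k
    refine exists_coef (fun (i : Fin n × Fin 2) m => amp n t φ k i.1 i.2 m) fun i => ?_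
    exact summable_of_sum_le (fun _ => sq_nonneg _)
      (sum_amp_le (hD k (Metric.mem_ball_self one_pos)) i)
  choose Φ hΦ using hex
  refine ⟨Φ, differentiable_of_coef (fun i m => ?_) (fun k₀ => ?_), hΦ⟩
  · simp only [hΦ]
    exact differentiable_amp hφ _ _ _
  · obtain ⟨D, hD0, hD⟩ := exists_bound_amp n t φ k₀
    obtain ⟨M, hM⟩ := (isCompact_closedBall k₀ 1).exists_bound_of_continuousOn
      hφ.continuous.continuousOn
    have hM0 : 0 ≤ M := (norm_nonneg _).trans (hM k₀ (Metric.mem_closedBall_self zero_le_one))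
    have ha := area_pos
    set K := (Fintype.card (Fin n × Fin 2) : ℝ) * (D ^ 2 * M ^ 2) with hKdef
    refine ⟨Real.sqrt K, fun k hk => Real.le_sqrt_of_sq_le ?_⟩
    have h1 : area * ‖Φ k‖ ^ 2 ≤ area * K := by
      refine hasSum_le_of_sum_le (hasSum_coef (Φ k)) fun S => ?_
      classical
      calc ∑ q ∈ S, ‖coef (Φ k) q.1 q.2‖ ^ 2
          ≤ ∑ q ∈ Finset.univ ×ˢ S.image Prod.snd, ‖coef (Φ k) q.1 q.2‖ ^ 2 := by
            refine Finset.sum_le_sum_of_subset_of_nonneg (fun q hq => ?_) fun _ _ _ => by positivity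
            rw [Finset.mem_product]
            exact ⟨Finset.mem_univ _, Finset.mem_image_of_mem _ hq⟩
        _ = ∑ i : Fin n × Fin 2, ∑ m ∈ S.image Prod.snd, ‖amp n t φ k i.1 i.2 m‖ ^ 2 := by
            rw [Finset.sum_product]
            simp only [hΦ]
        _ ≤ ∑ _i : Fin n × Fin 2, D ^ 2 * (area * M ^ 2) := by
            refine Finset.sum_le_sum fun i _ => (sum_amp_le (hD k hk) i _).trans ?_
            have := hM k (Metric.ball_subset_closedBall hk)
            gcongr
        _ = area * K := by
            rw [Finset.sum_const, Finset.card_univ, nsmul_eq_mul, hKdef]; ring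
    exact le_of_mul_le_mul_left h1 ha

end


section

section Component

variable {ι κ : Type} [Fintype ι] [DecidableEq ι] [Fintype κ] [DecidableEq κ]

lemma component_ae (i : ι) (v : L2 ι) :
    ∀ᵐ z : ℂ, component i v (toTorus z) () = v (toTorus z) i := by
  filter_upwards [quasi_toTorus.ae (((EuclideanSpace.proj i : EuclideanSpace ℂ ι →L[ℂ] ℂ).smulRight
    (EuclideanSpace.single () (1 : ℂ))).coeFn_compLp v)] with z hz
  rw [component, hz]
  simp

lemma coef_component (i : ι) (v : L2 ι) (m : ℤ × ℤ) : coef (component i v) () m = coef v i m :=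
  fc_congr (component_ae i v) m

lemma ae_eq_of_coef {v : L2 ι} {w : L2 κ} {i : ι} {j : κ} {c : ℂ}
    (h : ∀ m, coef v i m = c * coef w j m) :
    ∀ᵐ z : ℂ, v (toTorus z) i = c * w (toTorus z) j := by
  have e : component i v = c • component j w :=
    L2_ext_coef fun _ m => by rw [coef_smul, coef_component, coef_component, h]
  filter_upwards [component_ae i v, component_ae j w, ae_smul c (component j w)] with z h1 h2 h3
  rw [← h1, e, h3, ← h2]
  rfl

end Component

variable {n : ℕ} {t : ℕ → ℝ} {α : ℂ} {u₁ u₂ : ℂ → ℂ} {φ : ℂ → L2 (Fin 1 × Fin 2)}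
  {Φ : ℂ → L2 (Fin n × Fin 2)}

lemma layer_of_lt {x : Fin n × Fin 2 → ℂ} {j : ℕ} (h : j < n) (s : Fin 2) :
    layer x j s = x (⟨j, h⟩, s) := dif_pos h

lemma layer_of_le {x : Fin n × Fin 2 → ℂ} {j : ℕ} (h : n ≤ j) (s : Fin 2) :
    layer x j s = 0 := dif_neg (not_lt.2 h)

/-- The equation of layer `j + 1` for the second components. It holds at resonances as well, where the
resolvent does not exist, because `thetaQuot` carries a factor `θ` in place of the division. -/
lemma BilayerFamily.amp_rec (B : BilayerFamily α u₁ u₂ φ) (k : ℂ) {j : ℕ} (hj : j + 1 < n)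
    (m : ℤ × ℤ) : (pt m + k) * amp n t φ k (j + 1) 1 m + t (j + 1) * amp n t φ k j 1 m = 0 := by
  rw [amp_one, amp_one]
  by_cases h : coef (φ k) (0, 1) m = 0
  · rw [h]; ring
  · have h1 := mul_thetaQuot (B.dvd₂ h) k
    have e : n - 1 - j = n - 1 - (j + 1) + 1 := by omega
    rw [Finset.prod_Icc_succ_top (by omega), e, pow_succ (-1 : ℂ), pow_succ (thetaQuot m k),
      pow_succ (theta (k / cDual)), ← h1]
    ring

/-- The multilayer flat band functions solve the multilayer equation. -/
lemma BilayerFamily.mem_kerDn (B : BilayerFamily α u₁ u₂ φ)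
    (hΦ : ∀ k (i : Fin n × Fin 2) m, coef (Φ k) i m = amp n t φ k i.1 i.2 m) (k : ℂ) :
    Φ k ∈ kerDn n t α k := by
  have hl : ∀ j s m, j < n → layer (coefv (Φ k) m) j s = amp n t φ k j s m := fun j s m hj => by
    rw [layer_of_lt hj]; exact hΦ k _ m
  have hae : 0 < n → ∀ s, ∀ᵐ z : ℂ, layer (Φ k (toTorus z)).ofLp 0 s =
      theta (k / cDual) ^ (n - 1) * φ k (toTorus z) (0, s) := by
    intro hn s
    have := ae_eq_of_coef (v := Φ k) (w := φ k) (i := (⟨0, hn⟩, s)) (j := (0, s))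
      (c := theta (k / cDual) ^ (n - 1)) fun m => by
        rw [hΦ]
        have hs : s = 0 ∨ s = 1 := by fin_cases s <;> simp
        rcases hs with rfl | rfl
        · exact amp_zero_zero m
        · exact amp_zero_one m
    filter_upwards [this] with z hz
    rw [layer_of_lt hn, hz]
  refine mem_kerDn_of_coef ((mem_L20_iff _ _).2 ?_) (fun j m => ?_) (fun j m => ?_)
  · rintro ⟨j, s⟩ m h
    rw [hΦ] at h
    have hs : s = 0 ∨ s = 1 := by fin_cases s <;> simp
    rcases hs with rfl | rfl
    · by_cases hj : j.val = 0
      · rw [hj, amp_zero_zero] at h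
        simpa [layerCharge] using B.dvd₁ (right_ne_zero_of_mul h)
      · exact absurd (amp_zero _ hj m) h
    · rw [amp_one] at h
      simpa [layerCharge] using B.dvd₂ (right_ne_zero_of_mul h)
  · have h1 : layer (coefv (Φ k) m) (j + 1) 0 = 0 := by
      by_cases hj : j.val + 1 < n
      · rw [hl _ _ _ hj, amp_zero _ (by omega)]
      · exact layer_of_le (not_lt.1 hj) 0
    rw [h1, mul_zero, add_zero, hl _ _ _ j.2]
    split_ifs with hj
    · rw [hj, amp_zero_zero]
      have e : fc (fun z => α * U z * layer (Φ k (toTorus z)).ofLp 0 1) m =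
          theta (k / cDual) ^ (n - 1) * fc (fun z => α * U z * φ k (toTorus z) (0, 1)) m := by
        rw [← fc_const_mul]
        refine fc_congr ?_ m
        filter_upwards [hae j.pos 1] with z hz
        rw [hz]; ring
      rw [e]
      linear_combination theta (k / cDual) ^ (n - 1) * B.coef_eq₁ k m
    · rw [amp_zero _ hj]; ring
  · rw [hl _ _ _ j.2]
    split_ifs with hj
    · rw [hj, amp_zero_one]
      have e : fc (fun z => α * U (-z) * layer (Φ k (toTorus z)).ofLp 0 0) m =
          theta (k / cDual) ^ (n - 1) * fc (fun z => α * U (-z) * φ k (toTorus z) (0, 0)) m := by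
        rw [← fc_const_mul]
        refine fc_congr ?_ m
        filter_upwards [hae j.pos 0] with z hz
        rw [hz]; ring
      rw [e]
      linear_combination theta (k / cDual) ^ (n - 1) * B.coef_eq₂ k m
    · have hj' : j.val = (j.val - 1) + 1 := by omega
      have hlt := j.2
      rw [hl _ _ _ (by omega : j.val - 1 < n)]
      have := B.amp_rec (n := n) (t := t) k (j := j.val - 1) (by omega) m
      rwa [← hj'] at this

lemma pt_injective' {m m' : ℤ × ℤ} {k : ℂ} (h : pt m + k = 0) (h' : pt m' + k = 0) : m = m' :=
  pt_injective (by linear_combination h - h')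

/-- A solution of the multilayer equation: its first components vanish off the bilayer, the bilayer
part is a multiple of the bilayer solution, and the Fourier coefficients of the second components
satisfy a recursion. -/
lemma BilayerFamily.coef_of_mem_kerDn (B : BilayerFamily α u₁ u₂ φ)
    (ht : ∀ j ∈ Finset.Icc 1 (n - 1), t j ≠ 0) (h0 : 2 ≤ n → fc u₂ 0 ≠ 0) (hn : 0 < n) {k : ℂ}
    {v : L2 (Fin n × Fin 2)} (hv : v ∈ kerDn n t α k) : ∃ c : ℂ,
      (∀ s m, layer (coefv v m) 0 s = c * coef (φ k) (0, s) m) ∧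
      (∀ j m, j ≠ 0 → layer (coefv v m) j 0 = 0) ∧
      (∀ j m, j + 1 < n → (pt m + k) * layer (coefv v m) (j + 1) 1 +
        t (j + 1) * layer (coefv v m) j 1 = 0) := by
  obtain ⟨f, hf, hvf⟩ := exists_classical (elliptic_dbar _) (isTrig_potential n t α k) hv
  set g : ℕ → Fin 2 → ℂ → ℂ := fun j s z => layer (f z) j s with hg
  have gC : ∀ j s, ContDiff ℝ 1 (g j s) := by
    intro j s
    by_cases hj : j < n
    · simp only [hg, layer_of_lt hj]
      exact hf.contDiff _
    · simp only [hg, layer_of_le (not_lt.1 hj)]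
      exact contDiff_const
  have gD : ∀ j s, Differentiable ℝ (g j s) := fun j s => (gC j s).differentiable (by simp)
  have gcont : ∀ j s, Continuous (g j s) := fun j s => (gC j s).continuous
  have gper : ∀ j s, ∀ a ∈ lattice (3 * cLam), ∀ z, g j s (z + a) = g j s z := by
    intro j s a ha z
    simp only [hg]
    rw [periodic_of_phase hf.phase a ha z]
  have gfc : ∀ j s m, fc (g j s) m = layer (coefv v m) j s := by
    intro j s m
    rw [← fc_layer]
    refine fc_congr ?_ m
    filter_upwards [hvf] with z hz
    rw [hz]
  have geq0 : ∀ j, j < n → ∀ z, dz (g j 0) z + (if j = 0 then α * U z * g 0 1 z else 0) +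
      t (j + 1) * g (j + 1) 0 z + k * g j 0 z = 0 := by
    intro j hj z
    have e := hf.dbar_eq z (⟨j, hj⟩, 0)
    rw [potential_mulVec_zero] at e
    have e2 : g j 0 = fun w => f w (⟨j, hj⟩, 0) := by
      simp only [hg, layer_of_lt hj]
    rw [e2]
    refine Eq.trans ?_ e
    simp only [hg, layer_of_lt hj]
    ring
  have geq1 : ∀ j, j < n → ∀ z, dz (g j 1) z + (if j = 0 then α * U (-z) * g 0 0 z else
      t j * g (j - 1) 1 z) + k * g j 1 z = 0 := by
    intro j hj z
    have e := hf.dbar_eq z (⟨j, hj⟩, 1)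
    rw [potential_mulVec_one] at e
    have e2 : g j 1 = fun w => f w (⟨j, hj⟩, 1) := by
      simp only [hg, layer_of_lt hj]
    rw [e2]
    refine Eq.trans ?_ e
    simp only [hg, layer_of_lt hj]
    ring
  -- the recursions for the Fourier coefficients
  have rec0 : ∀ j m, j + 1 < n → (pt m + k) * fc (g (j + 1) 0) m +
      t (j + 2) * fc (g (j + 2) 0) m = 0 := by
    intro j m hj
    have e := fc_dz (gcont (j + 1) 0) (gper _ _) Set.countable_empty (fun z _ => gD _ _ z)
      (g := fun z => -1 * (t (j + 2) * g (j + 2) 0 z + k * g (j + 1) 0 z))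
      (((gcont _ _).const_mul _).add ((gcont _ _).const_mul _) |>.const_mul _)
      (fun z _ => by
        have := geq0 (j + 1) hj z
        rw [if_neg (Nat.succ_ne_zero j)] at this
        linear_combination this) m
    rw [fc_const_mul, fc_add (integrableOn_cell three_cLam_ne ((gcont _ _).const_mul _))
      (integrableOn_cell three_cLam_ne ((gcont _ _).const_mul _)), fc_const_mul,
      fc_const_mul] at e
    linear_combination -e
  have rec1 : ∀ j m, j + 1 < n → (pt m + k) * fc (g (j + 1) 1) m +
      t (j + 1) * fc (g j 1) m = 0 := by
    intro j m hj
    have e := fc_dz (gcont (j + 1) 1) (gper _ _) Set.countable_empty (fun z _ => gD _ _ z)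
      (g := fun z => -1 * (t (j + 1) * g j 1 z + k * g (j + 1) 1 z))
      (((gcont _ _).const_mul _).add ((gcont _ _).const_mul _) |>.const_mul _)
      (fun z _ => by
        have := geq1 (j + 1) hj z
        rw [if_neg (Nat.succ_ne_zero j), Nat.add_sub_cancel] at this
        linear_combination this) m
    rw [fc_const_mul, fc_add (integrableOn_cell three_cLam_ne ((gcont _ _).const_mul _))
      (integrableOn_cell three_cLam_ne ((gcont _ _).const_mul _)), fc_const_mul,
      fc_const_mul] at e
    linear_combination -e
  -- the first components vanish off the bilayer
  have hz0 : ∀ d j, n ≤ j + d → ∀ m, fc (g (j + 1) 0) m = 0 := by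
    intro d
    induction d with
    | zero =>
      intro j hj m
      rw [gfc, layer_of_le (by omega)]
    | succ d ih =>
      intro j hj m
      by_cases hjn : j + 1 < n
      swap
      · rw [gfc, layer_of_le (by omega)]
      have h1 := rec0 j m hjn
      rw [ih (j + 1) (by omega) m, mul_zero, add_zero] at h1
      rcases mul_eq_zero.1 h1 with hres | h2
      swap
      · exact h2
      have htj : (t (j + 1) : ℂ) ≠ 0 := by
        exact_mod_cast ht (j + 1) (Finset.mem_Icc.2 ⟨by omega, by omega⟩)
      rcases Nat.eq_zero_or_pos j with rfl | hjpos
      · -- the Wronskian with `u` excludes a resonant coefficient next to the bilayer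
        set x := fc (g 1 0) m / area with hx
        have ha : (area : ℂ) ≠ 0 := by exact_mod_cast area_pos.ne'
        -- all coefficients but the resonant one vanish, so the function is a multiple of a character
        have hchi : ∀ z, g 1 0 z = x * chi m z := by
          intro z
          have hd : g 1 0 z + -x * chi m z = 0 := by
            refine eq_zero_of_fc (f := fun z => g 1 0 z + -x * chi m z)
              ((gcont _ _).add ((continuous_chi m).const_mul _))
              (fun a ha z => by rw [gper 1 0 a ha, chi_periodic m ha]) (fun m' => ?_) z
            rw [fc_add (integrableOn_cell three_cLam_ne (gcont _ _)) (integrableOn_cell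
              three_cLam_ne ((continuous_chi m).const_mul _)), fc_const_mul]
            have hc : fc (chi m) m' = if m - m' = 0 then (area : ℂ) else 0 := by
              rw [← integral_chi, fc]
              simp only [sub_eq_add_neg, chi_add]
            rw [hc]
            by_cases hm : m = m'
            · subst hm
              rw [if_pos (sub_self _), hx]
              field_simp
              ring
            · rw [if_neg (sub_ne_zero.2 hm), mul_zero, add_zero]
              have h3 := rec0 0 m' hjn
              rw [ih 1 (by omega) m', mul_zero, add_zero] at h3
              exact (mul_eq_zero.1 h3).resolve_left fun h4 => hm (pt_injective' hres h4)
          linear_combination hd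
        have hu := B.flat
        have uper₁ : ∀ a ∈ lattice (3 * cLam), ∀ z, u₁ (z + a) = u₁ z :=
          periodic_of_phase_scalar (c := 1) fun a₁ a₂ z => by rw [one_mul, hu.phase₁]
        have uper₂ : ∀ a ∈ lattice (3 * cLam), ∀ z, u₂ (z + a) = u₂ z :=
          periodic_of_phase_scalar (c := 0) fun a₁ a₂ z => by
            rw [zero_mul, zpow_zero, one_mul, hu.phase₂]
        have cW : Continuous fun z => u₁ z * g 0 1 z + -1 * (u₂ z * g 0 0 z) :=
          (hu.contDiff₁.continuous.mul (gcont _ _)).add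
            ((hu.contDiff₂.continuous.mul (gcont _ _)).const_mul _)
        have c2 : Continuous fun z => chi m z * u₂ z :=
          (continuous_chi m).mul hu.contDiff₂.continuous
        have hW := fc_dz (f := fun z => u₁ z * g 0 1 z + -1 * (u₂ z * g 0 0 z))
          (g := fun z => -k * (u₁ z * g 0 1 z + -1 * (u₂ z * g 0 0 z)) +
            t 1 * x * (chi m z * u₂ z)) cW
          (fun a ha z => by rw [uper₁ a ha, uper₂ a ha, gper _ _ a ha, gper _ _ a ha])
          Set.countable_empty
          (fun z _ => ((hu.differentiable₁ z).mul (gD 0 1 z)).add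
            (((hu.differentiable₂ z).mul (gD 0 0 z)).const_mul _))
          ((cW.const_mul _).add (c2.const_mul _))
          (fun z _ => by
            have d1 : DifferentiableAt ℝ (fun z => u₁ z * g 0 1 z) z :=
              (hu.differentiable₁ z).mul (gD 0 1 z)
            have d2 : DifferentiableAt ℝ (fun z => u₂ z * g 0 0 z) z :=
              (hu.differentiable₂ z).mul (gD 0 0 z)
            rw [dz_add d1 (d2.const_mul _), dz_const_mul _ d2,
              dz_mul (hu.differentiable₁ z) (gD 0 1 z), dz_mul (hu.differentiable₂ z) (gD 0 0 z)]
            have e0 := geq0 0 hn z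
            have e1 := geq1 0 hn z
            rw [if_pos rfl] at e0 e1
            rw [zero_add, hchi] at e0
            linear_combination g 0 1 z * hu.eq₁ z + u₁ z * e1 - g 0 0 z * hu.eq₂ z - u₂ z * e0) m
        rw [fc_add (integrableOn_cell three_cLam_ne (cW.const_mul _)) (integrableOn_cell
          three_cLam_ne (c2.const_mul _)), fc_const_mul, fc_const_mul, fc_chi_mul, sub_self] at hW
        -- at the resonant frequency the Wronskian drops out and the mean of `u₂` remains
        have h5 : (t 1 : ℂ) * x * fc u₂ 0 = 0 := by
          linear_combination hW + fc (fun z => u₁ z * g 0 1 z + -1 * (u₂ z * g 0 0 z)) m * hres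
        have hx0 : x = 0 := by
          rcases mul_eq_zero.1 h5 with h6 | h6
          · exact (mul_eq_zero.1 h6).resolve_left htj
          · exact absurd h6 (h0 (by omega))
        rw [hx, div_eq_zero_iff] at hx0
        exact hx0.resolve_right ha
      · -- further away the equation of the preceding layer does, since `t j ≠ 0`
        obtain ⟨i, rfl⟩ : ∃ i, j = i + 1 := ⟨j - 1, by omega⟩
        have h3 := rec0 i m (by omega)
        rw [hres, zero_mul, zero_add] at h3
        exact (mul_eq_zero.1 h3).resolve_left htj
  have hzero : ∀ j m, j ≠ 0 → layer (coefv v m) j 0 = 0 := by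
    intro j m hj
    obtain ⟨i, rfl⟩ : ∃ i, j = i + 1 := ⟨j - 1, by omega⟩
    rw [← gfc]
    exact hz0 n i (by omega) m
  have hg10 : ∀ z, g 1 0 z = 0 := eq_zero_of_fc (gcont _ _) (gper _ _) fun m => by
    rw [gfc]; exact hzero 1 m one_ne_zero
  have hflat : IsFlat α k (g 0 0) (g 0 1) := by
    refine ⟨gC _ _, gC _ _, fun a₁ a₂ z => ?_, fun a₁ a₂ z => ?_, fun z => ?_, fun z => ?_⟩
    · have := hf.phase a₁ a₂ z (⟨0, hn⟩, 0)
      simpa [hg, layer_of_lt hn, layerCharge] using this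
    · have := hf.phase a₁ a₂ z (⟨0, hn⟩, 1)
      simpa [hg, layer_of_lt hn, layerCharge] using this
    · have := geq0 0 hn z
      rw [if_pos rfl, zero_add, hg10, mul_zero, add_zero] at this
      exact this
    · have := geq1 0 hn z
      rwa [if_pos rfl] at this
  obtain ⟨c, hc⟩ := B.flat.eq_const_mul B.simple B.ne (B.isFlat k) (B.twist_ne k) hflat
  refine ⟨c, fun s m => ?_, hzero, fun j m hj => ?_⟩
  · rw [← gfc]
    have hs : s = 0 ∨ s = 1 := by fin_cases s <;> simp
    rcases hs with rfl | rfl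
    · rw [B.coef₁, ← fc_const_mul]
      exact congrArg (fun f => fc f m) (funext fun z => (hc z).1)
    · rw [B.coef₂, ← fc_const_mul]
      exact congrArg (fun f => fc f m) (funext fun z => (hc z).2)
  · rw [← gfc, ← gfc]
    exact rec1 j m hj

end


section

/-! ### The kernels of the multilayer operators -/

lemma integral_comp_three_mul {h : ℝ → ℂ} (hh : Continuous h) (hp : Function.Periodic h 1) :
    ∫ x in (0 : ℝ)..1, h (3 * x) = ∫ x in (0 : ℝ)..1, h x := by
  have h1 := intervalIntegral.integral_comp_mul_left (a := 0) (b := 1) h (three_ne_zero' ℝ)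
  have h2 := hp.intervalIntegral_add_zsmul_eq 3 0 fun _ _ => hh.intervalIntegrable _ _
  have e : (0 : ℝ) + (3 : ℤ) • (1 : ℝ) = 3 * 1 := by simp
  rw [e, zero_add, zsmul_eq_mul] at h2
  rw [h1, mul_zero, h2, Complex.real_smul]
  push_cast
  ring

lemma integral_square_eq {g : ℝ × ℝ → ℂ} (hg : Continuous g) :
    ∫ p in Set.Ico (0 : ℝ) 1 ×ˢ Set.Ico (0 : ℝ) 1, g p =
      ∫ x in (0 : ℝ)..1, ∫ y in (0 : ℝ)..1, g (x, y) := by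
  have hi : IntegrableOn g (Set.Ico (0 : ℝ) 1 ×ˢ Set.Ico (0 : ℝ) 1) (volume.prod volume) :=
    (hg.continuousOn.integrableOn_compact (isCompact_Icc.prod isCompact_Icc)).mono_set
      (Set.prod_mono Set.Ico_subset_Icc_self Set.Ico_subset_Icc_self)
  rw [Measure.volume_eq_prod, setIntegral_prod _ hi, integral_Ico_eq_integral_Ioc,
    intervalIntegral.integral_of_le zero_le_one]
  simp only [integral_Ico_eq_integral_Ioc, intervalIntegral.integral_of_le zero_le_one]

/-- A period parallelogram of the lattice `3 · lattice c` consists of nine of `lattice c`. -/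
lemma integral_cell_three {c : ℂ} (hc : c ≠ 0) {f : ℂ → ℂ} (hf : Continuous f)
    (hper : ∀ a ∈ lattice c, ∀ z, f (z + a) = f z) :
    ∫ z in cell (3 * c), f z = 9 * ∫ z in cell c, f z := by
  set G : ℝ × ℝ → ℂ := fun p => f (c * (p.1 + p.2 * om)) with hG
  have hGc : Continuous G := by fun_prop
  have p1 : ∀ y, Function.Periodic (fun x => G (x, y)) 1 := fun y x => by
    have := hper _ (self_mem_lattice c) (c * (x + y * om))
    simp only [hG]
    rw [← this]; congr 1; push_cast; ring
  have p2 : ∀ x, Function.Periodic (fun y => G (x, y)) 1 := fun x y => by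
    have := hper _ (self_mul_om_mem_lattice c) (c * (x + y * om))
    simp only [hG]
    rw [← this]; congr 1; push_cast; ring
  rw [setIntegral_cell_eq (mul_ne_zero three_ne_zero hc), setIntegral_cell_eq hc]
  have e : ∀ p : ℝ × ℝ, f (3 * c * (p.1 + p.2 * om)) = G (3 * p.1, 3 * p.2) := fun p => by
    simp only [hG]; congr 1; push_cast; ring
  simp only [e]
  change _ • ∫ p : ℝ × ℝ in _, G (3 * p.1, 3 * p.2) = 9 * (_ • ∫ p : ℝ × ℝ in _, G p)
  rw [integral_square_eq (g := fun p => G (3 * p.1, 3 * p.2)) (by fun_prop),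
    integral_square_eq hGc]
  have e1 : ∀ x : ℝ, ∫ y in (0 : ℝ)..1, G (3 * x, 3 * y) = ∫ y in (0 : ℝ)..1, G (3 * x, y) :=
    fun x => integral_comp_three_mul (by fun_prop) (p2 _)
  simp only [e1]
  rw [integral_comp_three_mul (h := fun x => ∫ y in (0 : ℝ)..1, G (x, y))
    (intervalIntegral.continuous_parametric_intervalIntegral_of_continuous' hGc 0 1)
    fun x => by simp only [p1 _ x], norm_mul, Complex.real_smul, Complex.real_smul]
  norm_num
  ring

/-- A function that is periodic under `Λ` has the same mean over `ℂ/Λ` as over `ℂ/3Λ`. -/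
lemma fc_zero_ne {f : ℂ → ℂ} (hf : Continuous f)
    (hper : ∀ (a₁ a₂ : ℤ) (z : ℂ), f (z + lamPt a₁ a₂) = f z) (h : ∫ z in cell cLam, f z ≠ 0) :
    fc f 0 ≠ 0 := by
  have e : fc f 0 = ∫ z in cell (3 * cLam), f z := by
    simp only [fc, neg_zero, chi_zero, mul_one]
  rw [e, integral_cell_three cLam_ne hf fun a ha z => by
    obtain ⟨x, y, rfl⟩ := (mem_lattice_cLam a).1 ha
    exact hper x y z]
  exact mul_ne_zero (by norm_num) h

lemma flatMult_eq (n : ℕ) (hn : 0 < n) (p₁ p₂ : ℤ) (k : ℂ) :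
    flatMult n p₁ p₂ k = flatMult 1 p₁ p₂ k * mult 1 p₁ p₂ k ^ (n - 1) := by
  rw [flatMult, flatMult, mult_eq n, mul_assoc, ← pow_succ', Nat.sub_add_cancel hn]

namespace BilayerFamily

variable {n : ℕ} {t : ℕ → ℝ} {α : ℂ} {u₁ u₂ : ℂ → ℂ} {φ : ℂ → L2 (Fin 1 × Fin 2)}
  {Φ : ℂ → L2 (Fin n × Fin 2)} (B : BilayerFamily α u₁ u₂ φ)

include B

lemma flatMult_mul_amp (k : ℂ) (p₁ p₂ : ℤ) {j : ℕ} (hj : j < n) (s : Fin 2) (m : ℤ × ℤ) :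
    flatMult n p₁ p₂ k * amp n t φ (k + dualPt p₁ p₂) j s m =
      amp n t φ k j s (m + (3 * p₁, 3 * p₂)) := by
  rw [flatMult_eq n (by omega)]
  have hs : s = 0 ∨ s = 1 := by fin_cases s <;> simp
  rcases hs with rfl | rfl
  · by_cases h : j = 0
    · rw [h, amp_zero_zero, amp_zero_zero, ← B.tau, ← theta_mul_mult k p₁ p₂, mul_pow]
      ring
    · rw [amp_zero j h, amp_zero j h, mul_zero]
  · rw [amp_one, amp_one, ← B.tau, ← theta_mul_mult k p₁ p₂, ← thetaQuot_mul_mult, mul_pow,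
      mul_pow]
    have e : n - 1 = j + (n - 1 - j) := by omega
    have e2 : mult 1 p₁ p₂ k ^ (n - 1) = mult 1 p₁ p₂ k ^ j * mult 1 p₁ p₂ k ^ (n - 1 - j) := by
      rw [← pow_add, ← e]
    rw [e2]
    ring

variable (hΦ : ∀ k (i : Fin n × Fin 2) m, coef (Φ k) i m = amp n t φ k i.1 i.2 m)

include hΦ

/-- The multilayer flat band functions are quasi-periodic under the dual lattice. -/
lemma isTau (p₁ p₂ : ℤ) (k : ℂ) :
    IsTau (dualPt p₁ p₂) (Φ k) (flatMult n p₁ p₂ k • Φ (k + dualPt p₁ p₂)) := by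
  rw [isTau_iff]
  intro i m
  rw [coef_smul, hΦ, hΦ, B.flatMult_mul_amp k p₁ p₂ i.1.2]

/-- The bilayer part of the multilayer functions is `θ(k/cDual)^(n-1) F_k(z + z_S) u(z)`. -/
lemma component_ae_eq (hn : 0 < n) (k : ℂ) : ∀ᵐ z : ℂ,
    Φ k (toTorus z) (⟨0, hn⟩, 0) = theta (k / cDual) ^ (n - 1) * (F k (z + zS) * u₁ z) ∧
    Φ k (toTorus z) (⟨0, hn⟩, 1) = theta (k / cDual) ^ (n - 1) * (F k (z + zS) * u₂ z) := by
  have h0 : ∀ᵐ z : ℂ, Φ k (toTorus z) (⟨0, hn⟩, 0) =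
      theta (k / cDual) ^ (n - 1) * φ k (toTorus z) (0, 0) := ae_eq_of_coef fun m => by
    rw [hΦ]; exact amp_zero_zero m
  have h1 : ∀ᵐ z : ℂ, Φ k (toTorus z) (⟨0, hn⟩, 1) =
      theta (k / cDual) ^ (n - 1) * φ k (toTorus z) (0, 1) := ae_eq_of_coef fun m => by
    rw [hΦ]; exact amp_zero_one m
  filter_upwards [h0, h1, B.ae_eq k, (countable_den_zeros zS).ae_notMem volume] with z a b c d
  rw [a, b, c.1, c.2, twist_eq d, twist_eq d]
  exact ⟨rfl, rfl⟩

omit B in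
lemma component_zero (k : ℂ) (j : Fin n) (hj : j.val ≠ 0) : component (j, 0) (Φ k) = 0 :=
  L2_ext_coef fun _ m => by rw [coef_component, hΦ, amp_zero _ hj, coef_zero]

/-- Off the dual lattice each layer comes from the preceding one by the resolvent. -/
lemma component_one (hn : 0 < n) {k : ℂ} (hk : k ∉ lattice cDual) (j : Fin n) :
    component (j, 1) (Φ k) = ((-1) ^ j.val * ∏ i ∈ Finset.Icc 1 j.val, (t i : ℂ)) •
      (dbarResolvent k)^[j.val] (component (⟨0, hn⟩, 1) (Φ k)) := by
  have hper : component (⟨0, hn⟩, 1) (Φ k) ∈ periodicL2 := by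
    refine (mem_L20_iff (fun _ : Unit => 0) _).2 fun _ m h => ?_
    rw [coef_component, hΦ, amp_one] at h
    simpa using B.dvd₂ (right_ne_zero_of_mul h)
  refine L2_ext_coef fun _ m => ?_
  rw [coef_smul, (dbarResolvent_iterate_spec hk hper j).2 m, coef_component, coef_component, hΦ, hΦ]
  simp only [amp_one]
  by_cases h : coef (φ k) (0, 1) m = 0
  · rw [h]; simp
  · obtain ⟨h1, h2⟩ := B.dvd₂ h
    have hne := pt_add_ne hk h1 h2
    have h3 := mul_thetaQuot (B.dvd₂ h) k
    have e : n - 1 = j + (n - 1 - j) := by have := j.2; omega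
    have e2 : theta (k / cDual) ^ (n - 1) =
        (pt m + k) ^ j.val * thetaQuot m k ^ j.val * theta (k / cDual) ^ (n - 1 - j) := by
      rw [← mul_pow, h3, ← pow_add, ← e]
    simp only [Nat.sub_zero, pow_zero, e2, Finset.Icc_eq_empty_of_lt zero_lt_one,
      Finset.prod_empty]
    field_simp

/-- Off the resonances the bilayer part is non-zero. -/
lemma ne_zero_of_theta_ne (hn : 0 < n) {k : ℂ} (hθ : theta (k / cDual) ^ (n - 1) ≠ 0) :
    Φ k ≠ 0 := by
  intro h
  have hc : ∀ s m, coef (φ k) (0, s) m = 0 := by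
    intro s m
    have h1 := hΦ k (⟨0, hn⟩, s) m
    rw [h, coef_zero] at h1
    have hs : s = 0 ∨ s = 1 := by fin_cases s <;> simp
    rcases hs with rfl | rfl
    · rw [amp_zero_zero] at h1
      exact (mul_eq_zero.1 h1.symm).resolve_left hθ
    · rw [amp_zero_one] at h1
      exact (mul_eq_zero.1 h1.symm).resolve_left hθ
  have hf := B.isFlat k
  refine B.twist_ne k fun z => ⟨?_, ?_⟩
  · exact eq_zero_of_fc hf.contDiff₁.continuous (periodic_of_phase_scalar (c := 1) fun a₁ a₂ z => by
      rw [one_mul, hf.phase₁]) (fun m => by rw [← B.coef₁, hc]) z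
  · exact eq_zero_of_fc hf.contDiff₂.continuous (periodic_of_phase_scalar (c := 0) fun a₁ a₂ z => by
      rw [zero_mul, zpow_zero, one_mul, hf.phase₂]) (fun m => by rw [← B.coef₂, hc]) z

variable (ht : ∀ j ∈ Finset.Icc 1 (n - 1), t j ≠ 0) (h0 : 2 ≤ n → fc u₂ 0 ≠ 0) (hn : 0 < n)

include ht h0 hn

/-- Off the resonances the bilayer part determines a solution layer by layer. -/
lemma mem_span_of_theta_ne {k : ℂ} (hθ : theta (k / cDual) ^ (n - 1) ≠ 0)
    {v : L2 (Fin n × Fin 2)} (hv : v ∈ kerDn n t α k) : v ∈ Submodule.span ℂ {Φ k} := by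
  obtain ⟨c, hc, hz, hr⟩ := B.coef_of_mem_kerDn ht h0 hn hv
  set d := c / theta (k / cDual) ^ (n - 1) with hd
  have hcd : c = d * theta (k / cDual) ^ (n - 1) := by rw [hd, div_mul_cancel₀ _ hθ]
  have key : ∀ j, j < n → ∀ m, layer (coefv v m) j 1 = d * amp n t φ k j 1 m := by
    intro j
    induction j with
    | zero => intro _ m; rw [hc, amp_zero_one, hcd]; ring
    | succ j ih =>
      intro hj m
      have hθ1 : theta (k / cDual) ≠ 0 := fun h => hθ (by rw [h, zero_pow (by omega)])
      by_cases hm : (3 : ℤ) ∣ m.1 ∧ (3 : ℤ) ∣ m.2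
      · have hk : k ∉ lattice cDual := fun h => hθ1 ((theta_div_cDual_eq_zero_iff k).2 h)
        refine mul_left_cancel₀ (pt_add_ne hk hm.1 hm.2) ?_
        linear_combination hr j m hj - d * B.amp_rec (n := n) (t := t) k hj m -
          t (j + 1) * ih (by omega) m
      · have h1 : thetaQuot m k = 0 := if_neg hm
        rw [amp_one, h1, zero_pow (Nat.succ_ne_zero j), layer_of_lt hj]
        by_contra h2
        refine hm ?_
        have := (mem_L20_iff _ _).1 hv.1 (⟨j + 1, hj⟩, 1) m fun h3 => h2 (by
          rw [coefv, h3]; ring)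
        simpa [layerCharge] using this
  refine Submodule.mem_span_singleton.2 ⟨d, ?_⟩
  refine L2_ext_coef fun i m => ?_
  obtain ⟨j, s⟩ := i
  rw [coef_smul, hΦ]
  have e : coef v (j, s) m = layer (coefv v m) j s := (layer_val (coefv v m) j s).symm
  rw [e]
  have hs : s = 0 ∨ s = 1 := by fin_cases s <;> simp
  rcases hs with rfl | rfl
  · by_cases hj : j.val = 0
    · rw [hj, hc]
      change d * amp n t φ k 0 0 m = _
      rw [amp_zero_zero, hcd]; ring
    · rw [hz _ _ hj]
      change d * amp n t φ k j 0 m = _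
      rw [amp_zero _ hj, mul_zero]
  · exact (key _ j.2 m).symm

omit hΦ in
/-- At a point of the dual lattice a solution lives in the last layer and has a single frequency. -/
lemma coef_eq_zero_of_resonant (hn2 : 2 ≤ n) (p₁ p₂ : ℤ) {v : L2 (Fin n × Fin 2)}
    (hv : v ∈ kerDn n t α (dualPt p₁ p₂)) (i : Fin n × Fin 2) (m : ℤ × ℤ)
    (hi : ¬(i = (⟨n - 1, by omega⟩, 1) ∧ m = -(3 * p₁, 3 * p₂))) : coef v i m = 0 := by
  obtain ⟨c, hc, hz, hr⟩ := B.coef_of_mem_kerDn ht h0 hn hv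
  have ht' : ∀ j, j + 1 < n → (t (j + 1) : ℂ) ≠ 0 := fun j hj => by
    exact_mod_cast ht (j + 1) (Finset.mem_Icc.2 ⟨by omega, by omega⟩)
  have hres : pt (-(3 * p₁, 3 * p₂)) + dualPt p₁ p₂ = 0 := by
    rw [pt_neg, pt_three, neg_add_cancel]
  -- the resonant coefficient of the bilayer function is non-zero, which rules out a bilayer part
  have hc0 : c = 0 := by
    have h1 := hr 0 (-(3 * p₁, 3 * p₂)) (by omega)
    rw [hres, zero_mul, zero_add, hc] at h1
    have h2 := (mul_eq_zero.1 h1).resolve_left (ht' 0 (by omega))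
    exact (mul_eq_zero.1 h2).resolve_right (B.coef_resonant_ne (h0 hn2) p₁ p₂)
  have key : ∀ j, j < n → ∀ m, j + 1 < n ∨ m ≠ -(3 * p₁, 3 * p₂) →
      layer (coefv v m) j 1 = 0 := by
    intro j
    induction j with
    | zero => intro _ m _; rw [hc, hc0, zero_mul]
    | succ j ih =>
      intro hj m hm
      by_cases hm0 : m = -(3 * p₁, 3 * p₂)
      · have hj2 : j + 1 + 1 < n := hm.resolve_right fun h => h hm0
        have h1 := hr (j + 1) m hj2
        rw [hm0, hres, zero_mul, zero_add] at h1
        rw [hm0]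
        exact (mul_eq_zero.1 h1).resolve_left (ht' _ hj2)
      · have h1 := hr j m hj
        rw [ih (by omega) m (Or.inl hj), mul_zero, add_zero] at h1
        exact (mul_eq_zero.1 h1).resolve_left fun h => hm0 (pt_injective' h hres)
  obtain ⟨j, s⟩ := i
  have e : coef v (j, s) m = layer (coefv v m) j s := (layer_val (coefv v m) j s).symm
  rw [e]
  have hs : s = 0 ∨ s = 1 := by fin_cases s <;> simp
  rcases hs with rfl | rfl
  · by_cases hj : j.val = 0
    · rw [hj, hc, hc0, zero_mul]
    · exact hz _ _ hj
  · refine key _ j.2 m ?_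
    by_contra h
    rw [not_or, not_not] at h
    refine hi ⟨Prod.ext (Fin.ext ?_) rfl, h.2⟩
    have := j.2
    change j.val = n - 1
    omega

omit hn in
/-- In the last layer all factors `θ` have been traded, so its resonant coefficient survives at the
points of the dual lattice, where the other layers vanish. -/
lemma coef_resonant_multilayer_ne (hn2 : 2 ≤ n) (p₁ p₂ : ℤ) :
    coef (Φ (dualPt p₁ p₂)) (⟨n - 1, by omega⟩, 1) (-(3 * p₁, 3 * p₂)) ≠ 0 := by
  have hpt : dualPt p₁ p₂ = -pt (-(3 * p₁, 3 * p₂)) := by rw [pt_neg, pt_three, neg_neg]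
  rw [hΦ, amp_one]
  refine mul_ne_zero (mul_ne_zero (mul_ne_zero (mul_ne_zero ?_ ?_) (pow_ne_zero _ ?_)) ?_)
    (B.coef_resonant_ne (h0 hn2) p₁ p₂)
  · exact pow_ne_zero _ (by norm_num)
  · refine Finset.prod_ne_zero_iff.2 fun j hj => ?_
    exact_mod_cast ht j hj
  · rw [hpt]
    refine thetaQuot_self_ne ⟨?_, ?_⟩ <;> simp
  · simp

/-- The multilayer flat band functions span the kernels. -/
lemma ne_zero_and_kerDn_eq (k : ℂ) :
    Φ k ≠ 0 ∧ kerDn n t α k = Submodule.span ℂ {Φ k} := by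
  have hmem : ∀ k, Φ k ∈ kerDn n t α k := B.mem_kerDn hΦ
  have hspan : Submodule.span ℂ {Φ k} ≤ kerDn n t α k :=
    (Submodule.span_singleton_le_iff_mem _ _).2 (hmem k)
  by_cases hθ : theta (k / cDual) ^ (n - 1) = 0
  · have hn2 : 2 ≤ n := by
      by_contra h
      rw [show n - 1 = 0 by omega, pow_zero] at hθ
      exact one_ne_zero hθ
    obtain ⟨p₁, p₂, rfl⟩ := (mem_lattice_cDual k).1
      ((theta_div_cDual_eq_zero_iff k).1 (pow_eq_zero_iff (by omega) |>.1 hθ))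
    have hne := B.coef_resonant_multilayer_ne hΦ ht h0 hn2 p₁ p₂
    refine ⟨fun h => hne (by rw [h, coef_zero]), le_antisymm (fun v hv => ?_) hspan⟩
    refine Submodule.mem_span_singleton.2 ⟨coef v (⟨n - 1, by omega⟩, 1) (-(3 * p₁, 3 * p₂)) /
      coef (Φ (dualPt p₁ p₂)) (⟨n - 1, by omega⟩, 1) (-(3 * p₁, 3 * p₂)), ?_⟩
    refine L2_ext_coef fun i m => ?_
    rw [coef_smul]
    by_cases hi : i = (⟨n - 1, by omega⟩, 1) ∧ m = -(3 * p₁, 3 * p₂)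
    · rw [hi.1, hi.2, div_mul_cancel₀ _ hne]
    · rw [B.coef_eq_zero_of_resonant ht h0 hn hn2 p₁ p₂ hv i m hi,
        B.coef_eq_zero_of_resonant ht h0 hn hn2 p₁ p₂ (hmem _) i m hi, mul_zero]
  · exact ⟨B.ne_zero_of_theta_ne hΦ hn hθ,
      le_antisymm (fun v hv => B.mem_span_of_theta_ne hΦ ht h0 hn hθ hv) hspan⟩

end BilayerFamily

end


section

/-! ### The flat band bundle as a quotient -/

section Tau

variable {ι : Type} [Fintype ι]

lemma IsTau.trans {p q : ℂ} {v w x : L2 ι} (h : IsTau p v w) (h' : IsTau q w x) :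
    IsTau (p + q) v x := by
  filter_upwards [h, h'] with z a b
  rw [b, a, smul_smul, ← Complex.exp_add, pairing_add_right]
  congr 2
  push_cast; ring

lemma IsTau.symm {p : ℂ} {v w : L2 ι} (h : IsTau p v w) : IsTau (-p) w v := by
  filter_upwards [h] with z a
  rw [a, smul_smul, ← Complex.exp_add, pairing_neg_right]
  push_cast
  rw [mul_neg, neg_add_cancel, Complex.exp_zero, one_smul]

lemma isTau_zero (v : L2 ι) : IsTau 0 v v :=
  Filter.Eventually.of_forall fun z => by simp [pairing]

lemma IsTau.unique {p : ℂ} {v w w' : L2 ι} (h : IsTau p v w) (h' : IsTau p v w') : w = w' := by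
  refine L2_ext ?_
  filter_upwards [h, h'] with z a b
  rw [a, b]

lemma IsTau.smul {p : ℂ} {v w : L2 ι} (h : IsTau p v w) (c : ℂ) : IsTau p (c • v) (c • w) := by
  filter_upwards [h, ae_smul c v, ae_smul c w] with z a b d
  rw [d, b, a, smul_comm]

lemma IsTau.norm_eq {p : ℂ} {v w : L2 ι} (h : IsTau p v w) : ‖w‖ = ‖v‖ := by
  rw [Lp.norm_def, Lp.norm_def]
  congr 1
  have h1 : ∀ᵐ x ∂torusMeasure, ‖w x‖ = ‖v x‖ := by
    refine (ae_map_iff measurable_toTorus.aemeasurable (measurableSet_eq_fun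
      (Lp.stronglyMeasurable w).measurable.norm (Lp.stronglyMeasurable v).measurable.norm)).2
      (ae_restrict_of_ae ?_)
    filter_upwards [h] with z a
    have e : -Complex.I * pairing z p = ((-pairing z p : ℝ) : ℂ) * Complex.I := by push_cast; ring
    rw [a, norm_smul, e, Complex.norm_exp_ofReal_mul_I, one_mul]
  exact eLpNorm_congr_norm_ae h1

end Tau

variable {n : ℕ} {t : ℕ → ℝ} {α : ℂ}

/-- The class of a pair determines the pair over each point of its fibre. -/
lemma IsClass.iff {l : FlatBand n t α} {k k' : ℂ} {Ψ Ψ' : L2 (Fin n × Fin 2)}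
    (h : IsClass l k Ψ) :
    IsClass l k' Ψ' ↔ k' - k ∈ lattice cDual ∧ IsTau (k' - k) Ψ Ψ' := by
  obtain ⟨hk, rfl⟩ := h
  constructor
  · rintro ⟨hk', rfl⟩
    exact ⟨toBase_eq.1 (hk.trans hk'.symm), l.snd.2.2 ⟨k, hk⟩ ⟨k', hk'⟩⟩
  · rintro ⟨h1, h2⟩
    have hk' : toBase k' = l.proj := (toBase_eq.2 h1).symm.trans hk
    exact ⟨hk', (l.snd.2.2 ⟨k, hk⟩ ⟨k', hk'⟩).unique h2⟩

lemma IsClass.unique {l l' : FlatBand n t α} {k : ℂ} {Ψ : L2 (Fin n × Fin 2)}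
    (h : IsClass l k Ψ) (h' : IsClass l' k Ψ) : l = l' := by
  obtain ⟨b, s⟩ := l
  obtain ⟨b', s'⟩ := l'
  obtain ⟨hk, hs⟩ := h
  obtain ⟨hk', hs'⟩ := h'
  change toBase k = b at hk
  change toBase k = b' at hk'
  subst hk hk'
  congr 1
  refine Subtype.ext (funext fun x => ?_)
  have h1 := s.2.2 ⟨k, rfl⟩ x
  have h2 := s'.2.2 ⟨k, rfl⟩ x
  change s.1 ⟨k, rfl⟩ = Ψ at hs
  change s'.1 ⟨k, rfl⟩ = Ψ at hs'
  rw [hs] at h1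
  rw [hs'] at h2
  exact h1.unique h2

lemma mul_mult (n : ℕ) (p₁ p₂ q₁ q₂ : ℤ) (k : ℂ) : mult n (p₁ + q₁) (p₂ + q₂) k =
    mult n q₁ q₂ (k + dualPt p₁ p₂) * mult n p₁ p₂ k := by
  rw [mult, mult, mult, ← mul_pow, add_dualPt_div]
  congr 1
  have e : (-1 : ℂ) ^ (p₁ + q₁ + (p₂ + q₂)) = (-1) ^ (q₁ + q₂) * (-1) ^ (p₁ + p₂) := by
    rw [← zpow_add₀ (by norm_num)]; congr 1; ring
  have e2 : Complex.exp (2 * Real.pi * Complex.I * (-p₂ * q₁)) = 1 := by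
    have := Complex.exp_int_mul_two_pi_mul_I (-p₂ * q₁)
    rw [← this]; congr 1; push_cast; ring
  have e3 : Real.pi * Complex.I * ((p₁ + q₁ : ℤ) : ℂ) ^ 2 * om +
      2 * Real.pi * Complex.I * (k / cDual) * ((p₁ + q₁ : ℤ) : ℂ) =
      Real.pi * Complex.I * q₁ ^ 2 * om + 2 * Real.pi * Complex.I * (k / cDual + (om * p₁ - p₂)) * q₁
      + (Real.pi * Complex.I * p₁ ^ 2 * om + 2 * Real.pi * Complex.I * (k / cDual) * p₁) -
      2 * Real.pi * Complex.I * (-p₂ * q₁) := by push_cast; ring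
  rw [e, e3, Complex.exp_sub, e2, Complex.exp_add, div_one]
  ring

/-- The cocycle identity of the multipliers. -/
lemma flatMult_add (n : ℕ) (p₁ p₂ q₁ q₂ : ℤ) (k : ℂ) : flatMult n (p₁ + q₁) (p₂ + q₂) k =
    flatMult n q₁ q₂ (k + dualPt p₁ p₂) * flatMult n p₁ p₂ k := by
  rw [flatMult, flatMult, flatMult, mul_mult, dualPt_add, pairing_add_right, Complex.ofReal_add,
    mul_add, Complex.exp_add]
  ring

lemma differentiable_flatMult (n : ℕ) (p₁ p₂ : ℤ) : Differentiable ℂ (flatMult n p₁ p₂) := by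
  unfold flatMult mult
  fun_prop

/-- A holomorphic family of vectors that spans the kernels of the multilayer operators and is
quasi-periodic with the multipliers `flatMult`. -/
structure IsFrame (n : ℕ) (t : ℕ → ℝ) (α : ℂ) (Φ : ℂ → L2 (Fin n × Fin 2)) : Prop where
  differentiable : Differentiable ℂ Φ
  ne_zero : ∀ k, Φ k ≠ 0
  kerDn_eq : ∀ k, kerDn n t α k = Submodule.span ℂ {Φ k}
  isTau : ∀ p₁ p₂ k, IsTau (dualPt p₁ p₂) (Φ k) (flatMult n p₁ p₂ k • Φ (k + dualPt p₁ p₂))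

namespace IsFrame

variable {Φ : ℂ → L2 (Fin n × Fin 2)} (h : IsFrame n t α Φ)

include h

lemma exists_isClass_smul (k c : ℂ) : ∃ l : FlatBand n t α, IsClass l k (c • Φ k) := by
  have hex : ∀ x : {x : ℂ // toBase x = toBase k}, ∃ w ∈ kerDn n t α x.1,
      IsTau (x.1 - k) (c • Φ k) w := by
    rintro ⟨x, hx⟩
    obtain ⟨p₁, p₂, hp⟩ := (mem_lattice_cDual _).1 (toBase_eq.1 hx.symm)
    refine ⟨c • flatMult n p₁ p₂ k • Φ (k + dualPt p₁ p₂), ?_, ?_⟩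
    · have e : k + dualPt p₁ p₂ = x := by linear_combination -hp
      rw [h.kerDn_eq, e]
      exact Submodule.smul_mem _ _ (Submodule.smul_mem _ _ (Submodule.mem_span_singleton_self _))
    · change IsTau (x - k) _ _
      rw [hp]
      exact (h.isTau p₁ p₂ k).smul c
  choose s hs1 hs2 using hex
  refine ⟨⟨toBase k, ⟨s, hs1, fun x y => ?_⟩⟩, rfl, ?_⟩
  · have := (hs2 x).symm.trans (hs2 y)
    rwa [show -(x.1 - k) + (y.1 - k) = y.1 - x.1 by ring] at this
  · refine IsTau.unique (p := 0) (v := c • Φ k) ?_ (isTau_zero _)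
    have := hs2 ⟨k, rfl⟩
    rwa [sub_self] at this

lemma existsUnique_isClass (k : ℂ) {Ψ : L2 (Fin n × Fin 2)} (hΨ : Ψ ∈ kerDn n t α k) :
    ∃! l : FlatBand n t α, IsClass l k Ψ := by
  rw [h.kerDn_eq, Submodule.mem_span_singleton] at hΨ
  obtain ⟨c, rfl⟩ := hΨ
  obtain ⟨l, hl⟩ := h.exists_isClass_smul k c
  exact ⟨l, hl, fun l' hl' => hl'.unique hl⟩

lemma smul_injective (k : ℂ) : Function.Injective fun c : ℂ => c • Φ k :=
  smul_left_injective ℂ (h.ne_zero k)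

/-- The point `[k, c Φ_k]` of the flat band bundle. -/
noncomputable def toBand (x : ℂ × ℂ) : FlatBand n t α := (h.exists_isClass_smul x.1 x.2).choose

lemma isClass_toBand (k c : ℂ) : IsClass (h.toBand (k, c)) k (c • Φ k) :=
  (h.exists_isClass_smul k c).choose_spec

lemma toBand_proj (x : ℂ × ℂ) : (h.toBand x).proj = toBase x.1 :=
  (h.isClass_toBand x.1 x.2).choose.symm

lemma exists_eq_toBand (l : FlatBand n t α) {k : ℂ} (hk : toBase k = l.proj) :
    ∃ c, l = h.toBand (k, c) := by
  have h1 := l.snd.2.1 ⟨k, hk⟩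
  rw [h.kerDn_eq, Submodule.mem_span_singleton] at h1
  obtain ⟨c, hc⟩ := h1
  exact ⟨c, IsClass.unique ⟨hk, hc.symm⟩ (h.isClass_toBand k c)⟩

lemma toBand_surjective : Function.Surjective h.toBand := fun l => by
  obtain ⟨k, hk⟩ := toBase_surjective l.proj
  obtain ⟨c, hc⟩ := h.exists_eq_toBand l hk
  exact ⟨_, hc.symm⟩

lemma toBand_add (p₁ p₂ : ℤ) (k c : ℂ) :
    h.toBand (k + dualPt p₁ p₂, flatMult n p₁ p₂ k * c) = h.toBand (k, c) := by
  refine (h.isClass_toBand _ _).unique ((h.isClass_toBand k c).iff.2 ⟨?_, ?_⟩)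
  · rw [add_sub_cancel_left, mem_lattice_cDual]; exact ⟨p₁, p₂, rfl⟩
  · rw [add_sub_cancel_left, mul_comm (flatMult _ _ _ _), mul_smul]
    exact (h.isTau p₁ p₂ k).smul c

lemma toBand_eq_iff (k k' c c' : ℂ) : h.toBand (k, c) = h.toBand (k', c') ↔ ∃ p₁ p₂ : ℤ,
    k' = k + dualPt p₁ p₂ ∧ c' = flatMult n p₁ p₂ k * c := by
  constructor
  · intro he
    have h1 := h.isClass_toBand k' c'
    rw [← he, (h.isClass_toBand k c).iff] at h1
    obtain ⟨p₁, p₂, hp⟩ := (mem_lattice_cDual _).1 h1.1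
    have hk : k' = k + dualPt p₁ p₂ := by linear_combination hp
    refine ⟨p₁, p₂, hk, h.smul_injective k' ?_⟩
    change c' • Φ k' = _ • Φ k'
    refine h1.2.unique ?_
    rw [hp, mul_comm (flatMult _ _ _ _), mul_smul, hk]
    exact (h.isTau p₁ p₂ k).smul c
  · rintro ⟨p₁, p₂, rfl, rfl⟩
    exact (h.toBand_add p₁ p₂ k c).symm

/-- The coefficient of a vector along `Φ_k`. -/
noncomputable def along (_ : IsFrame n t α Φ) (k : ℂ) (v : L2 (Fin n × Fin 2)) : ℂ :=
  inner ℂ (Φ k) v / (‖Φ k‖ : ℂ) ^ 2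

lemma along_smul (k c : ℂ) : h.along k (c • Φ k) = c := by
  have h1 : (‖Φ k‖ : ℂ) ≠ 0 := by exact_mod_cast norm_ne_zero_iff.2 (h.ne_zero k)
  rw [along, inner_smul_right, inner_self_eq_norm_sq_to_K]
  exact mul_div_cancel_right₀ c (pow_ne_zero 2 h1)

lemma continuous_along : Continuous fun x : ℂ × L2 (Fin n × Fin 2) => h.along x.1 x.2 := by
  have hc := h.differentiable.continuous
  unfold along
  refine Continuous.div ((hc.comp continuous_fst).inner continuous_snd) ?_ fun x => ?_
  · exact (Complex.continuous_ofReal.comp (hc.comp continuous_fst).norm).pow 2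
  · have h1 : (‖Φ x.1‖ : ℂ) ≠ 0 := by exact_mod_cast norm_ne_zero_iff.2 (h.ne_zero x.1)
    exact pow_ne_zero 2 h1

/-- The topology of the flat band bundle is the quotient topology of the plane times `ℂ`. -/
lemma isQuotientMap_toBand : Topology.IsQuotientMap h.toBand := by
  let _ : TopologicalSpace {x : ℂ × FlatBand n t α // toBase x.1 = x.2.proj} :=
    .induced (fun x => (x.1.1, x.1.2.snd.1 ⟨x.1.1, x.2⟩)) inferInstance
  set J : {x : ℂ × FlatBand n t α // toBase x.1 = x.2.proj} → ℂ × L2 (Fin n × Fin 2) :=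
    fun x => (x.1.1, x.1.2.snd.1 ⟨x.1.1, x.2⟩) with hJ
  have hJi : Topology.IsInducing J := ⟨rfl⟩
  set Q : ℂ × ℂ → {x : ℂ × FlatBand n t α // toBase x.1 = x.2.proj} :=
    fun x => ⟨(x.1, h.toBand x), (h.toBand_proj x).symm⟩ with hQ
  have hJQ : ∀ x, J (Q x) = (x.1, x.2 • Φ x.1) := fun x =>
    Prod.ext rfl (h.isClass_toBand x.1 x.2).choose_spec
  have hc := h.differentiable.continuous
  have hi : Topology.IsInducing (J ∘ Q) := by
    have e : J ∘ Q = fun x => (x.1, x.2 • Φ x.1) := funext hJQ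
    rw [e]
    refine (Function.LeftInverse.isEmbedding (f := fun y : ℂ × L2 (Fin n × Fin 2) =>
      (y.1, h.along y.1 y.2)) (fun x => ?_)
      (continuous_fst.prodMk h.continuous_along) (by fun_prop)).isInducing
    simp only [h.along_smul]
  have hQi : Topology.IsInducing Q := hJi.of_comp_iff.1 hi
  have hQs : Function.Surjective Q := by
    rintro ⟨⟨k, l⟩, hk⟩
    obtain ⟨c, hc⟩ := h.exists_eq_toBand l hk
    exact ⟨(k, c), Subtype.ext (Prod.ext rfl hc.symm)⟩
  have hQq : Topology.IsQuotientMap Q := by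
    refine IsOpenMap.isQuotientMap ?_ hQi.continuous hQs
    intro V hV
    obtain ⟨W, hW, rfl⟩ := hQi.isOpen_iff.1 hV
    rwa [Set.image_preimage_eq W hQs]
  have hPq : Topology.IsQuotientMap
      (fun x : {x : ℂ × FlatBand n t α // toBase x.1 = x.2.proj} => x.1.2) := by
    refine ⟨⟨rfl⟩, fun l => ?_⟩
    obtain ⟨k, hk⟩ := toBase_surjective l.proj
    exact ⟨⟨(k, l), hk⟩, rfl⟩
  exact hPq.comp hQq

lemma continuous_toBand : Continuous h.toBand := h.isQuotientMap_toBand.continuous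

lemma isOpenMap_toBand : IsOpenMap h.toBand := by
  intro V hV
  rw [← h.isQuotientMap_toBand.isOpen_preimage]
  have e : h.toBand ⁻¹' (h.toBand '' V) = ⋃ p : ℤ × ℤ,
      (fun x : ℂ × ℂ => (x.1 + dualPt p.1 p.2, flatMult n p.1 p.2 x.1 * x.2)) ⁻¹' V := by
    ext ⟨k, c⟩
    rw [Set.mem_iUnion]
    constructor
    · rintro ⟨⟨k', c'⟩, hV, he⟩
      obtain ⟨p₁, p₂, rfl, rfl⟩ := (h.toBand_eq_iff k k' c c').1 he.symm
      exact ⟨(p₁, p₂), hV⟩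
    · rintro ⟨p, hp⟩
      exact ⟨_, hp, h.toBand_add p.1 p.2 k c⟩
  rw [e]
  refine isOpen_iUnion fun p => hV.preimage ?_
  exact (continuous_fst.add continuous_const).prodMk
    (((differentiable_flatMult n p.1 p.2).continuous.comp continuous_fst).mul continuous_snd)

end IsFrame

end


section

/-! ### The local trivializations of the flat band bundle -/

lemma continuous_toBase : Continuous toBase := continuous_quotient_mk'

/-- Near a point of the plane a chart of `ℂ/Λ*` is a translation by a point of `Λ*`. -/
lemma baseChart_toBase_eventually {b : Base} {k : ℂ} (hk : toBase k ∈ (baseChart b).source) :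
    ∃ p₁ p₂ : ℤ, ∀ᶠ x in nhds k, toBase x ∈ (baseChart b).source ∧
      baseChart b (toBase x) = x + dualPt p₁ p₂ := by
  have hmem : ∀ x, toBase x ∈ (baseChart b).source →
      baseChart b (toBase x) - x ∈ lattice cDual := fun x hx => by
    rw [← toBase_eq, toBase_baseChart b hx]
  obtain ⟨p₁, p₂, hp⟩ := (mem_lattice_cDual _).1 (hmem k hk)
  have hdisc : IsDiscrete (lattice cDual : Set ℂ) := ⟨lattice_discrete cDual cDual_ne⟩
  obtain ⟨V, hVo, hV⟩ := isDiscrete_iff_forall_mem_exists_isOpen.1 hdisc _ (hmem k hk)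
  have hc : ContinuousAt (fun x => baseChart b (toBase x) - x) k :=
    (((baseChart b).continuousAt hk).comp continuous_toBase.continuousAt).sub continuousAt_id
  have hkV : baseChart b (toBase k) - k ∈ V := by
    have : baseChart b (toBase k) - k ∈ V ∩ (lattice cDual : Set ℂ) := by rw [hV]; rfl
    exact this.1
  refine ⟨p₁, p₂, ?_⟩
  filter_upwards [hc.preimage_mem_nhds (hVo.mem_nhds hkV),
    continuous_toBase.continuousAt.preimage_mem_nhds ((baseChart b).open_source.mem_nhds hk)]
    with x h1 h2
  have h3 : baseChart b (toBase x) - x ∈ V ∩ (lattice cDual : Set ℂ) := ⟨h1, hmem x h2⟩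
  rw [hV, Set.mem_singleton_iff, hp] at h3
  exact ⟨h2, by linear_combination h3⟩

lemma contMDiff_toBase : ContMDiff 𝓘(ℂ, ℂ) 𝓘(ℂ, ℂ) ω toBase := by
  intro k
  have hs := mem_baseChart_source (toBase k)
  obtain ⟨p₁, p₂, hp⟩ := baseChart_toBase_eventually hs
  have e : toBase = fun x => (baseChart (toBase k)).symm (x + dualPt p₁ p₂) := by
    funext x
    rw [baseChart_symm, toBase_eq, add_sub_cancel_left, mem_lattice_cDual]
    exact ⟨p₁, p₂, rfl⟩
  have ht : k + dualPt p₁ p₂ ∈ (baseChart (toBase k)).target := by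
    rw [← hp.self_of_nhds.2]; exact (baseChart (toBase k)).map_source hs
  have h1 : ContMDiffAt 𝓘(ℂ, ℂ) 𝓘(ℂ, ℂ) ω (baseChart (toBase k)).symm (k + dualPt p₁ p₂) :=
    (contMDiffOn_chart_symm (I := 𝓘(ℂ, ℂ)) (x := toBase k)).contMDiffAt
      ((baseChart (toBase k)).open_target.mem_nhds ht)
  have h2 : ContMDiffAt 𝓘(ℂ, ℂ) 𝓘(ℂ, ℂ) ω (fun x => x + dualPt p₁ p₂) k :=
    (contDiff_id.add contDiff_const).contMDiff.contMDiffAt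
  have h3 := ContMDiffAt.comp (x := k) h1 h2
  rw [e]
  exact h3

namespace IsFrame

variable {n : ℕ} {t : ℕ → ℝ} {α : ℂ} {Φ : ℂ → L2 (Fin n × Fin 2)} (h : IsFrame n t α Φ)

open Classical in
/-- The fibre coordinate of a point of the flat band bundle: its coefficient along `Φ_k`, where `k`
is the representative of the base point in the chart at `b₀`. -/
noncomputable def coord (b₀ : Base) (l : FlatBand n t α) : ℂ :=
  if hb : l.proj ∈ (baseChart b₀).source then h.along (baseChart b₀ l.proj)
    (l.snd.1 ⟨baseChart b₀ l.proj, toBase_baseChart b₀ hb⟩) else 0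

include h

lemma coord_eq (b₀ : Base) {l : FlatBand n t α} (hb : l.proj ∈ (baseChart b₀).source) {c : ℂ}
    (hl : l = h.toBand (baseChart b₀ l.proj, c)) : h.coord b₀ l = c := by
  rw [coord, dif_pos hb]
  have h1 : ∀ (k : ℂ) (l : FlatBand n t α), l = h.toBand (k, c) → IsClass l k (c • Φ k) := by
    rintro k _ rfl
    exact h.isClass_toBand k c
  have h3 : l.snd.1 ⟨baseChart b₀ l.proj, toBase_baseChart b₀ hb⟩ = c • Φ (baseChart b₀ l.proj) :=
    (h1 _ l hl).choose_spec
  rw [h3, h.along_smul]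

lemma toBand_coord (b₀ : Base) {l : FlatBand n t α} (hb : l.proj ∈ (baseChart b₀).source) :
    h.toBand (baseChart b₀ l.proj, h.coord b₀ l) = l := by
  obtain ⟨c, hc⟩ := h.exists_eq_toBand l (toBase_baseChart b₀ hb)
  rw [h.coord_eq b₀ hb hc]
  exact hc.symm

lemma coord_toBand (b₀ : Base) {k : ℂ} (hk : toBase k ∈ (baseChart b₀).source)
    {p₁ p₂ : ℤ} (hp : baseChart b₀ (toBase k) = k + dualPt p₁ p₂) (c : ℂ) :
    h.coord b₀ (h.toBand (k, c)) = flatMult n p₁ p₂ k * c := by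
  have hpr := h.toBand_proj (k, c)
  refine h.coord_eq b₀ (by rwa [hpr]) ?_
  rw [hpr]
  change _ = h.toBand (baseChart b₀ (toBase k), _)
  rw [hp, h.toBand_add]

lemma coord_toBand_of_mem (b₀ : Base) {k : ℂ} (hk : k ∈ (baseChart b₀).target) (c : ℂ) :
    h.coord b₀ (h.toBand (k, c)) = c := by
  have hs : toBase k ∈ (baseChart b₀).source := by
    rw [← baseChart_symm b₀]; exact (baseChart b₀).map_target hk
  have hpr := h.toBand_proj (k, c)
  refine h.coord_eq b₀ (by rwa [hpr]) ?_
  rw [hpr]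
  change _ = h.toBand (baseChart b₀ (toBase k), _)
  rw [baseChart_right b₀ hk]

omit h in
lemma continuous_proj (h : IsFrame n t α Φ) :
    Continuous (Bundle.TotalSpace.proj : FlatBand n t α → Base) := by
  rw [h.isQuotientMap_toBand.continuous_iff]
  have e : Bundle.TotalSpace.proj ∘ h.toBand = fun x => toBase x.1 := funext h.toBand_proj
  rw [e]
  exact continuous_toBase.comp continuous_fst

lemma continuousOn_coord (b₀ : Base) :
    ContinuousOn (h.coord b₀) (Bundle.TotalSpace.proj ⁻¹' (baseChart b₀).source) := by
  have hso := (baseChart b₀).open_source.preimage h.continuous_proj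
  rw [continuousOn_open_iff hso]
  intro V hV
  have e : Bundle.TotalSpace.proj ⁻¹' (baseChart b₀).source ∩ h.coord b₀ ⁻¹' V =
      h.toBand '' ((baseChart b₀).target ×ˢ V) := by
    ext l
    constructor
    · rintro ⟨h1, h2⟩
      exact ⟨(baseChart b₀ l.proj, h.coord b₀ l), ⟨(baseChart b₀).map_source h1, h2⟩,
        h.toBand_coord b₀ h1⟩
    · rintro ⟨⟨k, c⟩, ⟨h1, h2⟩, rfl⟩
      refine ⟨?_, ?_⟩
      · rw [Set.mem_preimage, h.toBand_proj, ← baseChart_symm b₀]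
        exact (baseChart b₀).map_target h1
      · rw [Set.mem_preimage, h.coord_toBand_of_mem b₀ h1]
        exact h2
  rw [e]
  exact h.isOpenMap_toBand _ ((baseChart b₀).open_target.prod hV)

/-- The local trivialization of the flat band bundle over the domain of a chart. -/
noncomputable def triv (b₀ : Base) :
    Bundle.Trivialization ℂ (Bundle.TotalSpace.proj : FlatBand n t α → Base) where
  toFun l := (l.proj, h.coord b₀ l)
  invFun x := h.toBand (baseChart b₀ x.1, x.2)
  source := Bundle.TotalSpace.proj ⁻¹' (baseChart b₀).source
  target := (baseChart b₀).source ×ˢ Set.univ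
  map_source' l hl := ⟨hl, trivial⟩
  map_target' x hx := by
    rw [Set.mem_preimage, h.toBand_proj]
    change toBase (baseChart b₀ x.1) ∈ _
    rw [toBase_baseChart b₀ hx.1]
    exact hx.1
  left_inv' l hl := h.toBand_coord b₀ hl
  right_inv' x hx := by
    refine Prod.ext ?_ (h.coord_toBand_of_mem b₀ ((baseChart b₀).map_source hx.1) _)
    rw [h.toBand_proj]
    exact toBase_baseChart b₀ hx.1
  open_source := (baseChart b₀).open_source.preimage h.continuous_proj
  open_target := (baseChart b₀).open_source.prod isOpen_univ
  continuousOn_toFun := h.continuous_proj.continuousOn.prodMk (h.continuousOn_coord b₀)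
  continuousOn_invFun := h.continuous_toBand.comp_continuousOn
    (((baseChart b₀).continuousOn.comp continuousOn_fst fun _ hx => hx.1).prodMk continuousOn_snd)
  baseSet := (baseChart b₀).source
  open_baseSet := (baseChart b₀).open_source
  source_eq := rfl
  target_eq := rfl
  proj_toFun _ _ := rfl

lemma coord_mk (b₀ : Base) {b : Base} (hb : b ∈ (baseChart b₀).source) (s : Fiber n t α b) :
    h.coord b₀ ⟨b, s⟩ =
      h.along (baseChart b₀ b) (s.1 ⟨baseChart b₀ b, toBase_baseChart b₀ hb⟩) := dif_pos hb

omit h in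
lemma along_add (h : IsFrame n t α Φ) (k : ℂ) (v w : L2 (Fin n × Fin 2)) :
    h.along k (v + w) = h.along k v + h.along k w := by
  simp only [along, inner_add_right, add_div]

omit h in
lemma along_smul' (h : IsFrame n t α Φ) (k c : ℂ) (v : L2 (Fin n × Fin 2)) :
    h.along k (c • v) = c * h.along k v := by
  simp only [along, inner_smul_right, mul_div_assoc]

lemma isLinear_triv (b₀ : Base) : (h.triv b₀).IsLinear ℂ where
  linear b hb := by
    change b ∈ (baseChart b₀).source at hb
    constructor
    · intro s r
      change h.coord b₀ ⟨b, s + r⟩ = h.coord b₀ ⟨b, s⟩ + h.coord b₀ ⟨b, r⟩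
      rw [h.coord_mk b₀ hb, h.coord_mk b₀ hb, h.coord_mk b₀ hb, ← h.along_add]
      rfl
    · intro c s
      change h.coord b₀ ⟨b, c • s⟩ = c • h.coord b₀ ⟨b, s⟩
      rw [h.coord_mk b₀ hb, h.coord_mk b₀ hb, smul_eq_mul, ← h.along_smul']
      rfl

omit h in
lemma continuous_eval {b : Base} (x : {x : ℂ // toBase x = b}) :
    Continuous fun s : Fiber n t α b => s.1 x :=
  (continuous_apply (A := fun _ : {x : ℂ // toBase x = b} => L2 (Fin n × Fin 2)) x).comp
    continuous_subtype_val

lemma continuous_along_eval {b : Base} (x : {x : ℂ // toBase x = b}) (k : ℂ) :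
    Continuous fun s : Fiber n t α b => h.along k (s.1 x) := by
  have h1 : Continuous (h.along k) := (continuous_const.inner continuous_id).div_const _
  have h2 := continuous_eval (n := n) (t := t) (α := α) x
  exact Continuous.comp (g := h.along k) h1 h2

lemma continuous_mk (b : Base) :
    Continuous (Bundle.TotalSpace.mk b : Fiber n t α b → FlatBand n t α) := by
  have hb := mem_baseChart_source b
  have e : (Bundle.TotalSpace.mk b : Fiber n t α b → FlatBand n t α) = fun s =>
      h.toBand (baseChart b b, h.along (baseChart b b)
        (s.1 ⟨baseChart b b, toBase_baseChart b hb⟩)) := funext fun s => by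
    rw [← h.coord_mk b hb]
    exact (h.toBand_coord b (l := ⟨b, s⟩) hb).symm
  rw [e]
  exact h.continuous_toBand.comp (continuous_const.prodMk (h.continuous_along_eval _ _))

/-- The coordinate on a fibre is a homeomorphism, for the topology of pointwise convergence of the
functions `k ↦ Φ`. -/
lemma isInducing_along {b : Base} {k : ℂ} (hk : toBase k = b) :
    Topology.IsInducing fun s : Fiber n t α b => h.along k (s.1 ⟨k, hk⟩) := by
  have hex : ∀ x : {x : ℂ // toBase x = b}, ∃ w, IsTau (x.1 - k) (Φ k) w := by
    rintro ⟨x, hx⟩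
    obtain ⟨p₁, p₂, hp⟩ := (mem_lattice_cDual _).1 (toBase_eq.1 (hk.trans hx.symm))
    refine ⟨flatMult n p₁ p₂ k • Φ (k + dualPt p₁ p₂), ?_⟩
    change IsTau (x - k) _ _
    rw [hp]
    exact h.isTau p₁ p₂ k
  choose w hw using hex
  have hs : ∀ (s : Fiber n t α b) x, s.1 x = h.along k (s.1 ⟨k, hk⟩) • w x := by
    intro s x
    have h1 := s.2.1 ⟨k, hk⟩
    rw [h.kerDn_eq, Submodule.mem_span_singleton] at h1
    obtain ⟨c, hc⟩ := h1
    rw [← hc, h.along_smul]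
    refine (s.2.2 ⟨k, hk⟩ x).unique ?_
    rw [← hc]
    exact (hw x).smul c
  have hind : Topology.IsInducing fun s : Fiber n t α b => s.1 := Topology.IsInducing.subtypeVal
  have hcont : Continuous fun s : Fiber n t α b => h.along k (s.1 ⟨k, hk⟩) :=
    h.continuous_along_eval _ _
  have hf : Continuous fun (c : ℂ) (x : {x : ℂ // toBase x = b}) => c • w x := by fun_prop
  refine Topology.IsInducing.of_comp hcont hf ?_
  have e : (fun (c : ℂ) (x : {x : ℂ // toBase x = b}) => c • w x) ∘
      (fun s : Fiber n t α b => h.along k (s.1 ⟨k, hk⟩)) = fun s => s.1 :=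
    funext fun s => funext fun x => (hs s x).symm
  rw [e]
  exact hind

lemma isInducing_mk (b : Base) :
    Topology.IsInducing (Bundle.TotalSpace.mk b : Fiber n t α b → FlatBand n t α) := by
  have hb := mem_baseChart_source b
  have hi := h.isInducing_along (toBase_baseChart b hb)
  rw [Topology.isInducing_iff_nhds] at hi ⊢
  intro s
  refine le_antisymm (h.continuous_mk b).continuousAt.tendsto.le_comap ?_
  rw [hi s]
  have hc : ContinuousAt (h.coord b) (⟨b, s⟩ : FlatBand n t α) :=
    (h.continuousOn_coord b).continuousAt
      (((baseChart b).open_source.preimage h.continuous_proj).mem_nhds hb)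
  refine (Filter.comap_mono hc.tendsto.le_comap).trans ?_
  rw [Filter.comap_comap]
  have e : h.coord b ∘ (Bundle.TotalSpace.mk b : Fiber n t α b → FlatBand n t α) = fun s =>
      h.along (baseChart b b) (s.1 ⟨baseChart b b, toBase_baseChart b hb⟩) :=
    funext fun s => h.coord_mk b hb s
  rw [e, h.coord_mk b hb]

/-- The flat band bundle as a fibre bundle. -/
@[reducible]
noncomputable def fiberBundle : FiberBundle ℂ (Fiber n t α) where
  totalSpaceMk_isInducing' := h.isInducing_mk
  trivializationAtlas' := Set.range h.triv
  trivializationAt' := h.triv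
  mem_baseSet_trivializationAt' := mem_baseChart_source
  trivialization_mem_atlas' b := ⟨b, rfl⟩

/-- The transition functions are given by the multipliers. -/
lemma contMDiffOn_coordChange (b₀ b₁ : Base) [(h.triv b₀).IsLinear ℂ] [(h.triv b₁).IsLinear ℂ] :
    ContMDiffOn 𝓘(ℂ, ℂ) 𝓘(ℂ, ℂ →L[ℂ] ℂ) ω
      (fun b => ((h.triv b₀).coordChangeL ℂ (h.triv b₁) b : ℂ →L[ℂ] ℂ))
      ((h.triv b₀).baseSet ∩ (h.triv b₁).baseSet) := by
  rintro b ⟨hb0, hb1⟩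
  change b ∈ (baseChart b₀).source at hb0
  change b ∈ (baseChart b₁).source at hb1
  set k := baseChart b₀ b with hk
  have hkb : toBase k = b := toBase_baseChart b₀ hb0
  obtain ⟨p₁, p₂, hp⟩ := baseChart_toBase_eventually (b := b₁) (k := k) (by rwa [hkb])
  have hc0 : ContMDiffAt 𝓘(ℂ, ℂ) 𝓘(ℂ, ℂ) ω (baseChart b₀) b :=
    (contMDiffOn_chart (I := 𝓘(ℂ, ℂ)) (x := b₀)).contMDiffAt
      ((baseChart b₀).open_source.mem_nhds hb0)
  have hev : ∀ᶠ x in nhds b, ((h.triv b₀).coordChangeL ℂ (h.triv b₁) x : ℂ →L[ℂ] ℂ) =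
      flatMult n p₁ p₂ (baseChart b₀ x) • ContinuousLinearMap.id ℂ ℂ := by
    filter_upwards [(baseChart b₀).open_source.mem_nhds hb0,
      hc0.continuousAt.eventually hp] with x h0 h1
    rw [toBase_baseChart b₀ h0] at h1
    ext
    change (h.triv b₀).coordChangeL ℂ (h.triv b₁) x 1 = _
    rw [Bundle.Trivialization.coordChangeL_apply' _ _ ⟨h0, h1.1⟩]
    change h.coord b₁ (h.toBand (baseChart b₀ x, 1)) = _
    rw [h.coord_toBand b₁ (by rw [toBase_baseChart b₀ h0]; exact h1.1)
      (by rw [toBase_baseChart b₀ h0]; exact h1.2)]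
    simp
  have hm : ContMDiffAt 𝓘(ℂ, ℂ) 𝓘(ℂ, ℂ →L[ℂ] ℂ) ω
      (fun x => flatMult n p₁ p₂ x • ContinuousLinearMap.id ℂ ℂ) (baseChart b₀ b) :=
    ((differentiable_flatMult n p₁ p₂).contDiff.smul contDiff_const).contMDiff.contMDiffAt
  exact ((hm.comp b hc0).congr_of_eventuallyEq hev).contMDiffWithinAt

lemma vectorBundle :
    let _ := h.fiberBundle
    VectorBundle ℂ ℂ (Fiber n t α) := by
  intro _
  refine ⟨?_, ?_⟩
  · rintro _ ⟨b₀, rfl⟩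
    exact h.isLinear_triv b₀
  · rintro _ _ ⟨b₀, rfl⟩ ⟨b₁, rfl⟩
    have := h.isLinear_triv b₀
    have := h.isLinear_triv b₁
    exact (h.contMDiffOn_coordChange b₀ b₁).continuousOn

lemma contMDiffVectorBundle :
    let _ := h.fiberBundle
    let _ := h.vectorBundle
    ContMDiffVectorBundle ω ℂ (Fiber n t α) 𝓘(ℂ, ℂ) := by
  intro _ _
  refine ⟨?_⟩
  rintro _ _ ⟨b₀, rfl⟩ ⟨b₁, rfl⟩
  have := h.isLinear_triv b₀
  have := h.isLinear_triv b₁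
  exact h.contMDiffOn_coordChange b₀ b₁

/-- In the local trivializations the map `(k, c) ↦ [k, c Φ_k]` is `(k, c) ↦ (k, e(k) c)` with a
multiplier `e`. -/
lemma contMDiff_toBand :
    let _ := h.fiberBundle
    ContMDiff 𝓘(ℂ, ℂ × ℂ) (𝓘(ℂ, ℂ).prod 𝓘(ℂ, ℂ)) ω h.toBand := by
  intro _ x
  rw [Bundle.contMDiffAt_totalSpace]
  have hfst : ContMDiff 𝓘(ℂ, ℂ × ℂ) 𝓘(ℂ, ℂ) ω (Prod.fst : ℂ × ℂ → ℂ) := contDiff_fst.contMDiff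
  have hpr : (fun x => (h.toBand x).proj) = fun x => toBase x.1 := funext h.toBand_proj
  refine ⟨?_, ?_⟩
  · rw [hpr]
    exact (contMDiff_toBase.comp hfst).contMDiffAt
  · rw [h.toBand_proj]
    obtain ⟨p₁, p₂, hp⟩ := baseChart_toBase_eventually (mem_baseChart_source (toBase x.1))
    have h1 : ContMDiffAt 𝓘(ℂ, ℂ × ℂ) 𝓘(ℂ, ℂ) ω
        (fun y : ℂ × ℂ => flatMult n p₁ p₂ y.1 * y.2) x :=
      (((differentiable_flatMult n p₁ p₂).contDiff.comp contDiff_fst).mul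
        contDiff_snd).contMDiff.contMDiffAt
    refine h1.congr_of_eventuallyEq ?_
    filter_upwards [continuous_fst.continuousAt.eventually hp] with y hy
    exact h.coord_toBand _ hy.1 hy.2 y.2

end IsFrame

end


/-! ### Wirtinger derivatives -/

lemma contDiff_fderiv_apply {f : ℂ → ℂ} (hf : ContDiff ℝ ∞ f) (e : ℂ) :
    ContDiff ℝ ∞ fun k => fderiv ℝ f k e :=
  (hf.fderiv_right (m := ∞) (by simp)).clm_apply contDiff_const

lemma contDiff_wirt {f : ℂ → ℂ} (hf : ContDiff ℝ ∞ f) : ContDiff ℝ ∞ (wirt f) :=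
  contDiff_const.mul ((contDiff_fderiv_apply hf 1).sub
    (contDiff_const.mul (contDiff_fderiv_apply hf Complex.I)))

lemma contDiff_wirtBar {f : ℂ → ℂ} (hf : ContDiff ℝ ∞ f) : ContDiff ℝ ∞ (wirtBar f) :=
  contDiff_const.mul ((contDiff_fderiv_apply hf 1).add
    (contDiff_const.mul (contDiff_fderiv_apply hf Complex.I)))

lemma wirt_congr {f g : ℂ → ℂ} {k : ℂ} (h : f =ᶠ[nhds k] g) : wirt f k = wirt g k := by
  rw [wirt, wirt, h.fderiv_eq]

lemma wirtBar_congr {f g : ℂ → ℂ} {k : ℂ} (h : f =ᶠ[nhds k] g) : wirtBar f k = wirtBar g k := by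
  rw [wirtBar, wirtBar, h.fderiv_eq]

lemma wirt_add {f g : ℂ → ℂ} {k : ℂ} (hf : DifferentiableAt ℝ f k) (hg : DifferentiableAt ℝ g k) :
    wirt (fun x => f x + g x) k = wirt f k + wirt g k := by
  rw [wirt, wirt, wirt, fderiv_fun_add hf hg]
  simp only [add_apply]
  ring

lemma wirtBar_add {f g : ℂ → ℂ} {k : ℂ} (hf : DifferentiableAt ℝ f k)
    (hg : DifferentiableAt ℝ g k) :
    wirtBar (fun x => f x + g x) k = wirtBar f k + wirtBar g k := by
  rw [wirtBar, wirtBar, wirtBar, fderiv_fun_add hf hg]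
  simp only [add_apply]
  ring

/-- The imaginary part of the coordinate `κ = k / cDual`. -/
noncomputable def imCoord : ℂ →L[ℝ] ℂ :=
  Complex.ofRealCLM.comp (Complex.imCLM.comp (ContinuousLinearMap.mul ℝ ℂ cDual⁻¹))

lemma imCoord_apply (k : ℂ) : imCoord k = ((k / cDual).im : ℂ) := by
  simp [imCoord, div_eq_inv_mul]

lemma hasFDerivAt_affine (a b : ℂ) (k : ℂ) :
    HasFDerivAt (fun x => a + b * imCoord x) (b • imCoord) k :=
  (imCoord.hasFDerivAt.const_mul b).const_add a

lemma norm_cDual_sq : ‖cDual‖ ^ 2 = 3 := by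
  rw [cDual, norm_mul, norm_om, mul_one, Complex.norm_real, Real.norm_eq_abs, sq_abs,
    Real.sq_sqrt (by norm_num)]

lemma wirt_affine (a b k : ℂ) :
    wirt (fun x => a + b * imCoord x) k = b * (-Complex.I / 2 * cDual⁻¹) := by
  rw [wirt, (hasFDerivAt_affine a b k).fderiv]
  simp only [smul_apply, imCoord_apply, smul_eq_mul]
  have h : cDual⁻¹ = ((cDual⁻¹).re : ℂ) + (cDual⁻¹).im * Complex.I := (Complex.re_add_im _).symm
  have h1 : (1 / cDual).im = (cDual⁻¹).im := by rw [one_div]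
  have h2 : (Complex.I / cDual).im = (cDual⁻¹).re := by rw [div_eq_mul_inv, Complex.I_mul_im]
  rw [h1, h2]
  conv_rhs => rw [h]
  linear_combination (b * (cDual⁻¹).im / 2) * Complex.I_sq

lemma wirtBar_affine (a b k : ℂ) :
    wirtBar (fun x => a + b * imCoord x) k = b * (Complex.I / 2 * conj (cDual⁻¹)) := by
  rw [wirtBar, (hasFDerivAt_affine a b k).fderiv]
  simp only [smul_apply, imCoord_apply, smul_eq_mul]
  have h : conj (cDual⁻¹) = ((cDual⁻¹).re : ℂ) - (cDual⁻¹).im * Complex.I := by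
    generalize cDual⁻¹ = w
    apply Complex.ext <;> simp
  have h1 : (1 / cDual).im = (cDual⁻¹).im := by rw [one_div]
  have h2 : (Complex.I / cDual).im = (cDual⁻¹).re := by rw [div_eq_mul_inv, Complex.I_mul_im]
  rw [h1, h2, h]
  linear_combination (b * (cDual⁻¹).im / 2) * Complex.I_sq

lemma wirt_mul_sq (a k : ℂ) :
    wirt (fun x => a * imCoord x ^ 2) k = 2 * a * imCoord k * (-Complex.I / 2 * cDual⁻¹) := by
  have h1 : HasFDerivAt (fun x => a * imCoord x ^ 2) (a • ((2 * imCoord k) • imCoord)) k := by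
    have := (imCoord.hasFDerivAt (x := k)).pow 2
    refine (this.const_mul a).congr_fderiv ?_
    ext
    simp
  have h2 := wirt_affine 0 (2 * a * imCoord k) k
  rw [← h2, wirt, wirt, h1.fderiv, (hasFDerivAt_affine _ _ k).fderiv]
  simp only [smul_apply, smul_eq_mul]
  ring

lemma wirtBar_wirt_sq (a k : ℂ) : wirtBar (wirt fun x => a * imCoord x ^ 2) k = a / 6 := by
  have e : (wirt fun x => a * imCoord x ^ 2) =
      fun x => 0 + (2 * a * (-Complex.I / 2 * cDual⁻¹)) * imCoord x := by
    funext x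
    rw [wirt_mul_sq]; ring
  rw [e, wirtBar_affine]
  have h : cDual⁻¹ * conj (cDual⁻¹) = 1 / 3 := by
    rw [Complex.mul_conj, Complex.normSq_eq_norm_sq, norm_inv, inv_pow, norm_cDual_sq]
    norm_num
  linear_combination (-a * Complex.I ^ 2 / 2) * h - a / 6 * Complex.I_sq

/-- For a function that is periodic up to a quadratic correction, the integral of the second mixed
Wirtinger derivative over the torus sees the correction only. -/
lemma integral_wirtBar_wirt {f : ℂ → ℂ} (hf : ContDiff ℝ ∞ f) (a : ℂ)
    (hper : ∀ p₁ p₂ : ℤ, ∀ k, f (k + dualPt p₁ p₂) - a * imCoord (k + dualPt p₁ p₂) ^ 2 =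
      f k - a * imCoord k ^ 2) :
    ∫ k in cell cDual, wirtBar (wirt f) k = a * (Real.sqrt 3 / 4) := by
  have hq : ContDiff ℝ ∞ fun x => a * imCoord x ^ 2 :=
    contDiff_const.mul (imCoord.contDiff.pow 2)
  set G : ℂ → ℂ := fun k => f k - a * imCoord k ^ 2 with hG
  have hGs : ContDiff ℝ ∞ G := hf.sub hq
  have hd : ∀ {g : ℂ → ℂ}, ContDiff ℝ ∞ g → Differentiable ℝ g := fun hg =>
    hg.differentiable (by simp)
  have hfG : f = fun k => G k + a * imCoord k ^ 2 := by
    funext k; simp only [hG]; ring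
  have hw : wirt f = fun k => wirt G k + wirt (fun x => a * imCoord x ^ 2) k := by
    funext k
    conv_lhs => rw [hfG]
    exact wirt_add (hd hGs k) (hd hq k)
  have hww : ∀ k, wirtBar (wirt f) k = wirtBar (wirt G) k + a / 6 := by
    intro k
    rw [hw, wirtBar_add (hd (contDiff_wirt hGs) k) (hd (contDiff_wirt hq) k), wirtBar_wirt_sq]
  have hGp : ∀ b ∈ lattice cDual, ∀ k, wirt G (k + b) = wirt G k := by
    intro b hb k
    obtain ⟨p₁, p₂, rfl⟩ := (mem_lattice_cDual b).1 hb
    have e : (fun x => G (x + dualPt p₁ p₂)) = G := funext fun x => hper p₁ p₂ x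
    rw [wirt, wirt, ← fderiv_comp_add_right, e]
  have hc : Continuous (wirtBar (wirt G)) := (contDiff_wirtBar (contDiff_wirt hGs)).continuous
  have hform : wirtBar (wirt G) = fun k => 1 / 2 * fderiv ℝ (wirt G) k 1 +
      Complex.I / 2 * fderiv ℝ (wirt G) k Complex.I := by
    funext k; rw [wirtBar]; ring
  have hz : ∫ k in cell cDual, wirtBar (wirt G) k = 0 := by
    have hi := integrableOn_cell cDual_ne hc
    rw [hform] at hi ⊢
    exact integral_cell_deriv_eq_zero cDual_ne (contDiff_wirt hGs).continuous hGp
      Set.countable_empty (fun z _ => hd (contDiff_wirt hGs) z) _ _ hi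
  simp only [hww]
  rw [integral_add (integrableOn_cell cDual_ne hc) (integrableOn_cell cDual_ne continuous_const),
    hz, zero_add, integral_cell_const cDual_ne, norm_cDual_sq, Complex.real_smul]
  push_cast
  ring

lemma norm_flatMult_sq (n : ℕ) (p₁ p₂ : ℤ) (k : ℂ) : ‖flatMult n p₁ p₂ k‖ ^ 2 =
    Real.exp (-(n * (Real.sqrt 3 * Real.pi * p₁ ^ 2 + 4 * Real.pi * p₁ * (k / cDual).im))) := by
  have e1 : ‖Complex.exp (Complex.I * pairing zS (dualPt p₁ p₂))‖ = 1 := by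
    rw [mul_comm, Complex.norm_exp_ofReal_mul_I]
  have e2 : ‖(-1 : ℂ) ^ (p₁ + p₂)‖ = 1 := by simp
  have e3 : (Real.pi * Complex.I * p₁ ^ 2 * om + 2 * Real.pi * Complex.I * (k / cDual) * p₁).re =
      -(Real.sqrt 3 / 2 * Real.pi * p₁ ^ 2 + 2 * Real.pi * p₁ * (k / cDual).im) := by
    have h1 : (Real.pi * Complex.I * p₁ ^ 2 * om + 2 * Real.pi * Complex.I * (k / cDual) * p₁ : ℂ) =
        Complex.I * (((Real.pi * p₁ ^ 2 : ℝ) : ℂ) * om +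
          ((2 * Real.pi * p₁ : ℝ) : ℂ) * (k / cDual)) := by push_cast; ring
    rw [h1, Complex.I_mul_re, Complex.add_im, Complex.im_ofReal_mul, Complex.im_ofReal_mul, om_im]
    ring
  rw [flatMult, norm_mul, e1, one_mul, mult, norm_pow, norm_mul, e2, mul_one, Complex.norm_exp, e3,
    ← Real.exp_nat_mul, ← Real.exp_nat_mul]
  congr 1
  push_cast
  ring


section

/-! ### Hermitian metrics on the flat band bundle -/

namespace IsFrame

variable {n : ℕ} {t : ℕ → ℝ} {α : ℂ} {Φ : ℂ → L2 (Fin n × Fin 2)} (h : IsFrame n t α Φ)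

include h

lemma exists_frameAt (k : ℂ) : ∃ s : Fiber n t α (toBase k), s.1 ⟨k, rfl⟩ = Φ k := by
  obtain ⟨⟨b, s⟩, hk, hs⟩ := h.exists_isClass_smul k 1
  change toBase k = b at hk
  subst hk
  exact ⟨s, hs.trans (one_smul ℂ _)⟩

/-- The class of `Φ_k` as an element of the fibre over `[k]`. -/
noncomputable def frameAt (k : ℂ) : Fiber n t α (toBase k) := (h.exists_frameAt k).choose

lemma frameAt_self (k : ℂ) : (h.frameAt k).1 ⟨k, rfl⟩ = Φ k := (h.exists_frameAt k).choose_spec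

lemma frameAt_ne (k : ℂ) : h.frameAt k ≠ 0 := by
  intro h0
  have := h.frameAt_self k
  rw [h0] at this
  exact h.ne_zero k this.symm

lemma toBand_eq_mk (k c : ℂ) : h.toBand (k, c) = ⟨toBase k, c • h.frameAt k⟩ := by
  refine (h.isClass_toBand k c).unique ⟨rfl, ?_⟩
  change c • (h.frameAt k).1 ⟨k, rfl⟩ = c • Φ k
  rw [h.frameAt_self]

/-- The local frame of a trivialization in terms of the global frame over the plane. -/
lemma localFrame_eq {b₀ : Base} {k : ℂ} (hk : toBase k ∈ (baseChart b₀).source) {p₁ p₂ : ℤ}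
    (hp : baseChart b₀ (toBase k) = k + dualPt p₁ p₂) :
    let _ := h.fiberBundle
    localFrame (Fiber n t α) b₀ k = (flatMult n p₁ p₂ k)⁻¹ • h.frameAt k := by
  intro _
  have h1 : (⟨toBase k, localFrame (Fiber n t α) b₀ k⟩ : FlatBand n t α) =
      h.toBand (baseChart b₀ (toBase k), 1) :=
    Bundle.Trivialization.mk_symm (h.triv b₀) (b := toBase k) hk 1
  have h2 := h.toBand_add p₁ p₂ k (flatMult n p₁ p₂ k)⁻¹
  rw [mul_inv_cancel₀ (flatMult_ne n p₁ p₂ k)] at h2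
  rw [hp, h2, h.toBand_eq_mk] at h1
  exact Bundle.TotalSpace.mk_injective _ h1

/-- The metric that the norm of `L²` induces. -/
lemma exists_hermitianMetric :
    let _ := h.fiberBundle
    ∃ g : HermitianMetric (Fiber n t α), ∀ (b : Base) (s : Fiber n t α b)
      (k : {k : ℂ // toBase k = b}), g.normSq b s = ‖s.1 k‖ ^ 2 := by
  intro _
  have hex : ∀ b : Base, ∃ k : ℂ, toBase k = b := toBase_surjective
  choose r hr using hex
  have hnorm : ∀ (b : Base) (s : Fiber n t α b) (k : {k : ℂ // toBase k = b}),
      ‖s.1 ⟨r b, hr b⟩‖ ^ 2 = ‖s.1 k‖ ^ 2 := fun b s k => by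
    rw [(s.2.2 ⟨r b, hr b⟩ k).norm_eq]
  refine ⟨⟨fun b s => ‖s.1 ⟨r b, hr b⟩‖ ^ 2, fun b c v => ?_, fun b v hv => ?_, fun b₀ => ?_⟩, hnorm⟩
  · change ‖c • v.1 ⟨r b, hr b⟩‖ ^ 2 = _
    rw [norm_smul, mul_pow]
  · have hne : v.1 ⟨r b, hr b⟩ ≠ 0 := by
      intro h0
      refine hv (Subtype.ext (funext fun x => ?_))
      have h1 := (v.2.2 ⟨r b, hr b⟩ x).norm_eq
      rw [h0, norm_zero] at h1
      exact norm_eq_zero.1 h1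
    have := norm_pos_iff.2 hne
    positivity
  · intro k hk
    change toBase k ∈ (baseChart b₀).source at hk
    obtain ⟨p₁, p₂, hp⟩ := baseChart_toBase_eventually hk
    have hΦ : ContDiff ℝ ∞ Φ := (h.differentiable.contDiff (n := ∞)).restrict_scalars ℝ
    have hf : ContDiff ℝ ∞ (flatMult n p₁ p₂) :=
      ((differentiable_flatMult n p₁ p₂).contDiff (n := ∞)).restrict_scalars ℝ
    have hs : ContDiff ℝ ∞ fun x => ‖(flatMult n p₁ p₂ x)⁻¹ • Φ x‖ ^ 2 :=
      ((hf.inv fun x => flatMult_ne n p₁ p₂ x).smul hΦ).norm_sq ℂ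
    refine (hs.contDiffAt.congr_of_eventuallyEq ?_).contDiffWithinAt
    filter_upwards [hp] with x hx
    rw [hnorm _ _ ⟨x, rfl⟩, h.localFrame_eq hx.1 hx.2, ← h.frameAt_self x]
    rfl

/-- The Chern number of a Hermitian metric. The squared norm of the global frame over the plane is
multiplied by `exp (4π n p₁ Im κ + ⋯)` under translations by the dual lattice; so its logarithm is,
up to a periodic function, `(4π n / √3) (Im κ)²`. -/
lemma chernNumber_eq :
    let _ := h.fiberBundle
    ∀ g : HermitianMetric (Fiber n t α), g.chernNumber = -(n : ℂ) := by
  intro _ g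
  set H : ℂ → ℝ := fun k => g.normSq (toBase k) (h.frameAt k) with hH
  have hpos : ∀ k, 0 < H k := fun k => g.normSq_pos _ _ (h.frameAt_ne k)
  have hfpos : ∀ p₁ p₂ k, 0 < ‖flatMult n p₁ p₂ k‖ ^ 2 := fun p₁ p₂ k => by
    have := norm_pos_iff.2 (flatMult_ne n p₁ p₂ k)
    positivity
  -- the translation law
  have hper : ∀ p₁ p₂ k, ‖flatMult n p₁ p₂ k‖ ^ 2 * H (k + dualPt p₁ p₂) = H k := by
    intro p₁ p₂ k
    have h1 := h.toBand_add p₁ p₂ k 1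
    rw [h.toBand_eq_mk, h.toBand_eq_mk, mul_one, one_smul] at h1
    have h2 := congrArg (fun l : FlatBand n t α => g.normSq l.proj l.snd) h1
    change g.normSq _ (flatMult n p₁ p₂ k • h.frameAt (k + dualPt p₁ p₂)) = _ at h2
    rw [g.normSq_smul] at h2
    exact h2
  -- the local expression of the metric
  have hloc : ∀ b₀ k, toBase k ∈ (baseChart b₀).source → ∃ p₁ p₂ : ℤ, ∀ᶠ x in nhds k,
      toBase x ∈ (baseChart b₀).source ∧
      H x = ‖flatMult n p₁ p₂ x‖ ^ 2 * g.normSq (toBase x) (localFrame (Fiber n t α) b₀ x) := by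
    intro b₀ k hk
    obtain ⟨p₁, p₂, hp⟩ := baseChart_toBase_eventually hk
    refine ⟨p₁, p₂, ?_⟩
    filter_upwards [hp] with x hx
    refine ⟨hx.1, ?_⟩
    rw [h.localFrame_eq hx.1 hx.2, g.normSq_smul, norm_inv, inv_pow,
      mul_inv_cancel_left₀ (hfpos p₁ p₂ x).ne']
  have hsmooth : ContDiff ℝ ∞ H := by
    rw [contDiff_iff_contDiffAt]
    intro k
    have hs := mem_baseChart_source (toBase k)
    obtain ⟨p₁, p₂, hp⟩ := hloc _ k hs
    have h1 : ContDiffAt ℝ ∞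
        (fun x => g.normSq (toBase x) (localFrame (Fiber n t α) (toBase k) x)) k :=
      (g.smooth (toBase k)).contDiffAt
        (((baseChart (toBase k)).open_source.preimage continuous_toBase).mem_nhds hs)
    have hf : ContDiff ℝ ∞ (flatMult n p₁ p₂) :=
      ((differentiable_flatMult n p₁ p₂).contDiff (n := ∞)).restrict_scalars ℝ
    refine ((hf.norm_sq ℂ).contDiffAt.mul h1).congr_of_eventuallyEq ?_
    filter_upwards [hp] with x hx
    exact hx.2
  have hlog : ContDiff ℝ ∞ fun k => (Real.log (H k) : ℂ) :=
    Complex.ofRealCLM.contDiff.comp (hsmooth.log fun k => (hpos k).ne')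
  -- the curvature in terms of the global frame
  have hcurv : ∀ k, g.curvature k =
      wirtBar (wirt fun x => (Real.log (H x) : ℂ)) k * (2 * Complex.I) := by
    intro k
    obtain ⟨p₁, p₂, hp⟩ := hloc (toBase k) k (mem_baseChart_source (toBase k))
    -- the two logarithms differ by `log ‖multiplier‖²`, which is affine in `Im κ`
    set a : ℂ := n * (Real.sqrt 3 * Real.pi * p₁ ^ 2) with ha
    set b : ℂ := n * (4 * Real.pi * p₁) with hb
    have e1 : (fun x => (Real.log (g.normSq (toBase x)
        (localFrame (Fiber n t α) (toBase k) x)) : ℂ)) =ᶠ[nhds k]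
        fun x => (Real.log (H x) : ℂ) + (a + b * imCoord x) := by
      filter_upwards [hp] with x hx
      have h1 : g.normSq (toBase x) (localFrame (Fiber n t α) (toBase k) x) =
          H x / ‖flatMult n p₁ p₂ x‖ ^ 2 := by
        rw [hx.2, mul_div_cancel_left₀ _ (hfpos p₁ p₂ x).ne']
      rw [h1, Real.log_div (hpos x).ne' (hfpos p₁ p₂ x).ne', norm_flatMult_sq, Real.log_exp,
        imCoord_apply, ha, hb]
      push_cast
      ring
    have e2 : g.connection (toBase k) =ᶠ[nhds k]
        fun x => wirt (fun x => (Real.log (H x) : ℂ)) x +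
          (b * (-Complex.I / 2 * cDual⁻¹) + 0 * imCoord x) := by
      filter_upwards [e1.eventually_nhds] with x hx
      rw [HermitianMetric.connection, wirt_congr hx,
        wirt_add (hlog.differentiable (by simp) x) (hasFDerivAt_affine a b x).differentiableAt,
        wirt_affine, zero_mul, add_zero]
    rw [HermitianMetric.curvature, wirtBar_congr e2,
      wirtBar_add ((contDiff_wirt hlog).differentiable (by simp) k)
        (hasFDerivAt_affine _ _ k).differentiableAt, wirtBar_affine, zero_mul, add_zero]
  have h3 : (Real.sqrt 3 : ℂ) ≠ 0 := sqrt3_ne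
  have hint := integral_wirtBar_wirt hlog (4 * Real.pi * n / Real.sqrt 3) fun p₁ p₂ k => by
    have hne := (hpos (k + dualPt p₁ p₂)).ne'
    rw [← hper p₁ p₂ k, Real.log_mul (hfpos p₁ p₂ k).ne' hne, norm_flatMult_sq, Real.log_exp,
      imCoord_apply, imCoord_apply, add_dualPt_div]
    have him : (k / cDual + (om * p₁ - p₂)).im = (k / cDual).im + Real.sqrt 3 / 2 * p₁ := by
      have h1 : (om * p₁ - p₂ : ℂ) = ((p₁ : ℝ) : ℂ) * om - ((p₂ : ℝ) : ℂ) := by push_cast; ring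
      rw [Complex.add_im, h1, Complex.sub_im, Complex.im_ofReal_mul, om_im, Complex.ofReal_im]
      ring
    rw [him]
    push_cast
    field_simp
    ring
  have hpi : (Real.pi : ℂ) ≠ 0 := by exact_mod_cast Real.pi_ne_zero
  rw [HermitianMetric.chernNumber]
  simp only [hcurv]
  rw [integral_mul_const, hint]
  field_simp
  linear_combination (n : ℂ) * Complex.I_sq

end IsFrame

end

end TMG


theorem theorem3 (n : ℕ) (hn : 0 < n) (t : ℕ → ℝ) (ht : ∀ j ∈ Finset.Icc 1 (n - 1), t j ≠ 0)
    (α : ℂ) (hα : TMG.IsSimpleMagic α)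
    (u : TMG.L2 (Fin 1 × Fin 2)) (hu : u ∈ TMG.kerDn 1 (fun _ => 0) α 0) (hu0 : u ≠ 0)
    (hint : 2 ≤ n → ∫ z in TMG.cell TMG.cLam, u (TMG.toTorus z) (0, 1) ≠ 0) :
    -- the resolvent of `2 D_{z̄}` on periodic functions exists off the dual lattice
    (∀ k ∉ TMG.lattice TMG.cDual, ∀ f ∈ TMG.periodicL2, ∃! w, TMG.IsDbarSolution k f w) ∧
    -- the flat band eigenfunctions
    ∃ Φ : ℂ → TMG.L2 (Fin n × Fin 2),
      (∀ k, ∀ᵐ z : ℂ, ∀ s : Fin 2, Φ k (TMG.toTorus z) (⟨0, hn⟩, s) =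
        TMG.theta (k / TMG.cDual) ^ (n - 1) *
          (TMG.F k (z + TMG.zS) * u (TMG.toTorus z) (0, s))) ∧
      (∀ k, ∀ m : Fin n, m.val ≠ 0 → TMG.component (m, 0) (Φ k) = 0) ∧
      (∀ k ∉ TMG.lattice TMG.cDual, ∀ m : Fin n, TMG.component (m, 1) (Φ k) =
        ((-1) ^ m.val * ∏ j ∈ Finset.Icc 1 m.val, (t j : ℂ)) •
          (TMG.dbarResolvent k)^[m.val] (TMG.component (⟨0, hn⟩, 1) (Φ k))) ∧
      Differentiable ℂ Φ ∧
      (∀ k, Φ k ≠ 0 ∧ TMG.kerDn n t α k = Submodule.span ℂ {Φ k}) ∧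
      (∀ (p₁ p₂ : ℤ) (k : ℂ), TMG.IsTau (TMG.dualPt p₁ p₂) (Φ k)
        (TMG.flatMult n p₁ p₂ k • Φ (k + TMG.dualPt p₁ p₂))) ∧
      -- `L` consists of the classes of pairs, one class for each pair
      (∀ k, ∀ Ψ ∈ TMG.kerDn n t α k, ∃! l : TMG.FlatBand n t α, TMG.IsClass l k Ψ) ∧
      (∀ (l : TMG.FlatBand n t α) (k k' : ℂ) (Ψ Ψ' : TMG.L2 (Fin n × Fin 2)),
        TMG.IsClass l k Ψ → (TMG.IsClass l k' Ψ' ↔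
          k' - k ∈ TMG.lattice TMG.cDual ∧ TMG.IsTau (k' - k) Ψ Ψ')) ∧
      -- `L` is a holomorphic line bundle over `ℂ/Λ*`
      ∃ (_ : FiberBundle ℂ (TMG.Fiber n t α)) (_ : VectorBundle ℂ ℂ (TMG.Fiber n t α)),
        ContMDiffVectorBundle ω ℂ (TMG.Fiber n t α) 𝓘(ℂ, ℂ) ∧
        -- with the multipliers
        (∀ (p₁ p₂ q₁ q₂ : ℤ) (k : ℂ), TMG.flatMult n (p₁ + q₁) (p₂ + q₂) k =
          TMG.flatMult n q₁ q₂ (k + TMG.dualPt p₁ p₂) * TMG.flatMult n p₁ p₂ k) ∧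
        (∃ q : ℂ × ℂ → TMG.FlatBand n t α,
          (∀ k c, TMG.IsClass (q (k, c)) k (c • Φ k)) ∧
          Function.Surjective q ∧
          ContMDiff 𝓘(ℂ, ℂ × ℂ) (𝓘(ℂ, ℂ).prod 𝓘(ℂ, ℂ)) ω q ∧
          ∀ k k' c c', q (k, c) = q (k', c') ↔ ∃ p₁ p₂ : ℤ,
            k' = k + TMG.dualPt p₁ p₂ ∧ c' = TMG.flatMult n p₁ p₂ k * c) ∧
        -- the `L²` norm defines a Hermitian metric, and the Chern number is `-n`
        (∃ h : TMG.HermitianMetric (TMG.Fiber n t α),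
          ∀ (b : TMG.Base) (s : TMG.Fiber n t α b) (k : {k : ℂ // TMG.toBase k = b}),
            h.normSq b s = ‖s.1 k‖ ^ 2) ∧
        ∀ h : TMG.HermitianMetric (TMG.Fiber n t α), h.chernNumber = -(n : ℂ) := by
  refine ⟨fun k hk f hf => TMG.existsUnique_isDbarSolution hk hf, ?_⟩
  obtain ⟨u₁, u₂, hflat, hae⟩ := TMG.exists_isFlat hu
  have hne : ¬∀ z, u₁ z = 0 ∧ u₂ z = 0 := by
    intro hz
    refine hu0 (TMG.L2_ext ?_)
    filter_upwards [hae, TMG.ae_zero (ι := Fin 1 × Fin 2)] with z h1 h2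
    rw [h2]
    ext ⟨i, s⟩
    obtain rfl := Subsingleton.elim i 0
    have hs : s = 0 ∨ s = 1 := by fin_cases s <;> simp
    rcases hs with rfl | rfl
    · exact h1.1.trans (hz z).1
    · exact h1.2.trans (hz z).2
  have h0 : 2 ≤ n → TMG.fc u₂ 0 ≠ 0 := fun hn2 => by
    refine TMG.fc_zero_ne hflat.contDiff₂.continuous hflat.phase₂ ?_
    have e : ∫ z in TMG.cell TMG.cLam, u₂ z =
        ∫ z in TMG.cell TMG.cLam, u (TMG.toTorus z) (0, 1) :=
      integral_congr_ae (ae_restrict_of_ae (by filter_upwards [hae] with z hz; rw [hz.2]))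
    rw [e]
    exact hint hn2
  obtain ⟨hz1, hz2⟩ := hflat.zero_neg_zS hα hne
  obtain ⟨φ, hφd, hφ⟩ := TMG.exists_bilayer_family hflat hz1 hz2
  have B : TMG.BilayerFamily α u₁ u₂ φ := ⟨hα, hflat, hne, hz1, hz2, hφ⟩
  obtain ⟨Φ, hΦd, hΦ⟩ := TMG.exists_multilayer_family n t hφd
  have hker := B.ne_zero_and_kerDn_eq hΦ ht h0 hn
  have hF : TMG.IsFrame n t α Φ :=
    ⟨hΦd, fun k => (hker k).1, fun k => (hker k).2, fun p₁ p₂ k => B.isTau hΦ p₁ p₂ k⟩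
  refine ⟨Φ, fun k => ?_, fun k m hm => TMG.BilayerFamily.component_zero hΦ k m hm,
    fun k hk m => B.component_one hΦ hn hk m, hΦd, hker, hF.isTau,
    fun k Ψ hΨ => hF.existsUnique_isClass k hΨ, fun l k k' Ψ Ψ' hl => hl.iff,
    hF.fiberBundle, hF.vectorBundle, hF.contMDiffVectorBundle,
    fun p₁ p₂ q₁ q₂ k => TMG.flatMult_add n p₁ p₂ q₁ q₂ k,
    ⟨hF.toBand, hF.isClass_toBand, hF.toBand_surjective, hF.contMDiff_toBand, hF.toBand_eq_iff⟩,
    hF.exists_hermitianMetric, hF.chernNumber_eq⟩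
  filter_upwards [B.component_ae_eq hΦ hn k, hae] with z h1 h2 s
  have hs : s = 0 ∨ s = 1 := by fin_cases s <;> simp
  rcases hs with rfl | rfl
  · rw [h1.1, h2.1]
  · rw [h1.2, h2.2]
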